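/- **Setting.** Let $d\ge1$, $\mathfrak s\in[1,\infty)^d$, $\ell>0$, $|\mathfrak s|=\sum_i\mathfrak s_i$, $|\mathbf k|_{\mathfrak s}=\sum_i\mathfrak s_ik_i$, $\mathbb N[\mathfrak s]=\{|\mathbf k|_{\mathfrak s}:\mathbf k\in\mathbb N^d\}$, $\|x\|_{\mathfrak s}=\sum_i|x_i|^{1/\mathfrak s_i}$, $\varphi(x)=|x_1|^{1/\mathfrak s_1}\wedge1$, $\varphi(x,y)=\varphi(x)\wedge\varphi(y)$, $t^{\pm\mathfrak s/\ell}x=(t^{\pm\mathfrak s_i/\ell}x_i)_i$. Let $G:\mathbb R^d\to[0,\infty)$ be measurable and $G_t(x)=t^{-|\mathfrak s|/\ell}G(t^{-\mathfrak s/\ell}x)$. *Weights.* A continuous $w:\mathbb R^d\to(0,1]$ is $G$-controlled, with the continuous function $w^*:\mathbb R^d\to[1,\infty)$, if $w(x+y)\le w^*(x)w(y)$ and $\sup_{0<t\le T}\sup_x\|x\|_{\mathfrak s}^n\,w^*(t^{\mathfrak s/\ell}x)G(x)<\infty$ for all $n,T$. A product $uv$ of weights is always taken with $(uv)^*=u^*v^*$.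 $C(w)$ is the set of continuous $g$ with $\|g\|_{L^\infty(w)}=\sup_x w(x)|g(x)|<\infty$. *Semigroup, Besov space.* A $G$-type semigroup is a family of continuous kernels $(Q_t)_{t>0}$ on $\mathbb R^d\times\mathbb R^d$ with $\int Q_{t-s}(x,z)Q_s(z,y)dz=Q_t(x,y)$ for $0<s<t$, $\lim_{t\downarrow0}\int Q_t(x,y)dy=1$, differentiable in $t$, and $|Q_t(x,y)|\le C_1G_t(x-y)$, $|\partial_tQ_t(x,y)|\le C_2t^{-1}G_t(x-y)$. For $\alpha\le0$, $C^{\alpha,Q}(w)$ is the completion of $C(w)$ under $\|g\|=\sup_{0<t\le1}t^{-\alpha/\ell}\|Q_tg\|_{L^\infty(w)}$. *Kernel.* A $\bar\beta$-regularizing kernel admissible for $Q$, with constants $\delta,C_K>0$, is a family of continuous kernels $(K_t)_{t>0}$ with $\int K_{t-s}(x,z)Q_s(z,y)dz=K_t(x,y)$ for $0<s<t$, whose partial derivatives $\partial_x^{\mathbf k}K_t$, $|\mathbf k|_{\mathfrak s}<\delta$, exist and satisfy $|\partial_x^{\mathbf k}K_t(x,y)|\le C_Kt^{(\bar\beta-|\mathbf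 k|_{\mathfrak s})/\ell-1}G_t(x-y)$ and, for $\|h\|_{\mathfrak s}\le t^{1/\ell}$, $$\Big|\partial_x^{\mathbf k}K_t(x+h,y)-\sum_{|\mathbf l|_{\mathfrak s}<\delta-|\mathbf k|_{\mathfrak s}}\tfrac{h^{\mathbf l}}{\mathbf l!}\partial_x^{\mathbf k+\mathbf l}K_t(x,y)\Big|\le C_K\|h\|_{\mathfrak s}^{\delta-|\mathbf k|_{\mathfrak s}}t^{(\bar\beta-\delta)/\ell-1}G_t(x-y).$$ Set $\partial^{\mathbf k}K_t(x,g)=\int\partial_x^{\mathbf k}K_t(x,y)g(y)dy$, extended by continuity to generalized $g$, and $\partial^{\mathbf k}K=\int_0^1\partial^{\mathbf k}K_t\,dt$. *Regularity structures, models.* A regularity structure $(\mathbf A,\mathbf T,\mathbf G)$ has a non-empty, locally finite index set $\mathbf A\subset\mathbb R$ bounded below, with $\alpha_0=\min\mathbf A$, $\mathbf T=\bigoplus_{\alpha\in\mathbf A}\mathbf T_\alpha$ (algebraic sum of Banach spaces), and a group $\mathbf G$ of continuous linear operators with $(\Gamma-\mathrm{id})\mathbf T_\alpha\subset\mathbf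 T_{<\alpha}$; $\|\tau\|_\alpha$ is the norm of the $\mathbf T_\alpha$-component of $\tau$. A smooth model consists of continuous linear maps $\Pi_x:\mathbf T\to C(w)$ and of $\Gamma_{xy}\in\mathbf G$ with $\Pi_x\Gamma_{xy}=\Pi_y$, $\Gamma_{xx}=\mathrm{id}$, $\Gamma_{xy}\Gamma_{yz}=\Gamma_{xz}$ such that for all $\gamma\in\mathbb R$ the quantities $$\|\Pi\|_{\gamma,w}=\max_{\alpha<\gamma}\sup_{0<t\le1,\,x,\,\tau\in\mathbf T_\alpha\setminus\{0\}}t^{-\alpha/\ell}w(x)\frac{|Q_t(x,\Pi_x\tau)|}{\|\tau\|_\alpha},\qquad\|\Gamma\|_{\gamma,w}=\max_{\beta<\alpha<\gamma}\sup_{x\ne y}\frac{w(x)\|\Gamma_{yx}\|_{\mathcal L(\mathbf T_\alpha,\mathbf T_\beta)}}{w^*(y-x)\|y-x\|_{\mathfrak s}^{\alpha-\beta}}$$ are finite. $\mathscr M_w(\mathscr T)$, the space of models, is the completion of the smooth models under the pseudo-metrics $|||M^{(1)};M^{(2)}|||_{\gamma,w}=\|\Pi^{(1)}-\Pi^{(2)}\|_{\gamma,w}+\|\Gamma^{(1)}-\Gamma^{(2)}\|_{\gamma,w}$,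 $\gamma\in\mathbb R$; $|||M|||_{\gamma,w}=\|\Pi\|_{\gamma,w}+\|\Gamma\|_{\gamma,w}$. *Singular modelled distributions, reconstructions.* For $\eta\le\gamma$, $\mathcal D^{\gamma,\eta}_v(\Gamma)^\#$ is the set of $f:\{x_1\ne0\}\to\mathbf T_{<\gamma}$ with $|||f|||^\#_{\gamma,\eta,v}=\llparenthesis f\rrparenthesis_{\gamma,\eta,v}+\|f\|^\#_{\gamma,\eta,v}<\infty$, where, with $\Delta^\Gamma_{yx}f=f(y)-\Gamma_{yx}f(x)$, $$\llparenthesis f\rrparenthesis_{\gamma,\eta,v}=\max_{\alpha<\gamma}\sup_{x_1\neq0}\frac{v(x)\|f(x)\|_\alpha}{\varphi(x)^{(\eta-\alpha)\wedge0}},\qquad\|f\|^\#_{\gamma,\eta,v}=\max_{\alpha<\gamma}\sup_{x_1,y_1\ne0,\,x\ne y}\frac{v(x)\|\Delta^\Gamma_{yx}f\|_\alpha}{\varphi(x,y)^{\eta-\gamma}v^*(x-y)\|y-x\|_{\mathfrak s}^{\gamma-\alpha}}.$$ The distance $|||f^{(1)};f^{(2)}|||^\#_{\gamma,\eta,v}$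 is defined by the same formulas with $f$ replaced by $f^{(1)}-f^{(2)}$ and $\Delta^\Gamma_{yx}f$ by $\Delta^{\Gamma^{(1)}}_{yx}f^{(1)}-\Delta^{\Gamma^{(2)}}_{yx}f^{(2)}$. A reconstruction of $f$ is a $\Lambda\in C^{\zeta,Q}(wv)$, $\zeta\le0$, such that, with $\Lambda_x=\Lambda-\Pi_xf(x)$, $\llbracket\Lambda\rrbracket_{\gamma,\eta,wv}=\sup_{0<t\le1}\sup_{x_1\ne0}t^{-\gamma/\ell}\varphi(x)^{\gamma-\eta}(wv)(x)|Q_t(x,\Lambda_x)|<\infty$; $\llbracket\Lambda^{(1)};\Lambda^{(2)}\rrbracket_{\gamma,\eta,wv}$ is the same with $\Lambda^{(1)}_x-\Lambda^{(2)}_x$. *Compatibility.* Let $\bar{\mathscr T}=(\bar{\mathbf A},\bar{\mathbf T},\bar{\mathbf G})$ be a regularity structure with $\mathbb N[\mathfrak s]\subset\bar{\mathbf A}$ containing linearly independent monomials $X^{\mathbf k}\in\bar{\mathbf T}_{|\mathbf k|_{\mathfrak s}}$ whose span is stable under $\bar{\mathbf G}$. An abstract integration of order $\beta\in(0,\bar\beta]$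 is a continuous linear $\mathcal I:\mathbf T\to\bar{\mathbf T}$ with $\mathcal I\mathbf T_\alpha\subset\bar{\mathbf T}_{\alpha+\beta}$; $\|\mathcal I\|$ is its norm from $\mathbf T_{<\gamma}$ to $\bar{\mathbf T}_{<\gamma+\beta}$. For $\tau\in\mathbf T_\alpha$, $\alpha+\beta<\delta$, let $\mathcal J(x)\tau=\sum_{|\mathbf k|_{\mathfrak s}<\alpha+\beta}\frac{X^{\mathbf k}}{\mathbf k!}\partial^{\mathbf k}K(x,\Pi_x\tau)$. Models $M=(\Pi,\Gamma)\in\mathscr M_w(\mathscr T)$ and $\bar M=(\bar\Pi,\bar\Gamma)\in\mathscr M_w(\bar{\mathscr T})$ are compatible if $\bar\Pi_xX^{\mathbf k}=(\cdot-x)^{\mathbf k}$, $\bar\Gamma_{yx}X^{\mathbf k}=\sum_{\mathbf l\le\mathbf k}\binom{\mathbf k}{\mathbf l}(y-x)^{\mathbf l}X^{\mathbf k-\mathbf l}$, and $\bar\Gamma_{yx}(\mathcal I+\mathcal J(x))\tau=(\mathcal I+\mathcal J(y))\Gamma_{yx}\tau$ for $\tau\in\mathbf T_{<\delta-\beta}$.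 **Theorem.** Let $w,v$ be $G$-controlled weights such that $w^2v$ is $G$-controlled. Assume that there are $G$-controlled $w_1,w_2$ such that $ww_1,ww_2$ are $G$-controlled and $\|x\|^n_{\mathfrak s}w^*(x)w_1(x)$, $\|x\|^n_{\mathfrak s}w_1^*(x)w_2(x)$ are bounded for every $n\ge0$. Let $0<\beta\le\bar\beta$, $\gamma+\bar\beta<\delta$, $\eta\in(\gamma-\mathfrak s_1,\gamma]$, $\zeta\le\eta\wedge\alpha_0\wedge0$, and let either $\beta<\bar\beta$, or $\beta=\bar\beta$ and $\{\alpha+\bar\beta:\alpha\in\mathbf A\cup\{\gamma,\zeta\}\}\cap\mathbb N[\mathfrak s]=\emptyset$. For a compatible pair $(M,\bar M)$, $f\in\mathcal D^{\gamma,\eta}_v(\Gamma)^\#$ and a reconstruction $\Lambda\in C^{\zeta,Q}(wv)$ of $f$ put, for $x_1\ne0$, $$\mathcal Kf(x)=\mathcal If(x)+\mathcal J(x)f(x)+\sum_{|\mathbf k|_{\mathfrak s}<\gamma+\beta}\frac{X^{\mathbf k}}{\mathbf k!}\partial^{\mathbf k}K(x,\Lambda_x).$$ (a) $\mathcal Kf\in\mathcal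 D^{\gamma+\beta,\zeta+\beta}_{w^2v}(\bar\Gamma)^\#$, and $$\llparenthesis\mathcal Kf\rrparenthesis_{\gamma+\beta,\zeta+\beta,w^2v}\le C\Big(\|\mathcal I\|\llparenthesis f\rrparenthesis_{\gamma,\eta,v}+C_K\big\{\|\Pi\|_{\gamma,w}(1+\|\Gamma\|_{\gamma,w})|||f|||^\#_{\gamma,\eta,v}+\|\Lambda\|_{C^{\zeta,Q}(wv)}+\llbracket\Lambda\rrbracket_{\gamma,\eta,wv}\big\}\Big),$$ $$\|\mathcal Kf\|^\#_{\gamma+\beta,\zeta+\beta,w^2v}\le C\Big(\|\mathcal I\|\|f\|^\#_{\gamma,\eta,v}+C_K\big\{\|\Pi\|_{\gamma,w}(1+\|\Gamma\|_{\gamma,w})\|f\|^\#_{\gamma,\eta,v}+\llbracket\Lambda\rrbracket_{\gamma,\eta,wv}\big\}\Big),$$ where $C$ depends only on $G,w,v,\gamma,\eta,\mathbf A$, on the fixed parameters $d,\mathfrak s,\ell,\beta,\bar\beta,\delta,\zeta$, and on an upper bound of the norms $\|X^{\mathbf k}\|$, $|\mathbf k|_{\mathfrak s}<\gamma+\beta$.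 (b) For fixed $Q,K,\mathscr T,\bar{\mathscr T},\mathcal I$ there is a quadratic function $R\mapsto C_R>0$ of $R>0$ such that for all compatible pairs $(M^{(i)},\bar M^{(i)})$, all $f^{(i)}\in\mathcal D^{\gamma,\eta}_v(\Gamma^{(i)})^\#$ and all reconstructions $\Lambda^{(i)}\in C^{\zeta,Q}(wv)$ of $f^{(i)}$ ($i=1,2$) with $|||M^{(i)}|||_{\gamma,w}\le R$ and $|||f^{(i)}|||^\#_{\gamma,\eta,v}\le R$, the distance $|||\mathcal Kf^{(1)};\mathcal Kf^{(2)}|||^\#_{\gamma+\beta,\zeta+\beta,w^2v}$ is at most $$C_R\Big(|||M^{(1)};M^{(2)}|||_{\gamma,w}+|||f^{(1)};f^{(2)}|||^\#_{\gamma,\eta,v}+\|\Lambda^{(1)}-\Lambda^{(2)}\|_{C^{\zeta,Q}(wv)}+\llbracket\Lambda^{(1)};\Lambda^{(2)}\rrbracket_{\gamma,\eta,wv}\Big),$$ and if $\gamma>0$ it is at most $C_R\big(|||M^{(1)};M^{(2)}|||_{\gamma,w}+|||f^{(1)};f^{(2)}|||^\#_{\gamma,\eta,v}\big)$. -/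

import Mathlib

open MeasureTheory Filter Topology
open scoped NNReal ENNReal

universe u₁ u₂ u

noncomputable section

namespace SingularMD

/-! Scaled Euclidean space -/

/-- Points of `ℝ^d`. Only the topology and the Lebesgue measure of this type are used. -/
abbrev Pt (d : ℕ) : Type := Fin d → ℝ

/-- Multiindices. -/
abbrev Idx (d : ℕ) : Type := Fin d → ℕ

/-- A scaling `𝔰 ∈ [1,∞)^d` together with the number `ℓ > 0`. -/
structure Scaling (d : ℕ) where
  s : Fin d → ℝ
  one_le : ∀ i, 1 ≤ s i
  ell : ℝ
  ell_pos : 0 < ell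

variable {d : ℕ}

/-- `|k|_𝔰`. -/
def Scaling.deg (σ : Scaling d) (k : Idx d) : ℝ := ∑ i, σ.s i * (k i : ℝ)

/-- `‖x‖_𝔰`. -/
def Scaling.nrm (σ : Scaling d) (x : Pt d) : ℝ := ∑ i, |x i| ^ (1 / σ.s i)

/-- `|𝔰|`. -/
def Scaling.total (σ : Scaling d) : ℝ := ∑ i, σ.s i

/-- `t^{𝔰/ℓ} x`. -/
def Scaling.dil (σ : Scaling d) (t : ℝ) (x : Pt d) : Pt d := fun i => t ^ (σ.s i / σ.ell) * x i

/-- `G_t(x) = t^{-|𝔰|/ℓ} G(t^{-𝔰/ℓ} x)`. -/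
def Scaling.scaled (σ : Scaling d) (G : Pt d → ℝ) (t : ℝ) (x : Pt d) : ℝ :=
  t ^ (-σ.total / σ.ell) * G (fun i => t ^ (-σ.s i / σ.ell) * x i)

/-- `x^k`. -/
def mpow (x : Pt d) (k : Idx d) : ℝ := ∏ i, x i ^ k i

/-- `k!`. -/
def mfact (k : Idx d) : ℝ := ∏ i, ((k i).factorial : ℝ)

/-- The binomial coefficient of two multiindices. -/
def mchoose (k l : Idx d) : ℝ := ∏ i, ((k i).choose (l i) : ℝ)

/-- The finite set of all multiindices with `|k|_𝔰 < c`, see `Scaling.mem_idxBelow`. -/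
def Scaling.idxBelow (σ : Scaling d) (c : ℝ) : Finset (Idx d) :=
  (Fintype.piFinset fun _ => Finset.range ⌈c⌉₊).filter fun k => σ.deg k < c

theorem Scaling.mem_idxBelow (σ : Scaling d) (c : ℝ) (k : Idx d) :
    k ∈ σ.idxBelow c ↔ σ.deg k < c := by
  simp only [Scaling.idxBelow, Finset.mem_filter, Fintype.mem_piFinset, Finset.mem_range,
    and_iff_right_iff_imp]
  intro h i
  have h1 : (k i : ℝ) ≤ σ.deg k := by
    have h2 : σ.s i * (k i : ℝ) ≤ σ.deg k :=
      Finset.single_le_sum (f := fun j => σ.s j * (k j : ℝ))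
        (fun j _ => mul_nonneg (zero_le_one.trans (σ.one_le j)) (Nat.cast_nonneg _))
        (Finset.mem_univ i)
    have h3 : (k i : ℝ) ≤ σ.s i * (k i : ℝ) :=
      le_mul_of_one_le_left (Nat.cast_nonneg _) (σ.one_le i)
    linarith
  exact Nat.lt_ceil.mpr (lt_of_le_of_lt h1 h)

/-- The temporal weight `φ(x) = |x_1|^{1/𝔰_1} ∧ 1` (the coordinate `0` is time). -/
def Scaling.phi [NeZero d] (σ : Scaling d) (x : Pt d) : ℝ := min (|x 0| ^ (1 / σ.s 0)) 1

/-- `φ(x,y) = φ(x) ∧ φ(y)`. -/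
def Scaling.phi₂ [NeZero d] (σ : Scaling d) (x y : Pt d) : ℝ := min (σ.phi x) (σ.phi y)

/-! Weights -/

/-- A weight `w` together with the function `w^*` that controls its translations. -/
structure Weight (d : ℕ) where
  w : Pt d → ℝ
  star : Pt d → ℝ

/-- Products of weights; the product weight is controlled by the product `u^* v^*`. -/
instance : Mul (Weight d) := ⟨fun u v => ⟨fun x => u.w x * v.w x, fun x => u.star x * v.star x⟩⟩

/-- `w` is `G`-controlled, with the controlling function `w^*`. -/
structure Weight.IsControlled (σ : Scaling d) (G : Pt d → ℝ) (u : Weight d) : Prop where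
  cont : Continuous u.w
  pos : ∀ x, 0 < u.w x
  le_one : ∀ x, u.w x ≤ 1
  star_cont : Continuous u.star
  one_le_star : ∀ x, 1 ≤ u.star x
  moderate : ∀ x y, u.w (x + y) ≤ u.star x * u.w y
  integrable : ∀ (n : ℕ) (T : ℝ), 0 < T →
    ∃ C : ℝ, ∀ t, 0 < t → t ≤ T → ∀ x, σ.nrm x ^ n * u.star (σ.dil t x) * G x ≤ C

/-- The existence of two auxiliary weights which decay faster than the growth of `w^*`
and which keep `w` controlled; it allows one to view `Π_x τ` as a distribution. -/
def Weight.HasDecay (σ : Scaling d) (G : Pt d → ℝ) (u : Weight d) : Prop :=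
  ∃ u₁ u₂ : Weight d,
    u₁.IsControlled σ G ∧ u₂.IsControlled σ G ∧
    (u * u₁).IsControlled σ G ∧ (u * u₂).IsControlled σ G ∧
    (∀ n : ℕ, ∃ C : ℝ, ∀ x, σ.nrm x ^ n * u.star x * u₁.w x ≤ C) ∧
    (∀ n : ℕ, ∃ C : ℝ, ∀ x, σ.nrm x ^ n * u₁.star x * u₂.w x ≤ C)

/-- `C(w)`: continuous functions with finite `L^∞(w)` norm. For continuous functions and
strictly positive continuous weights the essential supremum is the supremum. -/
def MemC (w : Pt d → ℝ) (g : Pt d → ℝ) : Prop :=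
  Continuous g ∧ ∃ C : ℝ, ∀ x, w x * |g x| ≤ C

/-! Semigroups and Besov spaces -/

/-- Families of integral kernels `(t,x,y) ↦ Q_t(x,y)`; only `t > 0` matters. -/
abbrev Ker (d : ℕ) : Type := ℝ → Pt d → Pt d → ℝ

/-- `G`-type semigroups. -/
structure IsSemigroup (σ : Scaling d) (G : Pt d → ℝ) (Q : Ker d) : Prop where
  cont : ∀ t, 0 < t → Continuous fun p : Pt d × Pt d => Q t p.1 p.2
  semigroup : ∀ s t, 0 < s → s < t → ∀ x y, ∫ z, Q (t - s) x z * Q s z y = Q t x y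
  conservative : ∀ x, Tendsto (fun t => ∫ y, Q t x y) (𝓝[>] 0) (𝓝 1)
  upper : ∃ C₁ : ℝ, 0 < C₁ ∧ ∀ t, 0 < t → ∀ x y, |Q t x y| ≤ C₁ * σ.scaled G t (x - y)
  diff : ∀ t, 0 < t → ∀ x y, DifferentiableAt ℝ (fun r => Q r x y) t
  diff_bound : ∃ C₂ : ℝ, 0 < C₂ ∧ ∀ t, 0 < t → ∀ x y,
    |deriv (fun r => Q r x y) t| ≤ C₂ * t⁻¹ * σ.scaled G t (x - y)

/-- `(Q_t g)(x)` for a function `g`. -/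
def smear (Q : Ker d) (g : Pt d → ℝ) (t : ℝ) (x : Pt d) : ℝ := ∫ y, Q t x y * g y

/-- The norm `sup_{0<t≤1} t^{-α/ℓ} sup_x w(x) |F_t(x)|` of a family `F_t`; for
`F_t = Q_t g` it is the `C^{α,Q}(w)` norm of `g`. -/
def besovNorm (σ : Scaling d) (α : ℝ) (w : Pt d → ℝ) (F : ℝ → Pt d → ℝ) : ℝ≥0∞ :=
  ⨆ (t : ℝ) (_ : 0 < t ∧ t ≤ 1) (x : Pt d),
    ENNReal.ofReal (t ^ (-α / σ.ell) * (w x * |F t x|))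

/-- The Besov space `C^{α,Q}(w)`, the completion of `C(w)` under the norm
`sup_{0<t≤1} t^{-α/ℓ} ‖Q_t g‖_{L^∞(w)}`. By definition of this norm, `g ↦ (Q_t g)_{0<t≤1}` is an
isometry into a complete space of families of functions, and the completion is the closure
of its image: an element `Λ` is recorded as the family `Λ.Qt t x = Q_t(x,Λ)`, `0 < t ≤ 1`,
a limit of families `Q_t g` with `g ∈ C(w)`. Values at other `t` are irrelevant. -/
structure Besov (σ : Scaling d) (Q : Ker d) (α : ℝ) (w : Pt d → ℝ) where
  Qt : ℝ → Pt d → ℝ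
  approx : ∀ ε : ℝ≥0∞, 0 < ε →
    ∃ g : Pt d → ℝ, MemC w g ∧ besovNorm σ α w (fun t x => smear Q g t x - Qt t x) < ε

/-- The functions `g ∈ C(w)` that converge to `Λ` in `C^{α,Q}(w)`. -/
def Besov.approaching {σ : Scaling d} {Q : Ker d} {α : ℝ} {w : Pt d → ℝ}
    (Λ : Besov σ Q α w) : Filter (Pt d → ℝ) :=
  comap (fun g => besovNorm σ α w (fun t x => smear Q g t x - Λ.Qt t x)) (𝓝 0) ⊓
    𝓟 {g | MemC w g}

/-! Regularizing kernels -/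

/-- The partial derivative in the `i`-th coordinate. -/
def pderiv₁ (i : Fin d) (f : Pt d → ℝ) (x : Pt d) : ℝ :=
  deriv (fun r => f (Function.update x i r)) (x i)

/-- The `k`-th partial derivative `∂^k f`. -/
def mderiv (k : Idx d) (f : Pt d → ℝ) : Pt d → ℝ :=
  (List.finRange d).foldr (fun i g => (pderiv₁ i)^[k i] g) f

/-- `∂_x^k K_t(x,y)`. -/
def kderiv (K : Ker d) (k : Idx d) (t : ℝ) (x y : Pt d) : ℝ := mderiv k (fun z => K t z y) x

/-- `K` is a `β̄`-regularizing kernel admissible for `Q`, with the constants `δ` and `C_K`.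
The field `hasDeriv` says that the partial derivatives of order `|k|_𝔰 < δ` exist (taken in
any order). -/
structure IsRegularizing (σ : Scaling d) (G : Pt d → ℝ) (Q K : Ker d) (βb δ CK : ℝ) : Prop where
  cont : ∀ t, 0 < t → Continuous fun p : Pt d × Pt d => K t p.1 p.2
  conv : ∀ s t, 0 < s → s < t → ∀ x y, ∫ z, K (t - s) x z * Q s z y = K t x y
  hasDeriv : ∀ (k : Idx d) (i : Fin d), σ.deg (k + Pi.single i 1) < δ → ∀ t, 0 < t → ∀ x y,
    HasDerivAt (fun r => kderiv K k t (Function.update x i r) y)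
      (kderiv K (k + Pi.single i 1) t x y) (x i)
  upper : ∀ k : Idx d, σ.deg k < δ → ∀ t, 0 < t → ∀ x y,
    |kderiv K k t x y| ≤ CK * t ^ ((βb - σ.deg k) / σ.ell - 1) * σ.scaled G t (x - y)
  holder : ∀ k : Idx d, σ.deg k < δ → ∀ t, 0 < t → ∀ x y h, σ.nrm h ≤ t ^ (1 / σ.ell) →
    |kderiv K k t (x + h) y -
        ∑ l ∈ σ.idxBelow (δ - σ.deg k), mpow h l / mfact l * kderiv K (k + l) t x y| ≤
      CK * σ.nrm h ^ (δ - σ.deg k) * t ^ ((βb - δ) / σ.ell - 1) * σ.scaled G t (x - y)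

/-- `∂^k K_t(x,g) = ∫ ∂_x^k K_t(x,y) g(y) dy` for a function `g`. -/
def kfun (K : Ker d) (k : Idx d) (t : ℝ) (x : Pt d) (g : Pt d → ℝ) : ℝ :=
  ∫ y, kderiv K k t x y * g y

/-- `∂^k K_t(x,Λ)` for `Λ ∈ C^{α,Q}(w)`: the continuous extension from `C(w)`. -/
def kbesov {σ : Scaling d} {Q : Ker d} {α : ℝ} {w : Pt d → ℝ} (K : Ker d) (k : Idx d) (t : ℝ)
    (x : Pt d) (Λ : Besov σ Q α w) : ℝ :=
  limUnder Λ.approaching (fun g => kfun K k t x g)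

/-! Regularity structures -/

/-- An index set: locally finite, bounded below (and non-empty). -/
structure IndexSet where
  carrier : Set ℝ
  nonempty : carrier.Nonempty
  bddBelow : BddBelow carrier
  locallyFinite : ∀ a b : ℝ, (carrier ∩ Set.Icc a b).Finite

/-- The regularity `α₀ = min A`. -/
def IndexSet.reg (A : IndexSet) : ℝ := sInf A.carrier

theorem IndexSet.finite_lt (A : IndexSet) (c : ℝ) : (A.carrier ∩ Set.Iio c).Finite := by
  obtain ⟨a, ha⟩ := A.bddBelow
  exact (A.locallyFinite a c).subset fun x hx => ⟨hx.1, ha hx.1, le_of_lt hx.2⟩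

/-- The indices `α ∈ A` with `α < c`. -/
def IndexSet.below (A : IndexSet) (c : ℝ) : Finset ℝ := (A.finite_lt c).toFinset

/-- A regularity structure with index set `A`. The spaces `T_α` are indexed by all real `α`
and vanish for `α ∉ A`; the model space is the algebraic direct sum of the `T_α`. The
continuity of an operator of the structure group is that of its components
`T_α → T_β`, since it maps `T_α` into the finite sum `T_α ⊕ T_{<α}`. -/
structure RegStructure (A : IndexSet) where
  T : ℝ → Type u
  [normed : ∀ α, NormedAddCommGroup (T α)]
  [space : ∀ α, NormedSpace ℝ (T α)]
  [complete : ∀ α, CompleteSpace (T α)]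
  trivial_off : ∀ α, α ∉ A.carrier → Subsingleton (T α)
  grp : Subgroup ((Π₀ α, T α) ≃ₗ[ℝ] (Π₀ α, T α))
  grp_cont : ∀ g ∈ grp, ∀ α β : ℝ, Continuous fun τ : T α => g (DFinsupp.single α τ) β
  grp_lower : ∀ g ∈ grp, ∀ (α : ℝ) (τ : T α) (β : ℝ), α ≤ β →
    (g (DFinsupp.single α τ) - DFinsupp.single α τ) β = 0

attribute [instance] RegStructure.normed RegStructure.space RegStructure.complete

/-- The model space `T = ⨁ T_α`. -/
abbrev RegStructure.Sum {A : IndexSet} (𝒯 : RegStructure.{u} A) : Type u := Π₀ α, 𝒯.T α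

/-- The element of `T` given by an element of `T_α`. -/
abbrev RegStructure.emb {A : IndexSet} (𝒯 : RegStructure.{u} A) (α : ℝ) (τ : 𝒯.T α) : 𝒯.Sum :=
  DFinsupp.single α τ

/-- `τ ∈ T_{<c}`. -/
def RegStructure.IsBelow {A : IndexSet} (𝒯 : RegStructure.{u} A) (c : ℝ) (τ : 𝒯.Sum) : Prop :=
  ∀ β, c ≤ β → τ β = 0

/-! Models -/

section Models

variable (σ : Scaling d) {A : IndexSet} (𝒯 : RegStructure.{u} A) (Q : Ker d) (p : Weight d)

/-- `‖Π‖_{γ,w}`, as a function of `(t,x,τ) ↦ Q_t(x,Π_x τ)`. -/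
def piNorm (γ : ℝ) (P : ℝ → Pt d → 𝒯.Sum → ℝ) : ℝ≥0∞ :=
  ⨆ (α : ℝ) (_ : α ∈ A.carrier ∧ α < γ) (t : ℝ) (_ : 0 < t ∧ t ≤ 1) (x : Pt d)
    (τ : 𝒯.T α) (_ : τ ≠ 0),
    ENNReal.ofReal (t ^ (-α / σ.ell) * p.w x * (|P t x (𝒯.emb α τ)| / ‖τ‖))

/-- `‖Γ‖_{γ,w}`, as a function of `(y,x,τ) ↦ Γ_{yx} τ`. -/
def gammaNorm (γ : ℝ) (Γ : Pt d → Pt d → 𝒯.Sum → 𝒯.Sum) : ℝ≥0∞ :=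
  ⨆ (α : ℝ) (β : ℝ) (_ : α ∈ A.carrier ∧ β ∈ A.carrier ∧ β < α ∧ α < γ) (x : Pt d) (y : Pt d)
    (_ : x ≠ y) (τ : 𝒯.T α) (_ : τ ≠ 0),
    ENNReal.ofReal (p.w x * ‖Γ y x (𝒯.emb α τ) β‖ /
      (p.star (y - x) * σ.nrm (y - x) ^ (α - β) * ‖τ‖))

/-- Smooth models `(Π,Γ)`. -/
structure SmoothModel where
  Pi : Pt d → 𝒯.Sum →ₗ[ℝ] (Pt d → ℝ)
  Γ : Pt d → Pt d → (𝒯.Sum ≃ₗ[ℝ] 𝒯.Sum)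
  Pi_cont : ∀ x τ, Continuous (Pi x τ)
  Pi_bdd : ∀ (x : Pt d) (α : ℝ), ∃ C : ℝ, ∀ (τ : 𝒯.T α) (y : Pt d),
    p.w y * |Pi x (𝒯.emb α τ) y| ≤ C * ‖τ‖
  Γ_mem : ∀ x y, Γ x y ∈ 𝒯.grp
  Pi_Γ : ∀ x y τ, Pi x (Γ x y τ) = Pi y τ
  Γ_self : ∀ x τ, Γ x x τ = τ
  Γ_comp : ∀ x y z τ, Γ x y (Γ y z τ) = Γ x z τ
  Pi_fin : ∀ γ, piNorm σ 𝒯 p γ (fun t x τ => smear Q (Pi x τ) t x) < ∞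
  Γ_fin : ∀ γ, gammaNorm σ 𝒯 p γ (fun y x τ => Γ y x τ) < ∞

/-- Models: the completion of the smooth models under the pseudo-metrics
`‖Π - Π'‖_{γ,w} + ‖Γ - Γ'‖_{γ,w}`, `γ ∈ ℝ`. As these pseudo-metrics only involve
`Q_t(x,Π_x τ)`, `0 < t ≤ 1`, and the lower triangular part of `Γ_{yx}`, `x ≠ y`, an element of the
completion is recorded by `QPi t x τ = Q_t(x,Π_x τ)` and `Γ`, which are limits of
those of smooth models. Values of `QPi` at other `t` are irrelevant. -/
structure Model where
  QPi : ℝ → Pt d → 𝒯.Sum →ₗ[ℝ] ℝ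
  Γ : Pt d → Pt d → 𝒯.Sum →ₗ[ℝ] 𝒯.Sum
  Γ_self : ∀ x τ, Γ x x τ = τ
  Γ_lower : ∀ (x y : Pt d) (α : ℝ) (τ : 𝒯.T α), 𝒯.IsBelow α (Γ x y (𝒯.emb α τ) - 𝒯.emb α τ)
  approx : ∀ (γ : ℝ) (ε : ℝ≥0∞), 0 < ε → ∃ S : SmoothModel σ 𝒯 Q p,
    piNorm σ 𝒯 p γ (fun t x τ => smear Q (S.Pi x τ) t x - QPi t x τ) +
      gammaNorm σ 𝒯 p γ (fun y x τ => S.Γ y x τ - Γ y x τ) < ε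

variable {σ 𝒯 Q p}

/-- `‖Π‖_{γ,w}`. -/
def Model.normPi (M : Model σ 𝒯 Q p) (γ : ℝ) : ℝ≥0∞ :=
  piNorm σ 𝒯 p γ (fun t x τ => M.QPi t x τ)

/-- `‖Γ‖_{γ,w}`. -/
def Model.normΓ (M : Model σ 𝒯 Q p) (γ : ℝ) : ℝ≥0∞ :=
  gammaNorm σ 𝒯 p γ (fun y x τ => M.Γ y x τ)

/-- `|||M^{(1)};M^{(2)}|||_{γ,w}`. -/
def Model.dist (M₁ M₂ : Model σ 𝒯 Q p) (γ : ℝ) : ℝ≥0∞ :=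
  piNorm σ 𝒯 p γ (fun t x τ => M₁.QPi t x τ - M₂.QPi t x τ) +
    gammaNorm σ 𝒯 p γ (fun y x τ => M₁.Γ y x τ - M₂.Γ y x τ)

/-- The smooth models that converge to `M`. -/
def Model.approaching (M : Model σ 𝒯 Q p) : Filter (SmoothModel σ 𝒯 Q p) :=
  ⨅ γ : ℝ, comap (fun S : SmoothModel σ 𝒯 Q p =>
    piNorm σ 𝒯 p γ (fun t x τ => smear Q (S.Pi x τ) t x - M.QPi t x τ) +
      gammaNorm σ 𝒯 p γ (fun y x τ => S.Γ y x τ - M.Γ y x τ)) (𝓝 0)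

/-- `Q_t(y,Π_x τ)` for arbitrary `x` and `y`. -/
def Model.evalAt (M : Model σ 𝒯 Q p) (t : ℝ) (y x : Pt d) (τ : 𝒯.Sum) : ℝ :=
  M.QPi t y (M.Γ y x τ)

/-- `∂^k K_t(x,Π_x τ)`: the continuous extension from smooth models, for which it is
`∫ ∂_x^k K_t(x,y) (Π_x τ)(y) dy`. -/
def Model.kPi (M : Model σ 𝒯 Q p) (K : Ker d) (k : Idx d) (t : ℝ) (x : Pt d) (τ : 𝒯.Sum) : ℝ :=
  limUnder M.approaching (fun S => kfun K k t x (S.Pi x τ))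

/-- `∂^k K(x,Π_x τ) = ∫_0^1 ∂^k K_t(x,Π_x τ) dt`. -/
def Model.kPiInt (M : Model σ 𝒯 Q p) (K : Ker d) (k : Idx d) (x : Pt d) (τ : 𝒯.Sum) : ℝ :=
  ∫ t in Set.Ioc (0 : ℝ) 1, M.kPi K k t x τ

end Models

/-! Singular modelled distributions. They are functions on `{x | x_1 ≠ 0}`; values on the
hyperplane `x_1 = 0` never enter. -/

section Modelled

variable [NeZero d] (σ : Scaling d) {A : IndexSet} (𝒯 : RegStructure.{u} A) (p : Weight d)

/-- `⦅f⦆_{γ,η,v}`. -/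
def sizeNorm (γ η : ℝ) (f : Pt d → 𝒯.Sum) : ℝ≥0∞ :=
  ⨆ (α : ℝ) (_ : α ∈ A.carrier ∧ α < γ) (x : Pt d) (_ : x 0 ≠ 0),
    ENNReal.ofReal (p.w x * ‖f x α‖ / σ.phi x ^ min (η - α) 0)

/-- The norm `‖·‖^#_{γ,η,v}` of a family of increments `Δ_{yx}`, `D y x = Δ_{yx}`. -/
def incrNorm (γ η : ℝ) (D : Pt d → Pt d → 𝒯.Sum) : ℝ≥0∞ :=
  ⨆ (α : ℝ) (_ : α ∈ A.carrier ∧ α < γ) (x : Pt d) (y : Pt d)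
    (_ : x 0 ≠ 0 ∧ y 0 ≠ 0 ∧ x ≠ y),
    ENNReal.ofReal (p.w x * ‖D y x α‖ /
      (σ.phi₂ x y ^ (η - γ) * p.star (x - y) * σ.nrm (y - x) ^ (γ - α)))

variable {𝒯}

/-- `Δ^Γ_{yx} f = f(y) - Γ_{yx} f(x)`. -/
def incr (Γ : Pt d → Pt d → 𝒯.Sum →ₗ[ℝ] 𝒯.Sum) (f : Pt d → 𝒯.Sum) (y x : Pt d) : 𝒯.Sum :=
  f y - Γ y x (f x)

/-- `‖f‖^#_{γ,η,v}`. -/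
def sharpNorm (γ η : ℝ) (Γ : Pt d → Pt d → 𝒯.Sum →ₗ[ℝ] 𝒯.Sum) (f : Pt d → 𝒯.Sum) : ℝ≥0∞ :=
  incrNorm σ 𝒯 p γ η (incr Γ f)

/-- `|||f|||^#_{γ,η,v}`. -/
def fullNorm (γ η : ℝ) (Γ : Pt d → Pt d → 𝒯.Sum →ₗ[ℝ] 𝒯.Sum) (f : Pt d → 𝒯.Sum) : ℝ≥0∞ :=
  sizeNorm σ 𝒯 p γ η f + sharpNorm σ p γ η Γ f

/-- `|||f^{(1)};f^{(2)}|||^#_{γ,η,v}`. -/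
def fullDist (γ η : ℝ) (Γ₁ Γ₂ : Pt d → Pt d → 𝒯.Sum →ₗ[ℝ] 𝒯.Sum) (f₁ f₂ : Pt d → 𝒯.Sum) : ℝ≥0∞ :=
  sizeNorm σ 𝒯 p γ η (fun x => f₁ x - f₂ x) +
    incrNorm σ 𝒯 p γ η (fun y x => incr Γ₁ f₁ y x - incr Γ₂ f₂ y x)

/-- `f ∈ 𝒟_v^{γ,η}(Γ)^#`. -/
def MemD (γ η : ℝ) (Γ : Pt d → Pt d → 𝒯.Sum →ₗ[ℝ] 𝒯.Sum) (f : Pt d → 𝒯.Sum) : Prop :=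
  (∀ x : Pt d, x 0 ≠ 0 → 𝒯.IsBelow γ (f x)) ∧ fullNorm σ p γ η Γ f < ∞

/-- `sup_{0<t≤1} sup_x t^{-γ/ℓ} φ(x)^{γ-η} u(x) |R_t(x)|`. -/
def recNorm (γ η : ℝ) (R : ℝ → Pt d → ℝ) : ℝ≥0∞ :=
  ⨆ (t : ℝ) (_ : 0 < t ∧ t ≤ 1) (x : Pt d) (_ : x 0 ≠ 0),
    ENNReal.ofReal (t ^ (-γ / σ.ell) * σ.phi x ^ (γ - η) * p.w x * |R t x|)

end Modelled

section Reconstruction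

variable [NeZero d] {σ : Scaling d} {A : IndexSet} {𝒯 : RegStructure.{u} A} {Q : Ker d}
  {w v : Weight d} {ζ : ℝ}

/-- `Q_t(x,Λ_x)` with `Λ_x = Λ - Π_x f(x)`. -/
def centered (M : Model σ 𝒯 Q w) (f : Pt d → 𝒯.Sum) (Λ : Besov σ Q ζ (w * v).w)
    (t : ℝ) (x : Pt d) : ℝ :=
  Λ.Qt t x - M.QPi t x (f x)

/-- `⟦Λ⟧_{γ,η,wv}`. -/
def recSize (γ η : ℝ) (M : Model σ 𝒯 Q w) (f : Pt d → 𝒯.Sum) (Λ : Besov σ Q ζ (w * v).w) : ℝ≥0∞ :=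
  recNorm σ (w * v) γ η (centered M f Λ)

/-- `⟦Λ^{(1)};Λ^{(2)}⟧_{γ,η,wv}`. -/
def recDist (γ η : ℝ) (M₁ M₂ : Model σ 𝒯 Q w) (f₁ f₂ : Pt d → 𝒯.Sum)
    (Λ₁ Λ₂ : Besov σ Q ζ (w * v).w) : ℝ≥0∞ :=
  recNorm σ (w * v) γ η (fun t x => centered M₁ f₁ Λ₁ t x - centered M₂ f₂ Λ₂ t x)

/-- `Λ ∈ C^{ζ,Q}(wv)` is a reconstruction of `f` for `M`. -/
def IsReconstruction (γ η : ℝ) (M : Model σ 𝒯 Q w) (f : Pt d → 𝒯.Sum)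
    (Λ : Besov σ Q ζ (w * v).w) : Prop :=
  recSize γ η M f Λ < ∞

/-- `∂^k K(x,Λ_x) = ∫_0^1 ∂^k K_t(x,Λ_x) dt` with `Λ_x = Λ - Π_x f(x)`. -/
def kCentered (K : Ker d) (k : Idx d) (M : Model σ 𝒯 Q w) (f : Pt d → 𝒯.Sum)
    (Λ : Besov σ Q ζ (w * v).w) (x : Pt d) : ℝ :=
  ∫ t in Set.Ioc (0 : ℝ) 1, (kbesov K k t x Λ - M.kPi K k t x (f x))

end Reconstruction

/-! Abstract integration, compatible models, and the lift of the kernel -/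

/-- The polynomial structure contained in `𝒯̄`: linearly independent elements
`X^k ∈ T̄_{|k|_𝔰}` whose span is stable under the structure group. -/
structure Polynomials (σ : Scaling d) {Ab : IndexSet} (𝒯b : RegStructure.{u} Ab) where
  deg_mem : ∀ k : Idx d, σ.deg k ∈ Ab.carrier
  X : ∀ k : Idx d, 𝒯b.T (σ.deg k)
  indep : LinearIndependent ℝ fun k : Idx d => 𝒯b.emb (σ.deg k) (X k)
  stable : ∀ g ∈ 𝒯b.grp, ∀ k : Idx d,
    g (𝒯b.emb (σ.deg k) (X k)) ∈
      Submodule.span ℝ (Set.range fun l : Idx d => 𝒯b.emb (σ.deg l) (X l))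

/-- `X^k` as an element of the model space. -/
def Polynomials.mono {σ : Scaling d} {Ab : IndexSet} {𝒯b : RegStructure.{u} Ab}
    (X : Polynomials σ 𝒯b) (k : Idx d) : 𝒯b.Sum := 𝒯b.emb (σ.deg k) (X.X k)

/-- Abstract integrations of order `β`: continuous linear maps `T_α → T̄_{α+β}`. -/
abbrev AbsInt {A Ab : IndexSet} (𝒯 : RegStructure.{u₁} A) (𝒯b : RegStructure.{u₂} Ab) (β : ℝ) :
    Type (max u₁ u₂) := ∀ α : ℝ, 𝒯.T α →L[ℝ] 𝒯b.T (α + β)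

section Lift

variable {A Ab : IndexSet} {𝒯 : RegStructure.{u₁} A} {𝒯b : RegStructure.{u₂} Ab} {β : ℝ}

/-- The linear map `𝓘 : T → T̄`. -/
def AbsInt.map (I : AbsInt 𝒯 𝒯b β) : 𝒯.Sum →ₗ[ℝ] 𝒯b.Sum :=
  DFinsupp.lsum ℝ fun α => (DFinsupp.lsingle (α + β)).comp (I α).toLinearMap

/-- The operator norm of `𝓘 : T_{<γ} → T̄_{<γ+β}`. -/
def AbsInt.normBelow (I : AbsInt 𝒯 𝒯b β) (γ : ℝ) : ℝ≥0∞ :=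
  ⨆ (α : ℝ) (_ : α ∈ A.carrier ∧ α < γ), ‖I α‖ₑ

variable {σ : Scaling d} {Q : Ker d} {w v : Weight d} {ζ : ℝ}

/-- `𝓙(x) τ = ∑_α ∑_{|k|_𝔰 < α+β} (X^k / k!) ∂^k K(x,Π_x τ_α)` for `τ = ∑_α τ_α ∈ T_{<δ-β}`. -/
def liftJ (K : Ker d) (δ β : ℝ) (X : Polynomials σ 𝒯b) (M : Model σ 𝒯 Q w) (x : Pt d)
    (τ : 𝒯.Sum) : 𝒯b.Sum :=
  ∑ α ∈ A.below (δ - β), ∑ k ∈ σ.idxBelow (α + β),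
    (M.kPiInt K k x (𝒯.emb α (τ α)) / mfact k) • X.mono k

/-- `𝓝(x;f,Λ) = ∑_{|k|_𝔰 < γ+β} (X^k / k!) ∂^k K(x,Λ_x)`. -/
def liftN [NeZero d] (K : Ker d) (γ β : ℝ) (X : Polynomials σ 𝒯b) (M : Model σ 𝒯 Q w)
    (f : Pt d → 𝒯.Sum) (Λ : Besov σ Q ζ (w * v).w) (x : Pt d) : 𝒯b.Sum :=
  ∑ k ∈ σ.idxBelow (γ + β), (kCentered K k M f Λ x / mfact k) • X.mono k

/-- `𝒦 f (x) = 𝓘 f(x) + 𝓙(x) f(x) + 𝓝(x;f,Λ)`. -/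
def liftK [NeZero d] (K : Ker d) (δ γ : ℝ) (X : Polynomials σ 𝒯b) (I : AbsInt 𝒯 𝒯b β)
    (M : Model σ 𝒯 Q w) (f : Pt d → 𝒯.Sum) (Λ : Besov σ Q ζ (w * v).w) (x : Pt d) : 𝒯b.Sum :=
  I.map (f x) + liftJ K δ β X M x (f x) + liftN K γ β X M f Λ x

/-- The pair of models `(M, M̄)` is compatible for `𝓘`. The identity
`(Π̄_x X^k)(·) = (· - x)^k` is an identity of distributions, tested against `Q_t(y,·)`. -/
structure Compatible (K : Ker d) (δ : ℝ) (X : Polynomials σ 𝒯b) (I : AbsInt 𝒯 𝒯b β)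
    (M : Model σ 𝒯 Q w) (Mb : Model σ 𝒯b Q w) : Prop where
  Pi_poly : ∀ (k : Idx d) (x y : Pt d) (t : ℝ), 0 < t → t ≤ 1 →
    Mb.evalAt t y x (X.mono k) = smear Q (fun z => mpow (z - x) k) t y
  Γ_poly : ∀ (k : Idx d) (x y : Pt d),
    Mb.Γ y x (X.mono k) =
      ∑ l ∈ Finset.Icc 0 k, (mchoose k l * mpow (y - x) l) • X.mono (k - l)
  intertwine : ∀ (x y : Pt d) (τ : 𝒯.Sum), 𝒯.IsBelow (δ - β) τ →
    Mb.Γ y x (I.map τ + liftJ K δ β X M x τ) =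
      I.map (M.Γ y x τ) + liftJ K δ β X M y (M.Γ y x τ)

end Lift

end SingularMD

end

open SingularMD

set_option linter.unusedSectionVars false

noncomputable section

/-! The identity ∂^kK_t = ∂^kK_{t/2} Q_{t/2} turns every quantity in the lift into a pairing of
∂^kK_{t/2}(x,·) with one of the functions Q_{t/2}(·,Λ) or Q_{t/2}(·,Π_xτ) (`kderiv_conv`,
`kbesov_eq`, `kPi_eq`). Such a pairing inherits its power of t from the tested function: Q_s(z,Π_xτ)
= Q_s(z,Π_zΓ_{zx}τ) has the order s^{α/ℓ} of τ ∈ T_α, up to weights and a polynomial in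
s^{-1/ℓ}‖z-x‖, and G absorbs both (`exists_env_pairing`). For Λ_x = Λ - Π_xf(x), recentring at z
leaves Q_s(z,Λ_z) and Q_s(z,Π_zΔ_{zx}f), which are of order s^{γ/ℓ} with a singularity φ^{η-γ} at
the hyperplane; it is integrable because γ-η < 𝔰_1 (`exists_rem_pairing`).

What remains is integration in t. For the coefficient of X^k at one point x, the interval (0,1] is
cut at t = φ(x)^ℓ. Below the cut, the integrals of Λ_x and of the terms of 𝒥(x)f(x) converge
separately. Above it, the terms of 𝒥 cancel against the same terms inside Λ_x, and what is left is Λ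
itself together with the homogeneities α ≤ |k|-β (`exists_size_coeff_bound`).

For increments, compatibility gives Γ̄_{yx}(𝓘+𝒥(x))f(x) = (𝓘+𝒥(y))Γ_{yx}f(x), so the coefficient of
X^k consists of the terms ∂^kK(y,Π_yΔ_{yx}f), of ∂^kK(y,Λ_y), and of the Taylor terms (y-x)^l/l!
∂^{k+l}K(x,Λ_x) with a minus sign (`liftK_incr`). The cut is now at t = 2‖y-x‖^ℓ. Below it each term
is small by itself. Above it, Λ_y + Π_yΔ_{yx}f = Λ_x recombines everything into a Taylor remainder
of the kernel tested against Λ_x (`exists_sharp_coeff_bound`, `exists_lift_sharp_bound`). In both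
cases a vanishing exponent would produce a logarithm; it is excluded by nonintegrality, or made
harmless by the gain β < β̄ (`exists_integral_Ioc_one_bound`).

These estimates are linear in the tested families, so they are proved for abstract families
(`LiftData`) and applied to differences of two sets of data (`liftData_sub`,
`exists_lift_sub_bounds`). Part (a) is the case where the second set is zero; part (b) is the
general case. For γ > 0 the two distances of the reconstructions are redundant: passing from time εt
to time t with the semigroup bounds the reconstruction distance by Cε^{γ/ℓ} times itself plus a
multiple of the other distances, and a small ε absorbs it (`exists_recDist_le`). The Besov distance
is in turn controlled by the reconstruction distance (`exists_besovNorm_sub_le`). -/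

namespace SingularMD

/-! ### One-dimensional smearing of a power singularity. -/

section Bump

/-- The rescaled profile `(1 + y²)⁻¹`. -/
def bump (lam y : ℝ) : ℝ := lam⁻¹ * (1 + (lam⁻¹ * y) ^ 2)⁻¹

theorem bump_nonneg {lam : ℝ} (h : 0 < lam) (y : ℝ) : 0 ≤ bump lam y := by
  unfold bump; positivity

theorem bump_le_inv {lam : ℝ} (h : 0 < lam) (y : ℝ) : bump lam y ≤ lam⁻¹ := by
  unfold bump
  refine mul_le_of_le_one_right (by positivity) (inv_le_one_of_one_le₀ ?_)
  nlinarith [sq_nonneg (lam⁻¹ * y)]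

/-- The inequality 1 + u² ≥ 2u with u = |y|/lam cancels the scale, so away from the origin the
profile is bounded uniformly in `lam`. -/
theorem bump_le_of_le {lam ρ y : ℝ} (h : 0 < lam) (hρ : 0 < ρ) (hy : ρ ≤ |y|) :
    bump lam y ≤ (2 * ρ)⁻¹ := by
  unfold bump
  rw [← mul_inv]
  refine inv_anti₀ (by positivity) ?_
  have h1 : 2 * (lam⁻¹ * |y|) ≤ 1 + (lam⁻¹ * y) ^ 2 := by
    have : (lam⁻¹ * y) ^ 2 = (lam⁻¹ * |y|) ^ 2 := by rw [mul_pow, mul_pow, sq_abs]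
    rw [this]; nlinarith [sq_nonneg (lam⁻¹ * |y| - 1)]
  have h2 : lam * (2 * (lam⁻¹ * |y|)) = 2 * |y| := by field_simp
  nlinarith [mul_le_mul_of_nonneg_left h1 h.le]

theorem integrable_bump {lam : ℝ} (h : 0 < lam) (x : ℝ) :
    Integrable (fun z => bump lam (x - z)) := by
  have h1 : Integrable (fun z : ℝ => bump lam z) :=
    ((integrable_inv_one_add_sq.comp_mul_left' (inv_pos.2 h).ne').const_mul _)
  exact h1.comp_sub_left x

theorem integral_bump {lam : ℝ} (h : 0 < lam) (x : ℝ) : ∫ z, bump lam (x - z) = Real.pi := by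
  rw [integral_sub_left_eq_self (fun z => bump lam z) volume x]
  unfold bump
  rw [integral_const_mul, Measure.integral_comp_mul_left (fun y => (1 + y ^ 2)⁻¹),
    integral_univ_inv_one_add_sq, inv_inv, abs_of_pos h, smul_eq_mul]
  field_simp

theorem integrableOn_abs_rpow_neg {θ ρ : ℝ} (hθ : θ < 1) (hρ : 0 < ρ) :
    IntegrableOn (fun z : ℝ => |z| ^ (-θ)) (Set.Ioc (-ρ) ρ) ∧
      ∫ z in Set.Ioc (-ρ) ρ, |z| ^ (-θ) = 2 * (ρ ^ (1 - θ) / (1 - θ)) := by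
  have hpos : IntervalIntegrable (fun z : ℝ => |z| ^ (-θ)) volume 0 ρ := by
    refine (intervalIntegral.intervalIntegrable_rpow' (a := 0) (b := ρ)
      (by linarith : -1 < -θ)).congr ?_
    intro z hz
    rw [Set.uIoc_of_le hρ.le] at hz
    simp [abs_of_pos hz.1]
  have hneg : IntervalIntegrable (fun z : ℝ => |z| ^ (-θ)) volume (-ρ) 0 := by
    have := ((IntervalIntegrable.iff_comp_neg (by simp)).1 hpos).symm
    simpa using this
  have hall := hneg.trans hpos
  have hle : -ρ ≤ ρ := by linarith
  refine ⟨(intervalIntegrable_iff_integrableOn_Ioc_of_le hle).1 hall, ?_⟩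
  rw [← intervalIntegral.integral_of_le hle, ← intervalIntegral.integral_add_adjacent_intervals hneg hpos]
  have e1 : ∫ z in (0 : ℝ)..ρ, |z| ^ (-θ) = ρ ^ (1 - θ) / (1 - θ) := by
    have : ∫ z in (0 : ℝ)..ρ, |z| ^ (-θ) = ∫ z in (0 : ℝ)..ρ, z ^ (-θ) := by
      refine intervalIntegral.integral_congr fun z hz => ?_
      rw [Set.uIcc_of_le hρ.le] at hz
      simp [abs_of_nonneg hz.1]
    rw [this, integral_rpow (Or.inl (by linarith)), Real.zero_rpow (by linarith)]
    rw [show -θ + 1 = 1 - θ by ring, sub_zero]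
  have e2 : ∫ z in (-ρ)..(0 : ℝ), |z| ^ (-θ) = ∫ z in (0 : ℝ)..ρ, |z| ^ (-θ) := by
    have := intervalIntegral.integral_comp_neg (a := 0) (b := ρ) (fun z : ℝ => |z| ^ (-θ))
    simp only [abs_neg, neg_zero] at this
    exact this.symm
  rw [e2, e1]; ring

/-- Cut at |z| = ρ. Outside, the singular factor is at most ρ^{-θ} and the bump has mass π; inside,
the bump is at most m and |z|^{-θ} is integrable because θ < 1. -/
theorem bump_mul_rpow_bound {θ lam ρ m x : ℝ} (hθ0 : 0 ≤ θ) (hθ : θ < 1) (hl : 0 < lam)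
    (hρ : 0 < ρ) (h : ∀ z, |z| ≤ ρ → bump lam (x - z) ≤ m) :
    Integrable (fun z => bump lam (x - z) * |z| ^ (-θ)) ∧
      ∫ z, bump lam (x - z) * |z| ^ (-θ) ≤
        ρ ^ (-θ) * Real.pi + m * (2 * (ρ ^ (1 - θ) / (1 - θ))) := by
  obtain ⟨hi, hv⟩ := integrableOn_abs_rpow_neg hθ hρ
  have hb := integrable_bump hl x
  set g : ℝ → ℝ := fun z => ρ ^ (-θ) * bump lam (x - z) +
    m * (Set.Ioc (-ρ) ρ).indicator (fun z : ℝ => |z| ^ (-θ)) z with hg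
  have hind : Integrable ((Set.Ioc (-ρ) ρ).indicator (fun z : ℝ => |z| ^ (-θ))) :=
    (integrable_indicator_iff measurableSet_Ioc).2 hi
  have hgi : Integrable g := (hb.const_mul _).add (hind.const_mul _)
  have hle : ∀ z, bump lam (x - z) * |z| ^ (-θ) ≤ g z := by
    intro z
    have h0 := bump_nonneg hl (x - z)
    have hz0 : 0 ≤ |z| ^ (-θ) := by positivity
    have hρ0 : 0 ≤ ρ ^ (-θ) := by positivity
    by_cases hz : z ∈ Set.Ioc (-ρ) ρ
    · simp only [hg, Set.indicator_of_mem hz]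
      have : |z| ≤ ρ := abs_le.2 ⟨hz.1.le, hz.2⟩
      nlinarith [h z this, mul_le_mul_of_nonneg_right (h z this) hz0, mul_nonneg hρ0 h0]
    · simp only [hg, Set.indicator_of_notMem hz, mul_zero, add_zero]
      have : ρ ≤ |z| := by
        by_contra hc
        push Not at hc
        exact hz ⟨(abs_lt.1 hc).1, (abs_lt.1 hc).2.le⟩
      have : |z| ^ (-θ) ≤ ρ ^ (-θ) :=
        Real.rpow_le_rpow_of_nonpos hρ this (by linarith)
      nlinarith
  have hf0 : ∀ z, 0 ≤ bump lam (x - z) * |z| ^ (-θ) := fun z =>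
    mul_nonneg (bump_nonneg hl _) (by positivity)
  have hfi : Integrable (fun z => bump lam (x - z) * |z| ^ (-θ)) := by
    refine hgi.mono' ?_ (Eventually.of_forall fun z => ?_)
    · unfold bump; exact (by fun_prop : Measurable _).aestronglyMeasurable
    · rw [Real.norm_eq_abs, abs_of_nonneg (hf0 z)]; exact hle z
  refine ⟨hfi, (integral_mono hfi hgi hle).trans (le_of_eq ?_)⟩
  rw [hg, integral_add (hb.const_mul _) (hind.const_mul _), integral_const_mul, integral_const_mul,
    integral_bump hl, integral_indicator measurableSet_Ioc, hv]

/-- Smearing the singular weight `1 + |z|^{-θ}`, `θ < 1`, at scale `lam`. -/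
theorem exists_bump_weight_bound {θ : ℝ} (hθ0 : 0 ≤ θ) (hθ : θ < 1) :
    ∃ C : ℝ, 0 ≤ C ∧ ∀ lam x : ℝ, 0 < lam → 
      Integrable (fun z => bump lam (x - z) * (1 + |z| ^ (-θ))) ∧
      (lam ≤ 1 → ∫ z, bump lam (x - z) * (1 + |z| ^ (-θ)) ≤ C * lam ^ (-θ)) ∧
      (x ≠ 0 → ∫ z, bump lam (x - z) * (1 + |z| ^ (-θ)) ≤ C * (1 + |x| ^ (-θ))) := by
  have hθ1 : 0 < 1 - θ := by linarith
  set c : ℝ := Real.pi + 2 * (1 / (1 - θ)) with hc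
  have hc0 : 0 ≤ c := by positivity
  have hcπ : Real.pi ≤ c := by
    rw [hc]; have : 0 ≤ 2 * (1 / (1 - θ)) := by positivity
    linarith
  refine ⟨2 * c, by positivity, fun lam x hl => ?_⟩
  -- With the cut at ρ = lam and the bound lam⁻¹ for the bump, both pieces are multiples of
  -- lam^{-θ}.
  obtain ⟨i1, b1⟩ := bump_mul_rpow_bound (x := x) hθ0 hθ hl hl
    (fun z _ => bump_le_inv hl _)
  have hb := integrable_bump hl x
  have e : (fun z => bump lam (x - z) * (1 + |z| ^ (-θ))) =
      fun z => bump lam (x - z) + bump lam (x - z) * |z| ^ (-θ) := by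
    funext z; ring
  have key : ∫ z, bump lam (x - z) * (1 + |z| ^ (-θ)) =
      Real.pi + ∫ z, bump lam (x - z) * |z| ^ (-θ) := by
    rw [e, integral_add hb i1, integral_bump hl]
  have hsplit : ∀ r : ℝ, 0 < r → r ^ (1 - θ) = r * r ^ (-θ) := fun r hr => by
    rw [sub_eq_add_neg, Real.rpow_add hr, Real.rpow_one]
  refine ⟨by rw [e]; exact hb.add i1, fun h1 => ?_, fun hx => ?_⟩
  · rw [key]
    have h2 : 1 ≤ lam ^ (-θ) := Real.one_le_rpow_of_pos_of_le_one_of_nonpos hl h1 (by linarith)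
    have h3 : lam ^ (-θ) * Real.pi + lam⁻¹ * (2 * (lam ^ (1 - θ) / (1 - θ))) = c * lam ^ (-θ) := by
      rw [hsplit lam hl, hc]; field_simp
    rw [h3] at b1
    nlinarith
  · rw [key]
    have hx0 : 0 < |x| := abs_pos.2 hx
    have hρ : 0 < |x| / 2 := by positivity
    -- On |z| ≤ |x|/2 the bump is evaluated at distance at least |x|/2 from the origin. Its bound
    -- |x|⁻¹ there is free of `lam`, so this estimate holds at every scale.
    obtain ⟨-, b2⟩ := bump_mul_rpow_bound (x := x) (m := |x|⁻¹) hθ0 hθ hl hρ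
      (fun z hz => by
        have : |x| / 2 ≤ |x - z| := by
          have := abs_sub_abs_le_abs_sub x z
          linarith
        refine (bump_le_of_le hl hρ this).trans (le_of_eq ?_)
        congr 1; ring)
    have h4 : (|x| / 2) ^ (-θ) ≤ 2 * |x| ^ (-θ) := by
      rw [Real.div_rpow hx0.le (by norm_num), Real.rpow_neg (by norm_num : (0:ℝ) ≤ 2) θ, div_inv_eq_mul,
        mul_comm]
      refine mul_le_mul_of_nonneg_right ?_ (by positivity)
      calc (2 : ℝ) ^ θ ≤ 2 ^ (1 : ℝ) := Real.rpow_le_rpow_of_exponent_le (by norm_num) hθ.le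
        _ = 2 := by norm_num
    have h3 : (|x| / 2) ^ (-θ) * Real.pi + |x|⁻¹ * (2 * ((|x| / 2) ^ (1 - θ) / (1 - θ))) ≤
        c * (|x| / 2) ^ (-θ) := by
      rw [hsplit _ hρ, hc]
      have h5 : |x|⁻¹ * (2 * (|x| / 2 * (|x| / 2) ^ (-θ) / (1 - θ))) =
          1 / (1 - θ) * (|x| / 2) ^ (-θ) := by field_simp
      rw [h5]
      have : 0 ≤ 1 / (1 - θ) * (|x| / 2) ^ (-θ) := by positivity
      linarith
    have h6 : 0 ≤ |x| ^ (-θ) := by positivity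
    nlinarith [b2.trans h3, mul_le_mul_of_nonneg_left h4 hc0]

end Bump

variable {d : ℕ}

/-! ### Scaled norms and monomials. -/

section ScaledSpace

theorem Scaling.s_pos (σ : Scaling d) (i : Fin d) : 0 < σ.s i := zero_lt_one.trans_le (σ.one_le i)

theorem Scaling.nrm_nonneg (σ : Scaling d) (x : Pt d) : 0 ≤ σ.nrm x :=
  Finset.sum_nonneg fun _ _ => by positivity

theorem Scaling.nrm_neg (σ : Scaling d) (x : Pt d) : σ.nrm (-x) = σ.nrm x := by
  simp [Scaling.nrm]

theorem Scaling.nrm_sub_comm (σ : Scaling d) (x y : Pt d) : σ.nrm (x - y) = σ.nrm (y - x) := by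
  rw [← σ.nrm_neg, neg_sub]

theorem Scaling.abs_rpow_le_nrm (σ : Scaling d) (x : Pt d) (i : Fin d) :
    |x i| ^ (1 / σ.s i) ≤ σ.nrm x :=
  Finset.single_le_sum (f := fun j => |x j| ^ (1 / σ.s j)) (fun _ _ => by positivity)
    (Finset.mem_univ i)

theorem Scaling.abs_le_nrm_rpow (σ : Scaling d) (x : Pt d) (i : Fin d) :
    |x i| ≤ σ.nrm x ^ σ.s i := by
  have h := Real.rpow_le_rpow (by positivity) (σ.abs_rpow_le_nrm x i) (σ.s_pos i).le
  rwa [← Real.rpow_mul (abs_nonneg _), one_div_mul_cancel (σ.s_pos i).ne', Real.rpow_one] at h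

theorem Scaling.nrm_pos (σ : Scaling d) {x : Pt d} (hx : x ≠ 0) : 0 < σ.nrm x := by
  obtain ⟨i, hi⟩ := Function.ne_iff.1 hx
  refine lt_of_lt_of_le ?_ (σ.abs_rpow_le_nrm x i)
  exact Real.rpow_pos_of_pos (abs_pos.2 hi) _

theorem Scaling.deg_nonneg (σ : Scaling d) (k : Idx d) : 0 ≤ σ.deg k :=
  Finset.sum_nonneg fun i _ => mul_nonneg (σ.s_pos i).le (Nat.cast_nonneg _)

theorem Scaling.deg_add (σ : Scaling d) (k l : Idx d) : σ.deg (k + l) = σ.deg k + σ.deg l := by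
  simp [Scaling.deg, mul_add, Finset.sum_add_distrib]

theorem Scaling.deg_single_pos (σ : Scaling d) (i : Fin d) :
    0 < σ.deg (Pi.single i 1 : Idx d) := by
  classical
  have : σ.deg (Pi.single i 1 : Idx d) = σ.s i := by
    simp [Scaling.deg, Pi.single_apply]
  rw [this]; exact σ.s_pos i

theorem abs_mpow_le (σ : Scaling d) (x : Pt d) (k : Idx d) :
    |mpow x k| ≤ σ.nrm x ^ σ.deg k := by
  unfold mpow Scaling.deg
  rw [Finset.abs_prod]
  -- Turning a sum of exponents into a product needs a positive base. If the norm is zero, all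
  -- coordinates vanish and so does the monomial, unless k = 0.
  rcases (σ.nrm_nonneg x).eq_or_lt with h0 | h0
  · by_cases hk : k = 0
    · subst hk; simp
    · obtain ⟨i, hi⟩ := Function.ne_iff.1 hk
      have hx : x i = 0 := by
        have := σ.abs_le_nrm_rpow x i
        rw [← h0, Real.zero_rpow (σ.s_pos i).ne'] at this
        exact abs_eq_zero.1 (le_antisymm this (abs_nonneg _))
      rw [Finset.prod_eq_zero (Finset.mem_univ i) (by
        rw [hx, zero_pow hi, abs_zero])]
      positivity
  · rw [Real.rpow_sum_of_pos h0]
    refine Finset.prod_le_prod (fun _ _ => abs_nonneg _) fun i _ => ?_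
    rw [abs_pow, Real.rpow_mul h0.le, Real.rpow_natCast]
    exact pow_le_pow_left₀ (abs_nonneg _) (σ.abs_le_nrm_rpow x i) _

theorem Scaling.nrm_dil (σ : Scaling d) {t : ℝ} (ht : 0 < t) (x : Pt d) :
    σ.nrm (σ.dil t x) = t ^ (1 / σ.ell) * σ.nrm x := by
  unfold Scaling.nrm Scaling.dil
  rw [Finset.mul_sum]
  refine Finset.sum_congr rfl fun i _ => ?_
  have hs := (σ.s_pos i).ne'
  have hl := σ.ell_pos.ne'
  rw [abs_mul, abs_of_pos (Real.rpow_pos_of_pos ht _), Real.mul_rpow (by positivity) (abs_nonneg _),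
    ← Real.rpow_mul ht.le]
  congr 2
  field_simp

/-- The distance to the origin at scale `t`, bounded away from zero. -/
def Scaling.rho (σ : Scaling d) (t : ℝ) (x : Pt d) : ℝ := 1 + t ^ (-(1 / σ.ell)) * σ.nrm x

theorem Scaling.one_le_rho (σ : Scaling d) {t : ℝ} (ht : 0 < t) (x : Pt d) : 1 ≤ σ.rho t x := by
  have := σ.nrm_nonneg x
  unfold Scaling.rho
  have : 0 ≤ t ^ (-(1 / σ.ell)) * σ.nrm x := by positivity
  linarith

theorem Scaling.rho_sub_comm (σ : Scaling d) (t : ℝ) (x y : Pt d) :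
    σ.rho t (x - y) = σ.rho t (y - x) := by
  unfold Scaling.rho; rw [σ.nrm_sub_comm]

/-- `‖x‖^c ≤ t^{c/ℓ} (1 + t^{-1/ℓ}‖x‖)^N` for `0 ≤ c ≤ N`. -/
theorem Scaling.nrm_rpow_le (σ : Scaling d) {t c : ℝ} {N : ℕ} (ht : 0 < t) (hc : 0 ≤ c)
    (hN : c ≤ N) (x : Pt d) :
    σ.nrm x ^ c ≤ t ^ (c / σ.ell) * σ.rho t x ^ N := by
  have h1 : σ.nrm x ≤ t ^ (1 / σ.ell) * σ.rho t x := by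
    unfold Scaling.rho
    rw [mul_add, ← mul_assoc, ← Real.rpow_add ht, add_neg_cancel, Real.rpow_zero, one_mul]
    have : 0 < t ^ (1 / σ.ell) := Real.rpow_pos_of_pos ht _
    linarith
  have hρ := σ.one_le_rho ht x
  calc σ.nrm x ^ c ≤ (t ^ (1 / σ.ell) * σ.rho t x) ^ c :=
        Real.rpow_le_rpow (σ.nrm_nonneg x) h1 hc
    _ = t ^ (c / σ.ell) * σ.rho t x ^ c := by
        rw [Real.mul_rpow (by positivity) (by linarith), ← Real.rpow_mul ht.le]
        congr 2; ring
    _ ≤ t ^ (c / σ.ell) * σ.rho t x ^ N := by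
        refine mul_le_mul_of_nonneg_left ?_ (by positivity)
        rw [← Real.rpow_natCast]
        exact Real.rpow_le_rpow_of_exponent_le hρ hN

end ScaledSpace

/-! ### Testing against rescaled kernels. -/

section Testing

/-- All polynomially weighted suprema of `W(t^{𝔰/ℓ}x) G(x)`, `t ≤ 1`, are finite. -/
def Scaling.Decays (σ : Scaling d) (G W : Pt d → ℝ) : Prop :=
  ∀ n : ℕ, ∃ C : ℝ, ∀ t, 0 < t → t ≤ 1 → ∀ x, σ.nrm x ^ n * W (σ.dil t x) * G x ≤ C

variable {σ : Scaling d} {G W : Pt d → ℝ}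

theorem Scaling.scaled_nonneg (σ : Scaling d) (hG0 : ∀ x, 0 ≤ G x) {t : ℝ} (ht : 0 < t)
    (x : Pt d) : 0 ≤ σ.scaled G t x :=
  mul_nonneg (by positivity) (hG0 _)

theorem Weight.IsControlled.decays {u : Weight d} (hu : u.IsControlled σ G) :
    σ.Decays G u.star := fun n => hu.integrable n 1 one_pos

theorem Scaling.Decays.const_mul (hW : σ.Decays G W) {c : ℝ} (hc : 0 ≤ c) :
    σ.Decays G (fun x => c * W x) := fun n => by
  obtain ⟨C, hC⟩ := hW n
  refine ⟨c * C, fun t ht ht1 x => ?_⟩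
  have := mul_le_mul_of_nonneg_left (hC t ht ht1 x) hc
  linarith

theorem Scaling.Decays.pow_bound (hW : σ.Decays G W) (hG0 : ∀ x, 0 ≤ G x) (hW0 : ∀ x, 0 ≤ W x)
    (n : ℕ) : ∃ C : ℝ, 0 ≤ C ∧ ∀ t, 0 < t → t ≤ 1 → ∀ x,
      (1 + σ.nrm x) ^ n * W (σ.dil t x) * G x ≤ C := by
  obtain ⟨C0, h0⟩ := hW 0
  obtain ⟨C1, h1⟩ := hW n
  have hp : ∀ (m : ℕ) C, (∀ t, 0 < t → t ≤ 1 → ∀ x,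
      σ.nrm x ^ m * W (σ.dil t x) * G x ≤ C) → 0 ≤ C := fun m C h =>
    le_trans (mul_nonneg (mul_nonneg (pow_nonneg (σ.nrm_nonneg _) _) (hW0 _)) (hG0 _))
      (h 1 one_pos le_rfl 0)
  refine ⟨2 ^ (n - 1) * (C0 + C1), ?_, fun t ht ht1 x => ?_⟩
  · have := hp 0 C0 h0; have := hp n C1 h1; positivity
  · have hpow := add_pow_le zero_le_one (σ.nrm_nonneg x) n
    have a0 := h0 t ht ht1 x
    have a1 := h1 t ht ht1 x
    have hWG : 0 ≤ W (σ.dil t x) * G x := mul_nonneg (hW0 _) (hG0 _)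
    calc (1 + σ.nrm x) ^ n * W (σ.dil t x) * G x
        ≤ (2 ^ (n - 1) * (1 ^ n + σ.nrm x ^ n)) * (W (σ.dil t x) * G x) := by
          rw [mul_assoc]; exact mul_le_mul_of_nonneg_right hpow hWG
      _ = 2 ^ (n - 1) * (σ.nrm x ^ 0 * W (σ.dil t x) * G x +
            σ.nrm x ^ n * W (σ.dil t x) * G x) := by ring
      _ ≤ 2 ^ (n - 1) * (C0 + C1) := by gcongr

/-- Pointwise domination of a rescaled kernel by a product of bumps. -/
theorem Scaling.Decays.exists_le_prod_bump (hW : σ.Decays G W) (hG0 : ∀ x, 0 ≤ G x)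
    (hW0 : ∀ x, 0 ≤ W x) (N : ℕ) : ∃ C : ℝ, 0 ≤ C ∧ ∀ t, 0 < t → t ≤ 1 → ∀ x,
      σ.scaled G t x * W x * σ.rho t x ^ N ≤ C * ∏ i, bump (t ^ (σ.s i / σ.ell)) (x i) := by
  -- An integer above all 𝔰_i, so that |y_i| ≤ ‖y‖^{𝔰_i} ≤ (1 + ‖y‖)^m.
  set m : ℕ := ⌈σ.total⌉₊ with hm
  have hsm : ∀ i, σ.s i ≤ m := fun i =>
    (Finset.single_le_sum (f := σ.s) (fun j _ => (σ.s_pos j).le) (Finset.mem_univ i)).trans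
      (Nat.le_ceil _)
  -- N powers pay for ρ^N, and 2m powers for each of the d factors 1 + y_i².
  obtain ⟨C, hC0, hC⟩ := hW.pow_bound hG0 hW0 (N + 2 * m * d)
  refine ⟨2 ^ d * C, by positivity, fun t ht ht1 x => ?_⟩
  set y : Pt d := fun i => t ^ (-σ.s i / σ.ell) * x i with hy
  have hxy : x = σ.dil t y := by
    funext i
    simp only [Scaling.dil, hy]
    rw [← mul_assoc, ← Real.rpow_add ht, neg_div, add_neg_cancel, Real.rpow_zero, one_mul]
  have hρ : σ.rho t x = 1 + σ.nrm y := by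
    rw [Scaling.rho, hxy, σ.nrm_dil ht, ← mul_assoc, ← Real.rpow_add ht, neg_add_cancel,
      Real.rpow_zero, one_mul]
  have hbump : ∏ i, bump (t ^ (σ.s i / σ.ell)) (x i) =
      t ^ (-σ.total / σ.ell) * ∏ i, (1 + y i ^ 2)⁻¹ := by
    unfold bump
    rw [Finset.prod_mul_distrib]
    congr 1
    · unfold Scaling.total
      rw [neg_div, Finset.sum_div, ← Finset.sum_neg_distrib, Real.rpow_sum_of_pos ht]
      exact Finset.prod_congr rfl fun i _ => (Real.rpow_neg ht.le _).symm
    · refine Finset.prod_congr rfl fun i _ => ?_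
      simp only [hy, neg_div, Real.rpow_neg ht.le]
  rw [hbump, hρ]
  have hr1 : 1 ≤ 1 + σ.nrm y := by linarith [σ.nrm_nonneg y]
  have hfac : ∀ i, 1 + y i ^ 2 ≤ 2 * (1 + σ.nrm y) ^ (2 * m) := fun i => by
    have h1 : |y i| ≤ (1 + σ.nrm y) ^ m := by
      refine (σ.abs_le_nrm_rpow y i).trans ?_
      rw [← Real.rpow_natCast]
      refine (Real.rpow_le_rpow (σ.nrm_nonneg y) (by linarith : σ.nrm y ≤ 1 + σ.nrm y)
        (σ.s_pos i).le).trans ?_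
      exact Real.rpow_le_rpow_of_exponent_le hr1 (hsm i)
    have h2 : y i ^ 2 ≤ (1 + σ.nrm y) ^ (2 * m) := by
      rw [← sq_abs, mul_comm 2 m, pow_mul]
      exact pow_le_pow_left₀ (abs_nonneg _) h1 2
    have h3 : (1 : ℝ) ≤ (1 + σ.nrm y) ^ (2 * m) := one_le_pow₀ hr1
    linarith
  have hprod : ∏ i, (1 + y i ^ 2) ≤ 2 ^ d * (1 + σ.nrm y) ^ (2 * m * d) := by
    calc ∏ i, (1 + y i ^ 2) ≤ ∏ _i : Fin d, 2 * (1 + σ.nrm y) ^ (2 * m) :=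
          Finset.prod_le_prod (fun i _ => by positivity) fun i _ => hfac i
      _ = _ := by
          rw [Finset.prod_const, Finset.card_univ, Fintype.card_fin, mul_pow, ← pow_mul]
  have hpos : 0 < ∏ i, (1 + y i ^ 2) := Finset.prod_pos fun i _ => by positivity
  have hmain : G y * W x * (1 + σ.nrm y) ^ N ≤ 2 ^ d * C * ∏ i, (1 + y i ^ 2)⁻¹ := by
    rw [Finset.prod_inv_distrib, ← div_eq_mul_inv, le_div_iff₀ hpos]
    have hb := hC t ht ht1 y
    rw [← hxy] at hb
    have h0 : 0 ≤ G y * W x * (1 + σ.nrm y) ^ N :=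
      mul_nonneg (mul_nonneg (hG0 _) (hW0 _)) (by positivity)
    calc G y * W x * (1 + σ.nrm y) ^ N * ∏ i, (1 + y i ^ 2)
        ≤ G y * W x * (1 + σ.nrm y) ^ N * (2 ^ d * (1 + σ.nrm y) ^ (2 * m * d)) :=
          mul_le_mul_of_nonneg_left hprod h0
      _ = 2 ^ d * ((1 + σ.nrm y) ^ (N + 2 * m * d) * W x * G y) := by rw [pow_add]; ring
      _ ≤ 2 ^ d * C := by gcongr
  have ht' : 0 ≤ t ^ (-σ.total / σ.ell) := by positivity
  unfold Scaling.scaled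
  calc t ^ (-σ.total / σ.ell) * G y * W x * (1 + σ.nrm y) ^ N
      = t ^ (-σ.total / σ.ell) * (G y * W x * (1 + σ.nrm y) ^ N) := by ring
    _ ≤ t ^ (-σ.total / σ.ell) * (2 ^ d * C * ∏ i, (1 + y i ^ 2)⁻¹) := by gcongr
    _ = _ := by ring

variable [NeZero d]

theorem Scaling.phi_nonneg (σ : Scaling d) (x : Pt d) : 0 ≤ σ.phi x :=
  le_min (by positivity) zero_le_one

theorem Scaling.phi_le_one (σ : Scaling d) (x : Pt d) : σ.phi x ≤ 1 := min_le_right _ _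

theorem Scaling.phi_pos (σ : Scaling d) {x : Pt d} (hx : x 0 ≠ 0) : 0 < σ.phi x :=
  lt_min (Real.rpow_pos_of_pos (abs_pos.2 hx) _) one_pos

/-- With `Scaling.le_phi_rpow_neg`, φ^{-a} is comparable to 1 + |x_1|^{-a/𝔰_1}. The one-dimensional
estimate then applies with θ = a/𝔰_1, and θ < 1 means a < 𝔰_1. -/
theorem Scaling.phi_rpow_neg_le (σ : Scaling d) {a : ℝ} (x : Pt d) :
    σ.phi x ^ (-a) ≤ 1 + |x 0| ^ (-(a / σ.s 0)) := by
  have h0 : 0 ≤ |x 0| ^ (-(a / σ.s 0)) := by positivity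
  have h1 : (|x 0| ^ (1 / σ.s 0)) ^ (-a) = |x 0| ^ (-(a / σ.s 0)) := by
    rw [← Real.rpow_mul (abs_nonneg _)]; congr 1; ring
  unfold Scaling.phi
  rcases min_choice (|x 0| ^ (1 / σ.s 0)) 1 with h | h <;> rw [h]
  · rw [h1]; linarith
  · rw [Real.one_rpow]; linarith

theorem Scaling.le_phi_rpow_neg (σ : Scaling d) {a : ℝ} (ha : 0 ≤ a) {x : Pt d} (hx : x 0 ≠ 0) :
    1 + |x 0| ^ (-(a / σ.s 0)) ≤ 2 * σ.phi x ^ (-a) := by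
  have h1 : (|x 0| ^ (1 / σ.s 0)) ^ (-a) = |x 0| ^ (-(a / σ.s 0)) := by
    rw [← Real.rpow_mul (abs_nonneg _)]; congr 1; ring
  have h2 := Real.rpow_le_rpow_of_nonpos (σ.phi_pos hx) (min_le_left _ _ : σ.phi x ≤ _)
    (by linarith : -a ≤ 0)
  have h3 := Real.one_le_rpow_of_pos_of_le_one_of_nonpos (σ.phi_pos hx) (σ.phi_le_one x)
    (by linarith : -a ≤ 0)
  rw [h1] at h2
  linarith

/-- Testing a function which is singular at the hyperplane against a rescaled kernel. -/
theorem Scaling.Decays.exists_test (hW : σ.Decays G W) (hG0 : ∀ x, 0 ≤ G x)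
    (hW0 : ∀ x, 0 ≤ W x) (N : ℕ) {a : ℝ} (ha0 : 0 ≤ a) (ha : a < σ.s 0) :
    ∃ C : ℝ, 0 ≤ C ∧ ∀ t, 0 < t → t ≤ 1 → ∀ (x : Pt d) (f : Pt d → ℝ) (p : ℝ), 0 ≤ p →
      AEStronglyMeasurable f →
      (∀ᵐ z, |f z| ≤ p * (σ.scaled G t (x - z) * W (x - z) * σ.rho t (x - z) ^ N *
        σ.phi z ^ (-a))) →
      Integrable f ∧ (|∫ z, f z| ≤ C * p * t ^ (-a / σ.ell)) ∧
        (x 0 ≠ 0 → |∫ z, f z| ≤ C * p * σ.phi x ^ (-a)) := by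
  obtain ⟨C₁, hC₁, h₁⟩ := hW.exists_le_prod_bump hG0 hW0 N
  have hs0 := σ.s_pos 0
  obtain ⟨C₂, hC₂, h₂⟩ := exists_bump_weight_bound (θ := a / σ.s 0) (by positivity)
    ((div_lt_one hs0).2 ha)
  set c : ℝ := ∏ _i ∈ (Finset.univ : Finset (Fin d)).erase 0, Real.pi with hc
  have hc0 : 0 ≤ c := Finset.prod_nonneg fun _ _ => Real.pi_pos.le
  refine ⟨C₁ * c * C₂ * 2, by positivity, fun t ht ht1 x f p hp hf hle => ?_⟩
  have hlam : ∀ i, 0 < t ^ (σ.s i / σ.ell) := fun i => Real.rpow_pos_of_pos ht _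
  -- The majorant is a product of functions of one variable. Only the time coordinate carries the
  -- singular weight; every other coordinate integrates to π, which accounts for `c`.
  set F : Fin d → ℝ → ℝ := fun i z => bump (t ^ (σ.s i / σ.ell)) (x i - z) *
    (if i = 0 then 1 + |z| ^ (-(a / σ.s 0)) else 1) with hF
  have hF0 : ∀ i z, 0 ≤ F i z := fun i z => by
    refine mul_nonneg (bump_nonneg (hlam i) _) ?_
    split_ifs <;> positivity
  have hFi : ∀ i, Integrable (F i) := fun i => by
    simp only [hF]
    by_cases hi : i = 0
    · simp only [hi, if_true]; exact (h₂ _ _ (hlam 0)).1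
    · simp only [hi, if_false, mul_one]; exact integrable_bump (hlam i) _
  set h : Pt d → ℝ := fun z => p * C₁ * ∏ i, F i (z i) with hh
  have hhi : Integrable h := (Integrable.fintype_prod hFi).const_mul _
  have hfh : ∀ᵐ z, ‖f z‖ ≤ h z := by
    filter_upwards [hle] with z hz
    rw [Real.norm_eq_abs]
    refine hz.trans ?_
    have e : ∏ i, F i (z i) = (∏ i, bump (t ^ (σ.s i / σ.ell)) ((x - z) i)) *
        (1 + |z 0| ^ (-(a / σ.s 0))) := by
      simp only [hF, Finset.prod_mul_distrib, Finset.prod_ite_eq', Finset.mem_univ, if_true,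
        Pi.sub_apply]
    simp only [hh]
    rw [e, mul_assoc p]
    refine mul_le_mul_of_nonneg_left ?_ hp
    rw [← mul_assoc]
    have hb : 0 ≤ ∏ i, bump (t ^ (σ.s i / σ.ell)) ((x - z) i) :=
      Finset.prod_nonneg fun i _ => bump_nonneg (hlam i) _
    exact mul_le_mul (h₁ t ht ht1 _) (σ.phi_rpow_neg_le z)
      (Real.rpow_nonneg (σ.phi_nonneg _) _) (by positivity)
  have hint : ∀ D : ℝ, 0 ≤ D → ∫ z, F 0 z ≤ D → ∫ z, h z ≤ C₁ * c * p * D := fun D hD hle => by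
    rw [hh, integral_const_mul, integral_fintype_prod_volume_eq_prod,
      ← Finset.mul_prod_erase _ _ (Finset.mem_univ (0 : Fin d))]
    have : ∏ i ∈ (Finset.univ : Finset (Fin d)).erase 0, ∫ z, F i z = c := by
      refine Finset.prod_congr rfl fun i hi => ?_
      simp only [hF, if_neg (Finset.ne_of_mem_erase hi), mul_one]
      exact integral_bump (hlam i) _
    rw [this]
    have : p * C₁ * ((∫ z, F 0 z) * c) ≤ p * C₁ * (D * c) := by gcongr
    linarith
  have hF00 : ∫ z, F 0 z = ∫ z, bump (t ^ (σ.s 0 / σ.ell)) (x 0 - z) *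
      (1 + |z| ^ (-(a / σ.s 0))) := by simp [hF]
  obtain ⟨-, hA, hB⟩ := h₂ (t ^ (σ.s 0 / σ.ell)) (x 0) (hlam 0)
  rw [← hF00] at hA hB
  have hnorm : |∫ z, f z| ≤ ∫ z, h z := norm_integral_le_of_norm_le hhi hfh
  refine ⟨hhi.mono' hf hfh, ?_, fun hx => ?_⟩
  · have hl1 : t ^ (σ.s 0 / σ.ell) ≤ 1 :=
      Real.rpow_le_one ht.le ht1 (div_nonneg hs0.le σ.ell_pos.le)
    have e : (t ^ (σ.s 0 / σ.ell)) ^ (-(a / σ.s 0)) = t ^ (-a / σ.ell) := by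
      rw [← Real.rpow_mul ht.le]; congr 1; field_simp
    have := hint _ (by positivity) (hA hl1)
    rw [e] at this
    refine hnorm.trans (this.trans ?_)
    have : 0 ≤ C₁ * c * C₂ * p * t ^ (-a / σ.ell) := by positivity
    linarith
  · have := hint _ (by positivity) (hB hx)
    refine hnorm.trans (this.trans ?_)
    have h5 := mul_le_mul_of_nonneg_left (σ.le_phi_rpow_neg ha0 hx)
      (by positivity : 0 ≤ C₁ * c * p * C₂)
    linarith

end Testing

/-! ### Integrable majorants at a fixed time. -/

section Tail

/-- The product of the profiles `(1 + x_i²)⁻¹`. -/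
def prodBump (x : Pt d) : ℝ := ∏ i, (1 + x i ^ 2)⁻¹

theorem prodBump_nonneg (x : Pt d) : 0 ≤ prodBump x :=
  Finset.prod_nonneg fun _ _ => by positivity

theorem prodBump_le_one (x : Pt d) : prodBump x ≤ 1 :=
  Finset.prod_le_one (fun _ _ => by positivity) fun i _ =>
    inv_le_one_of_one_le₀ (by nlinarith [sq_nonneg (x i)])

theorem integrable_prodBump_sub (x : Pt d) : Integrable (fun z => prodBump (x - z)) := by
  have h : ∀ i : Fin d, Integrable (fun z : ℝ => (1 + (x i - z) ^ 2)⁻¹) := fun i =>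
    integrable_inv_one_add_sq.comp_sub_left (x i)
  exact Integrable.fintype_prod h

/-- If |a - b| ≤ 1 then 1 + b² ≤ 3(1 + a²), coordinate by coordinate. The majorant of a kernel is
thus uniform while one coordinate varies in a unit interval, as differentiation under the integral
requires in `IsRegularizing.kderiv_conv`. -/
theorem prodBump_update_le (x z : Pt d) (i : Fin d) {r : ℝ} (hr : |r - x i| ≤ 1) :
    prodBump (Function.update x i r - z) ≤ 3 ^ d * prodBump (x - z) := by
  unfold prodBump
  have : (3 : ℝ) ^ d = ∏ _j : Fin d, 3 := by simp
  rw [this, ← Finset.prod_mul_distrib]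
  refine Finset.prod_le_prod (fun _ _ => by positivity) fun j _ => ?_
  have key : ∀ a b : ℝ, |a - b| ≤ 1 → (1 + a ^ 2)⁻¹ ≤ 3 * (1 + b ^ 2)⁻¹ := fun a b hab => by
    rw [← div_eq_mul_inv, le_div_iff₀ (by positivity), inv_mul_le_iff₀ (by positivity)]
    have := abs_le.1 hab
    nlinarith [sq_nonneg (2 * a - b), sq_nonneg (a - b), mul_nonneg (sub_nonneg.2 this.2)
      (by linarith [this.1] : 0 ≤ (a - b) + 1)]
  refine key _ _ ?_
  by_cases h : j = i
  · subst h
    simpa using hr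
  · simp [Function.update_of_ne h]

variable {σ : Scaling d} {G W : Pt d → ℝ}

/-- The kernel `G_t`, at fixed `t`, is dominated by an integrable product. -/
def Scaling.HasTail (σ : Scaling d) (G : Pt d → ℝ) : Prop :=
  ∀ t, 0 < t → ∃ C : ℝ, 0 ≤ C ∧ ∀ x, σ.scaled G t x ≤ C * prodBump x

/-- At t = 1 this is the product bound already proved. Another t rescales coordinate i by c_i, at
the cost of a factor 1 + c_i^{-2}. All t > 0 are covered, with no uniformity in t. -/
theorem Scaling.Decays.hasTail (hW : σ.Decays G W) (hG0 : ∀ x, 0 ≤ G x)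
    (hW1 : ∀ x, 1 ≤ W x) : σ.HasTail G := by
  obtain ⟨C, hC, h⟩ := hW.exists_le_prod_bump hG0 (fun x => zero_le_one.trans (hW1 x)) 0
  intro t ht
  have hGx : ∀ x, G x ≤ C * prodBump x := fun x => by
    have := h 1 one_pos le_rfl x
    simp only [Scaling.scaled, Real.one_rpow, one_mul, pow_zero, mul_one, bump, inv_one] at this
    exact (le_mul_of_one_le_right (hG0 x) (hW1 x)).trans this
  set c : Fin d → ℝ := fun i => t ^ (-σ.s i / σ.ell) with hc
  have hc0 : ∀ i, 0 < c i := fun i => Real.rpow_pos_of_pos ht _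
  refine ⟨t ^ (-σ.total / σ.ell) * (C * ∏ i, (1 + (c i ^ 2)⁻¹)), ?_, fun x => ?_⟩
  · have : 0 ≤ ∏ i, (1 + (c i ^ 2)⁻¹) := Finset.prod_nonneg fun i _ => by positivity
    positivity
  · have hp : prodBump (fun i => c i * x i) ≤ (∏ i, (1 + (c i ^ 2)⁻¹)) * prodBump x := by
      unfold prodBump
      rw [← Finset.prod_mul_distrib]
      refine Finset.prod_le_prod (fun _ _ => by positivity) fun i _ => ?_
      have := hc0 i
      rw [← div_eq_mul_inv, le_div_iff₀ (by positivity), inv_mul_le_iff₀ (by positivity)]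
      have e : (1 + (c i * x i) ^ 2) * (1 + (c i ^ 2)⁻¹) =
          1 + x i ^ 2 + (c i ^ 2)⁻¹ + (c i * x i) ^ 2 := by field_simp; ring
      rw [e]
      have : 0 ≤ (c i ^ 2)⁻¹ := by positivity
      nlinarith [sq_nonneg (c i * x i)]
    unfold Scaling.scaled
    calc _ ≤ t ^ (-σ.total / σ.ell) * (C * prodBump (fun i => c i * x i)) := by
          gcongr; exact hGx _
      _ ≤ t ^ (-σ.total / σ.ell) * (C * ((∏ i, (1 + (c i ^ 2)⁻¹)) * prodBump x)) := by gcongr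
      _ = _ := by ring

end Tail

/-! ### Derivatives of the kernel and the semigroup. -/

section KernelCalculus

/-- Induction on ∑ k_i: a nonzero multiindex can lose one unit in some coordinate. This matches
`IsRegularizing.hasDeriv`, which raises the order of a derivative by one in an arbitrary coordinate.
-/
theorem idx_induction {p : Idx d → Prop} (h0 : p 0)
    (hs : ∀ k i, p k → p (k + Pi.single i 1)) (k : Idx d) : p k := by
  obtain ⟨n, hn⟩ : ∃ n, ∑ i, k i = n := ⟨_, rfl⟩
  induction n generalizing k with
  | zero =>
    have : k = 0 := by
      funext i
      exact (Finset.sum_eq_zero_iff.1 hn) i (Finset.mem_univ i)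
    rwa [this]
  | succ n ih =>
    have : ∃ i, k i ≠ 0 := by
      by_contra hc
      push Not at hc
      simp [hc] at hn
    obtain ⟨i, hi⟩ := this
    have e : k = (k - Pi.single i 1) + Pi.single i 1 := by
      funext j
      by_cases h : j = i
      · subst h; simp; omega
      · simp [h]
    rw [e]
    refine hs _ _ (ih _ ?_)
    have e2 : ∑ j, k j = ∑ j, (k - Pi.single i 1 : Idx d) j + 1 := by
      conv_lhs => rw [e]
      simp [Finset.sum_add_distrib]
    omega

variable {σ : Scaling d} {G : Pt d → ℝ} {Q K : Ker d} {βb δ CK : ℝ}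

theorem kderiv_zero (K : Ker d) (t : ℝ) (x y : Pt d) : kderiv K 0 t x y = K t x y := by
  have : ∀ (L : List (Fin d)) (f : Pt d → ℝ),
      L.foldr (fun i g => (pderiv₁ i)^[(0 : Idx d) i] g) f = f := fun L f => by
    induction L with
    | nil => rfl
    | cons a L ih => simp
  unfold kderiv mderiv
  rw [this]

theorem Scaling.deg_lt_of_add_single {σ : Scaling d} {k : Idx d} {i : Fin d} {c : ℝ}
    (h : σ.deg (k + Pi.single i 1) < c) : σ.deg k < c := by
  rw [σ.deg_add] at h
  linarith [σ.deg_single_pos i]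

theorem IsRegularizing.hasDerivAt_update (hK : IsRegularizing σ G Q K βb δ CK) {k : Idx d}
    {i : Fin d} (hk : σ.deg (k + Pi.single i 1) < δ) {t : ℝ} (ht : 0 < t) (x y : Pt d) (r : ℝ) :
    HasDerivAt (fun r => kderiv K k t (Function.update x i r) y)
      (kderiv K (k + Pi.single i 1) t (Function.update x i r) y) r := by
  have := hK.hasDeriv k i hk t ht (Function.update x i r) y
  simpa using this

/-- K_t is continuous, and each further derivative is a pointwise limit of difference quotients of
the preceding one. -/
theorem IsRegularizing.measurable_kderiv (hK : IsRegularizing σ G Q K βb δ CK) (k : Idx d)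
    (hk : σ.deg k < δ) {t : ℝ} (ht : 0 < t) (x : Pt d) :
    Measurable (fun y => kderiv K k t x y) := by
  induction k using idx_induction generalizing x with
  | h0 =>
    simp only [kderiv_zero]
    have := (hK.cont t ht).comp (Continuous.prodMk_right x)
    exact this.measurable
  | hs k i ih =>
    have hk' := Scaling.deg_lt_of_add_single hk
    set e : ℕ → ℝ := fun n => 1 / ((n : ℝ) + 1) with he
    have hlim : Tendsto e atTop (𝓝[≠] 0) := by
      refine tendsto_nhdsWithin_iff.2 ⟨tendsto_one_div_add_atTop_nhds_zero_nat, ?_⟩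
      exact Eventually.of_forall fun n => by
        have : (0 : ℝ) < e n := Nat.one_div_pos_of_nat
        exact this.ne'
    refine measurable_of_tendsto_metrizable (f := fun n y => (e n)⁻¹ •
      (kderiv K k t (Function.update x i (x i + e n)) y -
        kderiv K k t (Function.update x i (x i)) y)) (fun n => ?_) ?_
    · simp only [smul_eq_mul]
      exact ((ih hk' _).sub (ih hk' _)).const_mul _
    · rw [tendsto_pi_nhds]
      intro y
      exact (hasDerivAt_iff_tendsto_slope_zero.1 (hK.hasDeriv k i hk t ht x y)).comp hlim

theorem IsSemigroup.exists_bound (hQ : IsSemigroup σ G Q) (hT : σ.HasTail G) {s : ℝ}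
    (hs : 0 < s) : ∃ C : ℝ, 0 ≤ C ∧ ∀ x y, |Q s x y| ≤ C := by
  obtain ⟨C₁, h1, hu⟩ := hQ.upper
  obtain ⟨C, hC, h⟩ := hT s hs
  refine ⟨C₁ * C, by positivity, fun x y => (hu s hs x y).trans ?_⟩
  have := mul_le_mul_of_nonneg_left (prodBump_le_one (x - y)) hC
  have := h (x - y)
  gcongr
  linarith

theorem IsSemigroup.measurable_left (hQ : IsSemigroup σ G Q) {s : ℝ} (hs : 0 < s) (y : Pt d) :
    Measurable (fun z => Q s z y) :=
  ((hQ.cont s hs).comp (Continuous.prodMk_left y)).measurable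

theorem IsSemigroup.measurable_right (hQ : IsSemigroup σ G Q) {s : ℝ} (hs : 0 < s) (x : Pt d) :
    Measurable (fun z => Q s x z) :=
  ((hQ.cont s hs).comp (Continuous.prodMk_right x)).measurable

/-- `∂^k K_t = ∂^k K_{t-s} Q_s`. -/
theorem IsRegularizing.kderiv_conv (hK : IsRegularizing σ G Q K βb δ CK) (hQ : IsSemigroup σ G Q)
    (hT : σ.HasTail G) (hCK : 0 < CK) (k : Idx d) (hk : σ.deg k < δ) {s t : ℝ} (hs : 0 < s)
    (hst : s < t) (x y : Pt d) : ∫ z, kderiv K k (t - s) x z * Q s z y = kderiv K k t x y := by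
  have hts : 0 < t - s := by linarith
  obtain ⟨C₂, hC₂, hQb⟩ := hQ.exists_bound hT hs
  obtain ⟨C₃, hC₃, hGb⟩ := hT (t - s) hts
  have hbd : ∀ k : Idx d, σ.deg k < δ → ∃ M : ℝ, 0 ≤ M ∧ ∀ x z,
      ‖kderiv K k (t - s) x z * Q s z y‖ ≤ M * prodBump (x - z) := fun k hk => by
    refine ⟨CK * (t - s) ^ ((βb - σ.deg k) / σ.ell - 1) * C₃ * C₂, by positivity, fun x z => ?_⟩
    rw [Real.norm_eq_abs, abs_mul]
    have h1 := hK.upper k hk _ hts x z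
    have h2 := hGb (x - z)
    have := prodBump_nonneg (x - z)
    calc _ ≤ CK * (t - s) ^ ((βb - σ.deg k) / σ.ell - 1) * (C₃ * prodBump (x - z)) * C₂ := by
          refine mul_le_mul (h1.trans ?_) (hQb z y) (abs_nonneg _) (by positivity)
          gcongr
      _ = _ := by ring
  induction k using idx_induction generalizing x with
  | h0 => simp only [kderiv_zero]; exact hK.conv s t hs hst x y
  | hs k i ih =>
    have hk' := Scaling.deg_lt_of_add_single hk
    obtain ⟨M₀, hM₀, h0⟩ := hbd k hk'
    obtain ⟨M₁, hM₁, h1⟩ := hbd _ hk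
    have hmeas : ∀ k : Idx d, σ.deg k < δ → ∀ x,
        AEStronglyMeasurable (fun z => kderiv K k (t - s) x z * Q s z y) volume := fun k hk x =>
      ((hK.measurable_kderiv k hk hts x).mul (hQ.measurable_left hs y)).aestronglyMeasurable
    -- A majorant of the differentiated integrand, uniform for r in the unit ball around x_i.
    set b : Pt d → ℝ := fun z => M₁ * (3 ^ d * prodBump (x - z)) with hb
    have hbi : Integrable b := ((integrable_prodBump_sub x).const_mul _).const_mul M₁
    have hF0 : Integrable (fun z => kderiv K k (t - s) (Function.update x i (x i)) z * Q s z y) := by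
      rw [Function.update_eq_self]
      exact ((integrable_prodBump_sub x).const_mul M₀).mono' (hmeas k hk' x)
        (Eventually.of_forall fun z => h0 x z)
    have hbd' : ∀ z, ∀ r ∈ Metric.ball (x i) 1,
        ‖kderiv K (k + Pi.single i 1) (t - s) (Function.update x i r) z * Q s z y‖ ≤ b z := by
      intro z r hr
      have : |r - x i| ≤ 1 := by
        rw [Metric.mem_ball, Real.dist_eq] at hr; exact hr.le
      exact (h1 _ z).trans (mul_le_mul_of_nonneg_left (prodBump_update_le x z i this) hM₁)
    have hder : ∀ z, ∀ r ∈ Metric.ball (x i) 1,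
        HasDerivAt (fun r => kderiv K k (t - s) (Function.update x i r) z * Q s z y)
          (kderiv K (k + Pi.single i 1) (t - s) (Function.update x i r) z * Q s z y) r :=
      fun z r _ => (hK.hasDerivAt_update hk hts x z r).mul_const _
    have hd := (hasDerivAt_integral_of_dominated_loc_of_deriv_le
      (Metric.ball_mem_nhds (x i) one_pos) (Eventually.of_forall fun r => hmeas k hk' _)
      hF0 (hmeas _ hk _) (Eventually.of_forall hbd') hbi (Eventually.of_forall hder)).2
    have hd2 := hK.hasDeriv k i hk t (hs.trans hst) x y
    -- By the induction hypothesis the differentiated integral is ∂^kK_t, whose derivative in x_i is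
    -- known as well; uniqueness of derivatives yields the identity of the next order.
    have e : (fun r => ∫ z, kderiv K k (t - s) (Function.update x i r) z * Q s z y) =
        fun r => kderiv K k t (Function.update x i r) y := by
      funext r; exact ih hk' _
    rw [e, Function.update_eq_self] at hd
    exact hd.unique hd2

end KernelCalculus

/-! ### Pairings of kernels with weighted functions. -/

section Pairing

variable {σ : Scaling d} {G : Pt d → ℝ} {Q K : Ker d} {u : Weight d} {βb δ CK : ℝ}

/-- Moderateness at (x - z) + z, inverted. In this form the weight at z is traded for the weight at
x at the price of u^*(x - z), which G absorbs. -/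
theorem Weight.IsControlled.inv_le (hu : u.IsControlled σ G) (x z : Pt d) :
    (u.w z)⁻¹ ≤ u.star (x - z) * (u.w x)⁻¹ := by
  have h := hu.moderate (x - z) z
  rw [sub_add_cancel] at h
  rw [← div_eq_mul_inv, le_div_iff₀ (hu.pos x), inv_mul_le_iff₀ (hu.pos z)]
  linarith

theorem Weight.IsControlled.star_nonneg (hu : u.IsControlled σ G) (x : Pt d) : 0 ≤ u.star x :=
  zero_le_one.trans (hu.one_le_star x)

theorem Weight.IsControlled.hasTail (hu : u.IsControlled σ G) (hG0 : ∀ x, 0 ≤ G x) :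
    σ.HasTail G := hu.decays.hasTail hG0 hu.one_le_star

/-- Pairing a function of growth `u⁻¹` with a kernel dominated by `G_s`. -/
theorem Weight.IsControlled.exists_pairing [NeZero d] (hu : u.IsControlled σ G)
    (hG0 : ∀ x, 0 ≤ G x) :
    ∃ C : ℝ, 0 ≤ C ∧ ∀ s, 0 < s → s ≤ 1 → ∀ (x : Pt d) (P g : Pt d → ℝ) (p c : ℝ), 0 ≤ p → 0 ≤ c →
      AEStronglyMeasurable P → AEStronglyMeasurable g →
      (∀ z, |P z| ≤ p * σ.scaled G s (x - z)) → (∀ z, |g z| ≤ c * (u.w z)⁻¹) →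
      Integrable (fun z => P z * g z) ∧ |∫ z, P z * g z| ≤ C * p * c * (u.w x)⁻¹ := by
  obtain ⟨C, hC, h⟩ := hu.decays.exists_test hG0 hu.star_nonneg 0 le_rfl (σ.s_pos 0)
  refine ⟨C, hC, fun s hs hs1 x P g p c hp hc hP hg hPb hgb => ?_⟩
  have hx := inv_pos.2 (hu.pos x)
  obtain ⟨h1, h2, -⟩ := h s hs hs1 x (fun z => P z * g z) (p * c * (u.w x)⁻¹) (by positivity)
    (hP.mul hg) (Eventually.of_forall fun z => by
      rw [abs_mul, pow_zero, mul_one, neg_zero, Real.rpow_zero, mul_one]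
      have hz := inv_pos.2 (hu.pos z)
      have hsc := σ.scaled_nonneg hG0 hs (x - z)
      calc |P z| * |g z| ≤ (p * σ.scaled G s (x - z)) * (c * (u.star (x - z) * (u.w x)⁻¹)) := by
            refine mul_le_mul (hPb z) ((hgb z).trans ?_) (abs_nonneg _) (by positivity)
            exact mul_le_mul_of_nonneg_left (hu.inv_le x z) hc
        _ = _ := by ring)
  refine ⟨h1, h2.trans (le_of_eq ?_)⟩
  rw [neg_zero, zero_div, Real.rpow_zero]; ring

theorem MemC.exists_bound {g : Pt d → ℝ} (hg : MemC u.w g) (hu : u.IsControlled σ G) :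
    ∃ c, 0 ≤ c ∧ ∀ z, |g z| ≤ c * (u.w z)⁻¹ := by
  obtain ⟨c, hc⟩ := hg.2
  refine ⟨c, (mul_nonneg (hu.pos 0).le (abs_nonneg _)).trans (hc 0), fun z => ?_⟩
  rw [← div_eq_mul_inv, le_div_iff₀ (hu.pos z)]
  linarith [hc z]

/-- The projection onto positive times. -/
def posTime (r : ℝ) : ℝ := if 0 < r then r else 1

theorem posTime_pos (r : ℝ) : 0 < posTime r := by
  unfold posTime; split_ifs with h
  · exact h
  · exact one_pos

theorem posTime_of_pos {r : ℝ} (h : 0 < r) : posTime r = r := if_pos h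

theorem measurable_posTime : Measurable posTime :=
  Measurable.ite measurableSet_Ioi measurable_id measurable_const

/-- Differentiability in t makes Q continuous in t, and Q_t is continuous in space, so Q is a
Carathéodory function on positive times. `posTime` keeps the time argument where these properties
are known. -/
theorem IsSemigroup.measurable_joint (hQ : IsSemigroup σ G Q) :
    Measurable (fun q : ℝ × Pt d × Pt d => Q (posTime q.1) q.2.1 q.2.2) := by
  have h : Measurable (Function.uncurry
      (fun (r : Set.Ioi (0 : ℝ)) (p : Pt d × Pt d) => Q r p.1 p.2)) := by
    refine measurable_uncurry_of_continuous_of_measurable (fun p => ?_) fun r =>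
      (hQ.cont r r.2).measurable
    refine continuous_iff_continuousAt.2 fun r => ?_
    exact (hQ.diff r r.2 p.1 p.2).continuousAt.comp continuous_subtype_val.continuousAt
  have h2 : Measurable (fun q : ℝ × Pt d × Pt d =>
      ((⟨posTime q.1, posTime_pos _⟩ : Set.Ioi (0 : ℝ)), q.2)) :=
    ((measurable_posTime.comp measurable_fst).subtype_mk).prodMk measurable_snd
  exact h.comp h2

theorem IsSemigroup.measurable_smear_joint (hQ : IsSemigroup σ G Q) {g : Pt d → ℝ}
    (hg : Measurable g) :
    Measurable (fun q : ℝ × Pt d => smear Q g (posTime q.1) q.2) := by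
  have h : Measurable (fun q : (ℝ × Pt d) × Pt d => Q (posTime q.1.1) q.1.2 q.2 * g q.2) := by
    refine Measurable.mul ?_ (hg.comp measurable_snd)
    exact hQ.measurable_joint.comp
      ((measurable_fst.comp measurable_fst).prodMk
        ((measurable_snd.comp measurable_fst).prodMk measurable_snd))
  exact h.stronglyMeasurable.integral_prod_right.measurable

theorem IsSemigroup.measurable_smear (hQ : IsSemigroup σ G Q) {g : Pt d → ℝ}
    (hg : Measurable g) {s : ℝ} (hs : 0 < s) : Measurable (smear Q g s) := by
  have := (hQ.measurable_smear_joint hg).comp (Measurable.prodMk (measurable_const (a := s))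
    measurable_id)
  simpa [Function.comp_def, posTime_of_pos hs] using this

variable [NeZero d]

theorem IsSemigroup.exists_smear_bound (hQ : IsSemigroup σ G Q) (hu : u.IsControlled σ G)
    (hG0 : ∀ x, 0 ≤ G x) :
    ∃ C : ℝ, 0 ≤ C ∧ ∀ s, 0 < s → s ≤ 1 → ∀ (z : Pt d) (g : Pt d → ℝ) (c : ℝ), 0 ≤ c →
      AEStronglyMeasurable g → (∀ z, |g z| ≤ c * (u.w z)⁻¹) →
      Integrable (fun y => Q s z y * g y) ∧ |smear Q g s z| ≤ C * c * (u.w z)⁻¹ := by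
  obtain ⟨C, hC, h⟩ := hu.exists_pairing hG0
  obtain ⟨C₁, hC₁, hq⟩ := hQ.upper
  refine ⟨C * C₁, by positivity, fun s hs hs1 z g c hc hg hgb => ?_⟩
  exact h s hs hs1 z (fun y => Q s z y) g C₁ c hC₁.le hc
    (hQ.measurable_right hs z).aestronglyMeasurable hg (fun y => hq s hs z y) hgb

/-- Associativity of the action of kernels on functions. -/
theorem IsSemigroup.integral_comp (hQ : IsSemigroup σ G Q) (hu : u.IsControlled σ G)
    (hG0 : ∀ x, 0 ≤ G x) {g : Pt d → ℝ} (hg : MemC u.w g) {r s p : ℝ} (hr : 0 < r) (hr1 : r ≤ 1)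
    (hs : 0 < s) (hs1 : s ≤ 1) (x : Pt d) {P : Pt d → ℝ} (hP : Measurable P) (hp : 0 ≤ p)
    (hPb : ∀ z, |P z| ≤ p * σ.scaled G r (x - z)) :
    ∫ y, (∫ z, P z * Q s z y) * g y = ∫ z, P z * smear Q g s z := by
  obtain ⟨c, hc, hgb⟩ := hg.exists_bound hu
  obtain ⟨C, hC, h⟩ := hu.exists_pairing hG0
  obtain ⟨C₁, hC₁, hq⟩ := hQ.upper
  have hgm := hg.1.measurable
  have hFm : Measurable (fun q : Pt d × Pt d => P q.1 * (Q s q.1 q.2 * g q.2)) :=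
    (hP.comp measurable_fst).mul ((hQ.cont s hs).measurable.mul (hgm.comp measurable_snd))
  have hin := fun z => h s hs hs1 z (fun y => |Q s z y|) (fun y => |g y|) C₁ c hC₁.le hc
    (hQ.measurable_right hs z).norm.aestronglyMeasurable hgm.norm.aestronglyMeasurable
    (fun y => by rw [abs_abs]; exact hq s hs z y) (fun y => by rw [abs_abs]; exact hgb y)
  -- Integrability on the product space comes from using the pairing bound twice: the inner integral
  -- of |Q_s| |g| is again of growth u⁻¹, hence an admissible function to pair with P.
  have hint : Integrable (fun q : Pt d × Pt d => P q.1 * (Q s q.1 q.2 * g q.2))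
      (volume.prod volume) := by
    rw [integrable_prod_iff hFm.aestronglyMeasurable]
    constructor
    · refine Eventually.of_forall fun z => ?_
      change Integrable (fun y => P z * (Q s z y * g y))
      refine Integrable.const_mul ?_ _
      refine (hin z).1.mono ((hQ.measurable_right hs z).mul hgm).aestronglyMeasurable
        (Eventually.of_forall fun y => ?_)
      simp
    · have hmn : AEStronglyMeasurable
          (fun z => ∫ y, ‖P z * (Q s z y * g y)‖ ∂(volume : Measure (Pt d))) volume :=
        hFm.norm.stronglyMeasurable.integral_prod_right.aestronglyMeasurable
      have e : (fun z => ∫ y, ‖P z * (Q s z y * g y)‖) =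
          fun z => |P z| * ∫ y, |Q s z y| * |g y| := by
        funext z
        simp only [norm_mul, Real.norm_eq_abs]
        exact integral_const_mul _ _
      have hm2 : AEStronglyMeasurable (fun z => ∫ y, |Q s z y| * |g y|) := by
        have : Measurable (fun q : Pt d × Pt d => |Q s q.1 q.2| * |g q.2|) :=
          (hQ.cont s hs).measurable.norm.mul (hgm.comp measurable_snd).norm
        exact this.stronglyMeasurable.integral_prod_right.aestronglyMeasurable
      change Integrable (fun z => ∫ y, ‖P z * (Q s z y * g y)‖) volume
      rw [e]
      exact (h r hr hr1 x (fun z => |P z|) (fun z => ∫ y, |Q s z y| * |g y|) p (C * C₁ * c) hp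
        (by positivity) hP.norm.aestronglyMeasurable hm2 (fun z => by rw [abs_abs]; exact hPb z)
        (fun z => (hin z).2)).1
  have hsw := integral_integral_swap (f := fun z y => P z * (Q s z y * g y)) hint
  have e1 : ∀ z, ∫ y, P z * (Q s z y * g y) = P z * smear Q g s z := fun z =>
    integral_const_mul _ _
  have e2 : ∀ y, ∫ z, P z * (Q s z y * g y) = (∫ z, P z * Q s z y) * g y := fun y => by
    rw [← integral_mul_const]; simp only [mul_assoc]
  simp only [e1, e2] at hsw
  exact hsw.symm

/-- The pairing of `∂^k K_{t/2}` with a family `F_{t/2}`. -/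
def kint (K : Ker d) (k : Idx d) (t : ℝ) (x : Pt d) (F : ℝ → Pt d → ℝ) : ℝ :=
  ∫ z, kderiv K k (t / 2) x z * F (t / 2) z

theorem IsRegularizing.kfun_eq (hK : IsRegularizing σ G Q K βb δ CK) (hQ : IsSemigroup σ G Q)
    (hu : u.IsControlled σ G) (hG0 : ∀ x, 0 ≤ G x) (hCK : 0 < CK) {k : Idx d} (hk : σ.deg k < δ)
    {g : Pt d → ℝ} (hg : MemC u.w g) {s t : ℝ} (hs : 0 < s) (hst : s < t) (ht : t ≤ 1)
    (x : Pt d) : kfun K k t x g = ∫ z, kderiv K k (t - s) x z * smear Q g s z := by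
  have hts : 0 < t - s := by linarith
  rw [← hQ.integral_comp hu hG0 hg (r := t - s) hts (by linarith) hs (by linarith) x
    (hK.measurable_kderiv k hk hts x)
    (p := CK * (t - s) ^ ((βb - σ.deg k) / σ.ell - 1)) (by positivity)
    (fun z => hK.upper k hk _ hts x z)]
  unfold kfun
  simp only [hK.kderiv_conv hQ (hu.hasTail hG0) hCK k hk hs hst x]

/-- The choice s = t/2. The right side depends on g only through Q_{t/2}g, so it keeps its meaning
for elements of the completion. -/
theorem IsRegularizing.kfun_eq_kint (hK : IsRegularizing σ G Q K βb δ CK) (hQ : IsSemigroup σ G Q)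
    (hu : u.IsControlled σ G) (hG0 : ∀ x, 0 ≤ G x) (hCK : 0 < CK) {k : Idx d} (hk : σ.deg k < δ)
    {g : Pt d → ℝ} (hg : MemC u.w g) {t : ℝ} (ht : 0 < t) (ht1 : t ≤ 1)
    (x : Pt d) : kfun K k t x g = kint K k t x (smear Q g) := by
  rw [hK.kfun_eq hQ hu hG0 hCK hk hg (half_pos ht) (half_lt_self ht) ht1 x, sub_half]
  rfl

theorem IsSemigroup.smear_semigroup (hQ : IsSemigroup σ G Q)
    (hu : u.IsControlled σ G) (hG0 : ∀ x, 0 ≤ G x)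
    {g : Pt d → ℝ} (hg : MemC u.w g) {s t : ℝ} (hs : 0 < s) (hst : s < t) (ht : t ≤ 1)
    (x : Pt d) : smear Q g t x = ∫ z, Q (t - s) x z * smear Q g s z := by
  have hts : 0 < t - s := by linarith
  obtain ⟨C₁, hC₁, hq⟩ := hQ.upper
  rw [← hQ.integral_comp hu hG0 hg (r := t - s) hts (by linarith) hs (by linarith) x
    (hQ.measurable_right hts x) hC₁.le (fun z => hq _ hts x z)]
  unfold smear
  simp only [hQ.semigroup s t hs hst x]

/-- The kernel carries no regularity in t by itself. On (s, 1], however, ∂^kK_t(x,g) is the pairing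
of the fixed kernel ∂^kK_s with Q_{t-s}g, so that all dependence on t sits in Q, which is jointly
measurable. The intervals with s = 1/(n+1) exhaust (0, 1]. -/
theorem IsRegularizing.aestronglyMeasurable_kfun (hK : IsRegularizing σ G Q K βb δ CK)
    (hQ : IsSemigroup σ G Q)
    (hu : u.IsControlled σ G) (hG0 : ∀ x, 0 ≤ G x) (hCK : 0 < CK) {k : Idx d} (hk : σ.deg k < δ)
    {g : Pt d → ℝ} (hg : MemC u.w g) (x : Pt d) :
    AEStronglyMeasurable (fun t => kfun K k t x g) (volume.restrict (Set.Ioc 0 1)) := by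
  have hU : Set.Ioc (0 : ℝ) 1 = ⋃ n : ℕ, Set.Ioc (1 / ((n : ℝ) + 1)) 1 := by
    ext t
    simp only [Set.mem_Ioc, Set.mem_iUnion]
    constructor
    · rintro ⟨h0, h1⟩
      obtain ⟨n, hn⟩ := exists_nat_one_div_lt h0
      exact ⟨n, hn, h1⟩
    · rintro ⟨n, hn, h1⟩
      exact ⟨lt_trans Nat.one_div_pos_of_nat hn, h1⟩
  rw [hU, aestronglyMeasurable_iUnion_iff]
  intro n
  set s : ℝ := 1 / ((n : ℝ) + 1) with hs
  have hs0 : 0 < s := Nat.one_div_pos_of_nat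
  have hm : Measurable (fun t : ℝ => ∫ z, kderiv K k s x z * smear Q g (posTime (t - s)) z) := by
    have : Measurable (fun q : ℝ × Pt d => kderiv K k s x q.2 * smear Q g (posTime (q.1 - s)) q.2) :=
      ((hK.measurable_kderiv k hk hs0 x).comp measurable_snd).mul
        ((hQ.measurable_smear_joint hg.1.measurable).comp
          ((measurable_fst.sub_const s).prodMk measurable_snd))
    exact this.stronglyMeasurable.integral_prod_right.measurable
  refine hm.aestronglyMeasurable.congr ?_
  refine (ae_restrict_iff' measurableSet_Ioc).2 (Eventually.of_forall fun t ht => ?_)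
  have hts : 0 < t - s := sub_pos.2 ht.1
  beta_reduce
  rw [hK.kfun_eq hQ hu hG0 hCK hk hg hts (by linarith) ht.2 x, posTime_of_pos hts, sub_sub_cancel]

end Pairing

/-! ### Elements of Besov spaces as tested families. -/

section Distributions

variable {σ : Scaling d} {G : Pt d → ℝ} {Q K : Ker d} {u : Weight d} {βb δ CK ζ : ℝ}

theorem besovNorm_le_iff {α : ℝ} {w : Pt d → ℝ} {F : ℝ → Pt d → ℝ} {c : ℝ} (hc : 0 ≤ c) :
    besovNorm σ α w F ≤ ENNReal.ofReal c ↔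
      ∀ t, 0 < t → t ≤ 1 → ∀ x, t ^ (-α / σ.ell) * (w x * |F t x|) ≤ c := by
  simp only [besovNorm, iSup_le_iff, ENNReal.ofReal_le_ofReal_iff hc, and_imp]

theorem abs_le_of_besovNorm {α : ℝ} {w : Pt d → ℝ} {F : ℝ → Pt d → ℝ}
    (h : besovNorm σ α w F < ∞) {t : ℝ} (ht : 0 < t) (ht1 : t ≤ 1) {x : Pt d} (hx : 0 < w x) :
    |F t x| ≤ (besovNorm σ α w F).toReal * t ^ (α / σ.ell) * (w x)⁻¹ := by
  have h1 := (besovNorm_le_iff ENNReal.toReal_nonneg).1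
    (ENNReal.ofReal_toReal h.ne).ge t ht ht1 x
  have hp : 0 < t ^ (α / σ.ell) := Real.rpow_pos_of_pos ht _
  have e : t ^ (-α / σ.ell) = (t ^ (α / σ.ell))⁻¹ := by rw [neg_div, Real.rpow_neg ht.le]
  rw [e, inv_mul_le_iff₀ hp] at h1
  rw [← div_eq_mul_inv, le_div_iff₀ hx]
  linarith

theorem besovNorm_add_le {α : ℝ} {w : Pt d → ℝ} (hw : ∀ x, 0 ≤ w x) (F H : ℝ → Pt d → ℝ) :
    besovNorm σ α w (fun t x => F t x + H t x) ≤ besovNorm σ α w F + besovNorm σ α w H := by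
  refine iSup_le fun t => iSup_le fun ht => iSup_le fun x => ?_
  have hF : ENNReal.ofReal (t ^ (-α / σ.ell) * (w x * |F t x|)) ≤ besovNorm σ α w F :=
    le_iSup_of_le t (le_iSup_of_le ht (le_iSup_of_le x le_rfl))
  have hH : ENNReal.ofReal (t ^ (-α / σ.ell) * (w x * |H t x|)) ≤ besovNorm σ α w H :=
    le_iSup_of_le t (le_iSup_of_le ht (le_iSup_of_le x le_rfl))
  refine le_trans ?_ (add_le_add hF hH)
  have := hw x
  have ht0 := ht.1
  rw [← ENNReal.ofReal_add (by positivity) (by positivity)]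
  refine ENNReal.ofReal_le_ofReal ?_
  rw [← mul_add, ← mul_add]
  have := abs_add_le (F t x) (H t x)
  gcongr

theorem besovNorm_sub_comm {α : ℝ} {w : Pt d → ℝ} (F H : ℝ → Pt d → ℝ) :
    besovNorm σ α w (fun t x => F t x - H t x) = besovNorm σ α w (fun t x => H t x - F t x) := by
  simp only [besovNorm, abs_sub_comm]

theorem Besov.exists_seq {α : ℝ} {w : Pt d → ℝ} (Λ : Besov σ Q α w) :
    ∃ g : ℕ → Pt d → ℝ, (∀ n, MemC w (g n)) ∧
      Tendsto (fun n => besovNorm σ α w (fun t x => smear Q (g n) t x - Λ.Qt t x)) atTop (𝓝 0) := by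
  have h : ∀ n : ℕ, (0 : ℝ≥0∞) < (n : ℝ≥0∞)⁻¹ := fun n => by simp
  choose g hg hlt using fun n => Λ.approx _ (h n)
  exact ⟨g, hg, tendsto_of_tendsto_of_tendsto_of_le_of_le tendsto_const_nhds
    ENNReal.tendsto_inv_nat_nhds_zero (fun _ => zero_le) fun n => (hlt n).le⟩

/-- The limit that defines `kbesov` is determined by convergence only along a nontrivial filter;
density of C(w) provides this. -/
instance Besov.approaching_neBot {α : ℝ} {w : Pt d → ℝ} (Λ : Besov σ Q α w) :
    Λ.approaching.NeBot := by
  obtain ⟨g, hg, h⟩ := Λ.exists_seq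
  have : Tendsto g atTop Λ.approaching :=
    tendsto_inf.2 ⟨tendsto_comap_iff.2 h, tendsto_principal.2 (Eventually.of_forall hg)⟩
  exact this.neBot

theorem tendsto_toReal_zero {ι : Type*} {l : Filter ι} {N : ι → ℝ≥0∞} (h : Tendsto N l (𝓝 0)) :
    Tendsto (fun i => (N i).toReal) l (𝓝 0) := by
  have h1 := (ENNReal.tendsto_toReal ENNReal.zero_ne_top).comp h
  rwa [ENNReal.toReal_zero] at h1

variable [NeZero d]

/-- Q_tg is of growth u⁻¹ uniformly in t ≤ 1, and ζ ≤ 0 makes the factor t^{-ζ/ℓ} at most 1. -/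
theorem IsSemigroup.besovNorm_smear_lt_top (hQ : IsSemigroup σ G Q) (hu : u.IsControlled σ G)
    (hG0 : ∀ x, 0 ≤ G x) (hζ : ζ ≤ 0) {g : Pt d → ℝ} (hg : MemC u.w g) :
    besovNorm σ ζ u.w (smear Q g) < ∞ := by
  obtain ⟨c, hc, hgb⟩ := hg.exists_bound hu
  obtain ⟨C, hC, h⟩ := hQ.exists_smear_bound hu hG0
  refine lt_of_le_of_lt ((besovNorm_le_iff (c := C * c) (by positivity)).2 fun t ht ht1 x => ?_)
    ENNReal.ofReal_lt_top
  have h1 := (h t ht ht1 x g c hc hg.1.measurable.aestronglyMeasurable hgb).2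
  have h2 : t ^ (-ζ / σ.ell) ≤ 1 := Real.rpow_le_one ht.le ht1
    (div_nonneg (by linarith) σ.ell_pos.le)
  rw [← div_eq_mul_inv, le_div_iff₀ (hu.pos x)] at h1
  have h3 : 0 ≤ u.w x * |smear Q g t x| := mul_nonneg (hu.pos x).le (abs_nonneg _)
  nlinarith

theorem Besov.norm_lt_top (Λ : Besov σ Q ζ u.w) (hQ : IsSemigroup σ G Q) (hu : u.IsControlled σ G)
    (hG0 : ∀ x, 0 ≤ G x) (hζ : ζ ≤ 0) : besovNorm σ ζ u.w Λ.Qt < ∞ := by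
  obtain ⟨g, hg, hlt⟩ := Λ.approx 1 one_pos
  have h1 := hQ.besovNorm_smear_lt_top hu hG0 hζ hg
  have h2 := besovNorm_add_le (σ := σ) (α := ζ) (fun x => (hu.pos x).le)
    (fun t x => Λ.Qt t x - smear Q g t x) (smear Q g)
  simp only [sub_add_cancel] at h2
  refine h2.trans_lt (ENNReal.add_lt_top.2 ⟨?_, h1⟩)
  rw [besovNorm_sub_comm]
  exact hlt.trans ENNReal.one_lt_top

theorem Besov.tendsto_smear (Λ : Besov σ Q ζ u.w) (hu : u.IsControlled σ G) {ι : Type*}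
    {l : Filter ι} {g : ι → Pt d → ℝ}
    (h : Tendsto (fun i => besovNorm σ ζ u.w (fun t x => smear Q (g i) t x - Λ.Qt t x)) l (𝓝 0))
    {t : ℝ} (ht : 0 < t) (ht1 : t ≤ 1) (x : Pt d) :
    Tendsto (fun i => smear Q (g i) t x) l (𝓝 (Λ.Qt t x)) := by
  rw [tendsto_iff_norm_sub_tendsto_zero]
  have h1 := ((tendsto_toReal_zero h).mul_const (t ^ (ζ / σ.ell))).mul_const (u.w x)⁻¹
  simp only [zero_mul] at h1
  refine squeeze_zero' (Eventually.of_forall fun _ => norm_nonneg _) ?_ h1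
  filter_upwards [h.eventually (gt_mem_nhds one_pos)] with i hi
  exact abs_le_of_besovNorm (F := fun t x => smear Q (g i) t x - Λ.Qt t x)
    (hi.trans ENNReal.one_lt_top) ht ht1 (hu.pos x)

theorem Besov.measurable_Qt (Λ : Besov σ Q ζ u.w) (hQ : IsSemigroup σ G Q)
    (hu : u.IsControlled σ G) {t : ℝ} (ht : 0 < t) (ht1 : t ≤ 1) : Measurable (Λ.Qt t) := by
  obtain ⟨g, hg, h⟩ := Λ.exists_seq
  exact measurable_of_tendsto_metrizable (fun n => hQ.measurable_smear (hg n).1.measurable ht)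
    (tendsto_pi_nhds.2 fun x => Λ.tendsto_smear hu h ht ht1 x)

/-- Pairings with a kernel are continuous in the Besov norm. -/
theorem Besov.tendsto_pairing (Λ : Besov σ Q ζ u.w) (hQ : IsSemigroup σ G Q)
    (hu : u.IsControlled σ G) (hG0 : ∀ x, 0 ≤ G x) (hζ : ζ ≤ 0) {ι : Type*}
    {l : Filter ι} {g : ι → Pt d → ℝ} (hg : ∀ᶠ i in l, MemC u.w (g i))
    (h : Tendsto (fun i => besovNorm σ ζ u.w (fun t x => smear Q (g i) t x - Λ.Qt t x)) l (𝓝 0))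
    {r s p : ℝ} (hr : 0 < r) (hr1 : r ≤ 1) (hs : 0 < s) (hs1 : s ≤ 1) (x : Pt d)
    {P : Pt d → ℝ} (hP : Measurable P) (hp : 0 ≤ p)
    (hPb : ∀ z, |P z| ≤ p * σ.scaled G r (x - z)) :
    Tendsto (fun i => ∫ z, P z * smear Q (g i) s z) l (𝓝 (∫ z, P z * Λ.Qt s z)) := by
  obtain ⟨C, hC, hpair⟩ := hu.exists_pairing hG0
  obtain ⟨C', hC', hsm⟩ := hQ.exists_smear_bound hu hG0
  have hi1 := (hpair r hr hr1 x P (Λ.Qt s) p _ hp (by positivity) hP.aestronglyMeasurable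
    (Λ.measurable_Qt hQ hu hs hs1).aestronglyMeasurable hPb
    (fun z => abs_le_of_besovNorm (Λ.norm_lt_top hQ hu hG0 hζ) hs hs1 (hu.pos z))).1
  rw [tendsto_iff_norm_sub_tendsto_zero]
  have h1 := (((tendsto_toReal_zero h).mul_const (s ^ (ζ / σ.ell))).const_mul (C * p)).mul_const
    (u.w x)⁻¹
  simp only [zero_mul, mul_zero] at h1
  refine squeeze_zero' (Eventually.of_forall fun _ => norm_nonneg _) ?_ h1
  filter_upwards [h.eventually (gt_mem_nhds one_pos), hg] with i hi hgi
  obtain ⟨c, hc, hgb⟩ := hgi.exists_bound hu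
  have hmi := hQ.measurable_smear hgi.1.measurable hs
  have hi2 := (hpair r hr hr1 x P (smear Q (g i) s) p (C' * c) hp (by positivity)
    hP.aestronglyMeasurable hmi.aestronglyMeasurable hPb (fun z =>
      (hsm s hs hs1 z (g i) c hc hgi.1.measurable.aestronglyMeasurable hgb).2)).1
  have hi3 := (hpair r hr hr1 x P (fun z => smear Q (g i) s z - Λ.Qt s z) p _ hp (by positivity)
    hP.aestronglyMeasurable (hmi.sub (Λ.measurable_Qt hQ hu hs hs1)).aestronglyMeasurable hPb
    (fun z => abs_le_of_besovNorm (F := fun t x => smear Q (g i) t x - Λ.Qt t x)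
      (hi.trans ENNReal.one_lt_top) hs hs1 (hu.pos z))).2
  rw [← integral_sub hi2 hi1]
  simp only [← mul_sub]
  exact hi3

/-- The semigroup property passes to the completion: it holds for the approximating functions, and
both sides are continuous in the Besov norm. -/
theorem Besov.Qt_eq (Λ : Besov σ Q ζ u.w) (hQ : IsSemigroup σ G Q)
    (hu : u.IsControlled σ G) (hG0 : ∀ x, 0 ≤ G x) (hζ : ζ ≤ 0) {s t : ℝ} (hs : 0 < s)
    (hst : s < t) (ht : t ≤ 1) (x : Pt d) :
    Λ.Qt t x = ∫ z, Q (t - s) x z * Λ.Qt s z := by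
  obtain ⟨g, hg, h⟩ := Λ.exists_seq
  obtain ⟨C₁, hC₁, hq⟩ := hQ.upper
  have hts : 0 < t - s := by linarith
  refine tendsto_nhds_unique (Λ.tendsto_smear hu h (hs.trans hst) ht x) ?_
  simp only [fun n => hQ.smear_semigroup hu hG0 (hg n) hs hst ht x]
  exact Λ.tendsto_pairing hQ hu hG0 hζ (Eventually.of_forall hg) h hts (by linarith) hs
    (by linarith) x (hQ.measurable_right hts x) hC₁.le (fun z => hq _ hts x z)

theorem IsRegularizing.tendsto_kfun_besov (hK : IsRegularizing σ G Q K βb δ CK)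
    (Λ : Besov σ Q ζ u.w) (hQ : IsSemigroup σ G Q)
    (hu : u.IsControlled σ G) (hG0 : ∀ x, 0 ≤ G x) (hCK : 0 < CK) (hζ : ζ ≤ 0) {k : Idx d}
    (hk : σ.deg k < δ) {ι : Type*}
    {l : Filter ι} {g : ι → Pt d → ℝ} (hg : ∀ᶠ i in l, MemC u.w (g i))
    (h : Tendsto (fun i => besovNorm σ ζ u.w (fun t x => smear Q (g i) t x - Λ.Qt t x)) l (𝓝 0))
    {t : ℝ} (ht : 0 < t) (ht1 : t ≤ 1) (x : Pt d) :
    Tendsto (fun i => kfun K k t x (g i)) l (𝓝 (kint K k t x Λ.Qt)) := by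
  have ht2 := half_pos ht
  have h1 := Λ.tendsto_pairing hQ hu hG0 hζ hg h ht2 (by linarith) ht2
    (by linarith) x (hK.measurable_kderiv k hk ht2 x)
    (p := CK * (t / 2) ^ ((βb - σ.deg k) / σ.ell - 1)) (by positivity)
    (fun z => hK.upper k hk _ ht2 x z)
  refine h1.congr' ?_
  filter_upwards [hg] with i hi
  exact (hK.kfun_eq_kint hQ hu hG0 hCK hk hi ht ht1 x).symm

/-- Replaces the abstract limit by a convergent integral, to which the estimates for pairings apply.
-/
theorem IsRegularizing.kbesov_eq (hK : IsRegularizing σ G Q K βb δ CK)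
    (Λ : Besov σ Q ζ u.w) (hQ : IsSemigroup σ G Q)
    (hu : u.IsControlled σ G) (hG0 : ∀ x, 0 ≤ G x) (hCK : 0 < CK) (hζ : ζ ≤ 0) {k : Idx d}
    (hk : σ.deg k < δ) {t : ℝ} (ht : 0 < t) (ht1 : t ≤ 1) (x : Pt d) :
    kbesov K k t x Λ = kint K k t x Λ.Qt := by
  refine Tendsto.limUnder_eq ?_
  refine hK.tendsto_kfun_besov Λ hQ hu hG0 hCK hζ hk ?_ ?_ ht ht1 x
  · exact mem_inf_of_right (mem_principal_self _)
  · exact tendsto_comap.mono_left inf_le_left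

theorem IsRegularizing.aestronglyMeasurable_kint_besov (hK : IsRegularizing σ G Q K βb δ CK)
    (Λ : Besov σ Q ζ u.w) (hQ : IsSemigroup σ G Q)
    (hu : u.IsControlled σ G) (hG0 : ∀ x, 0 ≤ G x) (hCK : 0 < CK) (hζ : ζ ≤ 0) {k : Idx d}
    (hk : σ.deg k < δ) (x : Pt d) :
    AEStronglyMeasurable (fun t => kint K k t x Λ.Qt) (volume.restrict (Set.Ioc 0 1)) := by
  obtain ⟨g, hg, h⟩ := Λ.exists_seq
  refine aestronglyMeasurable_of_tendsto_ae atTop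
    (fun n => hK.aestronglyMeasurable_kfun hQ hu hG0 hCK hk (hg n) x) ?_
  refine (ae_restrict_iff' measurableSet_Ioc).2 (Eventually.of_forall fun t ht => ?_)
  exact hK.tendsto_kfun_besov Λ hQ hu hG0 hCK hζ hk (Eventually.of_forall hg) h ht.1 ht.2 x

end Distributions

/-! ### Graded components in a model space. -/

section ModelAlgebra

theorem IndexSet.mem_below {A : IndexSet} {c α : ℝ} : α ∈ A.below c ↔ α ∈ A.carrier ∧ α < c := by
  simp [IndexSet.below]

theorem IndexSet.reg_le {A : IndexSet} {α : ℝ} (h : α ∈ A.carrier) : A.reg ≤ α :=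
  csInf_le A.bddBelow h

variable {A : IndexSet} {𝒯 : RegStructure.{u} A}

theorem RegStructure.eq_zero_of_notMem {α : ℝ} (h : α ∉ A.carrier) (τ : 𝒯.T α) : τ = 0 := by
  have := 𝒯.trivial_off α h
  exact Subsingleton.elim _ _

/-- T_α vanishes off A, and only finitely many indices of A lie below γ. All finite sums over
homogeneities rest on this decomposition. -/
theorem RegStructure.IsBelow.eq_sum {γ : ℝ} {τ : 𝒯.Sum} (h : 𝒯.IsBelow γ τ) :
    τ = ∑ α ∈ A.below γ, 𝒯.emb α (τ α) := by
  ext β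
  rw [DFinsupp.finsetSum_apply]
  by_cases hβ : β ∈ A.below γ
  · rw [Finset.sum_eq_single β (fun α _ hα => DFinsupp.single_eq_of_ne hα.symm)
      (fun h' => absurd hβ h')]
    exact DFinsupp.single_eq_same.symm
  · rw [Finset.sum_eq_zero fun α hα => DFinsupp.single_eq_of_ne fun (e : β = α) =>
      hβ (by rw [e]; exact hα)]
    by_cases hA : β ∈ A.carrier
    · exact h β (not_lt.1 fun hlt => hβ (IndexSet.mem_below.2 ⟨hA, hlt⟩))
    · exact RegStructure.eq_zero_of_notMem hA _

theorem RegStructure.isBelow_emb {γ α : ℝ} (h : α < γ) (τ : 𝒯.T α) : 𝒯.IsBelow γ (𝒯.emb α τ) :=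
  fun β hβ => DFinsupp.single_eq_of_ne (by linarith : β ≠ α)

theorem RegStructure.IsBelow.add {γ : ℝ} {τ τ' : 𝒯.Sum} (h : 𝒯.IsBelow γ τ)
    (h' : 𝒯.IsBelow γ τ') : 𝒯.IsBelow γ (τ + τ') := fun β hβ => by
  rw [DFinsupp.add_apply, h β hβ, h' β hβ, add_zero]

theorem RegStructure.IsBelow.sub {γ : ℝ} {τ τ' : 𝒯.Sum} (h : 𝒯.IsBelow γ τ)
    (h' : 𝒯.IsBelow γ τ') : 𝒯.IsBelow γ (τ - τ') := fun β hβ => by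
  rw [DFinsupp.sub_apply, h β hβ, h' β hβ, sub_zero]

theorem RegStructure.IsBelow.smul {γ : ℝ} {τ : 𝒯.Sum} (h : 𝒯.IsBelow γ τ) (c : ℝ) :
    𝒯.IsBelow γ (c • τ) := fun β hβ => by
  rw [DFinsupp.smul_apply, h β hβ, smul_zero]

theorem RegStructure.IsBelow.mono {γ γ' : ℝ} {τ : 𝒯.Sum} (h : 𝒯.IsBelow γ τ)
    (hγ : γ ≤ γ') : 𝒯.IsBelow γ' τ := fun β hβ => h β (hγ.trans hβ)

theorem RegStructure.isBelow_sum {γ : ℝ} {ι : Type*} (s : Finset ι) (f : ι → 𝒯.Sum)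
    (h : ∀ i ∈ s, 𝒯.IsBelow γ (f i)) : 𝒯.IsBelow γ (∑ i ∈ s, f i) := fun β hβ => by
  rw [DFinsupp.finsetSum_apply]
  exact Finset.sum_eq_zero fun i hi => h i hi β hβ

variable {σ : Scaling d} {Q : Ker d} {w : Weight d}

theorem Model.Γ_emb_self (M : Model σ 𝒯 Q w) (x y : Pt d) {α : ℝ} (τ : 𝒯.T α) :
    M.Γ x y (𝒯.emb α τ) α = τ := by
  have h := M.Γ_lower x y α τ α le_rfl
  rw [DFinsupp.sub_apply, sub_eq_zero] at h
  rw [h]; exact DFinsupp.single_eq_same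

theorem Model.Γ_emb_of_lt (M : Model σ 𝒯 Q w) (x y : Pt d) {α β : ℝ} (h : α < β) (τ : 𝒯.T α) :
    M.Γ x y (𝒯.emb α τ) β = 0 := by
  have h1 := M.Γ_lower x y α τ β h.le
  rw [DFinsupp.sub_apply, sub_eq_zero] at h1
  rw [h1]; exact DFinsupp.single_eq_of_ne h.ne'

theorem Model.isBelow_Γ (M : Model σ 𝒯 Q w) (x y : Pt d) {γ : ℝ} {τ : 𝒯.Sum}
    (h : 𝒯.IsBelow γ τ) : 𝒯.IsBelow γ (M.Γ x y τ) := by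
  rw [h.eq_sum, map_sum]
  refine RegStructure.isBelow_sum _ _ fun α hα β hβ => ?_
  exact M.Γ_emb_of_lt x y ((IndexSet.mem_below.1 hα).2.trans_le hβ) _

theorem Model.isBelow_incr (M : Model σ 𝒯 Q w) {γ : ℝ} {f : Pt d → 𝒯.Sum} {x y : Pt d}
    (hx : 𝒯.IsBelow γ (f x)) (hy : 𝒯.IsBelow γ (f y)) : 𝒯.IsBelow γ (incr M.Γ f y x) :=
  hy.sub (M.isBelow_Γ y x hx)

end ModelAlgebra

/-! ### Bounds for models and for differences of models. -/

section ModelNorms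

variable {A : IndexSet} {𝒯 : RegStructure.{u} A} {σ : Scaling d} {Q : Ker d} {w : Weight d}

theorem piNorm_le_iff {γ c : ℝ} {P : ℝ → Pt d → 𝒯.Sum → ℝ} (hc : 0 ≤ c) :
    piNorm σ 𝒯 w γ P ≤ ENNReal.ofReal c ↔ ∀ α, α ∈ A.carrier → α < γ → ∀ t, 0 < t → t ≤ 1 →
      ∀ x (τ : 𝒯.T α), τ ≠ 0 → t ^ (-α / σ.ell) * w.w x * (|P t x (𝒯.emb α τ)| / ‖τ‖) ≤ c := by
  simp only [piNorm, iSup_le_iff, ENNReal.ofReal_le_ofReal_iff hc, and_imp]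

theorem gammaNorm_le_iff {γ c : ℝ} {Γ : Pt d → Pt d → 𝒯.Sum → 𝒯.Sum} (hc : 0 ≤ c) :
    gammaNorm σ 𝒯 w γ Γ ≤ ENNReal.ofReal c ↔ ∀ α β, α ∈ A.carrier → β ∈ A.carrier → β < α →
      α < γ → ∀ x y, x ≠ y → ∀ τ : 𝒯.T α, τ ≠ 0 → w.w x * ‖Γ y x (𝒯.emb α τ) β‖ /
      (w.star (y - x) * σ.nrm (y - x) ^ (α - β) * ‖τ‖) ≤ c := by
  simp only [gammaNorm, iSup_le_iff, ENNReal.ofReal_le_ofReal_iff hc, and_imp]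

theorem abs_le_of_piNorm {γ : ℝ} {P : ℝ → Pt d → 𝒯.Sum → ℝ} (h : piNorm σ 𝒯 w γ P < ∞)
    {t : ℝ} (ht : 0 < t) (ht1 : t ≤ 1) {x : Pt d} (hx : 0 < w.w x) (h0 : P t x 0 = 0)
    {α : ℝ} (hα : α < γ) (τ : 𝒯.T α) :
    |P t x (𝒯.emb α τ)| ≤ (piNorm σ 𝒯 w γ P).toReal * (t ^ (α / σ.ell) * (w.w x)⁻¹ * ‖τ‖) := by
  by_cases hτ : τ = 0
  · subst hτ
    have : 𝒯.emb α (0 : 𝒯.T α) = 0 := DFinsupp.single_zero α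
    rw [this, h0, abs_zero, norm_zero, mul_zero, mul_zero]
  · have hA : α ∈ A.carrier := by
      by_contra hc; exact hτ (RegStructure.eq_zero_of_notMem hc τ)
    have h1 := (piNorm_le_iff ENNReal.toReal_nonneg).1
      (ENNReal.ofReal_toReal h.ne).ge α hA hα t ht ht1 x τ hτ
    have hp : 0 < t ^ (α / σ.ell) := Real.rpow_pos_of_pos ht _
    have e : t ^ (-α / σ.ell) = (t ^ (α / σ.ell))⁻¹ := by rw [neg_div, Real.rpow_neg ht.le]
    have hn := norm_pos_iff.2 hτ
    rw [e] at h1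
    have e2 : |P t x (𝒯.emb α τ)| = (t ^ (α / σ.ell))⁻¹ * w.w x * (|P t x (𝒯.emb α τ)| / ‖τ‖) *
      (t ^ (α / σ.ell) * (w.w x)⁻¹ * ‖τ‖) := by field_simp
    rw [e2]
    exact mul_le_mul_of_nonneg_right h1 (by positivity)

/-- The supremum runs over indices of A, nonzero τ and distinct points. The excluded cases are
covered by the triviality of T_α off A, by `h0` and by `hself`, so that the bound can be used
without case distinctions. -/
theorem norm_le_of_gammaNorm {γ : ℝ} {Γ : Pt d → Pt d → 𝒯.Sum → 𝒯.Sum}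
    (h : gammaNorm σ 𝒯 w γ Γ < ∞) {x y : Pt d} (hx : 0 < w.w x) (hs : 1 ≤ w.star (y - x))
    {α β : ℝ} (hα : α < γ) (hβ : β < α) (h0 : Γ y x 0 = 0) (τ : 𝒯.T α)
    (hself : x = y → Γ y x (𝒯.emb α τ) β = 0) :
    ‖Γ y x (𝒯.emb α τ) β‖ ≤ (gammaNorm σ 𝒯 w γ Γ).toReal *
      ((w.w x)⁻¹ * w.star (y - x) * σ.nrm (y - x) ^ (α - β) * ‖τ‖) := by
  have hn0 := σ.nrm_nonneg (y - x)
  have hR : 0 ≤ (gammaNorm σ 𝒯 w γ Γ).toReal *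
      ((w.w x)⁻¹ * w.star (y - x) * σ.nrm (y - x) ^ (α - β) * ‖τ‖) := by positivity
  by_cases hz : Γ y x (𝒯.emb α τ) β = 0
  · rw [hz, norm_zero]; exact hR
  · have hτ : τ ≠ 0 := by
      rintro rfl
      have : 𝒯.emb α (0 : 𝒯.T α) = 0 := DFinsupp.single_zero α
      exact hz (by rw [this, h0]; rfl)
    have hne : x ≠ y := fun e => hz (hself e)
    have hA : α ∈ A.carrier := by
      by_contra hc; exact hτ (RegStructure.eq_zero_of_notMem hc τ)
    have hB : β ∈ A.carrier := by
      by_contra hc; exact hz (RegStructure.eq_zero_of_notMem hc _)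
    have h1 := (gammaNorm_le_iff ENNReal.toReal_nonneg).1
      (ENNReal.ofReal_toReal h.ne).ge α β hA hB hβ hα x y hne τ hτ
    have hp : 0 < σ.nrm (y - x) ^ (α - β) :=
      Real.rpow_pos_of_pos (σ.nrm_pos (sub_ne_zero.2 hne.symm)) _
    have hn := norm_pos_iff.2 hτ
    rw [div_le_iff₀ (by positivity)] at h1
    rw [mul_comm] at h1
    have h2 := (le_div_iff₀ hx).2 h1
    refine h2.trans (le_of_eq ?_)
    field_simp

theorem piNorm_add_le {γ : ℝ} (hw : ∀ x, 0 ≤ w.w x) (P P' : ℝ → Pt d → 𝒯.Sum → ℝ) :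
    piNorm σ 𝒯 w γ (fun t x τ => P t x τ + P' t x τ) ≤
      piNorm σ 𝒯 w γ P + piNorm σ 𝒯 w γ P' := by
  refine iSup_le fun α => iSup_le fun hα => iSup_le fun t => iSup_le fun ht => iSup_le fun x =>
    iSup_le fun τ => iSup_le fun hτ => ?_
  have hF : ∀ P : ℝ → Pt d → 𝒯.Sum → ℝ, ENNReal.ofReal (t ^ (-α / σ.ell) * w.w x *
      (|P t x (𝒯.emb α τ)| / ‖τ‖)) ≤ piNorm σ 𝒯 w γ P := fun P =>
    le_iSup_of_le α (le_iSup_of_le hα (le_iSup_of_le t (le_iSup_of_le ht (le_iSup_of_le x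
      (le_iSup_of_le τ (le_iSup_of_le hτ le_rfl))))))
  refine le_trans ?_ (add_le_add (hF P) (hF P'))
  have := hw x
  have ht0 := ht.1
  rw [← ENNReal.ofReal_add (by positivity) (by positivity)]
  refine ENNReal.ofReal_le_ofReal ?_
  rw [← mul_add, ← add_div]
  have := abs_add_le (P t x (𝒯.emb α τ)) (P' t x (𝒯.emb α τ))
  gcongr

theorem gammaNorm_add_le {γ : ℝ} (hw : ∀ x, 0 ≤ w.w x) (hs : ∀ x, 0 ≤ w.star x)
    (Γ Γ' : Pt d → Pt d → 𝒯.Sum → 𝒯.Sum) :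
    gammaNorm σ 𝒯 w γ (fun y x τ => Γ y x τ + Γ' y x τ) ≤
      gammaNorm σ 𝒯 w γ Γ + gammaNorm σ 𝒯 w γ Γ' := by
  refine iSup_le fun α => iSup_le fun β => iSup_le fun hα => iSup_le fun x => iSup_le fun y =>
    iSup_le fun hxy => iSup_le fun τ => iSup_le fun hτ => ?_
  have hF : ∀ Γ : Pt d → Pt d → 𝒯.Sum → 𝒯.Sum, ENNReal.ofReal (w.w x * ‖Γ y x (𝒯.emb α τ) β‖ /
      (w.star (y - x) * σ.nrm (y - x) ^ (α - β) * ‖τ‖)) ≤ gammaNorm σ 𝒯 w γ Γ := fun Γ =>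
    le_iSup_of_le α (le_iSup_of_le β (le_iSup_of_le hα (le_iSup_of_le x (le_iSup_of_le y
      (le_iSup_of_le hxy (le_iSup_of_le τ (le_iSup_of_le hτ le_rfl)))))))
  refine le_trans ?_ (add_le_add (hF Γ) (hF Γ'))
  have := hw x
  have := hs (y - x)
  have := σ.nrm_nonneg (y - x)
  rw [← ENNReal.ofReal_add (by positivity) (by positivity)]
  refine ENNReal.ofReal_le_ofReal ?_
  rw [← add_div, ← mul_add]
  have := norm_add_le (Γ y x (𝒯.emb α τ) β) (Γ' y x (𝒯.emb α τ) β)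
  rw [DFinsupp.add_apply]
  gcongr

theorem piNorm_sub_comm {γ : ℝ} (P P' : ℝ → Pt d → 𝒯.Sum → ℝ) :
    piNorm σ 𝒯 w γ (fun t x τ => P t x τ - P' t x τ) =
      piNorm σ 𝒯 w γ (fun t x τ => P' t x τ - P t x τ) := by
  simp only [piNorm, abs_sub_comm]

theorem gammaNorm_sub_comm {γ : ℝ} (Γ Γ' : Pt d → Pt d → 𝒯.Sum → 𝒯.Sum) :
    gammaNorm σ 𝒯 w γ (fun t x τ => Γ t x τ - Γ' t x τ) =
      gammaNorm σ 𝒯 w γ (fun t x τ => Γ' t x τ - Γ t x τ) := by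
  simp only [gammaNorm, DFinsupp.sub_apply, norm_sub_rev]

theorem piNorm_congr {γ : ℝ} {P P' : ℝ → Pt d → 𝒯.Sum → ℝ}
    (h : ∀ t, 0 < t → t ≤ 1 → ∀ x τ, P t x τ = P' t x τ) :
    piNorm σ 𝒯 w γ P = piNorm σ 𝒯 w γ P' := by
  unfold piNorm
  refine iSup_congr fun α => iSup_congr fun _ => iSup_congr fun t => iSup_congr fun ht =>
    iSup_congr fun x => iSup_congr fun τ => ?_
  rw [h t ht.1 ht.2]

/-- Some smooth model lies at distance less than 1, and smooth models have finite norms. -/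
theorem Model.normPi_lt_top (M : Model σ 𝒯 Q w) (hw : ∀ x, 0 ≤ w.w x) (γ : ℝ) :
    M.normPi γ < ∞ := by
  obtain ⟨S, hS⟩ := M.approx γ 1 one_pos
  have h1 := piNorm_add_le (σ := σ) (γ := γ) hw
    (fun t x τ => M.QPi t x τ - smear Q (S.Pi x τ) t x) (fun t x τ => smear Q (S.Pi x τ) t x)
  simp only [sub_add_cancel] at h1
  refine h1.trans_lt (ENNReal.add_lt_top.2 ⟨?_, S.Pi_fin γ⟩)
  rw [piNorm_sub_comm]
  exact (le_self_add.trans_lt hS).trans ENNReal.one_lt_top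

theorem Model.normΓ_lt_top (M : Model σ 𝒯 Q w) (hw : ∀ x, 0 ≤ w.w x) (hs : ∀ x, 0 ≤ w.star x)
    (γ : ℝ) : M.normΓ γ < ∞ := by
  obtain ⟨S, hS⟩ := M.approx γ 1 one_pos
  have h1 := gammaNorm_add_le (σ := σ) (γ := γ) hw hs
    (fun t x τ => M.Γ t x τ - S.Γ t x τ) (fun t x τ => S.Γ t x τ)
  simp only [sub_add_cancel] at h1
  refine h1.trans_lt (ENNReal.add_lt_top.2 ⟨?_, S.Γ_fin γ⟩)
  rw [gammaNorm_sub_comm]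
  exact (le_add_self.trans_lt hS).trans ENNReal.one_lt_top

/-- The growth in `z` of a distribution centered at `x`. -/
def Weight.env (w : Weight d) (σ : Scaling d) (N : ℕ) (s : ℝ) (z x : Pt d) : ℝ :=
  (w.w z)⁻¹ * (w.w x)⁻¹ * w.star (z - x) * σ.rho s (z - x) ^ N

variable {G : Pt d → ℝ}

theorem Weight.IsControlled.env_nonneg (hw : w.IsControlled σ G) {N : ℕ} {s : ℝ} (hs : 0 < s)
    (z x : Pt d) : 0 ≤ w.env σ N s z x := by
  have := hw.pos z
  have := hw.pos x
  have := hw.star_nonneg (z - x)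
  have := σ.one_le_rho hs (z - x)
  unfold Weight.env
  positivity

/-- The component of T of degree β is of size ‖z-x‖^{α-β}, and P evaluates it with the factor
s^{β/ℓ}. Since ‖z-x‖^{α-β} ≤ s^{(α-β)/ℓ} ρ^N, all components contribute the same power s^{α/ℓ}; N ≥
γ - min A covers every difference α - β that occurs. -/
theorem abs_apply_le_env (hw : w.IsControlled σ G) {γ α p c : ℝ} {N : ℕ} (hN : γ - A.reg ≤ N)
    (hα : α < γ) {s : ℝ} (hs : 0 < s) {z x : Pt d} (hp : 0 ≤ p) (hc : 0 ≤ c) (P : 𝒯.Sum →ₗ[ℝ] ℝ)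
    (hP : ∀ β, β < γ → ∀ τ : 𝒯.T β, |P (𝒯.emb β τ)| ≤ p * (s ^ (β / σ.ell) * (w.w z)⁻¹ * ‖τ‖))
    (T : 𝒯.Sum) (hT : ∀ β, α < β → T β = 0)
    (hTb : ∀ β, β ≤ α → ‖T β‖ ≤ c * ((w.w x)⁻¹ * w.star (z - x) * σ.nrm (z - x) ^ (α - β))) :
    |P T| ≤ (A.below γ).card * (p * c) * (s ^ (α / σ.ell) * w.env σ N s z x) := by
  have hTγ : 𝒯.IsBelow γ T := fun β hβ => hT β (hα.trans_le hβ)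
  have hz := inv_pos.2 (hw.pos z)
  have hx := inv_pos.2 (hw.pos x)
  have hst := hw.star_nonneg (z - x)
  have henv := hw.env_nonneg (N := N) hs z x
  conv_lhs => rw [hTγ.eq_sum]
  rw [map_sum]
  refine (Finset.abs_sum_le_sum_abs _ _).trans ?_
  have hterm : ∀ β ∈ A.below γ, |P (𝒯.emb β (T β))| ≤
      p * c * (s ^ (α / σ.ell) * w.env σ N s z x) := fun β hβ => by
    obtain ⟨hβA, hβγ⟩ := IndexSet.mem_below.1 hβ
    by_cases hβα : β ≤ α
    · have h1 := hTb β hβα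
      have h2 := σ.nrm_rpow_le (N := N) hs (sub_nonneg.2 hβα)
        (by have := IndexSet.reg_le hβA; linarith) (z - x)
      calc |P (𝒯.emb β (T β))| ≤ p * (s ^ (β / σ.ell) * (w.w z)⁻¹ * ‖T β‖) := hP β hβγ _
        _ ≤ p * (s ^ (β / σ.ell) * (w.w z)⁻¹ * (c * ((w.w x)⁻¹ * w.star (z - x) *
              (s ^ ((α - β) / σ.ell) * σ.rho s (z - x) ^ N)))) := by
            gcongr
            exact h1.trans (by gcongr)
        _ = p * c * ((s ^ (β / σ.ell) * s ^ ((α - β) / σ.ell)) * w.env σ N s z x) := by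
            unfold Weight.env; ring
        _ = _ := by
            rw [← Real.rpow_add hs]; congr 3; ring
    · have : 𝒯.emb β (T β) = 0 := by rw [hT β (not_le.1 hβα)]; exact DFinsupp.single_zero β
      rw [this, map_zero, abs_zero]; positivity
  refine (Finset.sum_le_card_nsmul _ _ _ hterm).trans (le_of_eq ?_)
  rw [nsmul_eq_mul]; ring

variable (M M₁ M₂ : Model σ 𝒯 Q w)

/-- The summand 1 accounts for β = α, where Γ acts as the identity and ‖Γ‖ says nothing; the weights
do no harm there because w⁻¹ w^* ≥ 1. -/
theorem Model.norm_Γ_le (hw : w.IsControlled σ G) {γ α β : ℝ} (hα : α < γ) (hβ : β ≤ α)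
    (z x : Pt d) (τ : 𝒯.T α) :
    ‖M.Γ z x (𝒯.emb α τ) β‖ ≤ (1 + (M.normΓ γ).toReal) * ‖τ‖ *
      ((w.w x)⁻¹ * w.star (z - x) * σ.nrm (z - x) ^ (α - β)) := by
  have hg : 0 ≤ (M.normΓ γ).toReal := ENNReal.toReal_nonneg
  have hx := inv_pos.2 (hw.pos x)
  have hst := hw.star_nonneg (z - x)
  have hn := σ.nrm_nonneg (z - x)
  have hp : 0 ≤ (w.w x)⁻¹ * w.star (z - x) * σ.nrm (z - x) ^ (α - β) := by positivity
  rcases hβ.eq_or_lt with rfl | hlt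
  · rw [M.Γ_emb_self, sub_self, Real.rpow_zero, mul_one]
    have h1 : 1 ≤ (w.w x)⁻¹ * w.star (z - x) :=
      one_le_mul_of_one_le_of_one_le ((one_le_inv₀ (hw.pos x)).2 (hw.le_one x))
        (hw.one_le_star _)
    have h2 : ‖τ‖ ≤ (1 + (M.normΓ γ).toReal) * ‖τ‖ := by nlinarith [norm_nonneg τ]
    calc ‖τ‖ ≤ (1 + (M.normΓ γ).toReal) * ‖τ‖ * 1 := by rw [mul_one]; exact h2
      _ ≤ _ := by gcongr
  · have h := norm_le_of_gammaNorm (Γ := fun y x τ => M.Γ y x τ)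
      (M.normΓ_lt_top (fun x => (hw.pos x).le) hw.star_nonneg γ)
      (hw.pos x) (hw.one_le_star (z - x)) hα hlt (map_zero _) τ (fun e => by
        subst e
        rw [M.Γ_self]; exact DFinsupp.single_eq_of_ne hlt.ne)
    refine h.trans ?_
    change (M.normΓ γ).toReal * _ ≤ _
    have : 0 ≤ ‖τ‖ * ((w.w x)⁻¹ * w.star (z - x) * σ.nrm (z - x) ^ (α - β)) := by positivity
    linarith

/-- The distance of the `Γ`-parts of two models. -/
def Model.distΓ (γ : ℝ) : ℝ≥0∞ := gammaNorm σ 𝒯 w γ (fun y x τ => M₁.Γ y x τ - M₂.Γ y x τ)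

/-- The distance of the `Π`-parts of two models. -/
def Model.distPi (γ : ℝ) : ℝ≥0∞ := piNorm σ 𝒯 w γ (fun t x τ => M₁.QPi t x τ - M₂.QPi t x τ)

theorem Model.distPi_lt_top (hw : w.IsControlled σ G) (γ : ℝ) : M₁.distPi M₂ γ < ∞ := by
  have h := piNorm_add_le (σ := σ) (γ := γ) (fun x => (hw.pos x).le)
    (fun t x τ => M₁.QPi t x τ) (fun t x τ => 0 - M₂.QPi t x τ)
  rw [piNorm_sub_comm] at h
  simp only [sub_zero, zero_sub, ← sub_eq_add_neg] at h
  exact h.trans_lt (ENNReal.add_lt_top.2 ⟨M₁.normPi_lt_top (fun x => (hw.pos x).le) γ,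
    M₂.normPi_lt_top (fun x => (hw.pos x).le) γ⟩)

theorem Model.distΓ_lt_top (hw : w.IsControlled σ G) (γ : ℝ) : M₁.distΓ M₂ γ < ∞ := by
  have h := gammaNorm_add_le (σ := σ) (γ := γ) (fun x => (hw.pos x).le) hw.star_nonneg
    (fun t x τ => M₁.Γ t x τ) (fun t x τ => 0 - M₂.Γ t x τ)
  rw [gammaNorm_sub_comm] at h
  simp only [sub_zero, zero_sub, ← sub_eq_add_neg] at h
  exact h.trans_lt (ENNReal.add_lt_top.2
    ⟨M₁.normΓ_lt_top (fun x => (hw.pos x).le) hw.star_nonneg γ,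
      M₂.normΓ_lt_top (fun x => (hw.pos x).le) hw.star_nonneg γ⟩)

/-- The diagonal components of both maps are the identity and cancel, so here the distance alone
suffices. -/
theorem Model.norm_Γ_sub_le (hw : w.IsControlled σ G) {γ α β : ℝ} (hα : α < γ) (hβ : β ≤ α)
    (z x : Pt d) (τ : 𝒯.T α) :
    ‖(M₁.Γ z x (𝒯.emb α τ) - M₂.Γ z x (𝒯.emb α τ)) β‖ ≤ (M₁.distΓ M₂ γ).toReal * ‖τ‖ *
      ((w.w x)⁻¹ * w.star (z - x) * σ.nrm (z - x) ^ (α - β)) := by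
  have hx := inv_pos.2 (hw.pos x)
  have hst := hw.star_nonneg (z - x)
  have hn := σ.nrm_nonneg (z - x)
  have hp : 0 ≤ (w.w x)⁻¹ * w.star (z - x) * σ.nrm (z - x) ^ (α - β) := by positivity
  rcases hβ.eq_or_lt with rfl | hlt
  · rw [DFinsupp.sub_apply, M₁.Γ_emb_self, M₂.Γ_emb_self, sub_self, norm_zero]
    positivity
  · have h := norm_le_of_gammaNorm (Γ := fun y x τ => M₁.Γ y x τ - M₂.Γ y x τ)
      (M₁.distΓ_lt_top M₂ hw γ)
      (hw.pos x) (hw.one_le_star (z - x)) hα hlt (by simp) τ (fun e => by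
        subst e
        rw [M₁.Γ_self, M₂.Γ_self, sub_self]; rfl)
    refine h.trans (le_of_eq ?_)
    change (M₁.distΓ M₂ γ).toReal * _ = _
    ring

theorem Model.abs_QPi_le (hw : w.IsControlled σ G) {γ α : ℝ} (hα : α < γ) {s : ℝ} (hs : 0 < s)
    (hs1 : s ≤ 1) (z : Pt d) (τ : 𝒯.T α) :
    |M.QPi s z (𝒯.emb α τ)| ≤ (M.normPi γ).toReal * (s ^ (α / σ.ell) * (w.w z)⁻¹ * ‖τ‖) :=
  abs_le_of_piNorm (P := fun t x τ => M.QPi t x τ) (M.normPi_lt_top (fun x => (hw.pos x).le) γ)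
    hs hs1 (hw.pos z) (map_zero _) hα τ

theorem Model.abs_QPi_sub_le (hw : w.IsControlled σ G) {γ α : ℝ} (hα : α < γ) {s : ℝ}
    (hs : 0 < s) (hs1 : s ≤ 1) (z : Pt d) (τ : 𝒯.T α) :
    |(M₁.QPi s z - M₂.QPi s z) (𝒯.emb α τ)| ≤
      (M₁.distPi M₂ γ).toReal * (s ^ (α / σ.ell) * (w.w z)⁻¹ * ‖τ‖) :=
  abs_le_of_piNorm (P := fun t x τ => M₁.QPi t x τ - M₂.QPi t x τ) (M₁.distPi_lt_top M₂ hw γ)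
    hs hs1 (hw.pos z) (by simp) hα τ

/-- Recentring: Γ_{zx}τ satisfies the hypotheses of `abs_apply_le_env` by `Model.norm_Γ_le`, and Π
is then tested at its own base point z. -/
theorem Model.abs_evalAt_le (hw : w.IsControlled σ G) {γ α : ℝ} {N : ℕ} (hN : γ - A.reg ≤ N)
    (hα : α < γ) {s : ℝ} (hs : 0 < s) (hs1 : s ≤ 1) (z x : Pt d) (τ : 𝒯.T α) :
    |M.evalAt s z x (𝒯.emb α τ)| ≤ (A.below γ).card *
      ((M.normPi γ).toReal * ((1 + (M.normΓ γ).toReal) * ‖τ‖)) *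
        (s ^ (α / σ.ell) * w.env σ N s z x) := by
  have hg : 0 ≤ (M.normΓ γ).toReal := ENNReal.toReal_nonneg
  exact abs_apply_le_env hw hN hα hs ENNReal.toReal_nonneg (by positivity) (M.QPi s z)
    (fun β hβ τ => M.abs_QPi_le hw hβ hs hs1 z τ) _ (fun β hβ => M.Γ_emb_of_lt z x hβ τ)
    (fun β hβ => M.norm_Γ_le hw hα hβ z x τ)

/-- Telescoping in Π, then Γ, then τ: (Π¹-Π²)Γ¹τ₁ + Π²(Γ¹-Γ²)τ₁ + Π²Γ²(τ₁-τ₂). Each term contains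
exactly one difference. -/
theorem Model.abs_evalAt_sub_le (hw : w.IsControlled σ G) {γ α : ℝ} {N : ℕ} (hN : γ - A.reg ≤ N)
    (hα : α < γ) {s : ℝ} (hs : 0 < s) (hs1 : s ≤ 1) (z x : Pt d) (τ₁ τ₂ : 𝒯.T α) :
    |M₁.evalAt s z x (𝒯.emb α τ₁) - M₂.evalAt s z x (𝒯.emb α τ₂)| ≤ (A.below γ).card *
      ((M₁.distPi M₂ γ).toReal * ((1 + (M₁.normΓ γ).toReal) * ‖τ₁‖) +
        (M₂.normPi γ).toReal * ((M₁.distΓ M₂ γ).toReal * ‖τ₁‖) +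
        (M₂.normPi γ).toReal * ((1 + (M₂.normΓ γ).toReal) * ‖τ₁ - τ₂‖)) *
        (s ^ (α / σ.ell) * w.env σ N s z x) := by
  have hg₁ : 0 ≤ (M₁.normΓ γ).toReal := ENNReal.toReal_nonneg
  have h1 := abs_apply_le_env hw hN hα hs ENNReal.toReal_nonneg (by positivity)
    (M₁.QPi s z - M₂.QPi s z)
    (fun β hβ τ => M₁.abs_QPi_sub_le M₂ hw hβ hs hs1 z τ) _
    (fun β hβ => M₁.Γ_emb_of_lt z x hβ τ₁)
    (fun β hβ => M₁.norm_Γ_le hw hα hβ z x τ₁)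
  have h2 := abs_apply_le_env hw hN hα hs ENNReal.toReal_nonneg (by positivity) (M₂.QPi s z)
    (fun β hβ τ => M₂.abs_QPi_le hw hβ hs hs1 z τ)
    (M₁.Γ z x (𝒯.emb α τ₁) - M₂.Γ z x (𝒯.emb α τ₁))
    (fun β hβ => by rw [DFinsupp.sub_apply, M₁.Γ_emb_of_lt z x hβ, M₂.Γ_emb_of_lt z x hβ, sub_zero])
    (fun β hβ => M₁.norm_Γ_sub_le M₂ hw hα hβ z x τ₁)
  have h3 := M₂.abs_evalAt_le hw hN hα hs hs1 z x (τ₁ - τ₂)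
  have e : M₁.evalAt s z x (𝒯.emb α τ₁) - M₂.evalAt s z x (𝒯.emb α τ₂) =
      (M₁.QPi s z - M₂.QPi s z) (M₁.Γ z x (𝒯.emb α τ₁)) +
      M₂.QPi s z (M₁.Γ z x (𝒯.emb α τ₁) - M₂.Γ z x (𝒯.emb α τ₁)) +
      M₂.evalAt s z x (𝒯.emb α (τ₁ - τ₂)) := by
    have : 𝒯.emb α (τ₁ - τ₂) = 𝒯.emb α τ₁ - 𝒯.emb α τ₂ := DFinsupp.single_sub α τ₁ τ₂
    simp only [Model.evalAt, this, map_sub, LinearMap.sub_apply]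
    ring
  rw [e]
  refine (abs_add_three _ _ _).trans ((add_le_add (add_le_add h1 h2) h3).trans (le_of_eq ?_))
  ring

end ModelNorms

variable {d : ℕ} {A : IndexSet} {𝒯 : RegStructure.{u} A} {σ : Scaling d} {Q K : Ker d}
  {w : Weight d} {G : Pt d → ℝ} {βb δ CK : ℝ}

/-! ### Pairings with recentred distributions. -/

section EnvPairing

/-- Pairing a distribution centred at x produces w^* at z-x, from Γ_{zx}, and w^* at x-z, from
moving the weight at z to x. The decaying weight u₁ tames the second factor: w^*(-x) ≤ C/u₁(-x) ≤ C
u₁^*(x)/u₁(0), and w^* u₁^* is absorbed by G because w u₁ is controlled. -/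
theorem Weight.HasDecay.exists_star_le (h : w.HasDecay σ G) :
    ∃ W : Pt d → ℝ, σ.Decays G W ∧ (∀ x, 0 ≤ W x) ∧
      ∀ x, w.star x * w.star (-x) ≤ W x := by
  obtain ⟨u₁, u₂, h1, -, h3, -, h5, -⟩ := h
  obtain ⟨C, hC⟩ := h5 0
  have h10 := h1.pos 0
  have hCb : ∀ x, w.star (-x) ≤ |C| * (u₁.w 0)⁻¹ * u₁.star x := fun x => by
    have a := hC (-x)
    rw [pow_zero, one_mul] at a
    have b := h1.inv_le 0 (-x)
    rw [zero_sub, neg_neg] at b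
    have hp := h1.pos (-x)
    have a' : w.star (-x) ≤ C * (u₁.w (-x))⁻¹ := by
      rw [← div_eq_mul_inv, le_div_iff₀ hp]; exact a
    calc w.star (-x) ≤ C * (u₁.w (-x))⁻¹ := a'
      _ ≤ |C| * (u₁.w (-x))⁻¹ := by gcongr; exact le_abs_self C
      _ ≤ |C| * (u₁.star x * (u₁.w 0)⁻¹) := by gcongr
      _ = _ := by ring
  have hws : ∀ x, 0 ≤ w.star x := fun x => by
    have h0 : 0 ≤ w.star x * u₁.star x := h3.star_nonneg x
    exact nonneg_of_mul_nonneg_left h0 (zero_lt_one.trans_le (h1.one_le_star x))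
  refine ⟨fun x => |C| * (u₁.w 0)⁻¹ * (w * u₁).star x, h3.decays.const_mul (by positivity),
    fun x => mul_nonneg (by positivity) (h3.star_nonneg x), fun x => ?_⟩
  have e : (w * u₁).star x = w.star x * u₁.star x := rfl
  beta_reduce
  rw [e]
  have := mul_le_mul_of_nonneg_left (hCb x) (hws x)
  linarith

variable [NeZero d]

/-- Pairing a distribution centered at `x` with a kernel around `x`. -/
theorem Weight.HasDecay.exists_env_pairing (h : w.HasDecay σ G) (hw : w.IsControlled σ G)
    (hG0 : ∀ x, 0 ≤ G x) (N : ℕ) :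
    ∃ C : ℝ, 0 ≤ C ∧ ∀ s, 0 < s → s ≤ 1 → ∀ (x : Pt d) (P F : Pt d → ℝ) (p c : ℝ), 0 ≤ p → 0 ≤ c →
      AEStronglyMeasurable P → AEStronglyMeasurable F →
      (∀ z, |P z| ≤ p * σ.scaled G s (x - z)) → (∀ z, |F z| ≤ c * w.env σ N s z x) →
      Integrable (fun z => P z * F z) ∧
        |∫ z, P z * F z| ≤ C * p * c * ((w.w x)⁻¹ * (w.w x)⁻¹) := by
  obtain ⟨W, hW, hW0, hle⟩ := h.exists_star_le
  obtain ⟨C, hC, ht⟩ := hW.exists_test hG0 hW0 N le_rfl (σ.s_pos 0)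
  refine ⟨C, hC, fun s hs hs1 x P F p c hp hc hP hF hPb hFb => ?_⟩
  have hx := inv_pos.2 (hw.pos x)
  obtain ⟨h1, h2, -⟩ := ht s hs hs1 x (fun z => P z * F z) (p * c * ((w.w x)⁻¹ * (w.w x)⁻¹))
    (by positivity) (hP.mul hF) (Eventually.of_forall fun z => by
      rw [abs_mul, neg_zero, Real.rpow_zero, mul_one]
      have hz := inv_pos.2 (hw.pos z)
      have hsc := σ.scaled_nonneg hG0 hs (x - z)
      have hst := hw.star_nonneg (z - x)
      have hρ := σ.one_le_rho hs (x - z)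
      have hl := hle (x - z)
      rw [neg_sub] at hl
      calc |P z| * |F z| ≤ (p * σ.scaled G s (x - z)) * (c * w.env σ N s z x) :=
            mul_le_mul (hPb z) (hFb z) (abs_nonneg _) (by positivity)
        _ ≤ (p * σ.scaled G s (x - z)) * (c * ((w.star (x - z) * (w.w x)⁻¹) * (w.w x)⁻¹ *
              w.star (z - x) * σ.rho s (x - z) ^ N)) := by
            unfold Weight.env
            rw [σ.rho_sub_comm s z x]
            have := hw.inv_le x z
            gcongr
        _ = p * c * ((w.w x)⁻¹ * (w.w x)⁻¹) * (σ.scaled G s (x - z) *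
              (w.star (x - z) * w.star (z - x)) * σ.rho s (x - z) ^ N) := by ring
        _ ≤ _ := by gcongr)
  refine ⟨h1, h2.trans (le_of_eq ?_)⟩
  rw [neg_zero, zero_div, Real.rpow_zero]; ring

theorem Scaling.rho_le_mul (σ : Scaling d) {r s c : ℝ} (hr : 0 < r) (hc : 1 ≤ c)
    (hrs : r ≤ c * s) (x : Pt d) : σ.rho s x ≤ c ^ (1 / σ.ell) * σ.rho r x := by
  have hc0 : 0 < c := by linarith
  have hs : 0 < s := pos_of_mul_pos_right (hr.trans_le hrs) hc0.le
  have hl := one_div_pos.2 σ.ell_pos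
  have h1 : 1 ≤ c ^ (1 / σ.ell) := Real.one_le_rpow hc hl.le
  have h2 : s ^ (-(1 / σ.ell)) ≤ c ^ (1 / σ.ell) * r ^ (-(1 / σ.ell)) := by
    have h3 : r / c ≤ s := by rw [div_le_iff₀ hc0]; linarith
    have h4 := Real.rpow_le_rpow_of_nonpos (div_pos hr hc0) h3 (by linarith : -(1 / σ.ell) ≤ 0)
    rw [Real.div_rpow hr.le hc0.le, Real.rpow_neg hc0.le, div_inv_eq_mul] at h4
    linarith
  have hn := σ.nrm_nonneg x
  unfold Scaling.rho
  calc 1 + s ^ (-(1 / σ.ell)) * σ.nrm x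
      ≤ c ^ (1 / σ.ell) + (c ^ (1 / σ.ell) * r ^ (-(1 / σ.ell))) * σ.nrm x := by gcongr
    _ = _ := by ring

/-- Kernel and distribution may live at different scales r and s. As long as r ≤ c s, the envelope
can be moved to the scale of the kernel for a power of c. -/
theorem Weight.IsControlled.env_le_mul (hw : w.IsControlled σ G) {r s c : ℝ} (hr : 0 < r)
    (hc : 1 ≤ c) (hrs : r ≤ c * s) (N : ℕ) (z x : Pt d) :
    w.env σ N s z x ≤ (c ^ (1 / σ.ell)) ^ N * w.env σ N r z x := by
  have hs : 0 < s := pos_of_mul_pos_right (hr.trans_le hrs) (by linarith)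
  have hz := inv_pos.2 (hw.pos z)
  have hx := inv_pos.2 (hw.pos x)
  have hst := hw.star_nonneg (z - x)
  have h1 := pow_le_pow_left₀ (zero_le_one.trans (σ.one_le_rho hs (z - x)))
    (σ.rho_le_mul hr hc hrs (z - x)) N
  rw [mul_pow] at h1
  unfold Weight.env
  calc _ ≤ (w.w z)⁻¹ * (w.w x)⁻¹ * w.star (z - x) *
        ((c ^ (1 / σ.ell)) ^ N * σ.rho r (z - x) ^ N) := by gcongr
    _ = _ := by ring

end EnvPairing

/-! ### Approximation of models by smooth models. -/

section SmoothApprox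

/-- The bound in a smooth model is given for homogeneous elements; induction over the finitely
supported sum extends it to all of T. -/
theorem SmoothModel.memC (S : SmoothModel σ 𝒯 Q w) (hw : w.IsControlled σ G) (x : Pt d)
    (τ : 𝒯.Sum) : MemC w.w (S.Pi x τ) := by
  refine ⟨S.Pi_cont x τ, ?_⟩
  induction τ using DFinsupp.induction with
  | h0 => exact ⟨0, fun y => by simp⟩
  | ha i b f _ _ hf =>
    obtain ⟨C, hC⟩ := hf
    obtain ⟨C', hC'⟩ := S.Pi_bdd x i
    refine ⟨C' * ‖b‖ + C, fun y => ?_⟩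
    rw [map_add, Pi.add_apply]
    have h1 := mul_le_mul_of_nonneg_left (abs_add_le (S.Pi x (𝒯.emb i b) y) (S.Pi x f y))
      (hw.pos y).le
    have h2 := hC' b y
    have h3 := hC y
    linarith

variable [NeZero d]

theorem SmoothModel.integrable_smear (S : SmoothModel σ 𝒯 Q w) (hQ : IsSemigroup σ G Q)
    (hw : w.IsControlled σ G)
    (hG0 : ∀ x, 0 ≤ G x) {s : ℝ} (hs : 0 < s) (hs1 : s ≤ 1) (z x : Pt d) (τ : 𝒯.Sum) :
    Integrable (fun y => Q s z y * S.Pi x τ y) := by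
  obtain ⟨C, -, h⟩ := hQ.exists_smear_bound hw hG0
  obtain ⟨c, hc, hb⟩ := (S.memC hw x τ).exists_bound hw
  exact (h s hs hs1 z _ c hc (S.Pi_cont x τ).measurable.aestronglyMeasurable hb).1

/-- The linear functional `τ ↦ Q_t(x,Π_x τ)` of a smooth model. -/
def SmoothModel.smearPi (S : SmoothModel σ 𝒯 Q w) (hQ : IsSemigroup σ G Q)
    (hw : w.IsControlled σ G) (hG0 : ∀ x, 0 ≤ G x) (t : ℝ) (x : Pt d) : 𝒯.Sum →ₗ[ℝ] ℝ :=
  open Classical in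
  -- Additivity needs integrability, which is available for 0 < t ≤ 1. At other times the value is
  -- immaterial, and zero is linear.
  if ht : 0 < t ∧ t ≤ 1 then
    { toFun := fun τ => smear Q (S.Pi x τ) t x
      map_add' := fun τ τ' => by
        simp only [smear, map_add, Pi.add_apply, mul_add]
        exact integral_add (S.integrable_smear hQ hw hG0 ht.1 ht.2 x x τ)
          (S.integrable_smear hQ hw hG0 ht.1 ht.2 x x τ')
      map_smul' := fun c τ => by
        simp only [smear, map_smul, Pi.smul_apply, smul_eq_mul, RingHom.id_apply]
        rw [← integral_const_mul]
        congr 1; funext y; ring }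
  else 0

theorem SmoothModel.smearPi_apply (S : SmoothModel σ 𝒯 Q w) (hQ : IsSemigroup σ G Q)
    (hw : w.IsControlled σ G) (hG0 : ∀ x, 0 ≤ G x) {t : ℝ} (ht : 0 < t) (ht1 : t ≤ 1) (x : Pt d)
    (τ : 𝒯.Sum) : S.smearPi hQ hw hG0 t x τ = smear Q (S.Pi x τ) t x := by
  unfold SmoothModel.smearPi
  rw [dif_pos ⟨ht, ht1⟩]; rfl

theorem piNorm_zero (γ : ℝ) : piNorm σ 𝒯 w γ (fun _ _ _ => 0) = 0 := by
  simp [piNorm]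

theorem gammaNorm_zero (γ : ℝ) : gammaNorm σ 𝒯 w γ (fun _ _ _ => 0) = 0 := by
  simp [gammaNorm]

/-- A smooth model is a model. -/
def SmoothModel.toModel (S : SmoothModel σ 𝒯 Q w) (hQ : IsSemigroup σ G Q)
    (hw : w.IsControlled σ G) (hG0 : ∀ x, 0 ≤ G x) : Model σ 𝒯 Q w where
  QPi := S.smearPi hQ hw hG0
  Γ x y := (S.Γ x y).toLinearMap
  Γ_self := S.Γ_self
  Γ_lower x y α τ β hβ := 𝒯.grp_lower _ (S.Γ_mem x y) α τ β hβ
  approx γ ε hε := ⟨S, by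
    have h1 : piNorm σ 𝒯 w γ (fun t x τ => smear Q (S.Pi x τ) t x -
        S.smearPi hQ hw hG0 t x τ) = 0 := by
      rw [← piNorm_zero (σ := σ) (𝒯 := 𝒯) (w := w) γ]
      exact piNorm_congr fun t ht ht1 x τ => by rw [S.smearPi_apply hQ hw hG0 ht ht1, sub_self]
    have h2 : gammaNorm σ 𝒯 w γ (fun y x τ => S.Γ y x τ - (S.Γ y x).toLinearMap τ) = 0 := by
      rw [← gammaNorm_zero (σ := σ) (𝒯 := 𝒯) (w := w) γ]
      congr 1; funext y x τ; exact sub_self _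
    rw [h1, h2, add_zero]; exact hε⟩

/-- `Model.evalAt` recentres with Γ_{zx}; the relation Π_zΓ_{zx} = Π_x of a smooth model undoes
this. -/
theorem SmoothModel.evalAt_toModel (S : SmoothModel σ 𝒯 Q w) (hQ : IsSemigroup σ G Q)
    (hw : w.IsControlled σ G) (hG0 : ∀ x, 0 ≤ G x) {t : ℝ} (ht : 0 < t) (ht1 : t ≤ 1)
    (z x : Pt d) (τ : 𝒯.Sum) :
    (S.toModel hQ hw hG0).evalAt t z x τ = smear Q (S.Pi x τ) t z := by
  change S.smearPi hQ hw hG0 t z (S.Γ z x τ) = _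
  rw [S.smearPi_apply hQ hw hG0 ht ht1, S.Pi_Γ]

/-- The pseudo-distance of a model to a smooth model. -/
def Model.smoothDist (M : Model σ 𝒯 Q w) (γ : ℝ) (S : SmoothModel σ 𝒯 Q w) : ℝ≥0∞ :=
  piNorm σ 𝒯 w γ (fun t x τ => smear Q (S.Pi x τ) t x - M.QPi t x τ) +
    gammaNorm σ 𝒯 w γ (fun y x τ => S.Γ y x τ - M.Γ y x τ)

theorem Model.smoothDist_eq (M : Model σ 𝒯 Q w) (hQ : IsSemigroup σ G Q)
    (hw : w.IsControlled σ G) (hG0 : ∀ x, 0 ≤ G x) (γ : ℝ) (S : SmoothModel σ 𝒯 Q w) :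
    M.smoothDist γ S = (S.toModel hQ hw hG0).distPi M γ + (S.toModel hQ hw hG0).distΓ M γ := by
  unfold Model.smoothDist
  congr 1
  refine piNorm_congr fun t ht ht1 x τ => ?_
  change _ = S.smearPi hQ hw hG0 t x τ - _
  rw [S.smearPi_apply hQ hw hG0 ht ht1]

theorem Model.exists_seq (M : Model σ 𝒯 Q w) (γ : ℝ) :
    ∃ S : ℕ → SmoothModel σ 𝒯 Q w, Tendsto (fun n => M.smoothDist γ (S n)) atTop (𝓝 0) := by
  have h : ∀ n : ℕ, (0 : ℝ≥0∞) < (n : ℝ≥0∞)⁻¹ := fun n => by simp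
  choose S hlt using fun n => M.approx γ _ (h n)
  exact ⟨S, tendsto_of_tendsto_of_tendsto_of_le_of_le tendsto_const_nhds
    ENNReal.tendsto_inv_nat_nhds_zero (fun _ => zero_le) fun n => (hlt n).le⟩

theorem Model.smoothDist_mono (M : Model σ 𝒯 Q w) {γ γ' : ℝ} (h : γ ≤ γ')
    (S : SmoothModel σ 𝒯 Q w) : M.smoothDist γ S ≤ M.smoothDist γ' S := by
  refine add_le_add ?_ ?_
  · refine iSup_mono fun α => iSup_mono' fun hα => ⟨⟨hα.1, hα.2.trans_le h⟩, le_rfl⟩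
  · refine iSup_mono fun α => iSup_mono fun β =>
      iSup_mono' fun hα => ⟨⟨hα.1, hα.2.1, hα.2.2.1, hα.2.2.2.trans_le h⟩, le_rfl⟩

theorem Model.tendsto_approaching (M : Model σ 𝒯 Q w) (γ : ℝ) :
    Tendsto (M.smoothDist γ) M.approaching (𝓝 0) :=
  tendsto_comap.mono_left (iInf_le _ γ)

/-- The pseudo-metrics increase with γ, so the infimum of filters is directed and it suffices that
each of them is nontrivial. This gives meaning to the limit in `Model.kPi`. -/
instance Model.approaching_neBot (M : Model σ 𝒯 Q w) : M.approaching.NeBot := by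
  refine iInf_neBot_of_directed' ?_ fun γ => ?_
  · refine directed_of_isDirected_le fun γ γ' h => ?_
    refine tendsto_iff_comap.1 ?_
    exact tendsto_of_tendsto_of_tendsto_of_le_of_le tendsto_const_nhds tendsto_comap
      (fun _ => zero_le) fun S => M.smoothDist_mono h S
  · obtain ⟨S, hS⟩ := M.exists_seq γ
    exact (tendsto_comap_iff.2 hS).neBot

/-- Convergence of smooth models controls `Γ`. -/
theorem Model.tendsto_Γ_emb (M : Model σ 𝒯 Q w) (hQ : IsSemigroup σ G Q)
    (hw : w.IsControlled σ G) (hG0 : ∀ x, 0 ≤ G x) {γ α : ℝ} (hα : α < γ) {ι : Type*}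
    {l : Filter ι} {S : ι → SmoothModel σ 𝒯 Q w}
    (h : Tendsto (fun i => M.smoothDist γ (S i)) l (𝓝 0)) (z x : Pt d) {τ : 𝒯.T α}
    {τs : ι → 𝒯.T α} (hτ : Tendsto τs l (𝓝 τ)) (β : ℝ) :
    Tendsto (fun i => (S i).Γ z x (𝒯.emb α (τs i)) β) l (𝓝 (M.Γ z x (𝒯.emb α τ) β)) := by
  rcases le_or_gt β α with hβ | hβ
  · set κ : ℝ := (w.w x)⁻¹ * w.star (z - x) * σ.nrm (z - x) ^ (α - β)
    rw [tendsto_iff_norm_sub_tendsto_zero]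
    have hd : Tendsto (fun i => (((S i).toModel hQ hw hG0).distΓ M γ).toReal) l (𝓝 0) := by
      refine tendsto_toReal_zero (tendsto_of_tendsto_of_tendsto_of_le_of_le tendsto_const_nhds h
        (fun _ => zero_le) fun i => ?_)
      beta_reduce
      rw [M.smoothDist_eq hQ hw hG0]; exact le_add_self
    have h1 := ((hd.mul hτ.norm).mul_const κ).add
      (((tendsto_iff_norm_sub_tendsto_zero.1 hτ).const_mul (1 + (M.normΓ γ).toReal)).mul_const κ)
    simp only [zero_mul, mul_zero, add_zero] at h1
    refine squeeze_zero (fun _ => norm_nonneg _) (fun i => ?_) h1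
    have a := ((S i).toModel hQ hw hG0).norm_Γ_sub_le M hw hα hβ z x (τs i)
    have b := M.norm_Γ_le hw hα hβ z x (τs i - τ)
    have e : (S i).Γ z x (𝒯.emb α (τs i)) β - M.Γ z x (𝒯.emb α τ) β =
        (((S i).toModel hQ hw hG0).Γ z x (𝒯.emb α (τs i)) - M.Γ z x (𝒯.emb α (τs i))) β +
          M.Γ z x (𝒯.emb α (τs i - τ)) β := by
      have e1 : 𝒯.emb α (τs i - τ) = 𝒯.emb α (τs i) - 𝒯.emb α τ := DFinsupp.single_sub α _ _
      rw [e1, map_sub, DFinsupp.sub_apply, DFinsupp.sub_apply]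
      change _ = (S i).Γ z x (𝒯.emb α (τs i)) β - _ + _
      abel
    rw [e]
    exact (norm_add_le _ _).trans (add_le_add a b)
  · have h1 : ∀ i, (S i).Γ z x (𝒯.emb α (τs i)) β = 0 := fun i =>
      ((S i).toModel hQ hw hG0).Γ_emb_of_lt z x hβ (τs i)
    simp only [h1, M.Γ_emb_of_lt z x hβ]
    exact tendsto_const_nhds

/-- The argument is allowed to vary along the sequence, because composing two maps Γ applies the
outer one to an argument that itself only converges. -/
theorem Model.tendsto_Γ (M : Model σ 𝒯 Q w) (hQ : IsSemigroup σ G Q)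
    (hw : w.IsControlled σ G) (hG0 : ∀ x, 0 ≤ G x) {γ : ℝ} {ι : Type*}
    {l : Filter ι} {S : ι → SmoothModel σ 𝒯 Q w}
    (h : Tendsto (fun i => M.smoothDist γ (S i)) l (𝓝 0)) (z x : Pt d) {τ : 𝒯.Sum}
    {τs : ι → 𝒯.Sum} (hτb : 𝒯.IsBelow γ τ) (hτsb : ∀ i, 𝒯.IsBelow γ (τs i))
    (hτ : ∀ β, Tendsto (fun i => τs i β) l (𝓝 (τ β))) (β : ℝ) :
    Tendsto (fun i => (S i).Γ z x (τs i) β) l (𝓝 (M.Γ z x τ β)) := by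
  have e1 : ∀ i, (S i).Γ z x (τs i) β =
      ∑ α ∈ A.below γ, (S i).Γ z x (𝒯.emb α (τs i α)) β := fun i => by
    conv_lhs => rw [(hτsb i).eq_sum]
    rw [map_sum, DFinsupp.finsetSum_apply]
  have e2 : M.Γ z x τ β = ∑ α ∈ A.below γ, M.Γ z x (𝒯.emb α (τ α)) β := by
    conv_lhs => rw [hτb.eq_sum]
    rw [map_sum, DFinsupp.finsetSum_apply]
  simp only [e1, e2]
  exact tendsto_finsetSum _ fun α hα =>
    M.tendsto_Γ_emb hQ hw hG0 (IndexSet.mem_below.1 hα).2 h z x (hτ α) β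

/-- The cocycle identity is not part of the data of a limit model; it is inherited from the smooth
models by convergence of components. -/
theorem Model.Γ_comp (M : Model σ 𝒯 Q w) (hQ : IsSemigroup σ G Q)
    (hw : w.IsControlled σ G) (hG0 : ∀ x, 0 ≤ G x) {γ : ℝ} {τ : 𝒯.Sum} (hτ : 𝒯.IsBelow γ τ)
    (z y x : Pt d) : M.Γ z y (M.Γ y x τ) = M.Γ z x τ := by
  obtain ⟨S, hS⟩ := M.exists_seq γ
  ext β
  have h1 := M.tendsto_Γ hQ hw hG0 hS y x hτ (fun _ => hτ) (fun _ => tendsto_const_nhds)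
  have h2 := M.tendsto_Γ hQ hw hG0 hS z y (M.isBelow_Γ y x hτ)
    (fun i => ((S i).toModel hQ hw hG0).isBelow_Γ y x hτ) h1 β
  have h3 := M.tendsto_Γ hQ hw hG0 hS z x hτ (fun _ => hτ) (fun _ => tendsto_const_nhds) β
  refine tendsto_nhds_unique h2 (h3.congr fun i => ?_)
  exact congrArg (fun τ => τ β) ((S i).Γ_comp z y x τ).symm

theorem Model.normΓ_le_add (M₁ M₂ : Model σ 𝒯 Q w) (hw : w.IsControlled σ G) (γ : ℝ) :
    (M₁.normΓ γ).toReal ≤ (M₁.distΓ M₂ γ).toReal + (M₂.normΓ γ).toReal := by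
  have h1 := gammaNorm_add_le (σ := σ) (γ := γ) (fun x => (hw.pos x).le) hw.star_nonneg
    (fun y x τ => M₁.Γ y x τ - M₂.Γ y x τ) (fun y x τ => M₂.Γ y x τ)
  simp only [sub_add_cancel] at h1
  have t1 := M₁.distΓ_lt_top M₂ hw γ
  have t2 := M₂.normΓ_lt_top (fun x => (hw.pos x).le) hw.star_nonneg γ
  have := ENNReal.toReal_mono (ENNReal.add_lt_top.2 ⟨t1, t2⟩).ne h1
  exact this.trans (ENNReal.toReal_add t1.ne t2.ne).le

theorem Model.evalAt_eq_sum (M : Model σ 𝒯 Q w) {γ : ℝ} {τ : 𝒯.Sum} (hτ : 𝒯.IsBelow γ τ)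
    (s : ℝ) (z x : Pt d) :
    M.evalAt s z x τ = ∑ α ∈ A.below γ, M.evalAt s z x (𝒯.emb α (τ α)) := by
  unfold Model.evalAt
  conv_lhs => rw [hτ.eq_sum]
  simp only [map_sum]

theorem Model.abs_evalAt_sub_le_sum (M₁ M₂ : Model σ 𝒯 Q w) (hw : w.IsControlled σ G) {γ : ℝ}
    {N : ℕ} (hN : γ - A.reg ≤ N) {τ : 𝒯.Sum} (hτ : 𝒯.IsBelow γ τ) {s : ℝ} (hs : 0 < s)
    (hs1 : s ≤ 1) (z x : Pt d) :
    |M₁.evalAt s z x τ - M₂.evalAt s z x τ| ≤ (∑ α ∈ A.below γ, (A.below γ).card *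
      ((M₁.distPi M₂ γ).toReal *
        ((1 + ((M₁.distΓ M₂ γ).toReal + (M₂.normΓ γ).toReal)) * ‖τ α‖) +
      (M₂.normPi γ).toReal * ((M₁.distΓ M₂ γ).toReal * ‖τ α‖)) * s ^ (α / σ.ell)) *
        w.env σ N s z x := by
  have henv := hw.env_nonneg (N := N) hs z x
  rw [M₁.evalAt_eq_sum hτ, M₂.evalAt_eq_sum hτ, ← Finset.sum_sub_distrib, Finset.sum_mul]
  refine (Finset.abs_sum_le_sum_abs _ _).trans (Finset.sum_le_sum fun α hα => ?_)
  have h1 := M₁.abs_evalAt_sub_le M₂ hw hN (IndexSet.mem_below.1 hα).2 hs hs1 z x (τ α) (τ α)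
  rw [sub_self, norm_zero, mul_zero, mul_zero, add_zero] at h1
  refine h1.trans ?_
  have := M₁.normΓ_le_add M₂ hw γ
  rw [mul_assoc _ (s ^ (α / σ.ell)) (w.env σ N s z x)]
  gcongr

/-- Uniform convergence of the tested smooth models, relative to the envelope. -/
theorem Model.exists_evalAt_rate (M : Model σ 𝒯 Q w) (hQ : IsSemigroup σ G Q)
    (hw : w.IsControlled σ G) (hG0 : ∀ x, 0 ≤ G x) {γ : ℝ} {N : ℕ} (hN : γ - A.reg ≤ N)
    {ι : Type*} {l : Filter ι} {S : ι → SmoothModel σ 𝒯 Q w}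
    (h : Tendsto (fun i => M.smoothDist γ (S i)) l (𝓝 0)) (x : Pt d) {τ : 𝒯.Sum}
    (hτ : 𝒯.IsBelow γ τ) {s : ℝ} (hs : 0 < s) (hs1 : s ≤ 1) :
    ∃ c : ι → ℝ, Tendsto c l (𝓝 0) ∧ (∀ i, 0 ≤ c i) ∧ ∀ i z,
      |smear Q ((S i).Pi x τ) s z - M.evalAt s z x τ| ≤ c i * w.env σ N s z x := by
  obtain ⟨M', hM'⟩ : ∃ M' : ι → Model σ 𝒯 Q w, ∀ i, M' i = (S i).toModel hQ hw hG0 :=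
    ⟨_, fun _ => rfl⟩
  have he : ∀ i, M.smoothDist γ (S i) = (M' i).distPi M γ + (M' i).distΓ M γ := fun i => by
    rw [hM', M.smoothDist_eq hQ hw hG0]
  simp only [he] at h
  have hP : Tendsto (fun i => ((M' i).distPi M γ).toReal) l (𝓝 0) :=
    tendsto_toReal_zero (tendsto_of_tendsto_of_tendsto_of_le_of_le tendsto_const_nhds h
      (fun _ => zero_le) fun i => le_self_add)
  have hΓ : Tendsto (fun i => ((M' i).distΓ M γ).toReal) l (𝓝 0) :=
    tendsto_toReal_zero (tendsto_of_tendsto_of_tendsto_of_le_of_le tendsto_const_nhds h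
      (fun _ => zero_le) fun i => le_add_self)
  obtain ⟨B, hB⟩ : ∃ B : ι → ℝ → ℝ, ∀ i α, B i α = (A.below γ).card *
      (((M' i).distPi M γ).toReal *
        ((1 + (((M' i).distΓ M γ).toReal + (M.normΓ γ).toReal)) * ‖τ α‖) +
      (M.normPi γ).toReal * (((M' i).distΓ M γ).toReal * ‖τ α‖)) * s ^ (α / σ.ell) :=
    ⟨_, fun _ _ => rfl⟩
  have hlim : ∀ α, Tendsto (fun i => B i α) l (𝓝 0) := fun α => by
    have := (((hP.mul (((hΓ.add_const (M.normΓ γ).toReal).const_add 1).mul_const ‖τ α‖)).add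
      ((hΓ.mul_const ‖τ α‖).const_mul (M.normPi γ).toReal)).const_mul
        ((A.below γ).card : ℝ)).mul_const (s ^ (α / σ.ell))
    simp only [zero_mul, mul_zero, add_zero] at this
    exact this.congr fun i => (hB i α).symm
  refine ⟨fun i => ∑ α ∈ A.below γ, B i α, ?_, fun i => Finset.sum_nonneg fun α _ => ?_,
    fun i z => ?_⟩
  · have := tendsto_finsetSum (A.below γ) fun α _ => hlim α
    rwa [Finset.sum_const_zero] at this
  · have h1 := ENNReal.toReal_nonneg (a := (M' i).distΓ M γ)
    have h2 := ENNReal.toReal_nonneg (a := M.normΓ γ)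
    have h3 := ENNReal.toReal_nonneg (a := (M' i).distPi M γ)
    have h4 := ENNReal.toReal_nonneg (a := M.normPi γ)
    have h5 := norm_nonneg (τ α)
    rw [hB]
    exact mul_nonneg (mul_nonneg (Nat.cast_nonneg _) (add_nonneg (mul_nonneg h3 (mul_nonneg
      (by linarith) h5)) (mul_nonneg h4 (mul_nonneg h1 h5)))) (Real.rpow_nonneg hs.le _)
  · have h2 : (M' i).evalAt s z x τ = smear Q ((S i).Pi x τ) s z := by
      rw [hM' i]; exact (S i).evalAt_toModel hQ hw hG0 hs hs1 z x τ
    have h1 := (M' i).abs_evalAt_sub_le_sum M hw hN hτ hs hs1 z x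
    simp only [← hB] at h1
    rw [h2] at h1
    exact h1

end SmoothApprox

variable {d : ℕ} {A : IndexSet} {𝒯 : RegStructure.{u} A} {σ : Scaling d} {Q K : Ker d}
  {w : Weight d} {G : Pt d → ℝ} {βb δ CK : ℝ}

/-! ### Kernels applied to model distributions. -/

section ModelPairing

theorem IndexSet.exists_nat (A : IndexSet) (γ : ℝ) : ∃ N : ℕ, γ - A.reg ≤ N := exists_nat_ge _

variable [NeZero d] (M : Model σ 𝒯 Q w)

theorem Model.tendsto_smear (hQ : IsSemigroup σ G Q)
    (hw : w.IsControlled σ G) (hG0 : ∀ x, 0 ≤ G x) {γ : ℝ}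
    {ι : Type*} {l : Filter ι} {S : ι → SmoothModel σ 𝒯 Q w}
    (h : Tendsto (fun i => M.smoothDist γ (S i)) l (𝓝 0)) (x : Pt d) {τ : 𝒯.Sum}
    (hτ : 𝒯.IsBelow γ τ) {s : ℝ} (hs : 0 < s) (hs1 : s ≤ 1) (z : Pt d) :
    Tendsto (fun i => smear Q ((S i).Pi x τ) s z) l (𝓝 (M.evalAt s z x τ)) := by
  obtain ⟨N, hN⟩ := A.exists_nat γ
  obtain ⟨c, hc, -, hle⟩ := M.exists_evalAt_rate hQ hw hG0 hN h x hτ hs hs1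
  rw [tendsto_iff_norm_sub_tendsto_zero]
  have h1 := hc.mul_const (w.env σ N s z x)
  rw [zero_mul] at h1
  exact squeeze_zero (fun _ => norm_nonneg _) (fun i => hle i z) h1

theorem Model.measurable_evalAt (hQ : IsSemigroup σ G Q)
    (hw : w.IsControlled σ G) (hG0 : ∀ x, 0 ≤ G x) {γ : ℝ} (x : Pt d) {τ : 𝒯.Sum}
    (hτ : 𝒯.IsBelow γ τ) {s : ℝ} (hs : 0 < s) (hs1 : s ≤ 1) :
    Measurable (fun z => M.evalAt s z x τ) := by
  obtain ⟨S, hS⟩ := M.exists_seq γ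
  exact measurable_of_tendsto_metrizable
    (fun n => hQ.measurable_smear ((S n).Pi_cont x τ).measurable hs)
    (tendsto_pi_nhds.2 fun z => M.tendsto_smear hQ hw hG0 hS x hτ hs hs1 z)

theorem Model.exists_abs_evalAt_le (hw : w.IsControlled σ G) {γ : ℝ} {N : ℕ}
    (hN : γ - A.reg ≤ N) {τ : 𝒯.Sum} (hτ : 𝒯.IsBelow γ τ) {s : ℝ} (hs : 0 < s)
    (hs1 : s ≤ 1) (x : Pt d) :
    ∃ c, 0 ≤ c ∧ ∀ z, |M.evalAt s z x τ| ≤ c * w.env σ N s z x := by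
  refine ⟨∑ α ∈ A.below γ, (A.below γ).card *
      ((M.normPi γ).toReal * ((1 + (M.normΓ γ).toReal) * ‖τ α‖)) * s ^ (α / σ.ell), ?_,
      fun z => ?_⟩
  · have := ENNReal.toReal_nonneg (a := M.normΓ γ)
    have := ENNReal.toReal_nonneg (a := M.normPi γ)
    exact Finset.sum_nonneg fun α _ => by positivity
  · rw [M.evalAt_eq_sum hτ, Finset.sum_mul]
    refine (Finset.abs_sum_le_sum_abs _ _).trans (Finset.sum_le_sum fun α hα => ?_)
    rw [mul_assoc _ (s ^ (α / σ.ell))]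
    exact M.abs_evalAt_le hw hN (IndexSet.mem_below.1 hα).2 hs hs1 z x (τ α)

theorem Model.integrable_pairing (hQ : IsSemigroup σ G Q)
    (hw : w.IsControlled σ G) (hG0 : ∀ x, 0 ≤ G x) (hd : w.HasDecay σ G) {γ : ℝ} (x : Pt d)
    {τ : 𝒯.Sum} (hτ : 𝒯.IsBelow γ τ) {r s p : ℝ} (hr : 0 < r) (hr1 : r ≤ 1) (hs : 0 < s)
    (hs1 : s ≤ 1) {P : Pt d → ℝ} (hP : Measurable P) (hp : 0 ≤ p)
    (hPb : ∀ z, |P z| ≤ p * σ.scaled G r (x - z)) :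
    Integrable (fun z => P z * M.evalAt s z x τ) := by
  obtain ⟨N, hN⟩ := A.exists_nat γ
  obtain ⟨C, hC, hpair⟩ := hd.exists_env_pairing hw hG0 N
  obtain ⟨c, hc, hle⟩ := M.exists_abs_evalAt_le hw hN hτ hs hs1 x
  -- The smallest admissible ratio with r ≤ m s, used to move the envelope from scale s to the scale
  -- r of the kernel P.
  set m : ℝ := max 1 (r / s)
  have hm : 1 ≤ m := le_max_left _ _
  have hrs : r ≤ m * s := by
    rw [← div_le_iff₀ hs]; exact le_max_right _ _
  exact (hpair r hr hr1 x P _ p (c * (m ^ (1 / σ.ell)) ^ N) hp (by positivity)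
    hP.aestronglyMeasurable (M.measurable_evalAt hQ hw hG0 x hτ hs hs1).aestronglyMeasurable hPb
    (fun z => (hle z).trans (by
      rw [mul_assoc]
      exact mul_le_mul_of_nonneg_left (hw.env_le_mul hr hm hrs N z x) hc))).1

theorem Model.tendsto_pairing (hQ : IsSemigroup σ G Q)
    (hw : w.IsControlled σ G) (hG0 : ∀ x, 0 ≤ G x) (hd : w.HasDecay σ G) {γ : ℝ}
    {ι : Type*} {l : Filter ι} {S : ι → SmoothModel σ 𝒯 Q w}
    (h : Tendsto (fun i => M.smoothDist γ (S i)) l (𝓝 0)) (x : Pt d) {τ : 𝒯.Sum}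
    (hτ : 𝒯.IsBelow γ τ) {r s p : ℝ} (hr : 0 < r) (hr1 : r ≤ 1) (hs : 0 < s) (hs1 : s ≤ 1)
    {P : Pt d → ℝ} (hP : Measurable P) (hp : 0 ≤ p)
    (hPb : ∀ z, |P z| ≤ p * σ.scaled G r (x - z)) :
    Tendsto (fun i => ∫ z, P z * smear Q ((S i).Pi x τ) s z) l
      (𝓝 (∫ z, P z * M.evalAt s z x τ)) := by
  obtain ⟨N, hN⟩ := A.exists_nat γ
  obtain ⟨c, hc, hc0, hle⟩ := M.exists_evalAt_rate hQ hw hG0 hN h x hτ hs hs1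
  obtain ⟨C, hC, hpair⟩ := hd.exists_env_pairing hw hG0 N
  set m : ℝ := max 1 (r / s)
  have hm : 1 ≤ m := le_max_left _ _
  have hrs : r ≤ m * s := by
    rw [← div_le_iff₀ hs]; exact le_max_right _ _
  have hi1 := M.integrable_pairing hQ hw hG0 hd x hτ hr hr1 hs hs1 hP hp hPb
  rw [tendsto_iff_norm_sub_tendsto_zero]
  have h1 := ((hc.mul_const ((m ^ (1 / σ.ell)) ^ N)).const_mul (C * p)).mul_const
    ((w.w x)⁻¹ * (w.w x)⁻¹)
  simp only [zero_mul, mul_zero] at h1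
  refine squeeze_zero (fun _ => norm_nonneg _) (fun i => ?_) h1
  have hmi := hQ.measurable_smear ((S i).Pi_cont x τ).measurable hs
  have hi2 : Integrable (fun z => P z * smear Q ((S i).Pi x τ) s z) := by
    have := ((S i).toModel hQ hw hG0).integrable_pairing hQ hw hG0 hd x hτ hr hr1 hs hs1 hP hp hPb
    simpa only [(S i).evalAt_toModel hQ hw hG0 hs hs1] using this
  have hi3 := (hpair r hr hr1 x P (fun z => smear Q ((S i).Pi x τ) s z - M.evalAt s z x τ) p
    (c i * (m ^ (1 / σ.ell)) ^ N) hp (mul_nonneg (hc0 i) (by positivity)) hP.aestronglyMeasurable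
    (hmi.sub (M.measurable_evalAt hQ hw hG0 x hτ hs hs1)).aestronglyMeasurable hPb
    (fun z => (hle i z).trans (by
      rw [mul_assoc]
      exact mul_le_mul_of_nonneg_left (hw.env_le_mul hr hm hrs N z x) (hc0 i)))).2
  rw [← integral_sub hi2 hi1]
  simp only [← mul_sub]
  exact hi3

/-- The semigroup property of Π_xτ with its base point held fixed, as a limit of the same identity
for smooth models. -/
theorem Model.QPi_eq (hQ : IsSemigroup σ G Q)
    (hw : w.IsControlled σ G) (hG0 : ∀ x, 0 ≤ G x) (hd : w.HasDecay σ G) {γ : ℝ} (x : Pt d)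
    {τ : 𝒯.Sum} (hτ : 𝒯.IsBelow γ τ) {s t : ℝ} (hs : 0 < s) (hst : s < t) (ht : t ≤ 1) :
    M.QPi t x τ = ∫ z, Q (t - s) x z * M.evalAt s z x τ := by
  obtain ⟨S, hS⟩ := M.exists_seq γ
  obtain ⟨C₁, hC₁, hq⟩ := hQ.upper
  have hts : 0 < t - s := by linarith
  have h0 := M.tendsto_smear hQ hw hG0 hS x hτ (hs.trans hst) ht x
  have e : M.evalAt t x x τ = M.QPi t x τ := by unfold Model.evalAt; rw [M.Γ_self]
  rw [e] at h0
  refine tendsto_nhds_unique h0 ?_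
  simp only [fun n => hQ.smear_semigroup hw hG0 ((S n).memC hw x τ) hs hst ht x]
  exact M.tendsto_pairing hQ hw hG0 hd hS x hτ hts (by linarith) hs (by linarith)
    (hQ.measurable_right hts x) hC₁.le (fun z => hq _ hts x z)

theorem IsRegularizing.tendsto_kfun_model (hK : IsRegularizing σ G Q K βb δ CK)
    (hQ : IsSemigroup σ G Q) (hw : w.IsControlled σ G) (hG0 : ∀ x, 0 ≤ G x)
    (hd : w.HasDecay σ G) (hCK : 0 < CK) {k : Idx d} (hk : σ.deg k < δ) {γ : ℝ}
    {ι : Type*} {l : Filter ι} {S : ι → SmoothModel σ 𝒯 Q w}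
    (h : Tendsto (fun i => M.smoothDist γ (S i)) l (𝓝 0)) (x : Pt d) {τ : 𝒯.Sum}
    (hτ : 𝒯.IsBelow γ τ) {t : ℝ} (ht : 0 < t) (ht1 : t ≤ 1) :
    Tendsto (fun i => kfun K k t x ((S i).Pi x τ)) l
      (𝓝 (kint K k t x (fun s z => M.evalAt s z x τ))) := by
  have ht2 := half_pos ht
  have h1 := M.tendsto_pairing hQ hw hG0 hd h x hτ ht2 (by linarith) ht2
    (by linarith) (hK.measurable_kderiv k hk ht2 x)
    (p := CK * (t / 2) ^ ((βb - σ.deg k) / σ.ell - 1)) (by positivity)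
    (fun z => hK.upper k hk _ ht2 x z)
  exact h1.congr fun i => (hK.kfun_eq_kint hQ hw hG0 hCK hk ((S i).memC hw x τ) ht ht1 x).symm

/-- As for Besov elements, the limit over smooth models is an honest integral against
Q_{t/2}(·,Π_xτ). -/
theorem IsRegularizing.kPi_eq (hK : IsRegularizing σ G Q K βb δ CK)
    (hQ : IsSemigroup σ G Q) (hw : w.IsControlled σ G) (hG0 : ∀ x, 0 ≤ G x)
    (hd : w.HasDecay σ G) (hCK : 0 < CK) {k : Idx d} (hk : σ.deg k < δ) {γ : ℝ}
    (x : Pt d) {τ : 𝒯.Sum} (hτ : 𝒯.IsBelow γ τ) {t : ℝ} (ht : 0 < t) (ht1 : t ≤ 1) :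
    M.kPi K k t x τ = kint K k t x (fun s z => M.evalAt s z x τ) :=
  (hK.tendsto_kfun_model M hQ hw hG0 hd hCK hk (M.tendsto_approaching γ) x hτ ht ht1).limUnder_eq

theorem IsRegularizing.aestronglyMeasurable_kint_model (hK : IsRegularizing σ G Q K βb δ CK)
    (hQ : IsSemigroup σ G Q) (hw : w.IsControlled σ G) (hG0 : ∀ x, 0 ≤ G x)
    (hd : w.HasDecay σ G) (hCK : 0 < CK) {k : Idx d} (hk : σ.deg k < δ) {γ : ℝ}
    (x : Pt d) {τ : 𝒯.Sum} (hτ : 𝒯.IsBelow γ τ) :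
    AEStronglyMeasurable (fun t => kint K k t x (fun s z => M.evalAt s z x τ))
      (volume.restrict (Set.Ioc 0 1)) := by
  obtain ⟨S, hS⟩ := M.exists_seq γ
  refine aestronglyMeasurable_of_tendsto_ae atTop
    (fun n => hK.aestronglyMeasurable_kfun hQ hw hG0 hCK hk ((S n).memC hw x τ) x) ?_
  refine (ae_restrict_iff' measurableSet_Ioc).2 (Eventually.of_forall fun t ht => ?_)
  exact hK.tendsto_kfun_model M hQ hw hG0 hd hCK hk hS x hτ ht.1 ht.2

end ModelPairing

/-! ### Integrals over time and their cutoffs. -/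

section TimeIntegrals

variable {ℓ : ℝ}

theorem integrableOn_of_abs_le_rpow_Ioc_zero (hℓ : 0 < ℓ) {e ρ c : ℝ} (he : 0 < e) (hρ : 0 < ρ)
    {g : ℝ → ℝ} (hg : AEStronglyMeasurable g (volume.restrict (Set.Ioc 0 ρ)))
    (hb : ∀ t, 0 < t → t ≤ ρ → |g t| ≤ c * t ^ (e / ℓ - 1)) :
    IntegrableOn g (Set.Ioc 0 ρ) ∧ |∫ t in Set.Ioc 0 ρ, g t| ≤ ℓ / e * c * ρ ^ (e / ℓ) := by
  have h1 : -1 < e / ℓ - 1 := by have := div_pos he hℓ; linarith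
  have hi : IntegrableOn (fun t : ℝ => c * t ^ (e / ℓ - 1)) (Set.Ioc 0 ρ) :=
    ((intervalIntegrable_iff_integrableOn_Ioc_of_le hρ.le).1
      (intervalIntegral.intervalIntegrable_rpow' h1)).const_mul c
  have hae : ∀ᵐ t ∂(volume.restrict (Set.Ioc 0 ρ)), ‖g t‖ ≤ c * t ^ (e / ℓ - 1) :=
    (ae_restrict_iff' measurableSet_Ioc).2 (Eventually.of_forall fun t ht => hb t ht.1 ht.2)
  refine ⟨hi.mono' hg hae, (norm_integral_le_of_norm_le hi hae).trans (le_of_eq ?_)⟩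
  rw [integral_const_mul, ← intervalIntegral.integral_of_le hρ.le,
    integral_rpow (Or.inl h1), Real.zero_rpow (by have := div_pos he hℓ; linarith)]
  rw [sub_add_cancel, sub_zero]
  field_simp

theorem integrableOn_of_abs_le_rpow_Ioc_one {e ρ c : ℝ} (hρ : 0 < ρ) (hρ1 : ρ ≤ 1)
    {g : ℝ → ℝ} (hg : AEStronglyMeasurable g (volume.restrict (Set.Ioc 0 1)))
    (hb : ∀ t, ρ < t → t ≤ 1 → |g t| ≤ c * t ^ e) :
    IntegrableOn g (Set.Ioc ρ 1) ∧
      |∫ t in Set.Ioc ρ 1, g t| ≤ c * ∫ t in Set.Ioc ρ 1, t ^ e := by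
  have hi : IntegrableOn (fun t : ℝ => c * t ^ e) (Set.Ioc ρ 1) := by
    refine ((intervalIntegrable_iff_integrableOn_Ioc_of_le hρ1).1
      (intervalIntegral.intervalIntegrable_rpow (Or.inr ?_))).const_mul c
    rw [Set.uIcc_of_le hρ1]
    exact fun h => absurd h.1 (not_le.2 hρ)
  have hae : ∀ᵐ t ∂(volume.restrict (Set.Ioc ρ 1)), ‖g t‖ ≤ c * t ^ e :=
    (ae_restrict_iff' measurableSet_Ioc).2 (Eventually.of_forall fun t ht => hb t ht.1 ht.2)
  refine ⟨hi.mono' (hg.mono_measure (Measure.restrict_mono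
    (Set.Ioc_subset_Ioc_left hρ.le) le_rfl)) hae, ?_⟩
  rw [← integral_const_mul]
  exact norm_integral_le_of_norm_le hi hae

/-- On t ≤ 1 a smaller exponent only enlarges the integrand. Having E' < 0 strictly makes the
primitive a power and never a logarithm, even if E = 0. -/
theorem integral_rpow_Ioc_one_le (hℓ : 0 < ℓ) {E E' : ℝ} (hEE : E' ≤ E) (hE' : E' < 0) {ρ : ℝ}
    (hρ : 0 < ρ) (hρ1 : ρ ≤ 1) :
    ∫ t in Set.Ioc ρ 1, t ^ (E / ℓ - 1) ≤ ℓ / -E' * ρ ^ (E' / ℓ) := by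
  have h0 : (0 : ℝ) ∉ Set.uIcc ρ 1 := by
    rw [Set.uIcc_of_le hρ1]
    exact fun h => absurd h.1 (not_le.2 hρ)
  have hi : ∀ e : ℝ, IntegrableOn (fun t : ℝ => t ^ e) (Set.Ioc ρ 1) := fun e =>
    (intervalIntegrable_iff_integrableOn_Ioc_of_le hρ1).1
      (intervalIntegral.intervalIntegrable_rpow (Or.inr h0))
  have hq : E' / ℓ < 0 := div_neg_of_neg_of_pos hE' hℓ
  calc ∫ t in Set.Ioc ρ 1, t ^ (E / ℓ - 1) ≤ ∫ t in Set.Ioc ρ 1, t ^ (E' / ℓ - 1) := by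
        refine setIntegral_mono_on (hi _) (hi _) measurableSet_Ioc fun t ht => ?_
        refine Real.rpow_le_rpow_of_exponent_ge (hρ.trans ht.1) ht.2 ?_
        have := div_le_div_of_nonneg_right hEE hℓ.le
        linarith
    _ = (1 - ρ ^ (E' / ℓ)) / (E' / ℓ) := by
        rw [← intervalIntegral.integral_of_le hρ1, integral_rpow (Or.inr ⟨by linarith, h0⟩)]
        rw [sub_add_cancel, Real.one_rpow]
    _ = ℓ / -E' * (ρ ^ (E' / ℓ) - 1) := by
        have : E' ≠ 0 := hE'.ne
        field_simp
        ring
    _ ≤ _ := by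
        have : 0 ≤ ℓ / -E' := div_nonneg hℓ.le (by linarith)
        nlinarith

/-- Integrals over large times: the gain `βb > β` or non-integrality removes logarithms. -/
theorem exists_integral_Ioc_one_bound (hℓ : 0 < ℓ) {β βb e : ℝ} (hβ : β ≤ βb)
    (hcase : β < βb ∨ e + βb ≠ 0) :
    ∃ C : ℝ, 0 ≤ C ∧ ∀ ρ c : ℝ, 0 < ρ → ρ ≤ 1 → 0 ≤ c → ∀ g : ℝ → ℝ,
      AEStronglyMeasurable g (volume.restrict (Set.Ioc 0 1)) →
      (∀ t, ρ < t → t ≤ 1 → |g t| ≤ c * t ^ ((e + βb) / ℓ - 1)) →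
      IntegrableOn g (Set.Ioc ρ 1) ∧
        |∫ t in Set.Ioc ρ 1, g t| ≤ C * c * ρ ^ (min (e + β) 0 / ℓ) := by
  -- For a positive exponent the integral over all of (0, 1] converges, and ρ raised to a
  -- nonpositive power is at least 1.
  rcases lt_or_ge 0 (e + βb) with hpos | hneg
  · refine ⟨ℓ / (e + βb), by positivity, fun ρ c hρ hρ1 hc g hg hb => ?_⟩
    obtain ⟨h1, h2⟩ := integrableOn_of_abs_le_rpow_Ioc_one hρ hρ1 hg hb
    refine ⟨h1, h2.trans ?_⟩
    have h3 : -1 < (e + βb) / ℓ - 1 := by have := div_pos hpos hℓ; linarith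
    have hi : IntegrableOn (fun t : ℝ => t ^ ((e + βb) / ℓ - 1)) (Set.Ioc 0 1) :=
      (intervalIntegrable_iff_integrableOn_Ioc_of_le zero_le_one).1
        (intervalIntegral.intervalIntegrable_rpow' h3)
    have h4 : ∫ t in Set.Ioc ρ 1, t ^ ((e + βb) / ℓ - 1) ≤ ℓ / (e + βb) := by
      calc _ ≤ ∫ t in Set.Ioc (0 : ℝ) 1, t ^ ((e + βb) / ℓ - 1) := by
            refine setIntegral_mono_set hi ?_ (Set.Ioc_subset_Ioc_left hρ.le).eventuallyLE
            exact (ae_restrict_iff' measurableSet_Ioc).2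
              (Eventually.of_forall fun t ht => Real.rpow_nonneg ht.1.le _)
        _ = _ := by
            rw [← intervalIntegral.integral_of_le zero_le_one, integral_rpow (Or.inl h3),
              Real.zero_rpow (by have := div_pos hpos hℓ; linarith), Real.one_rpow]
            rw [sub_add_cancel, sub_zero, one_div_div]
    have h5 : 1 ≤ ρ ^ (min (e + β) 0 / ℓ) := Real.one_le_rpow_of_pos_of_le_one_of_nonpos hρ hρ1
      (div_nonpos_of_nonpos_of_nonneg (min_le_right _ _) hℓ.le)
    have h6 : 0 ≤ ℓ / (e + βb) * c := by positivity
    nlinarith [mul_le_mul_of_nonneg_left h4 hc, mul_le_mul_of_nonneg_left h5 h6]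
  · have hlt : e + β < 0 := by
      rcases hcase with h | h
      · linarith
      · exact lt_of_le_of_lt (by linarith) (lt_of_le_of_ne hneg h)
    have hC : 0 ≤ ℓ / -(e + β) := div_nonneg hℓ.le (by linarith)
    refine ⟨ℓ / -(e + β), hC, fun ρ c hρ hρ1 hc g hg hb => ?_⟩
    obtain ⟨h1, h2⟩ := integrableOn_of_abs_le_rpow_Ioc_one hρ hρ1 hg hb
    refine ⟨h1, h2.trans ?_⟩
    rw [min_eq_left hlt.le]
    have := integral_rpow_Ioc_one_le hℓ (by linarith : e + β ≤ e + βb) hlt hρ hρ1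
    linarith [mul_le_mul_of_nonneg_left this hc]

theorem setIntegral_Ioc_split {ρ : ℝ} (hρ : 0 < ρ) (hρ1 : ρ ≤ 1) {g : ℝ → ℝ}
    (h : IntegrableOn g (Set.Ioc 0 1)) :
    ∫ t in Set.Ioc 0 1, g t = (∫ t in Set.Ioc 0 ρ, g t) + ∫ t in Set.Ioc ρ 1, g t := by
  rw [← setIntegral_union (Set.Ioc_disjoint_Ioc_of_le le_rfl) measurableSet_Ioc
    (h.mono_set (Set.Ioc_subset_Ioc_right hρ1)) (h.mono_set (Set.Ioc_subset_Ioc_left hρ.le)),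
    Set.Ioc_union_Ioc_eq_Ioc hρ.le hρ1]

theorem abs_add_four_le {a b c d A B C D : ℝ} (ha : |a| ≤ A) (hb : |b| ≤ B) (hc : |c| ≤ C)
    (hd : |d| ≤ D) : |a + b + (c - d)| ≤ A + B + C + D := by
  have h1 := abs_add_le (a + b) (c - d)
  have h2 := abs_add_le a b
  have h3 := abs_sub c d
  linarith

/-- The coefficient of a monomial in the lift, near and away from the hyperplane. -/
theorem exists_size_coeff_bound (hℓ : 0 < ℓ) {β βb γ η ζ κ : ℝ} (S : Finset ℝ) (hβ : β ≤ βb)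
    (hζη : ζ ≤ η) (hSζ : ∀ α ∈ S, ζ ≤ α) (hκ : κ < γ + β)
    (hcase : β < βb ∨ (ζ + βb ≠ κ ∧ ∀ α ∈ S, α + βb ≠ κ)) :
    ∃ C : ℝ, 0 ≤ C ∧ ∀ φ D : ℝ, 0 < φ → φ ≤ 1 → 0 ≤ D → ∀ (a : ℝ → ℝ) (b : ℝ → ℝ → ℝ),
      AEStronglyMeasurable a (volume.restrict (Set.Ioc 0 1)) →
      (∀ α ∈ S, AEStronglyMeasurable (b α) (volume.restrict (Set.Ioc 0 1))) →
      (∀ t, 0 < t → t ≤ 1 → |a t| ≤ D * t ^ ((ζ - κ + βb) / ℓ - 1)) →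
      (∀ α ∈ S, ∀ t, 0 < t → t ≤ 1 →
        |b α t| ≤ D * φ ^ min (η - α) 0 * t ^ ((α - κ + βb) / ℓ - 1)) →
      (∀ t, 0 < t → t ≤ 1 →
        |a t - ∑ α ∈ S, b α t| ≤ D * φ ^ (η - γ) * t ^ ((γ - κ + βb) / ℓ - 1)) →
      |∑ α ∈ S with κ < α + β, (∫ t in Set.Ioc 0 1, b α t) +
        ∫ t in Set.Ioc 0 1, (a t - ∑ α ∈ S, b α t)| ≤ C * D * φ ^ min (ζ + β - κ) 0 := by
  have hexa : β < βb ∨ ζ - κ + βb ≠ 0 := hcase.imp id fun h h' => h.1 (by linarith)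
  have hexb : ∀ α ∈ S, β < βb ∨ α - κ + βb ≠ 0 := fun α hα =>
    hcase.imp id fun h h' => h.2 α hα (by linarith)
  obtain ⟨Ca, hCa, hTa⟩ := exists_integral_Ioc_one_bound hℓ hβ hexa
  have hexb' : ∀ α, ∃ C : ℝ, 0 ≤ C ∧ (α ∈ S → ∀ ρ c : ℝ, 0 < ρ → ρ ≤ 1 → 0 ≤ c → ∀ g : ℝ → ℝ,
      AEStronglyMeasurable g (volume.restrict (Set.Ioc 0 1)) →
      (∀ t, ρ < t → t ≤ 1 → |g t| ≤ c * t ^ ((α - κ + βb) / ℓ - 1)) →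
      IntegrableOn g (Set.Ioc ρ 1) ∧
        |∫ t in Set.Ioc ρ 1, g t| ≤ C * c * ρ ^ (min (α - κ + β) 0 / ℓ)) := fun α => by
    by_cases hα : α ∈ S
    · obtain ⟨C, hC, h⟩ := exists_integral_Ioc_one_bound hℓ hβ (hexb α hα)
      exact ⟨C, hC, fun _ => h⟩
    · exact ⟨0, le_rfl, fun h => absurd h hα⟩
  choose Cb hCb hTb using hexb'
  -- The indices in S₁ are those whose polynomial term occurs in 𝒥. Up to the cut, the remainder a -
  -- ∑ b and the b_α with α ∈ S₁ are integrated separately. Beyond it, the latter cancel against the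
  -- same terms in the remainder, which leaves a and the b_α with α ∈ S₂.
  set S₁ := S.filter fun α => κ < α + β with hS₁
  set S₂ := S.filter fun α => ¬ κ < α + β with hS₂
  have hc1 : 0 ≤ ℓ / (γ - κ + βb) := div_nonneg hℓ.le (by linarith)
  have hc2 : ∀ α ∈ S₁, 0 ≤ ℓ / (α - κ + βb) := fun α hα =>
    div_nonneg hℓ.le (by have := (Finset.mem_filter.1 hα).2; linarith)
  refine ⟨ℓ / (γ - κ + βb) + ∑ α ∈ S₁, ℓ / (α - κ + βb) + Ca + ∑ α ∈ S₂, Cb α, ?_, ?_⟩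
  · have := Finset.sum_nonneg hc2
    have := Finset.sum_nonneg fun α (_ : α ∈ S₂) => hCb α
    linarith
  intro φ D hφ hφ1 hD a b ham hbm ha hb hab
  -- The cut is where the parabolic scale t^{1/ℓ} equals the distance φ to the hyperplane.
  set ρ := φ ^ ℓ with hρdef
  have hρ : 0 < ρ := Real.rpow_pos_of_pos hφ _
  have hρ1 : ρ ≤ 1 := Real.rpow_le_one hφ.le hφ1 hℓ.le
  have hρe : ∀ e : ℝ, ρ ^ (e / ℓ) = φ ^ e := fun e => by
    rw [hρdef, ← Real.rpow_mul hφ.le]; congr 1; field_simp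
  set X := φ ^ min (ζ + β - κ) 0 with hX
  have hX0 : 0 ≤ X := by positivity
  have hmono : ∀ {e : ℝ}, min (ζ + β - κ) 0 ≤ e → φ ^ e ≤ X := fun h =>
    Real.rpow_le_rpow_of_exponent_ge hφ hφ1 h
  have habm : AEStronglyMeasurable (fun t => a t - ∑ α ∈ S, b α t)
      (volume.restrict (Set.Ioc 0 1)) := by
    refine ham.sub ?_
    exact Finset.aestronglyMeasurable_fun_sum S hbm
  have hres : ∀ {g : ℝ → ℝ}, AEStronglyMeasurable g (volume.restrict (Set.Ioc 0 1)) →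
      AEStronglyMeasurable g (volume.restrict (Set.Ioc 0 ρ)) := fun h =>
    h.mono_measure (Measure.restrict_mono (Set.Ioc_subset_Ioc_right hρ1) le_rfl)
  have hmin0 : ∀ α, 0 ≤ D * φ ^ min (η - α) 0 := fun α => by positivity
  -- integrability
  have iab := (integrableOn_of_abs_le_rpow_Ioc_zero hℓ (by linarith : 0 < γ - κ + βb) one_pos
    habm hab).1
  have ib : ∀ α ∈ S₁, IntegrableOn (b α) (Set.Ioc 0 1) := fun α hα => by
    obtain ⟨h1, h2⟩ := Finset.mem_filter.1 hα
    exact (integrableOn_of_abs_le_rpow_Ioc_zero hℓ (by linarith : 0 < α - κ + βb) one_pos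
      (hbm α h1) (hb α h1)).1
  -- small times
  have s1 := (integrableOn_of_abs_le_rpow_Ioc_zero hℓ (by linarith : 0 < γ - κ + βb) hρ
    (hres habm) (fun t h0 h1 => hab t h0 (h1.trans hρ1))).2
  have s1' : |∫ t in Set.Ioc 0 ρ, (a t - ∑ α ∈ S, b α t)| ≤ ℓ / (γ - κ + βb) * (D * X) := by
    refine s1.trans ?_
    rw [hρe]
    have e : ℓ / (γ - κ + βb) * (D * φ ^ (η - γ)) * φ ^ (γ - κ + βb) =
        ℓ / (γ - κ + βb) * (D * φ ^ (η - γ + (γ - κ + βb))) := by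
      rw [Real.rpow_add hφ (η - γ) (γ - κ + βb)]; ring
    rw [e]
    have := hmono (e := η - γ + (γ - κ + βb)) ((min_le_left _ _).trans (by linarith))
    gcongr
  have s2 : ∀ α ∈ S₁, |∫ t in Set.Ioc 0 ρ, b α t| ≤ ℓ / (α - κ + βb) * (D * X) := fun α hα => by
    obtain ⟨h1, h2⟩ := Finset.mem_filter.1 hα
    have hc := hc2 α hα
    have h3 := (integrableOn_of_abs_le_rpow_Ioc_zero hℓ (by linarith : 0 < α - κ + βb) hρ
      (hres (hbm α h1)) (fun t h0 h1' => hb α h1 t h0 (h1'.trans hρ1))).2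
    refine h3.trans ?_
    rw [hρe]
    have e : ℓ / (α - κ + βb) * (D * φ ^ min (η - α) 0) * φ ^ (α - κ + βb) =
        ℓ / (α - κ + βb) * (D * φ ^ (min (η - α) 0 + (α - κ + βb))) := by
      rw [Real.rpow_add hφ (min (η - α) 0) (α - κ + βb)]; ring
    rw [e]
    have hζα := hSζ α h1
    -- Here min(η - α, 0) + α = min(η, α), which is at least ζ.
    have := hmono (e := min (η - α) 0 + (α - κ + βb)) ((min_le_left _ _).trans (by
      rcases min_choice (η - α) 0 with h | h <;> rw [h] <;> linarith))
    gcongr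
  have s2' : |∑ α ∈ S₁, ∫ t in Set.Ioc 0 ρ, b α t| ≤ (∑ α ∈ S₁, ℓ / (α - κ + βb)) * (D * X) := by
    rw [Finset.sum_mul]
    exact (Finset.abs_sum_le_sum_abs _ _).trans (Finset.sum_le_sum s2)
  -- large times
  obtain ⟨ja, l1⟩ := hTa ρ D hρ hρ1 hD a ham (fun t h0 h1 => ha t (hρ.trans h0) h1)
  have l1' : |∫ t in Set.Ioc ρ 1, a t| ≤ Ca * (D * X) := by
    refine l1.trans (le_of_eq ?_)
    rw [hρe, hX, show ζ - κ + β = ζ + β - κ by ring]; ring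
  have jb : ∀ α ∈ S, IntegrableOn (b α) (Set.Ioc ρ 1) := fun α hα =>
    (hTb α hα ρ _ hρ hρ1 (hmin0 α) (b α) (hbm α hα)
      (fun t h0 h1 => hb α hα t (hρ.trans h0) h1)).1
  have l2 : ∀ α ∈ S₂, |∫ t in Set.Ioc ρ 1, b α t| ≤ Cb α * (D * X) := fun α hα => by
    obtain ⟨h1, h2⟩ := Finset.mem_filter.1 hα
    have h3 := (hTb α h1 ρ _ hρ hρ1 (hmin0 α) (b α) (hbm α h1)
      (fun t h0 h1' => hb α h1 t (hρ.trans h0) h1')).2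
    refine h3.trans ?_
    rw [hρe, min_eq_left (by linarith : α - κ + β ≤ 0)]
    have e : Cb α * (D * φ ^ min (η - α) 0) * φ ^ (α - κ + β) =
        Cb α * (D * φ ^ (min (η - α) 0 + (α - κ + β))) := by
      rw [Real.rpow_add hφ (min (η - α) 0) (α - κ + β)]; ring
    rw [e]
    have hζα := hSζ α h1
    have := hmono (e := min (η - α) 0 + (α - κ + β)) ((min_le_left _ _).trans (by
      rcases min_choice (η - α) 0 with h | h <;> rw [h] <;> linarith))
    have := hCb α
    gcongr
  have l2' : |∑ α ∈ S₂, ∫ t in Set.Ioc ρ 1, b α t| ≤ (∑ α ∈ S₂, Cb α) * (D * X) := by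
    rw [Finset.sum_mul]
    exact (Finset.abs_sum_le_sum_abs _ _).trans (Finset.sum_le_sum l2)
  -- decomposition
  have dec : ∑ α ∈ S₁, (∫ t in Set.Ioc 0 1, b α t) + ∫ t in Set.Ioc 0 1, (a t - ∑ α ∈ S, b α t) =
      (∫ t in Set.Ioc 0 ρ, (a t - ∑ α ∈ S, b α t)) + (∑ α ∈ S₁, ∫ t in Set.Ioc 0 ρ, b α t) +
      ((∫ t in Set.Ioc ρ 1, a t) - ∑ α ∈ S₂, ∫ t in Set.Ioc ρ 1, b α t) := by
    rw [setIntegral_Ioc_split hρ hρ1 iab, Finset.sum_congr rfl fun α hα =>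
      setIntegral_Ioc_split hρ hρ1 (ib α hα), Finset.sum_add_distrib]
    have e1 : ∫ t in Set.Ioc ρ 1, (a t - ∑ α ∈ S, b α t) =
        (∫ t in Set.Ioc ρ 1, a t) - ∑ α ∈ S, ∫ t in Set.Ioc ρ 1, b α t := by
      rw [integral_sub ja (integrable_finsetSum S jb), integral_finsetSum S jb]
    have e2 : ∑ α ∈ S, (∫ t in Set.Ioc ρ 1, b α t) =
        ∑ α ∈ S₁, (∫ t in Set.Ioc ρ 1, b α t) + ∑ α ∈ S₂, ∫ t in Set.Ioc ρ 1, b α t :=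
      (Finset.sum_filter_add_sum_filter_not S _ _).symm
    rw [e1, e2]; ring
  rw [dec]
  refine (abs_add_four_le s1' s2' l1' l2').trans (le_of_eq ?_)
  ring

end TimeIntegrals

theorem abs_add_six_le {a b c d e f A B C D E F : ℝ} (ha : |a| ≤ A) (hb : |b| ≤ B)
    (hc : |c| ≤ C) (hd : |d| ≤ D) (he : |e| ≤ E) (hf : |f| ≤ F) :
    |a + b - c + (d - e + f)| ≤ A + B + C + (D + E + F) := by
  rw [abs_le] at *
  constructor <;> linarith [ha.1, ha.2, hb.1, hb.2, hc.1, hc.2, hd.1, hd.2, he.1, he.2, hf.1, hf.2]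

/-- The coefficient of a monomial in the increment of the lift: times below `2 r ^ ℓ` are treated
termwise, and the Taylor remainder is used for the larger ones. -/
theorem exists_sharp_coeff_bound {ℓ : ℝ} (hℓ : 0 < ℓ) {β βb γ δ κ : ℝ} (S : Finset ℝ)
    {ι : Type*} (L : Finset ι) (dg : ι → ℝ) (hβ : β ≤ βb) (hδ : γ + βb < δ) (hκ : κ < γ + β)
    (hcase : β < βb ∨ ((∀ α ∈ S, α + βb ≠ κ) ∧ ∀ l ∈ L, γ + βb ≠ κ + dg l)) :
    ∃ C : ℝ, 0 ≤ C ∧ ∀ r D : ℝ, 0 < r → 0 ≤ D →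
      ∀ (c : ℝ → ℝ → ℝ) (n : ℝ → ℝ) (m : ι → ℝ → ℝ) (h : ι → ℝ),
      (∀ α ∈ S, AEStronglyMeasurable (c α) (volume.restrict (Set.Ioc 0 1))) →
      AEStronglyMeasurable n (volume.restrict (Set.Ioc 0 1)) →
      (∀ l ∈ L, AEStronglyMeasurable (m l) (volume.restrict (Set.Ioc 0 1))) →
      (∀ l ∈ L, |h l| ≤ r ^ dg l) →
      (∀ α ∈ S, ∀ t, 0 < t → t ≤ 1 →
        |c α t| ≤ D * r ^ (γ - α) * t ^ ((α - κ + βb) / ℓ - 1)) →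
      (∀ t, 0 < t → t ≤ 1 → |n t| ≤ D * t ^ ((γ - κ + βb) / ℓ - 1)) →
      (∀ l ∈ L, ∀ t, 0 < t → t ≤ 1 → |m l t| ≤ D * t ^ ((γ - κ - dg l + βb) / ℓ - 1)) →
      (∀ t, 0 < t → 2 * r ^ ℓ ≤ t → t ≤ 1 → |n t + ∑ α ∈ S, c α t - ∑ l ∈ L, h l * m l t| ≤
        D * r ^ (δ - κ) * t ^ ((γ - δ + βb) / ℓ - 1)) →
      |(∑ α ∈ S with κ < α + β, ∫ t in Set.Ioc 0 1, c α t) + (∫ t in Set.Ioc 0 1, n t) -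
        ∑ l ∈ L with κ + dg l < γ + β, h l * ∫ t in Set.Ioc 0 1, m l t| ≤
        C * D * r ^ (γ + β - κ) := by
  -- Constants are fixed for every real exponent at once; the condition that excludes a logarithm is
  -- checked where an exponent is used.
  have hall : ∀ e : ℝ, ∃ C : ℝ, 0 ≤ C ∧ ((β < βb ∨ e + βb ≠ 0) →
      ∀ ρ c : ℝ, 0 < ρ → ρ ≤ 1 → 0 ≤ c → ∀ g : ℝ → ℝ,
      AEStronglyMeasurable g (volume.restrict (Set.Ioc 0 1)) →
      (∀ t, ρ < t → t ≤ 1 → |g t| ≤ c * t ^ ((e + βb) / ℓ - 1)) →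
      IntegrableOn g (Set.Ioc ρ 1) ∧
        |∫ t in Set.Ioc ρ 1, g t| ≤ C * c * ρ ^ (min (e + β) 0 / ℓ)) := fun e => by
    by_cases he : β < βb ∨ e + βb ≠ 0
    · obtain ⟨C, hC, h⟩ := exists_integral_Ioc_one_bound hℓ hβ he
      exact ⟨C, hC, fun _ => h⟩
    · exact ⟨0, le_rfl, fun h => absurd h he⟩
  choose T hT0 hT using hall
  -- The factor of (2 r^ℓ)^{(e+β)/ℓ} in front of r^{e+β}.
  set q : ℝ → ℝ := fun e => 2 ^ ((e + β) / ℓ) with hq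
  have hq0 : ∀ e, 0 ≤ q e := fun e => by positivity
  have ha0 : ∀ {e}, 0 < e + β → 0 ≤ ℓ / (e + βb) := fun h => div_nonneg hℓ.le (by linarith)
  -- S₁ and L₁ index the terms that occur in the lift; S₂ and L₂ index those that complete the
  -- Taylor expansion up to order δ. The terms in S₁ and L₁ are integrable near t = 0. Those in S₂
  -- and L₂ are needed only beyond the cut, where their exponents are nonpositive after replacing βb
  -- by β.
  set S₁ := S.filter fun α => κ < α + β with hS₁
  set S₂ := S.filter fun α => ¬ κ < α + β with hS₂
  set L₁ := L.filter fun l => κ + dg l < γ + β with hL₁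
  set L₂ := L.filter fun l => ¬ κ + dg l < γ + β with hL₂
  have hS₁m : ∀ α ∈ S₁, α ∈ S ∧ 0 < α - κ + β := fun α h =>
    ⟨(Finset.mem_filter.1 h).1, by have := (Finset.mem_filter.1 h).2; linarith⟩
  have hS₂m : ∀ α ∈ S₂, α ∈ S ∧ α - κ + β ≤ 0 := fun α h =>
    ⟨(Finset.mem_filter.1 h).1, by have := (Finset.mem_filter.1 h).2; linarith⟩
  have hL₁m : ∀ l ∈ L₁, l ∈ L ∧ 0 < γ - κ - dg l + β := fun α h =>
    ⟨(Finset.mem_filter.1 h).1, by have := (Finset.mem_filter.1 h).2; linarith⟩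
  have hL₂m : ∀ l ∈ L₂, l ∈ L ∧ γ - κ - dg l + β ≤ 0 := fun α h =>
    ⟨(Finset.mem_filter.1 h).1, by have := (Finset.mem_filter.1 h).2; linarith⟩
  set CS := ∑ α ∈ S₁, ℓ / (α - κ + βb) * q (α - κ) with hCS
  set Cn := ℓ / (γ - κ + βb) * q (γ - κ) with hCn
  set CL := ∑ l ∈ L₁, ℓ / (γ - κ - dg l + βb) * q (γ - κ - dg l) with hCL
  set CB := T (γ - δ) * q (γ - δ) with hCB
  set CS' := ∑ α ∈ S₂, T (α - κ) * q (α - κ) with hCS'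
  set CL' := ∑ l ∈ L₂, T (γ - κ - dg l) * q (γ - κ - dg l) with hCL'
  have nCS : 0 ≤ CS := Finset.sum_nonneg fun α hα => mul_nonneg (ha0 (hS₁m α hα).2) (hq0 _)
  have nCn : 0 ≤ Cn := mul_nonneg (ha0 (by linarith)) (hq0 _)
  have nCL : 0 ≤ CL := Finset.sum_nonneg fun α hα => mul_nonneg (ha0 (hL₁m α hα).2) (hq0 _)
  have nCB : 0 ≤ CB := mul_nonneg (hT0 _) (hq0 _)
  have nCS' : 0 ≤ CS' := Finset.sum_nonneg fun α hα => mul_nonneg (hT0 _) (hq0 _)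
  have nCL' : 0 ≤ CL' := Finset.sum_nonneg fun α hα => mul_nonneg (hT0 _) (hq0 _)
  refine ⟨CS + Cn + CL + (CB + CS' + CL'), by positivity, ?_⟩
  intro r D hr hD c n m h hcm hnm hmm hh hc hn hm hB
  set X := r ^ (γ + β - κ) with hX
  have hX0 : 0 ≤ X := by positivity
  have hrX : ∀ e e' : ℝ, e + e' = γ + β - κ → r ^ e * r ^ e' = X := fun e e' he => by
    rw [← Real.rpow_add hr, he]
  -- In the application the kernel is taken at time t/2, and its Taylor estimate requires r ≤
  -- (t/2)^{1/ℓ}, that is, t ≥ 2 r^ℓ.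
  set ρ := min (2 * r ^ ℓ) 1 with hρdef
  have hr2 : 0 < 2 * r ^ ℓ := by positivity
  have hρ : 0 < ρ := lt_min hr2 one_pos
  have hρ1 : ρ ≤ 1 := min_le_right _ _
  have h2r : ∀ e : ℝ, (2 * r ^ ℓ) ^ ((e + β) / ℓ) = q e * r ^ (e + β) := fun e => by
    rw [Real.mul_rpow (by norm_num) (by positivity), ← Real.rpow_mul hr.le]
    congr 2; field_simp
  have hsm : ∀ e, 0 < e + β → ρ ^ ((e + βb) / ℓ) ≤ q e * r ^ (e + β) := fun e he => by
    rw [← h2r]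
    refine (Real.rpow_le_rpow_of_exponent_ge hρ hρ1
      (div_le_div_of_nonneg_right (by linarith : e + β ≤ e + βb) hℓ.le)).trans ?_
    exact Real.rpow_le_rpow hρ.le (min_le_left _ _) (div_nonneg he.le hℓ.le)
  have hres : ∀ {g : ℝ → ℝ}, AEStronglyMeasurable g (volume.restrict (Set.Ioc 0 1)) →
      AEStronglyMeasurable g (volume.restrict (Set.Ioc 0 ρ)) := fun h =>
    h.mono_measure (Measure.restrict_mono (Set.Ioc_subset_Ioc_right hρ1) le_rfl)
  -- a bound for small times and integrability
  have small : ∀ (e A : ℝ) (g : ℝ → ℝ), 0 < e + β → 0 ≤ A →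
      AEStronglyMeasurable g (volume.restrict (Set.Ioc 0 1)) →
      (∀ t, 0 < t → t ≤ 1 → |g t| ≤ A * t ^ ((e + βb) / ℓ - 1)) →
      IntegrableOn g (Set.Ioc 0 1) ∧
        |∫ t in Set.Ioc 0 ρ, g t| ≤ ℓ / (e + βb) * q e * (A * r ^ (e + β)) := by
    intro e A g he hA hg hb
    have he' : 0 < e + βb := by linarith
    refine ⟨(integrableOn_of_abs_le_rpow_Ioc_zero hℓ he' one_pos hg hb).1, ?_⟩
    refine (integrableOn_of_abs_le_rpow_Ioc_zero hℓ he' hρ (hres hg)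
      (fun t h0 h1 => hb t h0 (h1.trans hρ1))).2.trans ?_
    calc _ ≤ ℓ / (e + βb) * A * (q e * r ^ (e + β)) :=
          mul_le_mul_of_nonneg_left (hsm e he) (mul_nonneg (ha0 he) hA)
      _ = _ := by ring
  have large : ∀ (e A : ℝ) (g : ℝ → ℝ), e + β ≤ 0 → (β < βb ∨ e + βb ≠ 0) → 0 ≤ A →
      AEStronglyMeasurable g (volume.restrict (Set.Ioc 0 1)) →
      (∀ t, ρ < t → t ≤ 1 → |g t| ≤ A * t ^ ((e + βb) / ℓ - 1)) →
      IntegrableOn g (Set.Ioc ρ 1) ∧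
        |∫ t in Set.Ioc ρ 1, g t| ≤ T e * q e * (A * r ^ (e + β)) := by
    intro e A g he hex hA hg hb
    obtain ⟨h1, h2⟩ := hT e hex ρ A hρ hρ1 hA g hg hb
    refine ⟨h1, ?_⟩
    have hn0 : 0 ≤ T e * q e * (A * r ^ (e + β)) :=
      mul_nonneg (mul_nonneg (hT0 _) (hq0 _)) (by positivity)
    -- For 2 r^ℓ ≥ 1 there are no large times and the integral vanishes.
    rcases le_total 1 (2 * r ^ ℓ) with hr1 | hr1
    · have : ρ = 1 := min_eq_right hr1
      rw [this]
      simpa using hn0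
    · refine h2.trans (le_of_eq ?_)
      rw [min_eq_left he, hρdef, min_eq_left hr1, h2r]
      ring
  have hDr : ∀ e : ℝ, 0 ≤ D * r ^ e := fun e => by positivity
  have smS : ∀ α ∈ S₁, IntegrableOn (c α) (Set.Ioc 0 1) ∧
      |∫ t in Set.Ioc 0 ρ, c α t| ≤ ℓ / (α - κ + βb) * q (α - κ) * (D * X) := fun α hα => by
    obtain ⟨h1, h2⟩ := hS₁m α hα
    have := small (α - κ) (D * r ^ (γ - α)) (c α) h2 (hDr _) (hcm α h1) (hc α h1)
    rwa [mul_assoc D, hrX (γ - α) (α - κ + β) (by ring)] at this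
  have smn : IntegrableOn n (Set.Ioc 0 1) ∧ |∫ t in Set.Ioc 0 ρ, n t| ≤ Cn * (D * X) := by
    have := small (γ - κ) D n (by linarith) hD hnm hn
    rwa [show γ - κ + β = γ + β - κ by ring] at this
  have hml : ∀ l ∈ L, AEStronglyMeasurable (fun t => h l * m l t)
      (volume.restrict (Set.Ioc 0 1)) := fun l hl => (hmm l hl).const_mul _
  have hmb : ∀ l ∈ L, ∀ t, 0 < t → t ≤ 1 →
      |h l * m l t| ≤ D * r ^ dg l * t ^ ((γ - κ - dg l + βb) / ℓ - 1) := fun l hl t h0 h1 => by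
    rw [abs_mul]
    calc _ ≤ r ^ dg l * (D * t ^ ((γ - κ - dg l + βb) / ℓ - 1)) :=
          mul_le_mul (hh l hl) (hm l hl t h0 h1) (abs_nonneg _) (by positivity)
      _ = _ := by ring
  have smL : ∀ l ∈ L₁, IntegrableOn (fun t => h l * m l t) (Set.Ioc 0 1) ∧
      |∫ t in Set.Ioc 0 ρ, h l * m l t| ≤
        ℓ / (γ - κ - dg l + βb) * q (γ - κ - dg l) * (D * X) := fun l hl => by
    obtain ⟨h1, h2⟩ := hL₁m l hl
    have := small (γ - κ - dg l) (D * r ^ dg l) _ h2 (hDr _) (hml l h1) (hmb l h1)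
    rwa [mul_assoc D, hrX (dg l) (γ - κ - dg l + β) (by ring)] at this
  have laS : ∀ α ∈ S₂, IntegrableOn (c α) (Set.Ioc ρ 1) ∧
      |∫ t in Set.Ioc ρ 1, c α t| ≤ T (α - κ) * q (α - κ) * (D * X) := fun α hα => by
    obtain ⟨h1, h2⟩ := hS₂m α hα
    have := large (α - κ) (D * r ^ (γ - α)) (c α) h2
      (hcase.imp id fun h h' => h.1 α h1 (by linarith)) (hDr _) (hcm α h1)
      (fun t h0 h1' => hc α h1 t (hρ.trans h0) h1')
    rwa [mul_assoc D, hrX (γ - α) (α - κ + β) (by ring)] at this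
  have laL : ∀ l ∈ L₂, IntegrableOn (fun t => h l * m l t) (Set.Ioc ρ 1) ∧
      |∫ t in Set.Ioc ρ 1, h l * m l t| ≤
        T (γ - κ - dg l) * q (γ - κ - dg l) * (D * X) := fun l hl => by
    obtain ⟨h1, h2⟩ := hL₂m l hl
    have := large (γ - κ - dg l) (D * r ^ dg l) _ h2
      (hcase.imp id fun h h' => h.2 l h1 (by linarith)) (hDr _) (hml l h1)
      (fun t h0 h1' => hmb l h1 t (hρ.trans h0) h1')
    rwa [mul_assoc D, hrX (dg l) (γ - κ - dg l + β) (by ring)] at this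
  have laB : |∫ t in Set.Ioc ρ 1, (n t + ∑ α ∈ S, c α t - ∑ l ∈ L, h l * m l t)| ≤
      CB * (D * X) := by
    have hmeas : AEStronglyMeasurable
        (fun t => n t + ∑ α ∈ S, c α t - ∑ l ∈ L, h l * m l t)
        (volume.restrict (Set.Ioc 0 1)) :=
      (hnm.add (Finset.aestronglyMeasurable_fun_sum S hcm)).sub
        (Finset.aestronglyMeasurable_fun_sum L hml)
    -- The exponent γ - δ + βb is negative because γ + βb < δ, so the Taylor remainder never meets a
    -- logarithm.
    have := (large (γ - δ) (D * r ^ (δ - κ)) _ (by linarith) (Or.inr (by linarith)) (hDr _)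
      hmeas (fun t h0 h1 => hB t (hρ.trans h0) ?_ h1)).2
    · rwa [mul_assoc D, hrX (δ - κ) (γ - δ + β) (by ring)] at this
    · rcases min_choice (2 * r ^ ℓ) 1 with h' | h' <;> rw [hρdef, h'] at h0
      · exact h0.le
      · linarith
  have sS : |∑ α ∈ S₁, ∫ t in Set.Ioc 0 ρ, c α t| ≤ CS * (D * X) := by
    rw [hCS, Finset.sum_mul]
    exact (Finset.abs_sum_le_sum_abs _ _).trans (Finset.sum_le_sum fun α hα => (smS α hα).2)
  have sL : |∑ l ∈ L₁, ∫ t in Set.Ioc 0 ρ, h l * m l t| ≤ CL * (D * X) := by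
    rw [hCL, Finset.sum_mul]
    exact (Finset.abs_sum_le_sum_abs _ _).trans (Finset.sum_le_sum fun α hα => (smL α hα).2)
  have sS' : |∑ α ∈ S₂, ∫ t in Set.Ioc ρ 1, c α t| ≤ CS' * (D * X) := by
    rw [hCS', Finset.sum_mul]
    exact (Finset.abs_sum_le_sum_abs _ _).trans (Finset.sum_le_sum fun α hα => (laS α hα).2)
  have sL' : |∑ l ∈ L₂, ∫ t in Set.Ioc ρ 1, h l * m l t| ≤ CL' * (D * X) := by
    rw [hCL', Finset.sum_mul]
    exact (Finset.abs_sum_le_sum_abs _ _).trans (Finset.sum_le_sum fun α hα => (laL α hα).2)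
  -- decomposition
  have hle : Set.Ioc ρ 1 ⊆ Set.Ioc (0 : ℝ) 1 := Set.Ioc_subset_Ioc_left hρ.le
  have jS : ∀ α ∈ S, IntegrableOn (c α) (Set.Ioc ρ 1) := fun α hα => by
    by_cases h1 : κ < α + β
    · exact ((smS α (Finset.mem_filter.2 ⟨hα, h1⟩)).1).mono_set hle
    · exact (laS α (Finset.mem_filter.2 ⟨hα, h1⟩)).1
  have jL : ∀ l ∈ L, IntegrableOn (fun t => h l * m l t) (Set.Ioc ρ 1) := fun l hl => by
    by_cases h1 : κ + dg l < γ + β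
    · exact ((smL l (Finset.mem_filter.2 ⟨hl, h1⟩)).1).mono_set hle
    · exact (laL l (Finset.mem_filter.2 ⟨hl, h1⟩)).1
  have jn : IntegrableOn n (Set.Ioc ρ 1) := smn.1.mono_set hle
  have eB : ∫ t in Set.Ioc ρ 1, (n t + ∑ α ∈ S, c α t - ∑ l ∈ L, h l * m l t) =
      (∫ t in Set.Ioc ρ 1, n t) + (∑ α ∈ S₁, (∫ t in Set.Ioc ρ 1, c α t) +
        ∑ α ∈ S₂, ∫ t in Set.Ioc ρ 1, c α t) -
        (∑ l ∈ L₁, (∫ t in Set.Ioc ρ 1, h l * m l t) +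
        ∑ l ∈ L₂, ∫ t in Set.Ioc ρ 1, h l * m l t) := by
    have jn' : IntegrableOn (fun t => n t + ∑ α ∈ S, c α t) (Set.Ioc ρ 1) :=
      jn.add (integrable_finsetSum S jS)
    rw [integral_sub jn' (integrable_finsetSum L jL),
      integral_add jn (integrable_finsetSum S jS), integral_finsetSum S jS,
      integral_finsetSum L jL, Finset.sum_filter_add_sum_filter_not,
      Finset.sum_filter_add_sum_filter_not]
  have dec : (∑ α ∈ S₁, ∫ t in Set.Ioc 0 1, c α t) + (∫ t in Set.Ioc 0 1, n t) -
        ∑ l ∈ L₁, h l * ∫ t in Set.Ioc 0 1, m l t =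
      (∑ α ∈ S₁, ∫ t in Set.Ioc 0 ρ, c α t) + (∫ t in Set.Ioc 0 ρ, n t) -
        (∑ l ∈ L₁, ∫ t in Set.Ioc 0 ρ, h l * m l t) +
      ((∫ t in Set.Ioc ρ 1, (n t + ∑ α ∈ S, c α t - ∑ l ∈ L, h l * m l t)) -
        (∑ α ∈ S₂, ∫ t in Set.Ioc ρ 1, c α t) +
        ∑ l ∈ L₂, ∫ t in Set.Ioc ρ 1, h l * m l t) := by
    have e3 : ∑ l ∈ L₁, h l * ∫ t in Set.Ioc 0 1, m l t =
        ∑ l ∈ L₁, ∫ t in Set.Ioc 0 1, h l * m l t :=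
      Finset.sum_congr rfl fun l _ => (integral_const_mul _ _).symm
    rw [e3, setIntegral_Ioc_split hρ hρ1 smn.1,
      Finset.sum_congr rfl fun α hα => setIntegral_Ioc_split hρ hρ1 (smS α hα).1,
      Finset.sum_congr rfl fun l hl => setIntegral_Ioc_split hρ hρ1 (smL l hl).1,
      Finset.sum_add_distrib, Finset.sum_add_distrib, eB]
    ring
  rw [dec]
  refine (abs_add_six_le sS smn.2 sL laB sS' sL').trans (le_of_eq ?_)
  ring

/-! ### Testing with singularities at the base point and at the hyperplane. -/

section SplitTest

variable [NeZero d] {σ : Scaling d} {G W : Pt d → ℝ}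

theorem ae_apply_zero_ne_zero : ∀ᵐ z : Pt d, z 0 ≠ 0 := by
  have := (Measure.pi_hyperplane (fun _ : Fin d => (volume : Measure ℝ)) 0 (0 : ℝ))
  rw [← volume_pi] at this
  exact measure_eq_zero_iff_ae_notMem.1 this

theorem Scaling.measurable_phi (σ : Scaling d) : Measurable σ.phi := by
  unfold Scaling.phi
  exact (((measurable_pi_apply 0).abs).pow_const _).min measurable_const

/-- Testing a function which is singular both at the hyperplane and in the base point. -/
theorem Scaling.Decays.exists_split_test (hW : σ.Decays G W) (hG0 : ∀ x, 0 ≤ G x)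
    (hW0 : ∀ x, 0 ≤ W x) (N : ℕ) {a : ℝ} (ha0 : 0 ≤ a) (ha : a < σ.s 0) :
    ∃ C : ℝ, 0 ≤ C ∧ ∀ t, 0 < t → t ≤ 1 → ∀ (x : Pt d) (f : Pt d → ℝ) (p : ℝ), 0 ≤ p →
      AEStronglyMeasurable f → x 0 ≠ 0 →
      (∀ᵐ z, |f z| ≤ p * (σ.scaled G t (x - z) * W (x - z) * σ.rho t (x - z) ^ N *
        (σ.phi x ^ (-a) + σ.phi z ^ (-a)))) →
      Integrable f ∧ |∫ z, f z| ≤ C * p * σ.phi x ^ (-a) := by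
  obtain ⟨C₁, hC₁, h₁⟩ := hW.exists_test hG0 hW0 N le_rfl (σ.s_pos 0)
  obtain ⟨C₂, hC₂, h₂⟩ := hW.exists_test hG0 hW0 N ha0 ha
  refine ⟨2 * C₁ + 2 * C₂, by positivity, fun t ht ht1 x f p hp hf hx hle => ?_⟩
  have hpx := σ.phi_pos hx
  -- On A the weight is at most 2φ(x)^{-a} and the test without singularity applies. On the
  -- complement it is at most 2φ(z)^{-a}, and the singular test returns φ(x)^{-a}, which needs a <
  -- 𝔰_1.
  set A := {z : Pt d | σ.phi x ≤ σ.phi z} with hA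
  have hAm : MeasurableSet A := measurableSet_le measurable_const σ.measurable_phi
  have hb0 : ∀ z, 0 ≤ σ.scaled G t (x - z) * W (x - z) * σ.rho t (x - z) ^ N := fun z =>
    mul_nonneg (mul_nonneg (σ.scaled_nonneg hG0 ht _) (hW0 _))
      (pow_nonneg (zero_le_one.trans (σ.one_le_rho ht _)) _)
  have hφ0 : 0 ≤ σ.phi x ^ (-a) := by positivity
  obtain ⟨i₁, -, b₁⟩ := h₁ t ht ht1 x (A.indicator f) (p * (2 * σ.phi x ^ (-a))) (by positivity)
    (hf.indicator hAm) (by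
      filter_upwards [hle] with z hz
      by_cases hzA : z ∈ A
      · rw [Set.indicator_of_mem hzA]
        have h : σ.phi z ^ (-a) ≤ σ.phi x ^ (-a) :=
          Real.rpow_le_rpow_of_nonpos hpx hzA (by linarith)
        rw [neg_zero, Real.rpow_zero, mul_one]
        refine hz.trans ?_
        nlinarith [mul_le_mul_of_nonneg_left h (mul_nonneg hp (hb0 z))]
      · rw [Set.indicator_of_notMem hzA, abs_zero, neg_zero, Real.rpow_zero, mul_one]
        exact mul_nonneg (by positivity) (hb0 z))
  have b₁' := b₁ hx
  obtain ⟨i₂, -, b₂⟩ := h₂ t ht ht1 x (Aᶜ.indicator f) (p * 2) (by positivity)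
    (hf.indicator hAm.compl) (by
      have hφz : ∀ z, 0 ≤ σ.phi z ^ (-a) := fun z => Real.rpow_nonneg (σ.phi_nonneg z) _
      have hnull : ∀ᵐ z : Pt d, z 0 ≠ 0 := ae_apply_zero_ne_zero
      filter_upwards [hle, hnull] with z hz hz0
      by_cases hzA : z ∈ A
      · rw [Set.indicator_of_notMem (by simpa using hzA), abs_zero]
        exact mul_nonneg (by positivity) (mul_nonneg (hb0 z) (hφz z))
      · rw [Set.indicator_of_mem (by simpa using hzA)]
        have h : σ.phi x ^ (-a) ≤ σ.phi z ^ (-a) :=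
          Real.rpow_le_rpow_of_nonpos (σ.phi_pos hz0) (not_le.1 hzA).le (by linarith)
        refine hz.trans ?_
        nlinarith [mul_le_mul_of_nonneg_left h (mul_nonneg hp (hb0 z))])
  have b₂' := b₂ hx
  have hsum : ∀ z, f z = A.indicator f z + Aᶜ.indicator f z := fun z =>
    (congrFun (Set.indicator_self_add_compl A f) z).symm
  have hfe : f = fun z => A.indicator f z + Aᶜ.indicator f z := funext hsum
  constructor
  · rw [hfe]; exact i₁.add i₂
  · rw [integral_congr_ae (Eventually.of_forall hsum), integral_add i₁ i₂]
    refine (abs_add_le _ _).trans ?_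
    rw [neg_zero, Real.rpow_zero, mul_one] at b₁'
    linarith

theorem half_rpow_le {t : ℝ} (ht : 0 < t) (e : ℝ) : (t / 2) ^ e ≤ 2 ^ |e| * t ^ e := by
  rw [Real.div_rpow ht.le (by norm_num), div_eq_mul_inv, mul_comm, ← Real.rpow_neg (by norm_num)]
  have := Real.rpow_le_rpow_of_exponent_le (by norm_num : (1 : ℝ) ≤ 2) (neg_le_abs e)
  gcongr

/-- Collects the power of t from the kernel and the one from the tested family; working at t/2 costs
only a constant. -/
theorem half_rpow_mul_le {ℓ t κ α βb : ℝ} (ht : 0 < t) :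
    (t / 2) ^ ((βb - κ) / ℓ - 1) * (t / 2) ^ (α / ℓ) ≤
      2 ^ |(α - κ + βb) / ℓ - 1| * t ^ ((α - κ + βb) / ℓ - 1) := by
  rw [← Real.rpow_add (by linarith)]
  have : (βb - κ) / ℓ - 1 + α / ℓ = (α - κ + βb) / ℓ - 1 := by ring
  rw [this]
  exact half_rpow_le ht _

end SplitTest

/-! ### Products of weights. -/

section WeightFacts

variable {σ : Scaling d} {G : Pt d → ℝ} {w v : Weight d}

/-- Since w^* ≥ 1, the function w^*v^* is at most (w^*)²v^*, so G absorbs it whenever it absorbs the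
latter. -/
theorem Weight.IsControlled.mul_of_mul_mul (hw : w.IsControlled σ G) (hv : v.IsControlled σ G)
    (hwwv : (w * w * v).IsControlled σ G) (hG0 : ∀ x, 0 ≤ G x) : (w * v).IsControlled σ G where
  cont := hw.cont.mul hv.cont
  pos x := mul_pos (hw.pos x) (hv.pos x)
  le_one x := mul_le_one₀ (hw.le_one x) (hv.pos x).le (hv.le_one x)
  star_cont := hw.star_cont.mul hv.star_cont
  one_le_star x := one_le_mul_of_one_le_of_one_le (hw.one_le_star x) (hv.one_le_star x)
  moderate x y := by
    have h1 := hw.moderate x y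
    have h2 := hv.moderate x y
    have h3 := mul_le_mul h1 h2 (hv.pos _).le (mul_nonneg (hw.star_nonneg x) (hw.pos y).le)
    calc w.w (x + y) * v.w (x + y) ≤ _ := h3
      _ = w.star x * v.star x * (w.w y * v.w y) := by ring
  integrable n T hT := by
    obtain ⟨C, hC⟩ := hwwv.integrable n T hT
    refine ⟨C, fun t ht htT x => le_trans ?_ (hC t ht htT x)⟩
    have h1 := hw.one_le_star (σ.dil t x)
    have h2 : 0 ≤ w.star (σ.dil t x) * v.star (σ.dil t x) :=
      mul_nonneg (hw.star_nonneg _) (hv.star_nonneg _)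
    have h3 : (w * v).star (σ.dil t x) ≤ (w * w * v).star (σ.dil t x) := by
      change w.star (σ.dil t x) * v.star (σ.dil t x) ≤
        w.star (σ.dil t x) * w.star (σ.dil t x) * v.star (σ.dil t x)
      nlinarith
    have := hG0 x
    have := σ.nrm_nonneg x
    gcongr

theorem inv_mul_le_inv_mul_mul (hw : w.IsControlled σ G) (hv : v.IsControlled σ G) (x : Pt d) :
    ((w * v).w x)⁻¹ ≤ ((w * w * v).w x)⁻¹ := by
  have h1 := hw.pos x
  have h2 := hv.pos x
  have h3 := hw.le_one x
  change (w.w x * v.w x)⁻¹ ≤ (w.w x * w.w x * v.w x)⁻¹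
  refine inv_anti₀ (by positivity) ?_
  have := mul_le_mul_of_nonneg_right h3 h1.le
  have := mul_le_mul_of_nonneg_right this h2.le
  linarith

end WeightFacts

/-! ### Pairings with the data of a lift. -/

section Lift

variable [NeZero d] {σ : Scaling d} {G : Pt d → ℝ} {w v : Weight d}

/-- The data that enter the lift of a kernel: the reconstruction `lam`, the pieces `size x α` of
the local expansion at `x`, and the pieces `inc y x α` of the increments of the expansions. -/
structure LiftData (σ : Scaling d) (w v : Weight d) (S : Finset ℝ) (N : ℕ) (γ η ζ L P₁ P₂ E : ℝ)
    (lam : ℝ → Pt d → ℝ) (size : Pt d → ℝ → ℝ → Pt d → ℝ)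
    (inc : Pt d → Pt d → ℝ → ℝ → Pt d → ℝ) : Prop where
  lam_meas : ∀ s, 0 < s → s ≤ 1 → Measurable (lam s)
  size_meas : ∀ x, x 0 ≠ 0 → ∀ α ∈ S, ∀ s, 0 < s → s ≤ 1 → Measurable (size x α s)
  inc_meas : ∀ x, x 0 ≠ 0 → ∀ y, y 0 ≠ 0 → ∀ α ∈ S, ∀ s, 0 < s → s ≤ 1 →
    Measurable (inc y x α s)
  lam_le : ∀ s, 0 < s → s ≤ 1 → ∀ z, |lam s z| ≤ L * s ^ (ζ / σ.ell) * ((w * v).w z)⁻¹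
  size_le : ∀ x, x 0 ≠ 0 → ∀ α ∈ S, ∀ s, 0 < s → s ≤ 1 → ∀ z,
    |size x α s z| ≤ P₁ * (σ.phi x ^ min (η - α) 0 * (v.w x)⁻¹) * s ^ (α / σ.ell) *
      w.env σ N s z x
  inc_le : ∀ x, x 0 ≠ 0 → ∀ y, y 0 ≠ 0 → ∀ α ∈ S, ∀ s, 0 < s → s ≤ 1 → ∀ z,
    |inc y x α s z| ≤ P₂ * (σ.phi₂ x y ^ (η - γ) * ((v.w x)⁻¹ * v.star (x - y)) *
      σ.nrm (y - x) ^ (γ - α)) * s ^ (α / σ.ell) * w.env σ N s z y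
  rem_le : ∀ x, x 0 ≠ 0 → ∀ z, z 0 ≠ 0 → ∀ s, 0 < s → s ≤ 1 →
    |lam s z - ∑ α ∈ S, size x α s z| ≤ E * (s ^ (γ / σ.ell) * ((w * v).w x)⁻¹) *
      ((w * v).star (x - z) * σ.rho s (x - z) ^ N * (σ.phi x ^ (η - γ) + σ.phi z ^ (η - γ)))
  inc_eq : ∀ x, x 0 ≠ 0 → ∀ y, y 0 ≠ 0 → ∀ s, 0 < s → s ≤ 1 → ∀ z,
    ∑ α ∈ S, inc y x α s z = ∑ α ∈ S, size y α s z - ∑ α ∈ S, size x α s z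

theorem phi₂_pos {x y : Pt d} (hx : x 0 ≠ 0) (hy : y 0 ≠ 0) : 0 < σ.phi₂ x y :=
  lt_min (σ.phi_pos hx) (σ.phi_pos hy)

theorem phi₂_le_one (x y : Pt d) : σ.phi₂ x y ≤ 1 := (min_le_left _ _).trans (σ.phi_le_one x)

variable {S : Finset ℝ} {N : ℕ} {γ η ζ : ℝ}

/-- Here, as in the next lemmas, the constant precedes all data. This order of quantifiers is what
makes the final constant independent of the semigroup, the kernel and the models. -/
theorem exists_lam_pairing (hw : w.IsControlled σ G) (hv : v.IsControlled σ G)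
    (hu : (w * v).IsControlled σ G) (hG0 : ∀ x, 0 ≤ G x) :
    ∃ C : ℝ, 0 ≤ C ∧ ∀ L P₁ P₂ E : ℝ, 0 ≤ L → ∀ lam size inc,
      LiftData σ w v S N γ η ζ L P₁ P₂ E lam size inc →
      ∀ s, 0 < s → s ≤ 1 → ∀ (x : Pt d) (P : Pt d → ℝ) (p : ℝ), 0 ≤ p → AEStronglyMeasurable P →
      (∀ z, |P z| ≤ p * σ.scaled G s (x - z)) →
      Integrable (fun z => P z * lam s z) ∧
        |∫ z, P z * lam s z| ≤ C * (p * s ^ (ζ / σ.ell)) * L * ((w * w * v).w x)⁻¹ := by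
  obtain ⟨C, hC, h⟩ := hu.exists_pairing hG0
  refine ⟨C, hC, fun L P₁ P₂ E hL lam size inc hD s hs hs1 x P p hp hP hPb => ?_⟩
  obtain ⟨h1, h2⟩ := h s hs hs1 x P (lam s) p (L * s ^ (ζ / σ.ell)) hp (by positivity) hP
    (hD.lam_meas s hs hs1).aestronglyMeasurable hPb (hD.lam_le s hs hs1)
  refine ⟨h1, h2.trans ?_⟩
  have := mul_le_mul_of_nonneg_left (inv_mul_le_inv_mul_mul hw hv x)
    (by positivity : 0 ≤ C * p * (L * s ^ (ζ / σ.ell)))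
  linarith

/-- One factor 1/w(x) comes from Γ_{zx}, another from moving 1/w(z) to x, and 1/v(x) comes from f.
This is why the lift lives in the weight w²v. -/
theorem exists_size_pairing (hw : w.IsControlled σ G) (hv : v.IsControlled σ G)
    (hd : w.HasDecay σ G) (hG0 : ∀ x, 0 ≤ G x) :
    ∃ C : ℝ, 0 ≤ C ∧ ∀ L P₁ P₂ E : ℝ, 0 ≤ P₁ → ∀ lam size inc,
      LiftData σ w v S N γ η ζ L P₁ P₂ E lam size inc →
      ∀ s, 0 < s → s ≤ 1 → ∀ (x : Pt d), x 0 ≠ 0 → ∀ α ∈ S, ∀ (P : Pt d → ℝ) (p : ℝ), 0 ≤ p →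
      AEStronglyMeasurable P → (∀ z, |P z| ≤ p * σ.scaled G s (x - z)) →
      Integrable (fun z => P z * size x α s z) ∧
        |∫ z, P z * size x α s z| ≤ C * (p * s ^ (α / σ.ell)) * P₁ * ((w * w * v).w x)⁻¹ *
          σ.phi x ^ min (η - α) 0 := by
  obtain ⟨C, hC, h⟩ := hd.exists_env_pairing hw hG0 N
  refine ⟨C, hC, fun L P₁ P₂ E hP₁ lam size inc hD s hs hs1 x hx α hα P p hp hP hPb => ?_⟩
  have hφ := σ.phi_pos hx
  have hvx := inv_pos.2 (hv.pos x)
  obtain ⟨h1, h2⟩ := h s hs hs1 x P (size x α s) p _ hp (by positivity) hP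
    (hD.size_meas x hx α hα s hs hs1).aestronglyMeasurable hPb (hD.size_le x hx α hα s hs hs1)
  refine ⟨h1, h2.trans (le_of_eq ?_)⟩
  have : ((w * w * v).w x)⁻¹ = (w.w x)⁻¹ * (w.w x)⁻¹ * (v.w x)⁻¹ := by
    rw [← mul_inv, ← mul_inv]; rfl
  rw [this]
  ring

/-- The increment is tested around y, which costs w(y)^{-2}. Moving both factors to x by
moderateness produces w^*(x-y)², and together with v^*(x-y) this is the controlling function of w²v.
-/
theorem exists_inc_pairing (hw : w.IsControlled σ G) (hv : v.IsControlled σ G)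
    (hd : w.HasDecay σ G) (hG0 : ∀ x, 0 ≤ G x) :
    ∃ C : ℝ, 0 ≤ C ∧ ∀ L P₁ P₂ E : ℝ, 0 ≤ P₂ → ∀ lam size inc,
      LiftData σ w v S N γ η ζ L P₁ P₂ E lam size inc →
      ∀ s, 0 < s → s ≤ 1 → ∀ (x : Pt d), x 0 ≠ 0 → ∀ (y : Pt d), y 0 ≠ 0 → ∀ α ∈ S,
      ∀ (P : Pt d → ℝ) (p : ℝ), 0 ≤ p →
      AEStronglyMeasurable P → (∀ z, |P z| ≤ p * σ.scaled G s (y - z)) →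
      Integrable (fun z => P z * inc y x α s z) ∧
        |∫ z, P z * inc y x α s z| ≤ C * (p * s ^ (α / σ.ell)) * P₂ *
          (σ.phi₂ x y ^ (η - γ) * (((w * w * v).w x)⁻¹ * (w * w * v).star (x - y))) *
          σ.nrm (y - x) ^ (γ - α) := by
  obtain ⟨C, hC, h⟩ := hd.exists_env_pairing hw hG0 N
  refine ⟨C, hC, fun L P₁ P₂ E hP₂ lam size inc hD s hs hs1 x hx y hy α hα P p hp hP hPb => ?_⟩
  have hφ := phi₂_pos (σ := σ) hx hy
  have hvx := inv_pos.2 (hv.pos x)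
  have hvs := hv.star_nonneg (x - y)
  have hn := σ.nrm_nonneg (y - x)
  obtain ⟨h1, h2⟩ := h s hs hs1 y P (inc y x α s) p _ hp (by positivity) hP
    (hD.inc_meas x hx y hy α hα s hs hs1).aestronglyMeasurable hPb
    (hD.inc_le x hx y hy α hα s hs hs1)
  refine ⟨h1, h2.trans ?_⟩
  have hwy := inv_pos.2 (hw.pos y)
  have hwi := hw.inv_le x y
  have hwi2 : (w.w y)⁻¹ * (w.w y)⁻¹ ≤
      (w.star (x - y) * (w.w x)⁻¹) * (w.star (x - y) * (w.w x)⁻¹) :=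
    mul_le_mul hwi hwi hwy.le (hwy.le.trans hwi)
  have e : ((w * w * v).w x)⁻¹ = (w.w x)⁻¹ * (w.w x)⁻¹ * (v.w x)⁻¹ := by
    rw [← mul_inv, ← mul_inv]; rfl
  have e' : (w * w * v).star (x - y) = w.star (x - y) * w.star (x - y) * v.star (x - y) := rfl
  rw [e, e']
  refine (mul_le_mul_of_nonneg_left hwi2 (by positivity)).trans (le_of_eq ?_)
  ring

/-- The singularity φ(z)^{η-γ} of the remainder is integrated here with a = γ - η; the bound a < 𝔰_1
is the lower bound on η. -/
theorem exists_rem_pairing (hw : w.IsControlled σ G) (hv : v.IsControlled σ G)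
    (hu : (w * v).IsControlled σ G) (hG0 : ∀ x, 0 ≤ G x) (hη : γ - σ.s 0 < η) (hηγ : η ≤ γ) :
    ∃ C : ℝ, 0 ≤ C ∧ ∀ L P₁ P₂ E : ℝ, 0 ≤ E → ∀ lam size inc,
      LiftData σ w v S N γ η ζ L P₁ P₂ E lam size inc →
      ∀ s, 0 < s → s ≤ 1 → ∀ (x : Pt d), x 0 ≠ 0 → ∀ (P : Pt d → ℝ) (p : ℝ), 0 ≤ p →
      AEStronglyMeasurable P → (∀ z, |P z| ≤ p * σ.scaled G s (x - z)) →
        |∫ z, P z * (lam s z - ∑ α ∈ S, size x α s z)| ≤ C * (p * s ^ (γ / σ.ell)) * E *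
          ((w * w * v).w x)⁻¹ * σ.phi x ^ (η - γ) := by
  obtain ⟨C, hC, h⟩ := hu.decays.exists_split_test hG0 hu.star_nonneg N
    (by linarith : 0 ≤ γ - η) (by linarith)
  refine ⟨C, hC, fun L P₁ P₂ E hE lam size inc hD s hs hs1 x hx P p hp hP hPb => ?_⟩
  have hux := inv_pos.2 (hu.pos x)
  have hm : AEStronglyMeasurable (fun z => lam s z - ∑ α ∈ S, size x α s z) :=
    (hD.lam_meas s hs hs1).aestronglyMeasurable.sub
      (Finset.aestronglyMeasurable_fun_sum S fun α hα =>
        (hD.size_meas x hx α hα s hs hs1).aestronglyMeasurable)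
  have hnull : ∀ᵐ z : Pt d, z 0 ≠ 0 := ae_apply_zero_ne_zero
  have h1 := (h s hs hs1 x _ (p * (E * (s ^ (γ / σ.ell) * ((w * v).w x)⁻¹))) (by positivity)
    (hP.mul hm) hx (by
      filter_upwards [hnull] with z hz
      have h2 := hD.rem_le x hx z hz s hs hs1
      rw [Pi.mul_apply, abs_mul, neg_sub]
      refine (mul_le_mul (hPb z) h2 (abs_nonneg _)
        (mul_nonneg hp (σ.scaled_nonneg hG0 hs _))).trans (le_of_eq ?_)
      ring)).2
  refine h1.trans ?_
  rw [neg_sub]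
  have hφ := σ.phi_pos hx
  have := mul_le_mul_of_nonneg_left (inv_mul_le_inv_mul_mul hw hv x)
    (by positivity : 0 ≤ C * (p * s ^ (γ / σ.ell)) * E * σ.phi x ^ (η - γ))
  linarith

end Lift

/-! ### Size of the polynomial coefficients. -/

section Coefficients

variable [NeZero d] {σ : Scaling d} {G : Pt d → ℝ} {w v : Weight d} {S : Finset ℝ} {N : ℕ}
  {γ η ζ β βb δ CK L P₁ P₂ E : ℝ} {Q K : Ker d} {lam : ℝ → Pt d → ℝ}
  {size : Pt d → ℝ → ℝ → Pt d → ℝ} {inc : Pt d → Pt d → ℝ → ℝ → Pt d → ℝ}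

/-- Measurability in time of the smeared lift data. -/
structure LiftTimeMeasurable (σ : Scaling d) (K : Ker d) (δ : ℝ) (S : Finset ℝ)
    (lam : ℝ → Pt d → ℝ) (size : Pt d → ℝ → ℝ → Pt d → ℝ)
    (inc : Pt d → Pt d → ℝ → ℝ → Pt d → ℝ) : Prop where
  lam : ∀ k, σ.deg k < δ → ∀ x,
    AEStronglyMeasurable (fun t => kint K k t x lam) (volume.restrict (Set.Ioc 0 1))
  size : ∀ k, σ.deg k < δ → ∀ x, x 0 ≠ 0 → ∀ α ∈ S,
    AEStronglyMeasurable (fun t => kint K k t x (size x α)) (volume.restrict (Set.Ioc 0 1))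
  inc : ∀ k, σ.deg k < δ → ∀ x, x 0 ≠ 0 → ∀ y, y 0 ≠ 0 → ∀ α ∈ S,
    AEStronglyMeasurable (fun t => kint K k t y (inc y x α)) (volume.restrict (Set.Ioc 0 1))

theorem LiftData.integral_rem (hD : LiftData σ w v S N γ η ζ L P₁ P₂ E lam size inc)
    (hw : w.IsControlled σ G) (hv : v.IsControlled σ G) (hu : (w * v).IsControlled σ G)
    (hd : w.HasDecay σ G) (hG0 : ∀ x, 0 ≤ G x) (hL : 0 ≤ L) (hP₁ : 0 ≤ P₁) {s : ℝ} (hs : 0 < s)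
    (hs1 : s ≤ 1) {x : Pt d} (hx : x 0 ≠ 0) {P : Pt d → ℝ} {p : ℝ} (hp : 0 ≤ p)
    (hP : AEStronglyMeasurable P) (hPb : ∀ z, |P z| ≤ p * σ.scaled G s (x - z)) :
    Integrable (fun z => P z * (lam s z - ∑ α ∈ S, size x α s z)) ∧
    ∫ z, P z * (lam s z - ∑ α ∈ S, size x α s z) =
      (∫ z, P z * lam s z) - ∑ α ∈ S, ∫ z, P z * size x α s z := by
  obtain ⟨C₁, -, h₁⟩ := exists_lam_pairing (S := S) (N := N) (γ := γ) (η := η) (ζ := ζ) hw hv hu hG0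
  obtain ⟨C₂, -, h₂⟩ := exists_size_pairing (S := S) (N := N) (γ := γ) (η := η) (ζ := ζ) hw hv hd
    hG0
  have i₁ := (h₁ L P₁ P₂ E hL lam size inc hD s hs hs1 x P p hp hP hPb).1
  have i₂ := fun α hα => (h₂ L P₁ P₂ E hP₁ lam size inc hD s hs hs1 x hx α hα P p hp hP hPb).1
  have e : (fun z => P z * (lam s z - ∑ α ∈ S, size x α s z)) =
      fun z => P z * lam s z - ∑ α ∈ S, P z * size x α s z := by
    funext z; rw [mul_sub, Finset.mul_sum]
  rw [e]
  exact ⟨i₁.sub (integrable_finsetSum S i₂), by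
    rw [integral_sub i₁ (integrable_finsetSum S i₂), integral_finsetSum S i₂]⟩

theorem IsRegularizing.aestronglyMeasurable_kderiv (hK : IsRegularizing σ G Q K βb δ CK)
    {k : Idx d} (hk : σ.deg k < δ) {t : ℝ} (ht : 0 < t) (x : Pt d) :
    AEStronglyMeasurable (fun y => kderiv K k t x y) :=
  (hK.measurable_kderiv k hk ht x).aestronglyMeasurable

/-- The three pairing bounds at s = t/2 become the three hypotheses of `exists_size_coeff_bound`,
with κ = |k|_𝔰 and φ = φ(x). -/
theorem exists_lift_size_bound (hw : w.IsControlled σ G) (hv : v.IsControlled σ G)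
    (hu : (w * v).IsControlled σ G) (hd : w.HasDecay σ G) (hG0 : ∀ x, 0 ≤ G x)
    (hη : γ - σ.s 0 < η) (hηγ : η ≤ γ) (hβ : β ≤ βb) (hδ : γ + βb < δ)
    (hζη : ζ ≤ η) (hSζ : ∀ α ∈ S, ζ ≤ α) (N : ℕ) (k : Idx d) (hk : σ.deg k < γ + β)
    (hcase : β < βb ∨ (ζ + βb ≠ σ.deg k ∧ ∀ α ∈ S, α + βb ≠ σ.deg k)) :
    ∃ C : ℝ, 0 ≤ C ∧ ∀ (Q K : Ker d) (CK : ℝ), 0 < CK → IsRegularizing σ G Q K βb δ CK →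
      ∀ L P₁ P₂ E : ℝ, 0 ≤ L → 0 ≤ P₁ → 0 ≤ E → ∀ lam size inc,
      LiftData σ w v S N γ η ζ L P₁ P₂ E lam size inc →
      LiftTimeMeasurable σ K δ S lam size inc → ∀ x, x 0 ≠ 0 →
      |∑ α ∈ S with σ.deg k < α + β, (∫ t in Set.Ioc 0 1, kint K k t x (size x α)) +
        ∫ t in Set.Ioc 0 1, (kint K k t x lam - ∑ α ∈ S, kint K k t x (size x α))| ≤
        C * (CK * (P₁ + L + E)) * (((w * w * v).w x)⁻¹ * σ.phi x ^ min (ζ + β - σ.deg k) 0) := by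
  obtain ⟨C₁, hC₁, h₁⟩ := exists_lam_pairing (S := S) (N := N) (γ := γ) (η := η) (ζ := ζ) hw hv hu
    hG0
  obtain ⟨C₂, hC₂, h₂⟩ := exists_size_pairing (S := S) (N := N) (γ := γ) (η := η) (ζ := ζ) hw hv hd
    hG0
  obtain ⟨C₃, hC₃, h₃⟩ := exists_rem_pairing (S := S) (N := N) (γ := γ) (η := η) (ζ := ζ) hw hv hu
    hG0 hη hηγ
  obtain ⟨C, hC, h⟩ := exists_size_coeff_bound σ.ell_pos (κ := σ.deg k) S hβ hζη hSζ hk hcase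
  have hkδ : σ.deg k < δ := by linarith
  -- The loss from evaluating powers of time at t/2.
  set q : ℝ → ℝ := fun e => 2 ^ |(e - σ.deg k + βb) / σ.ell - 1| with hq
  have hq0 : ∀ e, 0 ≤ q e := fun e => by positivity
  -- Summing the constants lets one number D serve all three hypotheses.
  set M := C₁ * q ζ + ∑ α ∈ S, C₂ * q α + C₃ * q γ with hM
  have hM1 : 0 ≤ C₁ * q ζ := mul_nonneg hC₁ (hq0 _)
  have hM2 : ∀ α ∈ S, 0 ≤ C₂ * q α := fun α _ => mul_nonneg hC₂ (hq0 _)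
  have hM3 : 0 ≤ C₃ * q γ := mul_nonneg hC₃ (hq0 _)
  have hM2s := Finset.sum_nonneg hM2
  refine ⟨C * M, by positivity, fun Q K CK hCK hK L P₁ P₂ E hL hP₁ hE lam size inc hD hT x hx => ?_⟩
  set W := ((w * w * v).w x)⁻¹ with hW
  have hW0 : 0 ≤ W := inv_nonneg.2 (mul_nonneg (mul_pos (hw.pos x) (hw.pos x)).le (hv.pos x).le)
  have hφ := σ.phi_pos hx
  have hker : ∀ t, 0 < t → ∀ z, |kderiv K k (t / 2) x z| ≤
      CK * (t / 2) ^ ((βb - σ.deg k) / σ.ell - 1) * σ.scaled G (t / 2) (x - z) := fun t ht z =>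
    hK.upper k hkδ _ (half_pos ht) x z
  have hkm : ∀ t, 0 < t → AEStronglyMeasurable (fun z => kderiv K k (t / 2) x z) := fun t ht =>
    hK.aestronglyMeasurable_kderiv hkδ (half_pos ht) x
  have hpt : ∀ t, 0 < t → 0 ≤ CK * (t / 2) ^ ((βb - σ.deg k) / σ.ell - 1) := fun t ht => by
    positivity
  -- a common bound
  have key : ∀ (c A e B t X : ℝ), 0 < t → 0 ≤ c → c * q e ≤ M → 0 ≤ A → A ≤ P₁ + L + E → 0 ≤ B →
      X ≤ c * (CK * (t / 2) ^ ((βb - σ.deg k) / σ.ell - 1) * (t / 2) ^ (e / σ.ell)) * A * W * B →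
      X ≤ M * (CK * (P₁ + L + E)) * W * B * t ^ ((e - σ.deg k + βb) / σ.ell - 1) := by
    intro c A e B t X ht hc hcM hA hAle hB hX
    refine hX.trans ?_
    have h1 : (t / 2) ^ ((βb - σ.deg k) / σ.ell - 1) * (t / 2) ^ (e / σ.ell) ≤
      q e * t ^ ((e - σ.deg k + βb) / σ.ell - 1) := half_rpow_mul_le ht
    have ht0 : 0 ≤ t ^ ((e - σ.deg k + βb) / σ.ell - 1) := by positivity
    calc _ = c * CK * A * W * B *
          ((t / 2) ^ ((βb - σ.deg k) / σ.ell - 1) * (t / 2) ^ (e / σ.ell)) := by ring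
      _ ≤ c * CK * A * W * B * (q e * t ^ ((e - σ.deg k + βb) / σ.ell - 1)) := by gcongr
      _ = (c * q e) * (CK * A) * (W * B * t ^ ((e - σ.deg k + βb) / σ.ell - 1)) := by ring
      _ ≤ M * (CK * (P₁ + L + E)) * (W * B * t ^ ((e - σ.deg k + βb) / σ.ell - 1)) := by
          gcongr
      _ = _ := by ring
  have hS2 : ∀ α ∈ S, C₂ * q α ≤ M := fun α hα => by
    have := Finset.single_le_sum hM2 hα
    linarith
  have hfin := h (σ.phi x) (M * (CK * (P₁ + L + E)) * W) hφ (σ.phi_le_one x) (by positivity)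
    (fun t => kint K k t x lam) (fun α t => kint K k t x (size x α)) (hT.lam k hkδ x)
    (fun α hα => hT.size k hkδ x hx α hα)
    (fun t ht ht1 => by
      have := (h₁ L P₁ P₂ E hL lam size inc hD (t / 2) (half_pos ht) (by linarith) x _ _
        (hpt t ht) (hkm t ht) (hker t ht)).2
      have := key C₁ L ζ 1 t _ ht hC₁ (by linarith) hL (by linarith) zero_le_one
        (this.trans (le_of_eq (by ring)))
      rwa [mul_one] at this)
    (fun α hα t ht ht1 => by
      have := (h₂ L P₁ P₂ E hP₁ lam size inc hD (t / 2) (half_pos ht) (by linarith) x hx α hα _ _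
        (hpt t ht) (hkm t ht) (hker t ht)).2
      exact key C₂ P₁ α _ t _ ht hC₂ (hS2 α hα) hP₁ (by linarith) (by positivity) this)
    (fun t ht ht1 => by
      have h4 := h₃ L P₁ P₂ E hE lam size inc hD (t / 2) (half_pos ht) (by linarith) x hx _ _
        (hpt t ht) (hkm t ht) (hker t ht)
      rw [(hD.integral_rem hw hv hu hd hG0 hL hP₁ (half_pos ht) (by linarith) hx (hpt t ht)
        (hkm t ht) (hker t ht)).2] at h4
      exact key C₃ E γ _ t _ ht hC₃ (by linarith) hE (by linarith) (by positivity) h4)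
  refine hfin.trans (le_of_eq ?_)
  ring

end Coefficients

/-! ### Increments of the polynomial coefficients. -/

section SharpCoefficients

variable [NeZero d] {σ : Scaling d} {G : Pt d → ℝ} {w v : Weight d} {S : Finset ℝ} {N : ℕ}
  {γ η ζ β βb δ CK L P₁ P₂ E : ℝ} {Q K : Ker d} {lam : ℝ → Pt d → ℝ}
  {size : Pt d → ℝ → ℝ → Pt d → ℝ} {inc : Pt d → Pt d → ℝ → ℝ → Pt d → ℝ}

theorem one_le_mfact (l : Idx d) : 1 ≤ mfact l :=
  (Finset.prod_const_one (s := Finset.univ)).symm.le.trans (Finset.prod_le_prod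
    (fun _ _ => zero_le_one) fun i _ => by exact_mod_cast (l i).factorial_pos)

theorem abs_mpow_div_mfact_le (σ : Scaling d) (x : Pt d) (l : Idx d) :
    |mpow x l / mfact l| ≤ σ.nrm x ^ σ.deg l := by
  have h := one_le_mfact l
  rw [abs_div, abs_of_pos (zero_lt_one.trans_le h)]
  exact (div_le_self (abs_nonneg _) h).trans (abs_mpow_le σ x l)

/-- Change of base point, Λ_x = Λ_y + Π_yΔ_{yx}f, under the integral. -/
theorem LiftData.integral_inc (hD : LiftData σ w v S N γ η ζ L P₁ P₂ E lam size inc)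
    (hw : w.IsControlled σ G) (hv : v.IsControlled σ G) (hu : (w * v).IsControlled σ G)
    (hd : w.HasDecay σ G) (hG0 : ∀ x, 0 ≤ G x) (hL : 0 ≤ L) (hP₁ : 0 ≤ P₁) (hP₂ : 0 ≤ P₂) {s : ℝ}
    (hs : 0 < s) (hs1 : s ≤ 1) {x y : Pt d} (hx : x 0 ≠ 0) (hy : y 0 ≠ 0) {P : Pt d → ℝ} {p : ℝ}
    (hp : 0 ≤ p) (hP : AEStronglyMeasurable P) (hPb : ∀ z, |P z| ≤ p * σ.scaled G s (y - z)) :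
    Integrable (fun z => P z * (lam s z - ∑ α ∈ S, size x α s z)) ∧
    ∫ z, P z * (lam s z - ∑ α ∈ S, size x α s z) =
      (∫ z, P z * (lam s z - ∑ α ∈ S, size y α s z)) + ∑ α ∈ S, ∫ z, P z * inc y x α s z := by
  obtain ⟨C₂, -, h₂⟩ := exists_inc_pairing (S := S) (N := N) (γ := γ) (η := η) (ζ := ζ) hw hv hd
    hG0
  have i₁ := (hD.integral_rem hw hv hu hd hG0 hL hP₁ hs hs1 hy hp hP hPb).1
  have i₂ := fun α hα => (h₂ L P₁ P₂ E hP₂ lam size inc hD s hs hs1 x hx y hy α hα P p hp hP hPb).1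
  have e : (fun z => P z * (lam s z - ∑ α ∈ S, size x α s z)) =
      fun z => P z * (lam s z - ∑ α ∈ S, size y α s z) + ∑ α ∈ S, P z * inc y x α s z := by
    funext z
    rw [← Finset.mul_sum, hD.inc_eq x hx y hy s hs hs1 z]; ring
  rw [e]
  exact ⟨i₁.add (integrable_finsetSum S i₂), by
    rw [integral_add i₁ (integrable_finsetSum S i₂), integral_finsetSum S i₂]⟩

/-- Above the cut, the terms based at y recombine to ∂^kK_t(y,Λ_x), and subtracting the Taylor terms
at x leaves the Taylor remainder of the kernel tested against Λ_x alone. Below the cut, the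
increments at y and the remainders at x and y are estimated one by one. -/
theorem exists_lift_sharp_bound (hw : w.IsControlled σ G) (hv : v.IsControlled σ G)
    (hwwv : (w * w * v).IsControlled σ G) (hd : w.HasDecay σ G) (hG0 : ∀ x, 0 ≤ G x)
    (hη : γ - σ.s 0 < η) (hηγ : η ≤ γ) (hβ : β ≤ βb) (hδ : γ + βb < δ)
    (S : Finset ℝ) (ζ : ℝ) (N : ℕ) (k : Idx d) (hk : σ.deg k < γ + β)
    (hcase : β < βb ∨ ((∀ α ∈ S, α + βb ≠ σ.deg k) ∧ ∀ l, γ + βb ≠ σ.deg k + σ.deg l)) :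
    ∃ C : ℝ, 0 ≤ C ∧ ∀ (Q K : Ker d) (CK : ℝ), 0 < CK → IsRegularizing σ G Q K βb δ CK →
      ∀ L P₁ P₂ E : ℝ, 0 ≤ L → 0 ≤ P₁ → 0 ≤ P₂ → 0 ≤ E → ∀ lam size inc,
      LiftData σ w v S N γ η ζ L P₁ P₂ E lam size inc →
      LiftTimeMeasurable σ K δ S lam size inc → ∀ x, x 0 ≠ 0 → ∀ y, y 0 ≠ 0 → x ≠ y →
      |(∑ α ∈ S with σ.deg k < α + β, ∫ t in Set.Ioc 0 1, kint K k t y (inc y x α)) +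
        (∫ t in Set.Ioc 0 1, (kint K k t y lam - ∑ α ∈ S, kint K k t y (size y α))) -
        ∑ l ∈ σ.idxBelow (δ - σ.deg k) with σ.deg k + σ.deg l < γ + β,
          mpow (y - x) l / mfact l * ∫ t in Set.Ioc 0 1,
            (kint K (k + l) t x lam - ∑ α ∈ S, kint K (k + l) t x (size x α))| ≤
        C * (CK * (P₂ + E)) * (((w * w * v).w x)⁻¹ * (w * w * v).star (x - y) *
          σ.phi₂ x y ^ (η - γ)) * σ.nrm (y - x) ^ (γ + β - σ.deg k) := by
  have hu := hw.mul_of_mul_mul hv hwwv hG0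
  obtain ⟨C₂, hC₂, h₂⟩ := exists_inc_pairing (S := S) (N := N) (γ := γ) (η := η) (ζ := ζ) hw hv hd
    hG0
  obtain ⟨C₃, hC₃, h₃⟩ := exists_rem_pairing (S := S) (N := N) (γ := γ) (η := η) (ζ := ζ) hw hv hu
    hG0 hη hηγ
  set I := σ.idxBelow (δ - σ.deg k) with hI
  obtain ⟨C, hC, h⟩ := exists_sharp_coeff_bound σ.ell_pos (κ := σ.deg k) S I σ.deg hβ hδ hk
    (hcase.imp id fun h => ⟨h.1, fun l _ => h.2 l⟩)
  have hkδ : σ.deg k < δ := by linarith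
  set q : ℝ → ℝ → ℝ := fun e κ => 2 ^ |(e - κ + βb) / σ.ell - 1| with hq
  have hq0 : ∀ e κ, 0 ≤ q e κ := fun e κ => by positivity
  set M := ∑ α ∈ S, C₂ * q α (σ.deg k) + C₃ * q γ (σ.deg k) +
    ∑ l ∈ I, C₃ * q γ (σ.deg (k + l)) + C₃ * q γ δ with hM
  have hM1 : ∀ α ∈ S, 0 ≤ C₂ * q α (σ.deg k) := fun α _ => mul_nonneg hC₂ (hq0 _ _)
  have hM2 : 0 ≤ C₃ * q γ (σ.deg k) := mul_nonneg hC₃ (hq0 _ _)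
  have hM3 : ∀ l ∈ I, 0 ≤ C₃ * q γ (σ.deg (k + l)) := fun l _ => mul_nonneg hC₃ (hq0 _ _)
  have hM4 : 0 ≤ C₃ * q γ δ := mul_nonneg hC₃ (hq0 _ _)
  have hM1s := Finset.sum_nonneg hM1
  have hM3s := Finset.sum_nonneg hM3
  have hM1' : ∀ α ∈ S, C₂ * q α (σ.deg k) ≤ M := fun α hα => by
    have := Finset.single_le_sum hM1 hα; linarith
  have hM3' : ∀ l ∈ I, C₃ * q γ (σ.deg (k + l)) ≤ M := fun l hl => by
    have := Finset.single_le_sum hM3 hl; linarith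
  have hM0 : 0 ≤ M := by rw [hM]; linarith
  have hMn : C₃ * q γ (σ.deg k) ≤ M := by rw [hM]; linarith
  have hMδ : C₃ * q γ δ ≤ M := by rw [hM]; linarith
  clear_value M
  refine ⟨C * M, mul_nonneg hC hM0, fun Q K CK hCK hK L P₁ P₂ E hL hP₁ hP₂ hE lam size inc hD hT
    x hx y hy hxy => ?_⟩
  set W := ((w * w * v).w x)⁻¹ with hW
  set St := (w * w * v).star (x - y) with hSt
  have hW0 : 0 ≤ W := inv_nonneg.2 (hwwv.pos x).le
  have hSt1 : 1 ≤ St := hwwv.one_le_star _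
  have hφ₂ := phi₂_pos (σ := σ) hx hy
  set Φ := σ.phi₂ x y ^ (η - γ) with hΦ
  have hΦ0 : 0 ≤ Φ := by positivity
  have hφx : σ.phi x ^ (η - γ) ≤ Φ :=
    Real.rpow_le_rpow_of_nonpos hφ₂ (min_le_left _ _) (by linarith)
  have hφy : σ.phi y ^ (η - γ) ≤ Φ :=
    Real.rpow_le_rpow_of_nonpos hφ₂ (min_le_right _ _) (by linarith)
  have hφx0 : 0 ≤ σ.phi x ^ (η - γ) := Real.rpow_nonneg (σ.phi_nonneg x) _
  have hφy0 : 0 ≤ σ.phi y ^ (η - γ) := Real.rpow_nonneg (σ.phi_nonneg y) _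
  -- A common weight for remainders based at x and at y; for the latter, moderateness supplies the
  -- factor `St`.
  set V := W * St * Φ with hV
  have hV0 : 0 ≤ V := by positivity
  have hVx : W * σ.phi x ^ (η - γ) ≤ V :=
    mul_le_mul (le_mul_of_one_le_right hW0 hSt1) hφx hφx0 (by positivity)
  have hVy : ((w * w * v).w y)⁻¹ * σ.phi y ^ (η - γ) ≤ V := by
    refine mul_le_mul ((hwwv.inv_le x y).trans (le_of_eq (mul_comm _ _))) hφy hφy0 (by positivity)
  set r := σ.nrm (y - x) with hr
  have hr0 : 0 < r := σ.nrm_pos (sub_ne_zero.2 hxy.symm)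
  have hker : ∀ l, σ.deg l < δ → ∀ t, 0 < t → ∀ x z, |kderiv K l (t / 2) x z| ≤
      CK * (t / 2) ^ ((βb - σ.deg l) / σ.ell - 1) * σ.scaled G (t / 2) (x - z) :=
    fun l hl t ht x z => hK.upper l hl _ (half_pos ht) x z
  have hkm : ∀ l, σ.deg l < δ → ∀ t, 0 < t → ∀ x,
      AEStronglyMeasurable (fun z => kderiv K l (t / 2) x z) := fun l hl t ht x =>
    hK.aestronglyMeasurable_kderiv hl (half_pos ht) x
  have hpt : ∀ l t, 0 < t → 0 ≤ CK * (t / 2) ^ ((βb - σ.deg l) / σ.ell - 1) := fun l t ht => by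
    positivity
  have hkl : ∀ l ∈ I, σ.deg (k + l) < δ := fun l hl => by
    have := (σ.mem_idxBelow _ _).1 hl
    rw [σ.deg_add]; linarith
  -- a common bound
  have key : ∀ (c A e κ R B t X : ℝ), 0 < t → 0 ≤ c → c * q e κ ≤ M → 0 ≤ A → A ≤ P₂ + E →
      0 ≤ R → B ≤ V → 0 ≤ B →
      X ≤ c * (CK * (t / 2) ^ ((βb - κ) / σ.ell - 1) * (t / 2) ^ (e / σ.ell)) * A * B * R →
      X ≤ M * (CK * (P₂ + E)) * V * R * t ^ ((e - κ + βb) / σ.ell - 1) := by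
    intro c A e κ R B t X ht hc hcM hA hAle hR hB hB0 hX
    refine hX.trans ?_
    have h1 : (t / 2) ^ ((βb - κ) / σ.ell - 1) * (t / 2) ^ (e / σ.ell) ≤
      q e κ * t ^ ((e - κ + βb) / σ.ell - 1) := half_rpow_mul_le ht
    have ht0 : 0 ≤ t ^ ((e - κ + βb) / σ.ell - 1) := by positivity
    calc _ = c * CK * A * B * R *
          ((t / 2) ^ ((βb - κ) / σ.ell - 1) * (t / 2) ^ (e / σ.ell)) := by ring
      _ ≤ c * CK * A * B * R * (q e κ * t ^ ((e - κ + βb) / σ.ell - 1)) := by gcongr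
      _ = (c * q e κ) * (CK * A) * B * (R * t ^ ((e - κ + βb) / σ.ell - 1)) := by ring
      _ ≤ M * (CK * (P₂ + E)) * V * (R * t ^ ((e - κ + βb) / σ.ell - 1)) := by
          gcongr
      _ = _ := by ring
  have hmeas : ∀ l, σ.deg l < δ → ∀ x, x 0 ≠ 0 → AEStronglyMeasurable
      (fun t => kint K l t x lam - ∑ α ∈ S, kint K l t x (size x α))
      (volume.restrict (Set.Ioc 0 1)) := fun l hl x hx =>
    (hT.lam l hl x).sub (Finset.aestronglyMeasurable_fun_sum S fun α hα => hT.size l hl x hx α hα)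
  have hrem : ∀ l, σ.deg l < δ → ∀ x, x 0 ≠ 0 → ∀ t, 0 < t → t ≤ 1 →
      kint K l t x lam - ∑ α ∈ S, kint K l t x (size x α) =
      ∫ z, kderiv K l (t / 2) x z * (lam (t / 2) z - ∑ α ∈ S, size x α (t / 2) z) :=
    fun l hl x hx t ht ht1 => ((hD.integral_rem hw hv hu hd hG0 hL hP₁ (half_pos ht)
      (by linarith) hx (hpt l t ht) (hkm l hl t ht x) (hker l hl t ht x)).2).symm
  have hrb : ∀ l, σ.deg l < δ → ∀ x, x 0 ≠ 0 → ∀ t, 0 < t → t ≤ 1 →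
      |kint K l t x lam - ∑ α ∈ S, kint K l t x (size x α)| ≤
      C₃ * (CK * (t / 2) ^ ((βb - σ.deg l) / σ.ell - 1) * (t / 2) ^ (γ / σ.ell)) * E *
        (((w * w * v).w x)⁻¹ * σ.phi x ^ (η - γ)) * 1 := fun l hl x hx t ht ht1 => by
    rw [hrem l hl x hx t ht ht1]
    refine (h₃ L P₁ P₂ E hE lam size inc hD (t / 2) (half_pos ht) (by linarith) x hx _ _
      (hpt l t ht) (hkm l hl t ht x) (hker l hl t ht x)).trans (le_of_eq (by ring))
  have hfin := h r (M * (CK * (P₂ + E)) * V) hr0 (by positivity)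
    (fun α t => kint K k t y (inc y x α))
    (fun t => kint K k t y lam - ∑ α ∈ S, kint K k t y (size y α))
    (fun l t => kint K (k + l) t x lam - ∑ α ∈ S, kint K (k + l) t x (size x α))
    (fun l => mpow (y - x) l / mfact l)
    (fun α hα => hT.inc k hkδ x hx y hy α hα) (hmeas k hkδ y hy)
    (fun l hl => hmeas _ (hkl l hl) x hx) (fun l _ => abs_mpow_div_mfact_le σ (y - x) l)
    (fun α hα t ht ht1 => by
      have := (h₂ L P₁ P₂ E hP₂ lam size inc hD (t / 2) (half_pos ht) (by linarith) x hx y hy α hα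
        _ _ (hpt k t ht) (hkm k hkδ t ht y) (hker k hkδ t ht y)).2
      exact key C₂ P₂ α (σ.deg k) (r ^ (γ - α)) V t _ ht hC₂ (hM1' α hα) hP₂ (by linarith)
        (by positivity) le_rfl hV0 (this.trans (le_of_eq (by ring))))
    (fun t ht ht1 => by
      have := key C₃ E γ (σ.deg k) 1 _ t _ ht hC₃ hMn hE (by linarith)
        zero_le_one hVy (mul_nonneg (inv_nonneg.2 (hwwv.pos y).le) hφy0) (hrb k hkδ y hy t ht ht1)
      rwa [mul_one] at this)
    (fun l hl t ht ht1 => by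
      have := key C₃ E γ (σ.deg (k + l)) 1 _ t _ ht hC₃ (hM3' l hl) hE (by linarith)
        zero_le_one hVx (mul_nonneg hW0 hφx0) (hrb (k + l) (hkl l hl) x hx t ht ht1)
      rwa [mul_one, σ.deg_add, ← sub_sub] at this)
    (fun t ht htr ht1 => by
      have ht2 := half_pos ht
      -- Beyond the cut the displacement y - x is admissible in the Taylor estimate of the kernel at
      -- time t/2.
      have hrt : r ≤ (t / 2) ^ (1 / σ.ell) := by
        have h1 : r ^ σ.ell ≤ t / 2 := by linarith
        calc r = (r ^ σ.ell) ^ (1 / σ.ell) := by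
              rw [← Real.rpow_mul hr0.le, mul_one_div_cancel σ.ell_pos.ne', Real.rpow_one]
          _ ≤ _ := Real.rpow_le_rpow (by positivity) h1 (one_div_pos.2 σ.ell_pos).le
      obtain ⟨i1, e1⟩ := hD.integral_inc hw hv hu hd hG0 hL hP₁ hP₂ ht2 (by linarith) hx hy
        (hpt k t ht) (hkm k hkδ t ht y) (hker k hkδ t ht y)
      have i2 : ∀ l ∈ I, Integrable (fun z => mpow (y - x) l / mfact l *
          (kderiv K (k + l) (t / 2) x z * (lam (t / 2) z - ∑ α ∈ S, size x α (t / 2) z))) :=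
        fun l hl => ((hD.integral_rem hw hv hu hd hG0 hL hP₁ ht2 (by linarith) hx
          (hpt (k + l) t ht) (hkm (k + l) (hkl l hl) t ht x)
          (hker (k + l) (hkl l hl) t ht x)).1).const_mul _
      -- The Taylor remainder of ∂^kK_{t/2} at x. It is dominated by G centred at x, so the
      -- remainder pairing with base point x applies to it directly.
      set P : Pt d → ℝ := fun z => kderiv K k (t / 2) y z -
        ∑ l ∈ I, mpow (y - x) l / mfact l * kderiv K (k + l) (t / 2) x z with hP
      have hPm : AEStronglyMeasurable P := (hkm k hkδ t ht y).sub
        (Finset.aestronglyMeasurable_fun_sum I fun l hl =>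
          (hkm (k + l) (hkl l hl) t ht x).const_mul _)
      have hPb : ∀ z, |P z| ≤ CK * r ^ (δ - σ.deg k) * (t / 2) ^ ((βb - δ) / σ.ell - 1) *
          σ.scaled G (t / 2) (x - z) := fun z => by
        have := hK.holder k hkδ (t / 2) ht2 x z (y - x) hrt
        rwa [add_sub_cancel] at this
      have h4 := h₃ L P₁ P₂ E hE lam size inc hD (t / 2) ht2 (by linarith) x hx P _
        (by positivity) hPm hPb
      -- Here the pieces based at y and the Taylor terms based at x merge into a single pairing.
      have e2 : (kint K k t y lam - ∑ α ∈ S, kint K k t y (size y α)) +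
          ∑ α ∈ S, kint K k t y (inc y x α) -
          ∑ l ∈ I, mpow (y - x) l / mfact l *
            (kint K (k + l) t x lam - ∑ α ∈ S, kint K (k + l) t x (size x α)) =
          ∫ z, P z * (lam (t / 2) z - ∑ α ∈ S, size x α (t / 2) z) := by
        have e3 : ∀ z, P z * (lam (t / 2) z - ∑ α ∈ S, size x α (t / 2) z) =
            kderiv K k (t / 2) y z * (lam (t / 2) z - ∑ α ∈ S, size x α (t / 2) z) -
            ∑ l ∈ I, mpow (y - x) l / mfact l * (kderiv K (k + l) (t / 2) x z *
              (lam (t / 2) z - ∑ α ∈ S, size x α (t / 2) z)) := fun z => by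
          rw [hP]; beta_reduce
          rw [sub_mul, Finset.sum_mul]
          exact congrArg _ (Finset.sum_congr rfl fun l _ => by ring)
        rw [integral_congr_ae (Eventually.of_forall e3), integral_sub i1
          (integrable_finsetSum I i2), integral_finsetSum I i2, e1, hrem k hkδ y hy t ht ht1]
        refine congrArg₂ _ rfl (Finset.sum_congr rfl fun l hl => ?_)
        rw [integral_const_mul, hrem (k + l) (hkl l hl) x hx t ht ht1]
      rw [e2]
      -- The Taylor remainder has the time exponent of a derivative of order δ, whence κ = δ.
      exact key C₃ E γ δ (r ^ (δ - σ.deg k)) _ t _ ht hC₃ hMδ hE (by linarith)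
        (by positivity) hVx (mul_nonneg hW0 hφx0) (h4.trans (le_of_eq (by ring))))
  refine hfin.trans (le_of_eq ?_)
  ring

end SharpCoefficients

/-! ### Norms of singular modelled distributions. -/

section ModelledNorms

variable [NeZero d] {A : IndexSet} {𝒯 : RegStructure.{u} A} {σ : Scaling d} {p : Weight d}
  {γ η : ℝ}

theorem sizeNorm_le_iff {c : ℝ} (hc : 0 ≤ c) {f : Pt d → 𝒯.Sum} :
    sizeNorm σ 𝒯 p γ η f ≤ ENNReal.ofReal c ↔ ∀ α, α ∈ A.carrier → α < γ → ∀ x : Pt d, x 0 ≠ 0 →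
      p.w x * ‖f x α‖ / σ.phi x ^ min (η - α) 0 ≤ c := by
  simp only [sizeNorm, iSup_le_iff, ENNReal.ofReal_le_ofReal_iff hc, and_imp]

theorem incrNorm_le_iff {c : ℝ} (hc : 0 ≤ c) {D : Pt d → Pt d → 𝒯.Sum} :
    incrNorm σ 𝒯 p γ η D ≤ ENNReal.ofReal c ↔ ∀ α, α ∈ A.carrier → α < γ → ∀ x y : Pt d,
      x 0 ≠ 0 → y 0 ≠ 0 → x ≠ y → p.w x * ‖D y x α‖ /
        (σ.phi₂ x y ^ (η - γ) * p.star (x - y) * σ.nrm (y - x) ^ (γ - α)) ≤ c := by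
  simp only [incrNorm, iSup_le_iff, ENNReal.ofReal_le_ofReal_iff hc, and_imp]

theorem recNorm_le_iff {c : ℝ} (hc : 0 ≤ c) {R : ℝ → Pt d → ℝ} :
    recNorm σ p γ η R ≤ ENNReal.ofReal c ↔ ∀ t, 0 < t → t ≤ 1 → ∀ x : Pt d, x 0 ≠ 0 →
      t ^ (-γ / σ.ell) * σ.phi x ^ (γ - η) * p.w x * |R t x| ≤ c := by
  simp only [recNorm, iSup_le_iff, ENNReal.ofReal_le_ofReal_iff hc, and_imp]

theorem norm_le_of_sizeNorm {f : Pt d → 𝒯.Sum} (h : sizeNorm σ 𝒯 p γ η f < ∞) {x : Pt d}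
    (hx : x 0 ≠ 0) (hp : 0 < p.w x) {α : ℝ} (hα : α < γ) :
    ‖f x α‖ ≤ (sizeNorm σ 𝒯 p γ η f).toReal * (σ.phi x ^ min (η - α) 0 * (p.w x)⁻¹) := by
  have hφ := σ.phi_pos hx
  have h0 : 0 ≤ (sizeNorm σ 𝒯 p γ η f).toReal := ENNReal.toReal_nonneg
  by_cases hA : α ∈ A.carrier
  · have := (sizeNorm_le_iff h0).1 (ENNReal.ofReal_toReal h.ne).ge α hA hα x hx
    rw [div_le_iff₀ (by positivity)] at this
    rw [← mul_assoc, ← div_eq_mul_inv, le_div_iff₀ hp]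
    linarith
  · rw [RegStructure.eq_zero_of_notMem hA (f x α), norm_zero]
    positivity

theorem norm_le_of_incrNorm {D : Pt d → Pt d → 𝒯.Sum} (h : incrNorm σ 𝒯 p γ η D < ∞) {x y : Pt d}
    (hx : x 0 ≠ 0) (hy : y 0 ≠ 0) (hp : 0 < p.w x) (hs : 1 ≤ p.star (x - y)) {α : ℝ} (hα : α < γ)
    (hself : x = y → D y x α = 0) :
    ‖D y x α‖ ≤ (incrNorm σ 𝒯 p γ η D).toReal * (σ.phi₂ x y ^ (η - γ) *
      ((p.w x)⁻¹ * p.star (x - y)) * σ.nrm (y - x) ^ (γ - α)) := by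
  have hφ := phi₂_pos (σ := σ) hx hy
  have h0 : 0 ≤ (incrNorm σ 𝒯 p γ η D).toReal := ENNReal.toReal_nonneg
  have hn0 := σ.nrm_nonneg (y - x)
  have hR : 0 ≤ (incrNorm σ 𝒯 p γ η D).toReal * (σ.phi₂ x y ^ (η - γ) *
      ((p.w x)⁻¹ * p.star (x - y)) * σ.nrm (y - x) ^ (γ - α)) := by positivity
  by_cases hz : D y x α = 0
  · rwa [hz, norm_zero]
  have hA : α ∈ A.carrier := by
    by_contra hA; exact hz (RegStructure.eq_zero_of_notMem hA _)
  have hxy : x ≠ y := fun e => hz (hself e)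
  have hn := σ.nrm_pos (sub_ne_zero.2 hxy.symm)
  have := (incrNorm_le_iff h0).1 (ENNReal.ofReal_toReal h.ne).ge α hA hα x y hx hy hxy
  rw [div_le_iff₀ (by positivity)] at this
  calc ‖D y x α‖ = (p.w x)⁻¹ * (p.w x * ‖D y x α‖) := by field_simp
    _ ≤ (p.w x)⁻¹ * _ := mul_le_mul_of_nonneg_left this (inv_pos.2 hp).le
    _ = _ := by ring

theorem abs_le_of_recNorm {R : ℝ → Pt d → ℝ} (h : recNorm σ p γ η R < ∞) {t : ℝ} (ht : 0 < t)
    (ht1 : t ≤ 1) {x : Pt d} (hx : x 0 ≠ 0) (hp : 0 < p.w x) :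
    |R t x| ≤ (recNorm σ p γ η R).toReal *
      (t ^ (γ / σ.ell) * σ.phi x ^ (η - γ) * (p.w x)⁻¹) := by
  have hφ := σ.phi_pos hx
  have h0 : 0 ≤ (recNorm σ p γ η R).toReal := ENNReal.toReal_nonneg
  have := (recNorm_le_iff h0).1 (ENNReal.ofReal_toReal h.ne).ge t ht ht1 x hx
  have e1 : t ^ (-γ / σ.ell) * t ^ (γ / σ.ell) = 1 := by
    rw [← Real.rpow_add ht, neg_div, neg_add_cancel, Real.rpow_zero]
  have e2 : σ.phi x ^ (γ - η) * σ.phi x ^ (η - γ) = 1 := by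
    rw [← Real.rpow_add hφ, sub_add_sub_cancel, sub_self, Real.rpow_zero]
  calc |R t x| = (t ^ (-γ / σ.ell) * t ^ (γ / σ.ell)) * (σ.phi x ^ (γ - η) * σ.phi x ^ (η - γ)) *
        (p.w x * (p.w x)⁻¹) * |R t x| := by
        rw [e1, e2, mul_inv_cancel₀ hp.ne']; ring
    _ = (t ^ (-γ / σ.ell) * σ.phi x ^ (γ - η) * p.w x * |R t x|) *
        (t ^ (γ / σ.ell) * σ.phi x ^ (η - γ) * (p.w x)⁻¹) := by ring
    _ ≤ _ := mul_le_mul_of_nonneg_right this (by positivity)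

theorem sizeNorm_sub_le (hp : ∀ x, 0 ≤ p.w x) (f f' : Pt d → 𝒯.Sum) :
    sizeNorm σ 𝒯 p γ η (fun x => f x - f' x) ≤ sizeNorm σ 𝒯 p γ η f + sizeNorm σ 𝒯 p γ η f' := by
  refine iSup_le fun α => iSup_le fun hα => iSup_le fun x => iSup_le fun hx => ?_
  have hF : ∀ f : Pt d → 𝒯.Sum, ENNReal.ofReal (p.w x * ‖f x α‖ / σ.phi x ^ min (η - α) 0) ≤
      sizeNorm σ 𝒯 p γ η f := fun f =>
    le_iSup_of_le α (le_iSup_of_le hα (le_iSup_of_le x (le_iSup_of_le hx le_rfl)))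
  refine le_trans ?_ (add_le_add (hF f) (hF f'))
  have h0 : ∀ f : Pt d → 𝒯.Sum, 0 ≤ p.w x * ‖f x α‖ / σ.phi x ^ min (η - α) 0 := fun f =>
    div_nonneg (mul_nonneg (hp x) (norm_nonneg _)) (Real.rpow_nonneg (σ.phi_nonneg x) _)
  rw [← ENNReal.ofReal_add (h0 f) (h0 f'), ← add_div, ← mul_add]
  refine ENNReal.ofReal_le_ofReal (div_le_div_of_nonneg_right (mul_le_mul_of_nonneg_left ?_ (hp x))
    (Real.rpow_nonneg (σ.phi_nonneg x) _))
  rw [DFinsupp.sub_apply]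
  exact norm_sub_le _ _

theorem incrNorm_sub_le (hp : ∀ x, 0 ≤ p.w x) (hs : ∀ x, 0 ≤ p.star x) (D D' : Pt d → Pt d → 𝒯.Sum) :
    incrNorm σ 𝒯 p γ η (fun y x => D y x - D' y x) ≤
      incrNorm σ 𝒯 p γ η D + incrNorm σ 𝒯 p γ η D' := by
  refine iSup_le fun α => iSup_le fun hα => iSup_le fun x => iSup_le fun y => iSup_le fun hx => ?_
  set m := σ.phi₂ x y ^ (η - γ) * p.star (x - y) * σ.nrm (y - x) ^ (γ - α) with hm
  have hm0 : 0 ≤ m := mul_nonneg (mul_nonneg (Real.rpow_nonneg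
    (phi₂_pos (σ := σ) hx.1 hx.2.1).le _) (hs _)) (Real.rpow_nonneg (σ.nrm_nonneg _) _)
  have hF : ∀ f : Pt d → Pt d → 𝒯.Sum, ENNReal.ofReal (p.w x * ‖f y x α‖ / m) ≤
      incrNorm σ 𝒯 p γ η f := fun f =>
    le_iSup_of_le α (le_iSup_of_le hα (le_iSup_of_le x (le_iSup_of_le y (le_iSup_of_le hx le_rfl))))
  refine le_trans ?_ (add_le_add (hF D) (hF D'))
  have h0 : ∀ f : Pt d → Pt d → 𝒯.Sum, 0 ≤ p.w x * ‖f y x α‖ / m := fun f =>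
    div_nonneg (mul_nonneg (hp x) (norm_nonneg _)) hm0
  rw [← ENNReal.ofReal_add (h0 D) (h0 D'), ← add_div, ← mul_add]
  refine ENNReal.ofReal_le_ofReal (div_le_div_of_nonneg_right (mul_le_mul_of_nonneg_left ?_ (hp x))
    hm0)
  rw [DFinsupp.sub_apply]
  exact norm_sub_le _ _

theorem recNorm_sub_le (hp : ∀ x, 0 ≤ p.w x) (R R' : ℝ → Pt d → ℝ) :
    recNorm σ p γ η (fun t x => R t x - R' t x) ≤ recNorm σ p γ η R + recNorm σ p γ η R' := by
  refine iSup_le fun t => iSup_le fun ht => iSup_le fun x => iSup_le fun hx => ?_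
  have hF : ∀ f : ℝ → Pt d → ℝ, ENNReal.ofReal (t ^ (-γ / σ.ell) * σ.phi x ^ (γ - η) * p.w x *
      |f t x|) ≤ recNorm σ p γ η f := fun f =>
    le_iSup_of_le t (le_iSup_of_le ht (le_iSup_of_le x (le_iSup_of_le hx le_rfl)))
  refine le_trans ?_ (add_le_add (hF R) (hF R'))
  have hm : 0 ≤ t ^ (-γ / σ.ell) * σ.phi x ^ (γ - η) * p.w x :=
    mul_nonneg (mul_nonneg (Real.rpow_nonneg ht.1.le _) (Real.rpow_nonneg (σ.phi_nonneg x) _)) (hp x)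
  rw [← ENNReal.ofReal_add (mul_nonneg hm (abs_nonneg _)) (mul_nonneg hm (abs_nonneg _)), ← mul_add]
  exact ENNReal.ofReal_le_ofReal (mul_le_mul_of_nonneg_left (abs_sub _ _) hm)

end ModelledNorms

/-! ### Two sets of data as one abstract lift. -/

section Pieces

variable [NeZero d] {A : IndexSet} {𝒯 : RegStructure.{u} A} {σ : Scaling d} {Q : Ker d}
  {w v : Weight d} {G : Pt d → ℝ} {γ η ζ : ℝ}

/-- The component of `Π_x f(x)` of homogeneity `α`, smeared at scale `s` around `z`. -/
def Model.sizePiece (M : Model σ 𝒯 Q w) (f : Pt d → 𝒯.Sum) (x : Pt d) (α s : ℝ) (z : Pt d) : ℝ :=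
  M.evalAt s z x (𝒯.emb α (f x α))

/-- The component of `Π_y Δ_{yx} f` of homogeneity `α`, smeared at scale `s` around `z`. -/
def Model.incPiece (M : Model σ 𝒯 Q w) (f : Pt d → 𝒯.Sum) (y x : Pt d) (α s : ℝ) (z : Pt d) : ℝ :=
  M.evalAt s z y (𝒯.emb α (incr M.Γ f y x α))

/-- The analogue of `abs_apply_le_env` for an increment: components of size ‖z-x‖^{γ-β} all
contribute the order s^{γ/ℓ}. -/
theorem abs_apply_le_rem {p c s : ℝ} {N : ℕ} (hN : γ - A.reg ≤ N) (hs : 0 < s) {x z : Pt d}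
    (hz : 0 < w.w z) (hp : 0 ≤ p) (P : 𝒯.Sum →ₗ[ℝ] ℝ)
    (hP : ∀ β, β < γ → ∀ τ : 𝒯.T β, |P (𝒯.emb β τ)| ≤ p * (s ^ (β / σ.ell) * (w.w z)⁻¹ * ‖τ‖))
    {T : 𝒯.Sum} (hT : 𝒯.IsBelow γ T) (hc : 0 ≤ c)
    (hTb : ∀ β, β < γ → ‖T β‖ ≤ c * σ.nrm (z - x) ^ (γ - β)) :
    |P T| ≤ (A.below γ).card * (p * c) *
      (s ^ (γ / σ.ell) * (w.w z)⁻¹ * σ.rho s (x - z) ^ N) := by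
  have hzi := inv_pos.2 hz
  conv_lhs => rw [hT.eq_sum, map_sum]
  rw [mul_assoc, ← nsmul_eq_mul]
  refine (Finset.abs_sum_le_sum_abs _ _).trans (Finset.sum_le_card_nsmul _ _ _ fun β hβ => ?_)
  obtain ⟨h1, h2⟩ := IndexSet.mem_below.1 hβ
  have hr := σ.nrm_rpow_le (c := γ - β) (N := N) hs (by linarith)
    (by have := IndexSet.reg_le h1; linarith) (z - x)
  rw [σ.rho_sub_comm] at hr
  have e : s ^ (β / σ.ell) * s ^ ((γ - β) / σ.ell) = s ^ (γ / σ.ell) := by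
    rw [← Real.rpow_add hs]; congr 1; ring
  calc |P (𝒯.emb β (T β))| ≤ p * (s ^ (β / σ.ell) * (w.w z)⁻¹ * ‖T β‖) := hP β h2 _
    _ ≤ p * (s ^ (β / σ.ell) * (w.w z)⁻¹ *
        (c * (s ^ ((γ - β) / σ.ell) * σ.rho s (x - z) ^ N))) := by
        have := (hTb β h2).trans (mul_le_mul_of_nonneg_left hr hc)
        gcongr
    _ = p * c * ((s ^ (β / σ.ell) * s ^ ((γ - β) / σ.ell)) * (w.w z)⁻¹ * σ.rho s (x - z) ^ N) := by
        ring
    _ = _ := by rw [e]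

theorem phi₂_rpow_le (x z : Pt d) (e : ℝ) :
    σ.phi₂ x z ^ e ≤ σ.phi x ^ e + σ.phi z ^ e := by
  have h1 := Real.rpow_nonneg (σ.phi_nonneg x) e
  have h2 := Real.rpow_nonneg (σ.phi_nonneg z) e
  unfold Scaling.phi₂
  rcases min_choice (σ.phi x) (σ.phi z) with h | h <;> rw [h] <;> linarith

theorem Model.incr_self (M : Model σ 𝒯 Q w) (f : Pt d → 𝒯.Sum) (x : Pt d) :
    incr M.Γ f x x = 0 := by
  unfold incr; rw [M.Γ_self, sub_self]

/-- Π_yΔ_{yx}f = Π_yf(y) - Π_yΓ_{yx}f(x), where the cocycle identity rewrites the last term as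
Π_xf(x) tested at an arbitrary point z. -/
theorem Model.sum_incPiece (M : Model σ 𝒯 Q w) (hQ : IsSemigroup σ G Q) (hw : w.IsControlled σ G)
    (hG0 : ∀ x, 0 ≤ G x) {f : Pt d → 𝒯.Sum} {x y : Pt d} (hx : 𝒯.IsBelow γ (f x))
    (hy : 𝒯.IsBelow γ (f y)) (s : ℝ) (z : Pt d) :
    ∑ α ∈ A.below γ, M.incPiece f y x α s z =
      ∑ α ∈ A.below γ, M.sizePiece f y α s z - ∑ α ∈ A.below γ, M.sizePiece f x α s z := by
  unfold Model.incPiece Model.sizePiece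
  rw [← M.evalAt_eq_sum (M.isBelow_incr hx hy), ← M.evalAt_eq_sum hx, ← M.evalAt_eq_sum hy]
  unfold Model.evalAt incr
  rw [map_sub, map_sub, M.Γ_comp hQ hw hG0 hx]

theorem MemD.sizeNorm_lt_top {Γ : Pt d → Pt d → 𝒯.Sum →ₗ[ℝ] 𝒯.Sum} {f : Pt d → 𝒯.Sum}
    (h : MemD σ v γ η Γ f) : sizeNorm σ 𝒯 v γ η f < ∞ := (ENNReal.add_lt_top.1 h.2).1

theorem MemD.sharpNorm_lt_top {Γ : Pt d → Pt d → 𝒯.Sum →ₗ[ℝ] 𝒯.Sum} {f : Pt d → 𝒯.Sum}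
    (h : MemD σ v γ η Γ f) : sharpNorm σ v γ η Γ f < ∞ := (ENNReal.add_lt_top.1 h.2).2

/-- The constant that controls pieces built from two models, in terms of the norm `n` of the first
modelled distribution and the distance `e` of the two. -/
def Model.pieceConst (M₁ M₂ : Model σ 𝒯 Q w) (γ n e : ℝ) : ℝ :=
  (A.below γ).card * ((M₁.distPi M₂ γ).toReal * ((1 + (M₁.normΓ γ).toReal) * n) +
    (M₂.normPi γ).toReal * ((M₁.distΓ M₂ γ).toReal * n) +
    (M₂.normPi γ).toReal * ((1 + (M₂.normΓ γ).toReal) * e))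

/-- The constant that controls the difference of two remainders. -/
def Model.remConst (M₁ M₂ : Model σ 𝒯 Q w) (γ n e r : ℝ) : ℝ :=
  r + (A.below γ).card * ((M₁.distPi M₂ γ).toReal * n + (M₂.normPi γ).toReal * e)

theorem Model.pieceConst_nonneg (M₁ M₂ : Model σ 𝒯 Q w) {n e : ℝ} (hn : 0 ≤ n) (he : 0 ≤ e) :
    0 ≤ M₁.pieceConst M₂ γ n e := by
  have h1 : 0 ≤ (M₁.distPi M₂ γ).toReal := ENNReal.toReal_nonneg
  have h2 : 0 ≤ (M₁.normΓ γ).toReal := ENNReal.toReal_nonneg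
  have h3 : 0 ≤ (M₂.normPi γ).toReal := ENNReal.toReal_nonneg
  have h4 : 0 ≤ (M₁.distΓ M₂ γ).toReal := ENNReal.toReal_nonneg
  have h5 : 0 ≤ (M₂.normΓ γ).toReal := ENNReal.toReal_nonneg
  unfold Model.pieceConst
  generalize (M₁.distPi M₂ γ).toReal = a at *
  generalize (M₁.normΓ γ).toReal = a at *
  generalize (M₂.normPi γ).toReal = a at *
  generalize (M₁.distΓ M₂ γ).toReal = a at *
  generalize (M₂.normΓ γ).toReal = a at *
  positivity

theorem Model.remConst_nonneg (M₁ M₂ : Model σ 𝒯 Q w) {n e r : ℝ} (hn : 0 ≤ n) (he : 0 ≤ e)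
    (hr : 0 ≤ r) : 0 ≤ M₁.remConst M₂ γ n e r := by
  have h1 : 0 ≤ (M₁.distPi M₂ γ).toReal := ENNReal.toReal_nonneg
  have h3 : 0 ≤ (M₂.normPi γ).toReal := ENNReal.toReal_nonneg
  unfold Model.remConst
  generalize (M₁.distPi M₂ γ).toReal = a at *
  generalize (M₂.normPi γ).toReal = a at *
  positivity

theorem Model.abs_evalAt_sub_le_pieceConst (M₁ M₂ : Model σ 𝒯 Q w) (hw : w.IsControlled σ G)
    {α : ℝ} {N : ℕ} (hN : γ - A.reg ≤ N) (hα : α < γ) {s : ℝ} (hs : 0 < s) (hs1 : s ≤ 1)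
    (z x : Pt d) {τ₁ τ₂ : 𝒯.T α} {n e X : ℝ} (h1 : ‖τ₁‖ ≤ n * X)
    (h2 : ‖τ₁ - τ₂‖ ≤ e * X) :
    |M₁.evalAt s z x (𝒯.emb α τ₁) - M₂.evalAt s z x (𝒯.emb α τ₂)| ≤
      M₁.pieceConst M₂ γ n e * X * s ^ (α / σ.ell) * w.env σ N s z x := by
  refine (M₁.abs_evalAt_sub_le M₂ hw hN hα hs hs1 z x τ₁ τ₂).trans ?_
  have he := hw.env_nonneg (N := N) hs z x
  have g1 : 0 ≤ (M₁.distPi M₂ γ).toReal := ENNReal.toReal_nonneg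
  have g2 : 0 ≤ (M₁.normΓ γ).toReal := ENNReal.toReal_nonneg
  have g3 : 0 ≤ (M₂.normPi γ).toReal := ENNReal.toReal_nonneg
  have g4 : 0 ≤ (M₁.distΓ M₂ γ).toReal := ENNReal.toReal_nonneg
  have g5 : 0 ≤ (M₂.normΓ γ).toReal := ENNReal.toReal_nonneg
  unfold Model.pieceConst
  generalize (M₁.distPi M₂ γ).toReal = a₁ at *
  generalize (M₁.normΓ γ).toReal = a₂ at *
  generalize (M₂.normPi γ).toReal = a₃ at *
  generalize (M₁.distΓ M₂ γ).toReal = a₄ at *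
  generalize (M₂.normΓ γ).toReal = a₅ at *
  calc _ ≤ (A.below γ).card * (a₁ * ((1 + a₂) * (n * X)) + a₃ * (a₄ * (n * X)) +
        a₃ * ((1 + a₅) * (e * X))) * (s ^ (α / σ.ell) * w.env σ N s z x) := by gcongr
    _ = _ := by ring

/-- Since Λ_x - Λ_z = Π_zf(z) - Π_xf(x) = Π_zΔ_{zx}f, the remainder at x tested around z differs
from its value centred at z only by a tested increment. The difference of two such terms is
telescoped in Π and in Δ. -/
theorem abs_rem_sub_centered_le (hw : w.IsControlled σ G) (hv : v.IsControlled σ G) {N : ℕ}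
    (hN : γ - A.reg ≤ N) (M₁ M₂ : Model σ 𝒯 Q w) {f₁ f₂ : Pt d → 𝒯.Sum}
    {Λ₁ Λ₂ : Besov σ Q ζ (w * v).w} (hf₁ : MemD σ v γ η M₁.Γ f₁) (hf₂ : MemD σ v γ η M₂.Γ f₂)
    {x z : Pt d} (hx : x 0 ≠ 0) (hz : z 0 ≠ 0) {s : ℝ} (hs : 0 < s) (hs1 : s ≤ 1) :
    |Λ₁.Qt s z - Λ₂.Qt s z - ∑ α ∈ A.below γ,
        (M₁.sizePiece f₁ x α s z - M₂.sizePiece f₂ x α s z) -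
        (centered M₁ f₁ Λ₁ s z - centered M₂ f₂ Λ₂ s z)| ≤
      (A.below γ).card * ((M₁.distPi M₂ γ).toReal * (sharpNorm σ v γ η M₁.Γ f₁).toReal +
        (M₂.normPi γ).toReal *
          (incrNorm σ 𝒯 v γ η (fun y x => incr M₁.Γ f₁ y x - incr M₂.Γ f₂ y x)).toReal) *
        (s ^ (γ / σ.ell) * ((w * v).w x)⁻¹ * ((w * v).star (x - z) * σ.rho s (x - z) ^ N *
          (σ.phi x ^ (η - γ) + σ.phi z ^ (η - γ)))) := by
  have hidiff := (incrNorm_sub_le (σ := σ) (γ := γ) (η := η) (fun x => (hv.pos x).le)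
    hv.star_nonneg (incr M₁.Γ f₁) (incr M₂.Γ f₂)).trans_lt
    (ENNReal.add_lt_top.2 ⟨hf₁.sharpNorm_lt_top, hf₂.sharpNorm_lt_top⟩)
  set R := s ^ (γ / σ.ell) * ((w * v).w x)⁻¹ * ((w * v).star (x - z) * σ.rho s (x - z) ^ N *
    (σ.phi x ^ (η - γ) + σ.phi z ^ (η - γ))) with hR
  have hφx := Real.rpow_nonneg (σ.phi_nonneg x) (η - γ)
  have hφz := Real.rpow_nonneg (σ.phi_nonneg z) (η - γ)
  have hρ : 1 ≤ σ.rho s (x - z) ^ N := one_le_pow₀ (σ.one_le_rho hs _)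
  have hvx := inv_pos.2 (hv.pos x)
  have hvs := hv.star_nonneg (x - z)
  have hz0 := inv_pos.2 (hw.pos z)
  have hwz := hw.inv_le x z
  set Y := σ.phi₂ x z ^ (η - γ) * ((v.w x)⁻¹ * v.star (x - z)) with hY
  have hY0 : 0 ≤ Y := mul_nonneg (Real.rpow_nonneg (phi₂_pos (σ := σ) hx hz).le _) (by positivity)
  have hYR : Y * (s ^ (γ / σ.ell) * (w.w z)⁻¹ * σ.rho s (x - z) ^ N) ≤ R := by
    have h1 : (w.w z)⁻¹ * Y ≤ (w.star (x - z) * (w.w x)⁻¹) *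
        ((σ.phi x ^ (η - γ) + σ.phi z ^ (η - γ)) * ((v.w x)⁻¹ * v.star (x - z))) := by
      refine mul_le_mul hwz ?_ hY0 (hz0.le.trans hwz)
      exact mul_le_mul_of_nonneg_right (phi₂_rpow_le x z _) (by positivity)
    have e1 : ((w * v).w x)⁻¹ = (w.w x)⁻¹ * (v.w x)⁻¹ := by rw [← mul_inv]; rfl
    have e2 : (w * v).star (x - z) = w.star (x - z) * v.star (x - z) := rfl
    have h2 := mul_le_mul_of_nonneg_left h1
      (by positivity : 0 ≤ s ^ (γ / σ.ell) * σ.rho s (x - z) ^ N)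
    rw [hR, e1, e2]
    linarith
  have hi₁ := M₁.isBelow_incr (hf₁.1 x hx) (hf₁.1 z hz)
  have hi₂ := M₂.isBelow_incr (hf₂.1 x hx) (hf₂.1 z hz)
  have b1 : ∀ β, β < γ → ‖incr M₁.Γ f₁ z x β‖ ≤ (sharpNorm σ v γ η M₁.Γ f₁).toReal * Y *
      σ.nrm (z - x) ^ (γ - β) := fun β hβ => by
    rw [mul_assoc]
    exact norm_le_of_incrNorm (D := incr M₁.Γ f₁) hf₁.sharpNorm_lt_top hx hz (hv.pos x)
      (hv.one_le_star _) hβ (fun e => by rw [e, M₁.incr_self]; rfl)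
  have b2 : ∀ β, β < γ → ‖(incr M₁.Γ f₁ z x - incr M₂.Γ f₂ z x) β‖ ≤
      (incrNorm σ 𝒯 v γ η (fun y x => incr M₁.Γ f₁ y x - incr M₂.Γ f₂ y x)).toReal * Y *
      σ.nrm (z - x) ^ (γ - β) := fun β hβ => by
    rw [mul_assoc]
    exact norm_le_of_incrNorm hidiff hx hz (hv.pos x) (hv.one_le_star _) hβ
      (fun e => by rw [e, M₁.incr_self, M₂.incr_self, sub_zero]; rfl)
  have c1 := abs_apply_le_rem hN hs (hw.pos z) ENNReal.toReal_nonneg (M₁.QPi s z - M₂.QPi s z)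
    (fun β hβ τ => M₁.abs_QPi_sub_le M₂ hw hβ hs hs1 z τ) hi₁
    (mul_nonneg ENNReal.toReal_nonneg hY0) b1
  have c2 := abs_apply_le_rem hN hs (hw.pos z) ENNReal.toReal_nonneg (M₂.QPi s z)
    (fun β hβ τ => M₂.abs_QPi_le hw hβ hs hs1 z τ) (hi₁.sub hi₂)
    (mul_nonneg ENNReal.toReal_nonneg hY0) b2
  have key : (Λ₁.Qt s z - Λ₂.Qt s z) - ∑ α ∈ A.below γ,
      (M₁.sizePiece f₁ x α s z - M₂.sizePiece f₂ x α s z) -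
      (centered M₁ f₁ Λ₁ s z - centered M₂ f₂ Λ₂ s z) =
      (M₁.QPi s z - M₂.QPi s z) (incr M₁.Γ f₁ z x) +
      M₂.QPi s z (incr M₁.Γ f₁ z x - incr M₂.Γ f₂ z x) := by
    unfold Model.sizePiece
    rw [Finset.sum_sub_distrib, ← M₁.evalAt_eq_sum (hf₁.1 x hx),
      ← M₂.evalAt_eq_sum (hf₂.1 x hx)]
    simp only [Model.evalAt, centered, incr, map_sub, LinearMap.sub_apply]
    ring
  rw [key]
  refine (abs_add_le _ _).trans ((add_le_add c1 c2).trans ?_)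
  have g1 : 0 ≤ (M₁.distPi M₂ γ).toReal := ENNReal.toReal_nonneg
  have g3 : 0 ≤ (M₂.normPi γ).toReal := ENNReal.toReal_nonneg
  have g4 : 0 ≤ (sharpNorm σ v γ η M₁.Γ f₁).toReal := ENNReal.toReal_nonneg
  have g5 : 0 ≤ (incrNorm σ 𝒯 v γ η
    (fun y x => incr M₁.Γ f₁ y x - incr M₂.Γ f₂ y x)).toReal := ENNReal.toReal_nonneg
  generalize (M₁.distPi M₂ γ).toReal = a at *
  generalize (M₂.normPi γ).toReal = b at *
  generalize (sharpNorm σ v γ η M₁.Γ f₁).toReal = c at *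
  generalize (incrNorm σ 𝒯 v γ η
    (fun y x => incr M₁.Γ f₁ y x - incr M₂.Γ f₂ y x)).toReal = e at *
  have h1 := mul_le_mul_of_nonneg_left hYR
    (by positivity : 0 ≤ ((A.below γ).card : ℝ) * (a * c))
  have h2 := mul_le_mul_of_nonneg_left hYR
    (by positivity : 0 ≤ ((A.below γ).card : ℝ) * (b * e))
  linarith

theorem Besov.norm_sub_lt_top {p : Weight d} (Λ₁ : Besov σ Q ζ p.w) (hQ : IsSemigroup σ G Q)
    (hp : p.IsControlled σ G) (hG0 : ∀ x, 0 ≤ G x) (hζ : ζ ≤ 0) (Λ₂ : Besov σ Q ζ p.w) :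
    besovNorm σ ζ p.w (fun t x => Λ₁.Qt t x - Λ₂.Qt t x) < ∞ := by
  have h1 := besovNorm_add_le (σ := σ) (α := ζ) (fun x => (hp.pos x).le) Λ₁.Qt
    (fun t x => 0 - Λ₂.Qt t x)
  rw [besovNorm_sub_comm] at h1
  simp only [sub_zero, zero_sub, ← sub_eq_add_neg] at h1
  exact h1.trans_lt (ENNReal.add_lt_top.2 ⟨Λ₁.norm_lt_top hQ hp hG0 hζ,
    Λ₂.norm_lt_top hQ hp hG0 hζ⟩)

/-- The abstract estimates use only linear relations between reconstruction, local expansion and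
increments, so differences of two sets of data satisfy them, with constants that contain the
distances. -/
theorem liftData_sub (hQ : IsSemigroup σ G Q) (hw : w.IsControlled σ G) (hv : v.IsControlled σ G)
    (hu : (w * v).IsControlled σ G) (hG0 : ∀ x, 0 ≤ G x) (hζ : ζ ≤ 0) {N : ℕ}
    (hN : γ - A.reg ≤ N) (M₁ M₂ : Model σ 𝒯 Q w) {f₁ f₂ : Pt d → 𝒯.Sum}
    {Λ₁ Λ₂ : Besov σ Q ζ (w * v).w} (hf₁ : MemD σ v γ η M₁.Γ f₁) (hf₂ : MemD σ v γ η M₂.Γ f₂)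
    (hΛ₁ : IsReconstruction γ η M₁ f₁ Λ₁) (hΛ₂ : IsReconstruction γ η M₂ f₂ Λ₂) :
    LiftData σ w v (A.below γ) N γ η ζ
      (besovNorm σ ζ (w * v).w (fun t x => Λ₁.Qt t x - Λ₂.Qt t x)).toReal
      (M₁.pieceConst M₂ γ (sizeNorm σ 𝒯 v γ η f₁).toReal
        (sizeNorm σ 𝒯 v γ η (fun x => f₁ x - f₂ x)).toReal)
      (M₁.pieceConst M₂ γ (sharpNorm σ v γ η M₁.Γ f₁).toReal
        (incrNorm σ 𝒯 v γ η (fun y x => incr M₁.Γ f₁ y x - incr M₂.Γ f₂ y x)).toReal)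
      (M₁.remConst M₂ γ (sharpNorm σ v γ η M₁.Γ f₁).toReal
        (incrNorm σ 𝒯 v γ η (fun y x => incr M₁.Γ f₁ y x - incr M₂.Γ f₂ y x)).toReal
        (recDist γ η M₁ M₂ f₁ f₂ Λ₁ Λ₂).toReal)
      (fun s z => Λ₁.Qt s z - Λ₂.Qt s z)
      (fun x α s z => M₁.sizePiece f₁ x α s z - M₂.sizePiece f₂ x α s z)
      (fun y x α s z => M₁.incPiece f₁ y x α s z - M₂.incPiece f₂ y x α s z) := by
  have hv0 := fun x => (hv.pos x).le
  have hdiff := (sizeNorm_sub_le (σ := σ) (γ := γ) (η := η) hv0 f₁ f₂).trans_lt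
    (ENNReal.add_lt_top.2 ⟨hf₁.sizeNorm_lt_top, hf₂.sizeNorm_lt_top⟩)
  have hidiff := (incrNorm_sub_le (σ := σ) (γ := γ) (η := η) hv0 hv.star_nonneg (incr M₁.Γ f₁)
    (incr M₂.Γ f₂)).trans_lt
    (ENNReal.add_lt_top.2 ⟨hf₁.sharpNorm_lt_top, hf₂.sharpNorm_lt_top⟩)
  have hrdiff : recDist γ η M₁ M₂ f₁ f₂ Λ₁ Λ₂ < ∞ :=
    (recNorm_sub_le (σ := σ) (γ := γ) (η := η) (fun x => (hu.pos x).le) (centered M₁ f₁ Λ₁)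
    (centered M₂ f₂ Λ₂)).trans_lt (ENNReal.add_lt_top.2 ⟨hΛ₁, hΛ₂⟩)
  have hbdiff : besovNorm σ ζ (w * v).w (fun t x => Λ₁.Qt t x - Λ₂.Qt t x) < ∞ :=
    Λ₁.norm_sub_lt_top hQ hu hG0 hζ Λ₂
  have hmem : ∀ {α}, α ∈ A.below γ → α < γ := fun h => (IndexSet.mem_below.1 h).2
  refine ⟨fun s hs hs1 => (Λ₁.measurable_Qt hQ hu hs hs1).sub (Λ₂.measurable_Qt hQ hu hs hs1),
    fun x hx α hα s hs hs1 => ?_, fun x hx y hy α hα s hs hs1 => ?_, fun s hs hs1 z => ?_,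
    fun x hx α hα s hs hs1 z => ?_, fun x hx y hy α hα s hs hs1 z => ?_,
    fun x hx z hz s hs hs1 => ?_, fun x hx y hy s hs hs1 z => ?_⟩
  · exact (M₁.measurable_evalAt hQ hw hG0 x (RegStructure.isBelow_emb (hmem hα) _) hs hs1).sub
      (M₂.measurable_evalAt hQ hw hG0 x (RegStructure.isBelow_emb (hmem hα) _) hs hs1)
  · exact (M₁.measurable_evalAt hQ hw hG0 y (RegStructure.isBelow_emb (hmem hα) _) hs hs1).sub
      (M₂.measurable_evalAt hQ hw hG0 y (RegStructure.isBelow_emb (hmem hα) _) hs hs1)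
  · exact abs_le_of_besovNorm (F := fun t x => Λ₁.Qt t x - Λ₂.Qt t x) hbdiff hs hs1 (hu.pos z)
  · have h1 := norm_le_of_sizeNorm hf₁.sizeNorm_lt_top hx (hv.pos x) (hmem hα)
    have h2 := norm_le_of_sizeNorm hdiff hx (hv.pos x) (hmem hα)
    exact M₁.abs_evalAt_sub_le_pieceConst M₂ hw hN (hmem hα) hs hs1 z x h1 h2
  · have h1 := norm_le_of_incrNorm (D := incr M₁.Γ f₁) hf₁.sharpNorm_lt_top hx hy (hv.pos x)
      (hv.one_le_star _) (hmem hα) (fun e => by rw [e, M₁.incr_self]; rfl)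
    have h2 := norm_le_of_incrNorm hidiff hx hy (hv.pos x) (hv.one_le_star _) (hmem hα)
      (fun e => by rw [e, M₁.incr_self, M₂.incr_self, sub_zero]; rfl)
    exact M₁.abs_evalAt_sub_le_pieceConst M₂ hw hN (hmem hα) hs hs1 z y h1 h2
  · have hux := inv_pos.2 (hu.pos x)
    have hus := hu.star_nonneg (x - z)
    have hφx := Real.rpow_nonneg (σ.phi_nonneg x) (η - γ)
    have hφz := Real.rpow_nonneg (σ.phi_nonneg z) (η - γ)
    have hrec : |centered M₁ f₁ Λ₁ s z - centered M₂ f₂ Λ₂ s z| ≤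
        (recDist γ η M₁ M₂ f₁ f₂ Λ₁ Λ₂).toReal * (s ^ (γ / σ.ell) * ((w * v).w x)⁻¹ *
          ((w * v).star (x - z) * σ.rho s (x - z) ^ N *
            (σ.phi x ^ (η - γ) + σ.phi z ^ (η - γ)))) := by
      refine (abs_le_of_recNorm (R := fun t x => centered M₁ f₁ Λ₁ t x - centered M₂ f₂ Λ₂ t x)
        hrdiff hs hs1 hz (hu.pos z)).trans ?_
      refine mul_le_mul_of_nonneg_left ?_ ENNReal.toReal_nonneg
      calc s ^ (γ / σ.ell) * σ.phi z ^ (η - γ) * ((w * v).w z)⁻¹ ≤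
          s ^ (γ / σ.ell) * (σ.phi x ^ (η - γ) + σ.phi z ^ (η - γ)) *
            ((w * v).star (x - z) * ((w * v).w x)⁻¹) * 1 := by
            rw [mul_one]
            have := inv_pos.2 (hu.pos z)
            have := hu.inv_le x z
            gcongr
            linarith
        _ ≤ s ^ (γ / σ.ell) * (σ.phi x ^ (η - γ) + σ.phi z ^ (η - γ)) *
            ((w * v).star (x - z) * ((w * v).w x)⁻¹) * σ.rho s (x - z) ^ N := by
            have := one_le_pow₀ (σ.one_le_rho hs (x - z)) (n := N)
            gcongr
        _ = _ := by ring
    have h1 := abs_rem_sub_centered_le hw hv hN M₁ M₂ hf₁ hf₂ (Λ₁ := Λ₁) (Λ₂ := Λ₂) hx hz hs hs1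
    have h2 := abs_add_le (Λ₁.Qt s z - Λ₂.Qt s z - ∑ α ∈ A.below γ,
      (M₁.sizePiece f₁ x α s z - M₂.sizePiece f₂ x α s z) -
      (centered M₁ f₁ Λ₁ s z - centered M₂ f₂ Λ₂ s z))
      (centered M₁ f₁ Λ₁ s z - centered M₂ f₂ Λ₂ s z)
    rw [sub_add_cancel] at h2
    refine h2.trans ((add_le_add h1 hrec).trans (le_of_eq ?_))
    unfold Model.remConst
    ring
  · rw [Finset.sum_sub_distrib, Finset.sum_sub_distrib, Finset.sum_sub_distrib,
      M₁.sum_incPiece hQ hw hG0 (hf₁.1 x hx) (hf₁.1 y hy),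
      M₂.sum_incPiece hQ hw hG0 (hf₂.1 x hx) (hf₂.1 y hy)]
    ring

end Pieces

/-! ### Convergence and linearity of the kernel integrals. -/

section KernelIntegrals

variable [NeZero d] {A : IndexSet} {𝒯 : RegStructure.{u} A} {σ : Scaling d} {Q K : Ker d}
  {w v : Weight d} {G : Pt d → ℝ} {γ η ζ β βb δ CK : ℝ} {k : Idx d}

theorem kint_sub {t : ℝ} {x : Pt d} {a b : ℝ → Pt d → ℝ}
    (ha : Integrable (fun z => kderiv K k (t / 2) x z * a (t / 2) z))
    (hb : Integrable (fun z => kderiv K k (t / 2) x z * b (t / 2) z)) :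
    kint K k t x (fun s z => a s z - b s z) = kint K k t x a - kint K k t x b := by
  unfold kint
  rw [← integral_sub ha hb]
  simp only [mul_sub]

theorem IsRegularizing.integrable_model (hK : IsRegularizing σ G Q K βb δ CK)
    (hQ : IsSemigroup σ G Q) (hw : w.IsControlled σ G) (hG0 : ∀ x, 0 ≤ G x) (hd : w.HasDecay σ G)
    (hCK : 0 < CK) (hk : σ.deg k < δ) (M : Model σ 𝒯 Q w) (x : Pt d) {τ : 𝒯.Sum}
    (hτ : 𝒯.IsBelow γ τ) {t : ℝ} (ht : 0 < t) (ht1 : t ≤ 1) :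
    Integrable (fun z => kderiv K k (t / 2) x z * M.evalAt (t / 2) z x τ) :=
  M.integrable_pairing hQ hw hG0 hd x hτ (half_pos ht) (by linarith) (half_pos ht)
    (by linarith) (hK.measurable_kderiv k hk (half_pos ht) x)
    (p := CK * (t / 2) ^ ((βb - σ.deg k) / σ.ell - 1)) (by positivity)
    (fun z => hK.upper k hk _ (half_pos ht) x z)

theorem IsRegularizing.integrable_besov {u : Weight d} (hK : IsRegularizing σ G Q K βb δ CK)
    (hQ : IsSemigroup σ G Q) (hu : u.IsControlled σ G) (hG0 : ∀ x, 0 ≤ G x) (hCK : 0 < CK)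
    (hζ : ζ ≤ 0) (hk : σ.deg k < δ) (Λ : Besov σ Q ζ u.w) (x : Pt d) {t : ℝ} (ht : 0 < t)
    (ht1 : t ≤ 1) : Integrable (fun z => kderiv K k (t / 2) x z * Λ.Qt (t / 2) z) := by
  obtain ⟨C, hC, h⟩ := hu.exists_pairing hG0
  have ht2 := half_pos ht
  exact (h (t / 2) ht2 (by linarith) x (fun z => kderiv K k (t / 2) x z) (Λ.Qt (t / 2))
    (CK * (t / 2) ^ ((βb - σ.deg k) / σ.ell - 1))
    ((besovNorm σ ζ u.w Λ.Qt).toReal * (t / 2) ^ (ζ / σ.ell)) (by positivity)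
    (mul_nonneg ENNReal.toReal_nonneg (by positivity))
    (hK.aestronglyMeasurable_kderiv hk ht2 x)
    (Λ.measurable_Qt hQ hu ht2 (by linarith)).aestronglyMeasurable
    (fun z => hK.upper k hk _ ht2 x z)
    (fun z => abs_le_of_besovNorm (Λ.norm_lt_top hQ hu hG0 hζ) ht2 (by linarith) (hu.pos z))).1

/-- The integrand is of order t^{(α-|k|+βb)/ℓ-1}, which is integrable at 0 exactly because |k| < α +
βb. -/
theorem IsRegularizing.integrableOn_kint_model (hK : IsRegularizing σ G Q K βb δ CK)
    (hQ : IsSemigroup σ G Q) (hw : w.IsControlled σ G) (hG0 : ∀ x, 0 ≤ G x) (hd : w.HasDecay σ G)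
    (hCK : 0 < CK) (hk : σ.deg k < δ) (M : Model σ 𝒯 Q w) (x : Pt d) {α : ℝ} (τ : 𝒯.T α)
    (hα : σ.deg k < α + βb) :
    IntegrableOn (fun t => kint K k t x (fun s z => M.evalAt s z x (𝒯.emb α τ)))
      (Set.Ioc 0 1) := by
  -- Any threshold above α would do; the resulting constant is only used to show integrability.
  have hτ : 𝒯.IsBelow (α + 1) (𝒯.emb α τ) := RegStructure.isBelow_emb (by linarith) τ
  obtain ⟨N, hN⟩ := A.exists_nat (α + 1)
  obtain ⟨C, hC, h⟩ := hd.exists_env_pairing hw hG0 N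
  set B := ((A.below (α + 1)).card : ℝ) *
    ((M.normPi (α + 1)).toReal * ((1 + (M.normΓ (α + 1)).toReal) * ‖τ‖)) with hB
  have hB0 : 0 ≤ B := by
    have h1 : 0 ≤ (M.normPi (α + 1)).toReal := ENNReal.toReal_nonneg
    have h2 : 0 ≤ (M.normΓ (α + 1)).toReal := ENNReal.toReal_nonneg
    rw [hB]
    generalize (M.normPi (α + 1)).toReal = a at *
    generalize (M.normΓ (α + 1)).toReal = b at *
    positivity
  clear_value B
  have hwx := inv_pos.2 (hw.pos x)
  refine (integrableOn_of_abs_le_rpow_Ioc_zero σ.ell_pos (e := α - σ.deg k + βb)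
    (c := C * CK * B * ((w.w x)⁻¹ * (w.w x)⁻¹) * 2 ^ |(α - σ.deg k + βb) / σ.ell - 1|)
    (by linarith) one_pos (hK.aestronglyMeasurable_kint_model M hQ hw hG0 hd hCK hk x hτ)
    fun t ht ht1 => ?_).1
  have ht2 := half_pos ht
  have h1 := (h (t / 2) ht2 (by linarith) x (fun z => kderiv K k (t / 2) x z)
    (fun z => M.evalAt (t / 2) z x (𝒯.emb α τ)) (CK * (t / 2) ^ ((βb - σ.deg k) / σ.ell - 1))
    (B * (t / 2) ^ (α / σ.ell)) (by positivity) (by positivity)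
    (hK.aestronglyMeasurable_kderiv hk ht2 x)
    (M.measurable_evalAt hQ hw hG0 x hτ ht2 (by linarith)).aestronglyMeasurable
    (fun z => hK.upper k hk _ ht2 x z)
    (fun z => (M.abs_evalAt_le hw hN (by linarith) ht2 (by linarith) z x τ).trans
      (le_of_eq (by rw [hB]; ring)))).2
  refine h1.trans ?_
  have h2 : (t / 2) ^ ((βb - σ.deg k) / σ.ell - 1) * (t / 2) ^ (α / σ.ell) ≤
      2 ^ |(α - σ.deg k + βb) / σ.ell - 1| * t ^ ((α - σ.deg k + βb) / σ.ell - 1) :=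
    half_rpow_mul_le ht
  have := mul_le_mul_of_nonneg_left h2
    (by positivity : 0 ≤ C * CK * B * ((w.w x)⁻¹ * (w.w x)⁻¹))
  linarith

/-- The zero element of the Besov space. -/
def Besov.zero (σ : Scaling d) (Q : Ker d) (ζ : ℝ) (w : Pt d → ℝ) : Besov σ Q ζ w where
  Qt := fun _ _ => 0
  approx := fun ε hε => ⟨fun _ => 0, ⟨continuous_const, 0, fun x => by simp⟩, by
    simpa [besovNorm, smear] using hε⟩

theorem memD_zero (Γ : Pt d → Pt d → 𝒯.Sum →ₗ[ℝ] 𝒯.Sum) : MemD σ v γ η Γ (fun _ => 0) := by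
  refine ⟨fun x _ β _ => rfl, ?_⟩
  simp [fullNorm, sizeNorm, sharpNorm, incrNorm, incr]

theorem isReconstruction_zero (M : Model σ 𝒯 Q w) :
    IsReconstruction γ η M (fun _ => 0) (Besov.zero σ Q ζ (w * v).w) := by
  simp [IsReconstruction, recSize, recNorm, centered, Besov.zero]

theorem Model.sizePiece_zero (M : Model σ 𝒯 Q w) (x : Pt d) (α s : ℝ) (z : Pt d) :
    M.sizePiece (fun _ => 0) x α s z = 0 := by
  simp [Model.sizePiece, Model.evalAt]

theorem Model.incPiece_zero (M : Model σ 𝒯 Q w) (y x : Pt d) (α s : ℝ) (z : Pt d) :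
    M.incPiece (fun _ => 0) y x α s z = 0 := by
  simp [Model.incPiece, Model.evalAt, incr]

/-- The comparison of f with the zero distribution. Only the existence of finite constants matters
here. -/
theorem exists_liftData (hQ : IsSemigroup σ G Q) (hw : w.IsControlled σ G) (hv : v.IsControlled σ G)
    (hu : (w * v).IsControlled σ G) (hG0 : ∀ x, 0 ≤ G x) (hζ : ζ ≤ 0) {N : ℕ}
    (hN : γ - A.reg ≤ N) (M : Model σ 𝒯 Q w) {f : Pt d → 𝒯.Sum}
    {Λ : Besov σ Q ζ (w * v).w} (hf : MemD σ v γ η M.Γ f) (hΛ : IsReconstruction γ η M f Λ) :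
    ∃ L P₁ P₂ E : ℝ, 0 ≤ L ∧ 0 ≤ P₁ ∧ 0 ≤ P₂ ∧ 0 ≤ E ∧
      LiftData σ w v (A.below γ) N γ η ζ L P₁ P₂ E Λ.Qt (M.sizePiece f) (M.incPiece f) := by
  have h := liftData_sub hQ hw hv hu hG0 hζ hN M M hf (memD_zero M.Γ) hΛ (isReconstruction_zero M)
  simp only [Besov.zero, M.sizePiece_zero, M.incPiece_zero, sub_zero] at h
  exact ⟨_, _, _, _, ENNReal.toReal_nonneg,
    M.pieceConst_nonneg M ENNReal.toReal_nonneg ENNReal.toReal_nonneg,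
    M.pieceConst_nonneg M ENNReal.toReal_nonneg ENNReal.toReal_nonneg,
    M.remConst_nonneg M ENNReal.toReal_nonneg ENNReal.toReal_nonneg ENNReal.toReal_nonneg, h⟩

theorem IsRegularizing.kbesov_sub_kPi (hK : IsRegularizing σ G Q K βb δ CK)
    (hQ : IsSemigroup σ G Q) (hw : w.IsControlled σ G) (hu : (w * v).IsControlled σ G)
    (hG0 : ∀ x, 0 ≤ G x) (hd : w.HasDecay σ G) (hCK : 0 < CK) (hζ : ζ ≤ 0) (hk : σ.deg k < δ)
    (M : Model σ 𝒯 Q w) {f : Pt d → 𝒯.Sum} (Λ : Besov σ Q ζ (w * v).w) {x : Pt d}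
    (hx : 𝒯.IsBelow γ (f x)) {t : ℝ} (ht : 0 < t) (ht1 : t ≤ 1) :
    kbesov K k t x Λ - M.kPi K k t x (f x) =
      kint K k t x Λ.Qt - ∑ α ∈ A.below γ, kint K k t x (M.sizePiece f x α) := by
  rw [hK.kbesov_eq Λ hQ hu hG0 hCK hζ hk ht ht1, hK.kPi_eq M hQ hw hG0 hd hCK hk x hx ht ht1]
  congr 1
  unfold kint Model.sizePiece
  rw [← integral_finsetSum _ fun α hα => hK.integrable_model hQ hw hG0 hd hCK hk M x
    (RegStructure.isBelow_emb (IndexSet.mem_below.1 hα).2 _) ht ht1]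
  refine integral_congr_ae (Eventually.of_forall fun z => ?_)
  beta_reduce
  rw [← Finset.mul_sum, ← M.evalAt_eq_sum hx]

/-- The contributions of Λ and of the pieces of Π_xf(x) need not be integrable at t = 0 one by one;
their difference is of order t^{(γ-|k|+βb)/ℓ-1}. -/
theorem IsRegularizing.integrableOn_rem (hK : IsRegularizing σ G Q K βb δ CK)
    (hQ : IsSemigroup σ G Q) (hw : w.IsControlled σ G) (hv : v.IsControlled σ G)
    (hu : (w * v).IsControlled σ G) (hG0 : ∀ x, 0 ≤ G x) (hd : w.HasDecay σ G) (hCK : 0 < CK)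
    (hζ : ζ ≤ 0) (hη : γ - σ.s 0 < η) (hηγ : η ≤ γ) (hk : σ.deg k < δ) (hkγ : σ.deg k < γ + βb)
    (M : Model σ 𝒯 Q w) {f : Pt d → 𝒯.Sum} {Λ : Besov σ Q ζ (w * v).w}
    (hf : MemD σ v γ η M.Γ f) (hΛ : IsReconstruction γ η M f Λ) {x : Pt d} (hx : x 0 ≠ 0) :
    IntegrableOn (fun t => kint K k t x Λ.Qt -
      ∑ α ∈ A.below γ, kint K k t x (M.sizePiece f x α)) (Set.Ioc 0 1) := by
  obtain ⟨N, hN⟩ := A.exists_nat γ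
  obtain ⟨L, P₁, P₂, E, hL, hP₁, hP₂, hE, hD⟩ := exists_liftData hQ hw hv hu hG0 hζ hN M hf hΛ
  obtain ⟨C, hC, h⟩ := exists_rem_pairing (S := A.below γ) (N := N) (γ := γ) (η := η) (ζ := ζ) hw hv
    hu hG0 hη hηγ
  have hm : AEStronglyMeasurable (fun t => kint K k t x Λ.Qt -
      ∑ α ∈ A.below γ, kint K k t x (M.sizePiece f x α)) (volume.restrict (Set.Ioc 0 1)) :=
    (hK.aestronglyMeasurable_kint_besov Λ hQ hu hG0 hCK hζ hk x).sub
      (Finset.aestronglyMeasurable_fun_sum _ fun α hα =>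
        hK.aestronglyMeasurable_kint_model M hQ hw hG0 hd hCK hk x
          (RegStructure.isBelow_emb (IndexSet.mem_below.1 hα).2 _))
  set W := E * ((w * w * v).w x)⁻¹ * σ.phi x ^ (η - γ) with hW
  have hW0 : 0 ≤ W := mul_nonneg (mul_nonneg hE (inv_nonneg.2
    (mul_nonneg (mul_pos (hw.pos x) (hw.pos x)).le (hv.pos x).le)))
    (Real.rpow_nonneg (σ.phi_nonneg x) _)
  refine (integrableOn_of_abs_le_rpow_Ioc_zero σ.ell_pos (e := γ - σ.deg k + βb)
    (c := C * CK * W * 2 ^ |(γ - σ.deg k + βb) / σ.ell - 1|) (by linarith) one_pos hm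
    fun t ht ht1 => ?_).1
  have ht2 := half_pos ht
  have hp : 0 ≤ CK * (t / 2) ^ ((βb - σ.deg k) / σ.ell - 1) := by positivity
  have h3 := h L P₁ P₂ E hE _ _ _ hD (t / 2) ht2 (by linarith) x hx _ _ hp
    (hK.aestronglyMeasurable_kderiv hk ht2 x) (fun z => hK.upper k hk _ ht2 x z)
  rw [(hD.integral_rem hw hv hu hd hG0 hL hP₁ ht2 (by linarith) hx hp
    (hK.aestronglyMeasurable_kderiv hk ht2 x) (fun z => hK.upper k hk _ ht2 x z)).2] at h3
  refine h3.trans ?_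
  have h2 : (t / 2) ^ ((βb - σ.deg k) / σ.ell - 1) * (t / 2) ^ (γ / σ.ell) ≤
      2 ^ |(γ - σ.deg k + βb) / σ.ell - 1| * t ^ ((γ - σ.deg k + βb) / σ.ell - 1) :=
    half_rpow_mul_le ht
  have := mul_le_mul_of_nonneg_left h2 (by positivity : 0 ≤ C * CK * W)
  rw [hW] at this ⊢
  linarith

theorem IsRegularizing.liftTimeMeasurable_sub (hK : IsRegularizing σ G Q K βb δ CK)
    (hQ : IsSemigroup σ G Q) (hw : w.IsControlled σ G)
    (hu : (w * v).IsControlled σ G) (hG0 : ∀ x, 0 ≤ G x) (hd : w.HasDecay σ G) (hCK : 0 < CK)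
    (hζ : ζ ≤ 0) (M₁ M₂ : Model σ 𝒯 Q w) (f₁ f₂ : Pt d → 𝒯.Sum)
    (Λ₁ Λ₂ : Besov σ Q ζ (w * v).w) :
    LiftTimeMeasurable σ K δ (A.below γ) (fun s z => Λ₁.Qt s z - Λ₂.Qt s z)
      (fun x α s z => M₁.sizePiece f₁ x α s z - M₂.sizePiece f₂ x α s z)
      (fun y x α s z => M₁.incPiece f₁ y x α s z - M₂.incPiece f₂ y x α s z) := by
  have hmodel : ∀ k, σ.deg k < δ → ∀ x, ∀ α ∈ A.below γ, ∀ τ₁ τ₂ : 𝒯.T α,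
      AEStronglyMeasurable (fun t => kint K k t x (fun s z => M₁.evalAt s z x (𝒯.emb α τ₁) -
        M₂.evalAt s z x (𝒯.emb α τ₂))) (volume.restrict (Set.Ioc 0 1)) := by
    intro k hk x α hα τ₁ τ₂
    have hα' := (IndexSet.mem_below.1 hα).2
    have h := (hK.aestronglyMeasurable_kint_model M₁ hQ hw hG0 hd hCK hk x
      (RegStructure.isBelow_emb hα' τ₁)).sub (hK.aestronglyMeasurable_kint_model M₂ hQ hw hG0 hd
        hCK hk x (RegStructure.isBelow_emb hα' τ₂))
    refine h.congr ((ae_restrict_iff' measurableSet_Ioc).2 (Eventually.of_forall fun t ht => ?_))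
    exact (kint_sub (hK.integrable_model hQ hw hG0 hd hCK hk M₁ x
      (RegStructure.isBelow_emb hα' τ₁) ht.1 ht.2) (hK.integrable_model hQ hw hG0 hd hCK hk M₂ x
      (RegStructure.isBelow_emb hα' τ₂) ht.1 ht.2)).symm
  refine ⟨fun k hk x => ?_, fun k hk x _ α hα => hmodel k hk x α hα _ _,
    fun k hk x _ y _ α hα => hmodel k hk y α hα _ _⟩
  have h := (hK.aestronglyMeasurable_kint_besov Λ₁ hQ hu hG0 hCK hζ hk x).sub
    (hK.aestronglyMeasurable_kint_besov Λ₂ hQ hu hG0 hCK hζ hk x)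
  refine h.congr ((ae_restrict_iff' measurableSet_Ioc).2 (Eventually.of_forall fun t ht => ?_))
  exact (kint_sub (hK.integrable_besov hQ hu hG0 hCK hζ hk Λ₁ x ht.1 ht.2)
    (hK.integrable_besov hQ hu hG0 hCK hζ hk Λ₂ x ht.1 ht.2)).symm

/-- Identifies a difference of coefficients with the time integral of a difference family, the form
required by the abstract estimates. Convergence of each integral is what permits the subtraction. -/
theorem IsRegularizing.kPiInt_sub (hK : IsRegularizing σ G Q K βb δ CK)
    (hQ : IsSemigroup σ G Q) (hw : w.IsControlled σ G) (hG0 : ∀ x, 0 ≤ G x) (hd : w.HasDecay σ G)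
    (hCK : 0 < CK) (hk : σ.deg k < δ) (M₁ M₂ : Model σ 𝒯 Q w) (x : Pt d) {α : ℝ} (τ₁ τ₂ : 𝒯.T α)
    (hα : σ.deg k < α + βb) :
    M₁.kPiInt K k x (𝒯.emb α τ₁) - M₂.kPiInt K k x (𝒯.emb α τ₂) =
      ∫ t in Set.Ioc 0 1, kint K k t x (fun s z => M₁.evalAt s z x (𝒯.emb α τ₁) -
        M₂.evalAt s z x (𝒯.emb α τ₂)) := by
  have e : ∀ (M : Model σ 𝒯 Q w) (τ : 𝒯.T α), M.kPiInt K k x (𝒯.emb α τ) =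
      ∫ t in Set.Ioc 0 1, kint K k t x (fun s z => M.evalAt s z x (𝒯.emb α τ)) := fun M τ =>
    setIntegral_congr_fun measurableSet_Ioc fun t ht => hK.kPi_eq M hQ hw hG0 hd hCK hk x
      (RegStructure.isBelow_emb (lt_add_one α) τ) ht.1 ht.2
  rw [e, e, ← integral_sub (hK.integrableOn_kint_model hQ hw hG0 hd hCK hk M₁ x τ₁ hα)
    (hK.integrableOn_kint_model hQ hw hG0 hd hCK hk M₂ x τ₂ hα)]
  refine setIntegral_congr_fun measurableSet_Ioc fun t ht => ?_
  exact (kint_sub (hK.integrable_model hQ hw hG0 hd hCK hk M₁ x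
    (RegStructure.isBelow_emb (lt_add_one α) τ₁) ht.1 ht.2)
    (hK.integrable_model hQ hw hG0 hd hCK hk M₂ x
    (RegStructure.isBelow_emb (lt_add_one α) τ₂) ht.1 ht.2)).symm

theorem IsRegularizing.kCentered_sub (hK : IsRegularizing σ G Q K βb δ CK)
    (hQ : IsSemigroup σ G Q) (hw : w.IsControlled σ G) (hv : v.IsControlled σ G)
    (hu : (w * v).IsControlled σ G) (hG0 : ∀ x, 0 ≤ G x) (hd : w.HasDecay σ G) (hCK : 0 < CK)
    (hζ : ζ ≤ 0) (hη : γ - σ.s 0 < η) (hηγ : η ≤ γ) (hk : σ.deg k < δ) (hkγ : σ.deg k < γ + βb)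
    (M₁ M₂ : Model σ 𝒯 Q w) {f₁ f₂ : Pt d → 𝒯.Sum} {Λ₁ Λ₂ : Besov σ Q ζ (w * v).w}
    (hf₁ : MemD σ v γ η M₁.Γ f₁) (hf₂ : MemD σ v γ η M₂.Γ f₂)
    (hΛ₁ : IsReconstruction γ η M₁ f₁ Λ₁) (hΛ₂ : IsReconstruction γ η M₂ f₂ Λ₂) {x : Pt d}
    (hx : x 0 ≠ 0) :
    kCentered K k M₁ f₁ Λ₁ x - kCentered K k M₂ f₂ Λ₂ x =
      ∫ t in Set.Ioc 0 1, (kint K k t x (fun s z => Λ₁.Qt s z - Λ₂.Qt s z) -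
        ∑ α ∈ A.below γ, kint K k t x
          (fun s z => M₁.sizePiece f₁ x α s z - M₂.sizePiece f₂ x α s z)) := by
  have e : ∀ (M : Model σ 𝒯 Q w) {f : Pt d → 𝒯.Sum} {Λ : Besov σ Q ζ (w * v).w},
      MemD σ v γ η M.Γ f → kCentered K k M f Λ x =
      ∫ t in Set.Ioc 0 1, (kint K k t x Λ.Qt -
        ∑ α ∈ A.below γ, kint K k t x (M.sizePiece f x α)) := fun M f Λ hf =>
    setIntegral_congr_fun measurableSet_Ioc fun t ht =>
      hK.kbesov_sub_kPi hQ hw hu hG0 hd hCK hζ hk M Λ (hf.1 x hx) ht.1 ht.2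
  rw [e M₁ hf₁, e M₂ hf₂, ← integral_sub
    (hK.integrableOn_rem hQ hw hv hu hG0 hd hCK hζ hη hηγ hk hkγ M₁ hf₁ hΛ₁ hx)
    (hK.integrableOn_rem hQ hw hv hu hG0 hd hCK hζ hη hηγ hk hkγ M₂ hf₂ hΛ₂ hx)]
  refine setIntegral_congr_fun measurableSet_Ioc fun t ht => ?_
  have e1 := kint_sub (hK.integrable_besov hQ hu hG0 hCK hζ hk Λ₁ x ht.1 ht.2)
    (hK.integrable_besov hQ hu hG0 hCK hζ hk Λ₂ x ht.1 ht.2)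
  have e2 : ∑ α ∈ A.below γ, kint K k t x
      (fun s z => M₁.sizePiece f₁ x α s z - M₂.sizePiece f₂ x α s z) =
      ∑ α ∈ A.below γ, (kint K k t x (M₁.sizePiece f₁ x α) - kint K k t x (M₂.sizePiece f₂ x α)) :=
    Finset.sum_congr rfl fun α hα => kint_sub
      (hK.integrable_model hQ hw hG0 hd hCK hk M₁ x
        (RegStructure.isBelow_emb (IndexSet.mem_below.1 hα).2 _) ht.1 ht.2)
      (hK.integrable_model hQ hw hG0 hd hCK hk M₂ x
        (RegStructure.isBelow_emb (IndexSet.mem_below.1 hα).2 _) ht.1 ht.2)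
  rw [e1, e2, Finset.sum_sub_distrib]
  ring

end KernelIntegrals

/-! ### Algebra of the lift and of its increments. -/

section LiftAlgebra

variable [NeZero d] {A Ab : IndexSet} {𝒯 : RegStructure.{u₁} A} {𝒯b : RegStructure.{u₂} Ab}
  {σ : Scaling d} {Q K : Ker d} {w v : Weight d} {G : Pt d → ℝ} {γ η ζ β βb δ CK : ℝ}

theorem AbsInt.map_emb (I : AbsInt 𝒯 𝒯b β) (α : ℝ) (τ : 𝒯.T α) :
    I.map (𝒯.emb α τ) = 𝒯b.emb (α + β) (I α τ) := by
  unfold AbsInt.map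
  rw [DFinsupp.lsum_single]
  rfl

theorem AbsInt.map_apply (I : AbsInt 𝒯 𝒯b β) {τ : 𝒯.Sum} (hτ : 𝒯.IsBelow γ τ) (α : ℝ) :
    I.map τ (α + β) = I α (τ α) := by
  have h : I.map τ = ∑ α' ∈ A.below γ, 𝒯b.emb (α' + β) (I α' (τ α')) := by
    conv_lhs => rw [hτ.eq_sum, map_sum]
    exact Finset.sum_congr rfl fun α' _ => I.map_emb α' _
  rw [h, DFinsupp.finsetSum_apply]
  by_cases hα : α ∈ A.below γ
  · rw [Finset.sum_eq_single α (fun α' _ hne => DFinsupp.single_eq_of_ne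
      fun e => hne (by linarith)) (fun h' => absurd hα h')]
    exact DFinsupp.single_eq_same
  · have h0 : τ α = 0 := by
      by_cases hA : α ∈ A.carrier
      · exact hτ α (not_lt.1 fun h' => hα (IndexSet.mem_below.2 ⟨hA, h'⟩))
      · exact RegStructure.eq_zero_of_notMem hA _
    rw [h0, map_zero]
    refine Finset.sum_eq_zero fun α' hα' => DFinsupp.single_eq_of_ne fun e => hα ?_
    rwa [show α = α' by linarith]

theorem AbsInt.isBelow_map (I : AbsInt 𝒯 𝒯b β) {τ : 𝒯.Sum} (hτ : 𝒯.IsBelow γ τ) :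
    𝒯b.IsBelow (γ + β) (I.map τ) := fun α' hα' => by
  obtain ⟨α, rfl⟩ : ∃ α, α' = α + β := ⟨α' - β, by ring⟩
  rw [I.map_apply hτ, hτ α (by linarith), map_zero]

/-- `Model.kPi` is a limit, so its linearity is not built in; the value at 0 is read off from the
integral. -/
theorem IsRegularizing.kPiInt_zero (hK : IsRegularizing σ G Q K βb δ CK)
    (hQ : IsSemigroup σ G Q) (hw : w.IsControlled σ G) (hG0 : ∀ x, 0 ≤ G x) (hd : w.HasDecay σ G)
    (hCK : 0 < CK) {k : Idx d} (hk : σ.deg k < δ) (M : Model σ 𝒯 Q w) (x : Pt d) :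
    M.kPiInt K k x 0 = 0 := by
  have h0 : 𝒯.IsBelow 0 0 := fun _ _ => rfl
  unfold Model.kPiInt
  rw [setIntegral_congr_fun (g := fun _ => 0) measurableSet_Ioc fun t ht => ?_]
  · simp
  · beta_reduce
    rw [hK.kPi_eq M hQ hw hG0 hd hCK hk x h0 ht.1 ht.2]
    simp [kint, Model.evalAt]

/-- Exchanging the sums over α and k collects in front of X^k all homogeneities α > |k| - β. Indices
between γ and δ - β drop out because τ has no such components. -/
theorem IsRegularizing.liftJ_eq (hK : IsRegularizing σ G Q K βb δ CK)
    (hQ : IsSemigroup σ G Q) (hw : w.IsControlled σ G) (hG0 : ∀ x, 0 ≤ G x) (hd : w.HasDecay σ G)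
    (hCK : 0 < CK) (hδ : γ + β < δ) (X : Polynomials σ 𝒯b) (M : Model σ 𝒯 Q w) (x : Pt d)
    {τ : 𝒯.Sum} (hτ : 𝒯.IsBelow γ τ) :
    liftJ K δ β X M x τ = ∑ k ∈ σ.idxBelow (γ + β), ((∑ α ∈ A.below γ with σ.deg k < α + β,
      M.kPiInt K k x (𝒯.emb α (τ α))) / mfact k) • X.mono k := by
  unfold liftJ
  have hsub : A.below γ ⊆ A.below (δ - β) := fun α hα => by
    rw [IndexSet.mem_below] at *
    exact ⟨hα.1, by linarith [hα.2]⟩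
  rw [← Finset.sum_subset hsub fun α hα hα' => ?_]
  · have e : ∀ α ∈ A.below γ, ∑ k ∈ σ.idxBelow (α + β),
        (M.kPiInt K k x (𝒯.emb α (τ α)) / mfact k) • X.mono k =
        ∑ k ∈ σ.idxBelow (γ + β), if σ.deg k < α + β then
          (M.kPiInt K k x (𝒯.emb α (τ α)) / mfact k) • X.mono k else 0 := fun α hα => by
      rw [← Finset.sum_filter]
      refine Finset.sum_congr ?_ fun _ _ => rfl
      ext k
      rw [Finset.mem_filter, σ.mem_idxBelow, σ.mem_idxBelow]
      have := (IndexSet.mem_below.1 hα).2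
      exact ⟨fun h => ⟨by linarith, h⟩, fun h => h.2⟩
    rw [Finset.sum_congr rfl e, Finset.sum_comm]
    refine Finset.sum_congr rfl fun k _ => ?_
    rw [← Finset.sum_filter, Finset.sum_div, Finset.sum_smul]
  · have hα2 : γ ≤ α := not_lt.1 fun h =>
      hα' (IndexSet.mem_below.2 ⟨(IndexSet.mem_below.1 hα).1, h⟩)
    refine Finset.sum_eq_zero fun k hk => ?_
    have h1 := (σ.mem_idxBelow _ _).1 hk
    have h2 := (IndexSet.mem_below.1 hα).2
    have h3 : 𝒯.emb α (τ α) = 0 := by rw [hτ α hα2]; exact DFinsupp.single_zero α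
    rw [h3, hK.kPiInt_zero hQ hw hG0 hd hCK (by linarith), zero_div, zero_smul]

/-- `k!` times the coefficient of `X^k` in the lift at `x`. -/
def liftCoef (K : Ker d) (γ β : ℝ) (M : Model σ 𝒯 Q w) (f : Pt d → 𝒯.Sum)
    (Λ : Besov σ Q ζ (w * v).w) (k : Idx d) (x : Pt d) : ℝ :=
  ∑ α ∈ A.below γ with σ.deg k < α + β, M.kPiInt K k x (𝒯.emb α (f x α)) + kCentered K k M f Λ x

/-- `k!` times the coefficient of `X^k` in the increment of the lift. -/
def liftIncrCoef (K : Ker d) (δ γ β : ℝ) (M : Model σ 𝒯 Q w) (f : Pt d → 𝒯.Sum)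
    (Λ : Besov σ Q ζ (w * v).w) (k : Idx d) (y x : Pt d) : ℝ :=
  (∑ α ∈ A.below γ with σ.deg k < α + β, M.kPiInt K k y (𝒯.emb α (incr M.Γ f y x α))) +
    kCentered K k M f Λ y -
    ∑ l ∈ σ.idxBelow (δ - σ.deg k) with σ.deg k + σ.deg l < γ + β,
      mpow (y - x) l / mfact l * kCentered K (k + l) M f Λ x

theorem IsRegularizing.liftK_eq (hK : IsRegularizing σ G Q K βb δ CK)
    (hQ : IsSemigroup σ G Q) (hw : w.IsControlled σ G) (hG0 : ∀ x, 0 ≤ G x) (hd : w.HasDecay σ G)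
    (hCK : 0 < CK) (hδ : γ + β < δ) (X : Polynomials σ 𝒯b) (I : AbsInt 𝒯 𝒯b β)
    (M : Model σ 𝒯 Q w) {f : Pt d → 𝒯.Sum} (Λ : Besov σ Q ζ (w * v).w) {x : Pt d}
    (hx : 𝒯.IsBelow γ (f x)) :
    liftK K δ γ X I M f Λ x = I.map (f x) +
      ∑ k ∈ σ.idxBelow (γ + β), (liftCoef K γ β M f Λ k x / mfact k) • X.mono k := by
  unfold liftK liftN liftCoef
  rw [hK.liftJ_eq hQ hw hG0 hd hCK hδ X M x hx, add_assoc, ← Finset.sum_add_distrib]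
  congr 1
  refine Finset.sum_congr rfl fun k _ => ?_
  rw [← add_smul, ← add_div]

theorem mchoose_mul (k l : Idx d) : mchoose (k + l) l * (mfact k * mfact l) = mfact (k + l) := by
  unfold mchoose mfact
  rw [← Finset.prod_mul_distrib, ← Finset.prod_mul_distrib]
  refine Finset.prod_congr rfl fun i _ => ?_
  rw [Pi.add_apply, ← mul_assoc]
  exact_mod_cast Nat.add_choose_mul_factorial_mul_factorial (k i) (l i)

/-- Re-expansion of a polynomial around another point. -/
theorem Compatible.map_monomials {X : Polynomials σ 𝒯b} {I : AbsInt 𝒯 𝒯b β} {M : Model σ 𝒯 Q w}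
    {Mb : Model σ 𝒯b Q w} (hC : Compatible K δ X I M Mb) (hδ : γ + β ≤ δ) (n : Idx d → ℝ)
    (y x : Pt d) :
    Mb.Γ y x (∑ k ∈ σ.idxBelow (γ + β), (n k / mfact k) • X.mono k) =
      ∑ k ∈ σ.idxBelow (γ + β), ((∑ l ∈ σ.idxBelow (δ - σ.deg k) with
        σ.deg k + σ.deg l < γ + β, mpow (y - x) l / mfact l * n (k + l)) / mfact k) • X.mono k := by
  have e1 : ∀ k ∈ σ.idxBelow (γ + β), Mb.Γ y x ((n k / mfact k) • X.mono k) =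
      ∑ l ∈ Finset.Icc 0 k, (n k / mfact k * (mchoose k l * mpow (y - x) l)) • X.mono (k - l) :=
    fun k _ => by
      rw [map_smul, hC.Γ_poly, Finset.smul_sum]
      exact Finset.sum_congr rfl fun l _ => smul_smul _ _ _
  have e2 : ∀ k ∈ σ.idxBelow (γ + β), ((∑ l ∈ σ.idxBelow (δ - σ.deg k) with
        σ.deg k + σ.deg l < γ + β, mpow (y - x) l / mfact l * n (k + l)) / mfact k) • X.mono k =
      ∑ l ∈ σ.idxBelow (δ - σ.deg k) with σ.deg k + σ.deg l < γ + β,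
        (mpow (y - x) l / mfact l * n (k + l) / mfact k) • X.mono k := fun k _ => by
    rw [Finset.sum_div, Finset.sum_smul]
  rw [map_sum, Finset.sum_congr rfl e1, Finset.sum_congr rfl e2, Finset.sum_sigma',
    Finset.sum_sigma']
  have hdeg := fun k : Idx d => σ.deg_nonneg k
  -- Both sides sum over decompositions m = k + l, on the left parametrized by (m, l) with l ≤ m and
  -- on the right by (k, l).
  refine Finset.sum_bij' (fun p _ => ⟨p.1 - p.2, p.2⟩) (fun p _ => ⟨p.1 + p.2, p.2⟩) ?_ ?_ ?_ ?_ ?_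
  · rintro ⟨m, l⟩ h
    simp only [Finset.mem_sigma, σ.mem_idxBelow, Finset.mem_Icc, Finset.mem_filter] at h ⊢
    have h1 : σ.deg m = σ.deg (m - l) + σ.deg l := by
      rw [← σ.deg_add, tsub_add_cancel_of_le h.2.2]
    have h2 := hdeg l
    refine ⟨by linarith, by linarith, by linarith⟩
  · rintro ⟨m, l⟩ h
    simp only [Finset.mem_sigma, σ.mem_idxBelow, Finset.mem_Icc, Finset.mem_filter] at h ⊢
    rw [σ.deg_add]
    exact ⟨h.2.2, zero_le, le_add_self⟩
  · rintro ⟨m, l⟩ h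
    simp only [Finset.mem_sigma, Finset.mem_Icc] at h
    simp only [tsub_add_cancel_of_le h.2.2]
  · rintro ⟨m, l⟩ h
    simp only [add_tsub_cancel_right]
  · rintro ⟨m, l⟩ h
    simp only [Finset.mem_sigma, Finset.mem_Icc] at h
    obtain ⟨k, rfl⟩ : ∃ k, m = k + l := ⟨m - l, (tsub_add_cancel_of_le h.2.2).symm⟩
    simp only [add_tsub_cancel_right]
    congr 1
    have h1 := mchoose_mul k l
    have h2 := (zero_lt_one.trans_le (one_le_mfact k)).ne'
    have h3 := (zero_lt_one.trans_le (one_le_mfact l)).ne'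
    have h4 := (zero_lt_one.trans_le (one_le_mfact (k + l))).ne'
    field_simp
    rw [← h1]; ring

theorem IsRegularizing.kPiInt_emb_sub (hK : IsRegularizing σ G Q K βb δ CK)
    (hQ : IsSemigroup σ G Q) (hw : w.IsControlled σ G) (hG0 : ∀ x, 0 ≤ G x) (hd : w.HasDecay σ G)
    (hCK : 0 < CK) {k : Idx d} (hk : σ.deg k < δ) (M : Model σ 𝒯 Q w) (x : Pt d) {α : ℝ}
    (τ₁ τ₂ : 𝒯.T α) (hα : σ.deg k < α + βb) :
    M.kPiInt K k x (𝒯.emb α (τ₁ - τ₂)) =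
      M.kPiInt K k x (𝒯.emb α τ₁) - M.kPiInt K k x (𝒯.emb α τ₂) := by
  rw [hK.kPiInt_sub hQ hw hG0 hd hCK hk M M x τ₁ τ₂ hα]
  refine setIntegral_congr_fun measurableSet_Ioc fun t ht => ?_
  rw [hK.kPi_eq M hQ hw hG0 hd hCK hk x (RegStructure.isBelow_emb (lt_add_one α) _) ht.1 ht.2]
  have : 𝒯.emb α (τ₁ - τ₂) = 𝒯.emb α τ₁ - 𝒯.emb α τ₂ := DFinsupp.single_sub α τ₁ τ₂
  simp only [Model.evalAt, this, map_sub]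

/-- Intertwining moves 𝓘 + 𝒥 from x to y and leaves 𝓘 + 𝒥(y) applied to the increment of f. The
remaining part is polynomial and is re-expanded by the binomial formula, which turns it into Taylor
coefficients. -/
theorem IsRegularizing.liftK_incr (hK : IsRegularizing σ G Q K βb δ CK)
    (hQ : IsSemigroup σ G Q) (hw : w.IsControlled σ G) (hG0 : ∀ x, 0 ≤ G x) (hd : w.HasDecay σ G)
    (hCK : 0 < CK) (hβ : β ≤ βb) (hδ : γ + β < δ) {X : Polynomials σ 𝒯b} {I : AbsInt 𝒯 𝒯b β}
    {M : Model σ 𝒯 Q w} {Mb : Model σ 𝒯b Q w} (hC : Compatible K δ X I M Mb)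
    {f : Pt d → 𝒯.Sum} (Λ : Besov σ Q ζ (w * v).w) {x y : Pt d}
    (hx : 𝒯.IsBelow γ (f x)) (hy : 𝒯.IsBelow γ (f y)) :
    incr Mb.Γ (liftK K δ γ X I M f Λ) y x = I.map (incr M.Γ f y x) +
      ∑ k ∈ σ.idxBelow (γ + β), (liftIncrCoef K δ γ β M f Λ k y x / mfact k) • X.mono k := by
  have hΓ := M.isBelow_Γ y x hx
  have e1 : Mb.Γ y x (liftK K δ γ X I M f Λ x) =
      I.map (M.Γ y x (f x)) + liftJ K δ β X M y (M.Γ y x (f x)) +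
        Mb.Γ y x (liftN K γ β X M f Λ x) := by
    unfold liftK
    rw [map_add, hC.intertwine x y (f x) (hx.mono (by linarith))]
  have e2 : liftJ K δ β X M y (f y) - liftJ K δ β X M y (M.Γ y x (f x)) =
      ∑ k ∈ σ.idxBelow (γ + β), ((∑ α ∈ A.below γ with σ.deg k < α + β,
        M.kPiInt K k y (𝒯.emb α (incr M.Γ f y x α))) / mfact k) • X.mono k := by
    rw [hK.liftJ_eq hQ hw hG0 hd hCK hδ X M y hy, hK.liftJ_eq hQ hw hG0 hd hCK hδ X M y hΓ,
      ← Finset.sum_sub_distrib]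
    refine Finset.sum_congr rfl fun k hk => ?_
    have hk' := (σ.mem_idxBelow _ _).1 hk
    rw [← sub_smul, ← sub_div, ← Finset.sum_sub_distrib]
    congr 2
    refine Finset.sum_congr rfl fun α hα => ?_
    have := (Finset.mem_filter.1 hα).2
    rw [← hK.kPiInt_emb_sub hQ hw hG0 hd hCK (by linarith) M y _ _ (by linarith)]
    rfl
  have e3 : incr Mb.Γ (liftK K δ γ X I M f Λ) y x =
      (I.map (f y) - I.map (M.Γ y x (f x))) +
      ((liftJ K δ β X M y (f y) - liftJ K δ β X M y (M.Γ y x (f x))) +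
      (liftN K γ β X M f Λ y - Mb.Γ y x (liftN K γ β X M f Λ x))) := by
    unfold incr
    rw [e1]
    unfold liftK
    abel
  rw [e3, e2, ← map_sub]
  unfold liftN
  rw [hC.map_monomials hδ.le, ← Finset.sum_sub_distrib, ← Finset.sum_add_distrib]
  refine congrArg₂ _ rfl (Finset.sum_congr rfl fun k _ => ?_)
  rw [← sub_smul, ← add_smul]
  congr 1
  unfold liftIncrCoef
  ring

end LiftAlgebra

/-! ### Components of the lift and differences of coefficients. -/

section LiftBounds

variable [NeZero d] {A Ab : IndexSet} {𝒯 : RegStructure.{u₁} A} {𝒯b : RegStructure.{u₂} Ab}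
  {σ : Scaling d} {Q K : Ker d} {w v : Weight d} {G : Pt d → ℝ} {γ η ζ β βb δ CK : ℝ}

theorem Polynomials.norm_mono_apply_le (X : Polynomials σ 𝒯b) {B : ℝ} {k : Idx d}
    (hX : ‖X.X k‖ ≤ B) (a : ℝ) : ‖X.mono k a‖ ≤ if σ.deg k = a then B else 0 := by
  unfold Polynomials.mono
  split_ifs with h
  · subst h
    rwa [show 𝒯b.emb (σ.deg k) (X.X k) (σ.deg k) = X.X k from DFinsupp.single_eq_same]
  · rw [show 𝒯b.emb (σ.deg k) (X.X k) a = 0 from DFinsupp.single_eq_of_ne (Ne.symm h), norm_zero]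

/-- Only monomials of degree a reach the component a, so coefficient bounds are needed only for |k|
= a. This is why the powers of φ and ‖y-x‖ from |k| match those prescribed by the homogeneity. -/
theorem Polynomials.norm_sum_mono_le (X : Polynomials σ 𝒯b) {B D s : ℝ} (hB : 0 ≤ B) (hD : 0 ≤ D)
    (hX : ∀ k, σ.deg k < s → ‖X.X k‖ ≤ B) (c : Idx d → ℝ) (a : ℝ)
    (hc : ∀ k, σ.deg k < s → σ.deg k = a → |c k| ≤ D) :
    ‖(∑ k ∈ σ.idxBelow s, (c k / mfact k) • X.mono k) a‖ ≤ (σ.idxBelow s).card * (D * B) := by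
  rw [DFinsupp.finsetSum_apply, ← nsmul_eq_mul]
  refine (norm_sum_le _ _).trans (Finset.sum_le_card_nsmul _ _ _ fun k hk => ?_)
  have hk' := (σ.mem_idxBelow _ _).1 hk
  have h1 := X.norm_mono_apply_le (hX k hk') a
  have h2 := one_le_mfact k
  rw [DFinsupp.smul_apply, norm_smul, Real.norm_eq_abs, abs_div, abs_of_pos (zero_lt_one.trans_le h2)]
  split_ifs at h1 with h
  · exact mul_le_mul ((div_le_self (abs_nonneg _) h2).trans (hc k hk' h)) h1 (norm_nonneg _) hD
  · rw [le_antisymm h1 (norm_nonneg _), mul_zero]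
    positivity

theorem Polynomials.isBelow_sum_mono (X : Polynomials σ 𝒯b) (s : ℝ) (c : Idx d → ℝ) :
    𝒯b.IsBelow s (∑ k ∈ σ.idxBelow s, (c k / mfact k) • X.mono k) :=
  RegStructure.isBelow_sum _ _ fun _ hk =>
    (RegStructure.isBelow_emb ((σ.mem_idxBelow _ _).1 hk) _).smul _

theorem AbsInt.normBelow_lt_top (I : AbsInt 𝒯 𝒯b β) (γ : ℝ) : I.normBelow γ < ∞ := by
  have h : I.normBelow γ ≤ ∑ α ∈ A.below γ, ‖I α‖ₑ := by
    refine iSup_le fun α => iSup_le fun hα => ?_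
    exact Finset.single_le_sum (f := fun α => ‖I α‖ₑ) (fun _ _ => zero_le)
      (IndexSet.mem_below.2 hα)
  exact h.trans_lt (ENNReal.sum_lt_top.2 fun α _ => enorm_lt_top)

theorem AbsInt.norm_map_apply_le (I : AbsInt 𝒯 𝒯b β) {τ : 𝒯.Sum} (hτ : 𝒯.IsBelow γ τ) {α : ℝ}
    (hα : α < γ) : ‖I.map τ (α + β)‖ ≤ (I.normBelow γ).toReal * ‖τ α‖ := by
  rw [I.map_apply hτ]
  by_cases hA : α ∈ A.carrier
  · refine ((I α).le_opNorm _).trans (mul_le_mul_of_nonneg_right ?_ (norm_nonneg _))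
    have h1 : ‖I α‖ₑ ≤ I.normBelow γ := le_iSup_of_le α (le_iSup_of_le ⟨hA, hα⟩ le_rfl)
    have h2 := ENNReal.toReal_mono (I.normBelow_lt_top γ).ne h1
    rwa [toReal_enorm] at h2
  · rw [RegStructure.eq_zero_of_notMem hA (τ α), map_zero, norm_zero, norm_zero, mul_zero]

theorem IsRegularizing.liftCoef_sub (hK : IsRegularizing σ G Q K βb δ CK)
    (hQ : IsSemigroup σ G Q) (hw : w.IsControlled σ G) (hv : v.IsControlled σ G)
    (hu : (w * v).IsControlled σ G) (hG0 : ∀ x, 0 ≤ G x) (hd : w.HasDecay σ G) (hCK : 0 < CK)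
    (hζ : ζ ≤ 0) (hη : γ - σ.s 0 < η) (hηγ : η ≤ γ) (hβ : β ≤ βb) (hδ : γ + βb < δ) {k : Idx d}
    (hk : σ.deg k < γ + β) (M₁ M₂ : Model σ 𝒯 Q w) {f₁ f₂ : Pt d → 𝒯.Sum}
    {Λ₁ Λ₂ : Besov σ Q ζ (w * v).w}
    (hf₁ : MemD σ v γ η M₁.Γ f₁) (hf₂ : MemD σ v γ η M₂.Γ f₂)
    (hΛ₁ : IsReconstruction γ η M₁ f₁ Λ₁) (hΛ₂ : IsReconstruction γ η M₂ f₂ Λ₂) {x : Pt d}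
    (hx : x 0 ≠ 0) :
    liftCoef K γ β M₁ f₁ Λ₁ k x - liftCoef K γ β M₂ f₂ Λ₂ k x =
      ∑ α ∈ A.below γ with σ.deg k < α + β, (∫ t in Set.Ioc 0 1, kint K k t x
        (fun s z => M₁.sizePiece f₁ x α s z - M₂.sizePiece f₂ x α s z)) +
      ∫ t in Set.Ioc 0 1, (kint K k t x (fun s z => Λ₁.Qt s z - Λ₂.Qt s z) -
        ∑ α ∈ A.below γ, kint K k t x
          (fun s z => M₁.sizePiece f₁ x α s z - M₂.sizePiece f₂ x α s z)) := by
  have hkδ : σ.deg k < δ := by linarith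
  rw [← hK.kCentered_sub hQ hw hv hu hG0 hd hCK hζ hη hηγ hkδ (by linarith) M₁ M₂ hf₁ hf₂ hΛ₁ hΛ₂ hx]
  unfold liftCoef
  rw [add_sub_add_comm, ← Finset.sum_sub_distrib]
  congr 1
  refine Finset.sum_congr rfl fun α hα => ?_
  have := (Finset.mem_filter.1 hα).2
  exact hK.kPiInt_sub hQ hw hG0 hd hCK hkδ M₁ M₂ x _ _ (by linarith)

theorem IsRegularizing.liftIncrCoef_sub (hK : IsRegularizing σ G Q K βb δ CK)
    (hQ : IsSemigroup σ G Q) (hw : w.IsControlled σ G) (hv : v.IsControlled σ G)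
    (hu : (w * v).IsControlled σ G) (hG0 : ∀ x, 0 ≤ G x) (hd : w.HasDecay σ G) (hCK : 0 < CK)
    (hζ : ζ ≤ 0) (hη : γ - σ.s 0 < η) (hηγ : η ≤ γ) (hβ : β ≤ βb) (hδ : γ + βb < δ) {k : Idx d}
    (hk : σ.deg k < γ + β) (M₁ M₂ : Model σ 𝒯 Q w) {f₁ f₂ : Pt d → 𝒯.Sum}
    {Λ₁ Λ₂ : Besov σ Q ζ (w * v).w}
    (hf₁ : MemD σ v γ η M₁.Γ f₁) (hf₂ : MemD σ v γ η M₂.Γ f₂)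
    (hΛ₁ : IsReconstruction γ η M₁ f₁ Λ₁) (hΛ₂ : IsReconstruction γ η M₂ f₂ Λ₂) {x y : Pt d}
    (hx : x 0 ≠ 0) (hy : y 0 ≠ 0) :
    liftIncrCoef K δ γ β M₁ f₁ Λ₁ k y x - liftIncrCoef K δ γ β M₂ f₂ Λ₂ k y x =
      (∑ α ∈ A.below γ with σ.deg k < α + β, ∫ t in Set.Ioc 0 1, kint K k t y
        (fun s z => M₁.incPiece f₁ y x α s z - M₂.incPiece f₂ y x α s z)) +
      (∫ t in Set.Ioc 0 1, (kint K k t y (fun s z => Λ₁.Qt s z - Λ₂.Qt s z) -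
        ∑ α ∈ A.below γ, kint K k t y
          (fun s z => M₁.sizePiece f₁ y α s z - M₂.sizePiece f₂ y α s z))) -
      ∑ l ∈ σ.idxBelow (δ - σ.deg k) with σ.deg k + σ.deg l < γ + β,
        mpow (y - x) l / mfact l * ∫ t in Set.Ioc 0 1,
          (kint K (k + l) t x (fun s z => Λ₁.Qt s z - Λ₂.Qt s z) -
          ∑ α ∈ A.below γ, kint K (k + l) t x
            (fun s z => M₁.sizePiece f₁ x α s z - M₂.sizePiece f₂ x α s z)) := by
  have hkδ : σ.deg k < δ := by linarith
  rw [← hK.kCentered_sub hQ hw hv hu hG0 hd hCK hζ hη hηγ hkδ (by linarith) M₁ M₂ hf₁ hf₂ hΛ₁ hΛ₂ hy]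
  have e1 : ∑ α ∈ A.below γ with σ.deg k < α + β, ∫ t in Set.Ioc 0 1, kint K k t y
        (fun s z => M₁.incPiece f₁ y x α s z - M₂.incPiece f₂ y x α s z) =
      ∑ α ∈ A.below γ with σ.deg k < α + β, (M₁.kPiInt K k y (𝒯.emb α (incr M₁.Γ f₁ y x α)) -
        M₂.kPiInt K k y (𝒯.emb α (incr M₂.Γ f₂ y x α))) := by
    refine Finset.sum_congr rfl fun α hα => ?_
    have := (Finset.mem_filter.1 hα).2
    exact (hK.kPiInt_sub hQ hw hG0 hd hCK hkδ M₁ M₂ y _ _ (by linarith)).symm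
  have e2 : ∑ l ∈ σ.idxBelow (δ - σ.deg k) with σ.deg k + σ.deg l < γ + β,
        mpow (y - x) l / mfact l * ∫ t in Set.Ioc 0 1,
          (kint K (k + l) t x (fun s z => Λ₁.Qt s z - Λ₂.Qt s z) -
          ∑ α ∈ A.below γ, kint K (k + l) t x
            (fun s z => M₁.sizePiece f₁ x α s z - M₂.sizePiece f₂ x α s z)) =
      ∑ l ∈ σ.idxBelow (δ - σ.deg k) with σ.deg k + σ.deg l < γ + β,
        (mpow (y - x) l / mfact l * kCentered K (k + l) M₁ f₁ Λ₁ x -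
          mpow (y - x) l / mfact l * kCentered K (k + l) M₂ f₂ Λ₂ x) := by
    refine Finset.sum_congr rfl fun l hl => ?_
    have h1 := (Finset.mem_filter.1 hl).2
    rw [← hK.kCentered_sub hQ hw hv hu hG0 hd hCK hζ hη hηγ (by rw [σ.deg_add]; linarith)
      (by rw [σ.deg_add]; linarith) M₁ M₂ hf₁ hf₂ hΛ₁ hΛ₂ hx, mul_sub]
  rw [e1, e2, Finset.sum_sub_distrib, Finset.sum_sub_distrib]
  unfold liftIncrCoef
  ring

end LiftBounds

/-! ### Estimates for the difference of two lifts. -/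

section MainBounds

variable [NeZero d] {σ : Scaling d} {w v : Weight d} {G : Pt d → ℝ} {A : IndexSet}
  {γ η ζ β βb δ : ℝ}

set_option maxHeartbeats 1000000 in
/-- The estimates for the difference of two lifts, with explicit constants. -/
theorem exists_lift_sub_bounds (hw : w.IsControlled σ G) (hv : v.IsControlled σ G)
    (hwwv : (w * w * v).IsControlled σ G) (hd : w.HasDecay σ G) (hG0 : ∀ x, 0 ≤ G x)
    (hββ : β ≤ βb) (hγ : γ + βb < δ)
    (hη : γ - σ.s 0 < η) (hηγ : η ≤ γ)
    (hζ0 : ζ ≤ 0) (hζη : ζ ≤ η) (hζα : ζ ≤ A.reg)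
    (hcase : β < βb ∨
      (β = βb ∧ ∀ α ∈ A.carrier ∪ {γ, ζ}, ∀ k : Idx d, α + βb ≠ σ.deg k)) (B : ℝ) (hB : 0 ≤ B) :
    ∃ C : ℝ, 0 ≤ C ∧ ∀ (Q K : Ker d) (CK : ℝ), IsSemigroup σ G Q → 0 < CK →
        IsRegularizing σ G Q K βb δ CK →
      ∀ (𝒯 : RegStructure.{u₁} A) (Ab : IndexSet)
        (𝒯b : RegStructure.{u₂} Ab) (X : Polynomials σ 𝒯b),
        (∀ k, σ.deg k < γ + β → ‖X.X k‖ ≤ B) →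
      ∀ (I : AbsInt 𝒯 𝒯b β) (M₁ M₂ : Model σ 𝒯 Q w) (Mb₁ Mb₂ : Model σ 𝒯b Q w),
        Compatible K δ X I M₁ Mb₁ → Compatible K δ X I M₂ Mb₂ →
      ∀ (f₁ f₂ : Pt d → 𝒯.Sum) (Λ₁ Λ₂ : Besov σ Q ζ (w * v).w),
        MemD σ v γ η M₁.Γ f₁ → MemD σ v γ η M₂.Γ f₂ →
        IsReconstruction γ η M₁ f₁ Λ₁ → IsReconstruction γ η M₂ f₂ Λ₂ →
        sizeNorm σ 𝒯b (w * w * v) (γ + β) (ζ + β)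
          (fun x => liftK K δ γ X I M₁ f₁ Λ₁ x - liftK K δ γ X I M₂ f₂ Λ₂ x) ≤
          ENNReal.ofReal (C * ((I.normBelow γ).toReal *
            (sizeNorm σ 𝒯 v γ η (fun x => f₁ x - f₂ x)).toReal +
            CK * (M₁.pieceConst M₂ γ (sizeNorm σ 𝒯 v γ η f₁).toReal
              (sizeNorm σ 𝒯 v γ η (fun x => f₁ x - f₂ x)).toReal +
              (besovNorm σ ζ (w * v).w (fun t x => Λ₁.Qt t x - Λ₂.Qt t x)).toReal +
              M₁.remConst M₂ γ (sharpNorm σ v γ η M₁.Γ f₁).toReal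
                (incrNorm σ 𝒯 v γ η (fun y x => incr M₁.Γ f₁ y x - incr M₂.Γ f₂ y x)).toReal
                (recDist γ η M₁ M₂ f₁ f₂ Λ₁ Λ₂).toReal))) ∧
        incrNorm σ 𝒯b (w * w * v) (γ + β) (ζ + β)
          (fun y x => incr Mb₁.Γ (liftK K δ γ X I M₁ f₁ Λ₁) y x -
            incr Mb₂.Γ (liftK K δ γ X I M₂ f₂ Λ₂) y x) ≤
          ENNReal.ofReal (C * ((I.normBelow γ).toReal *
            (incrNorm σ 𝒯 v γ η (fun y x => incr M₁.Γ f₁ y x - incr M₂.Γ f₂ y x)).toReal +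
            CK * (M₁.pieceConst M₂ γ (sharpNorm σ v γ η M₁.Γ f₁).toReal
              (incrNorm σ 𝒯 v γ η (fun y x => incr M₁.Γ f₁ y x - incr M₂.Γ f₂ y x)).toReal +
              M₁.remConst M₂ γ (sharpNorm σ v γ η M₁.Γ f₁).toReal
                (incrNorm σ 𝒯 v γ η (fun y x => incr M₁.Γ f₁ y x - incr M₂.Γ f₂ y x)).toReal
                (recDist γ η M₁ M₂ f₁ f₂ Λ₁ Λ₂).toReal))) := by
  have hu := hw.mul_of_mul_mul hv hwwv hG0
  obtain ⟨N, hN⟩ := A.exists_nat γ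
  have hc1 : ∀ k : Idx d, β < βb ∨ (ζ + βb ≠ σ.deg k ∧ ∀ α ∈ A.below γ, α + βb ≠ σ.deg k) :=
    fun k => hcase.imp id fun h => ⟨h.2 ζ (by simp) k, fun α hα =>
      h.2 α (Or.inl (IndexSet.mem_below.1 hα).1) k⟩
  -- The index γ meets degrees |k| + |l| = |k + l|, which are again degrees of multiindices.
  have hc2 : ∀ k : Idx d, β < βb ∨ ((∀ α ∈ A.below γ, α + βb ≠ σ.deg k) ∧
      ∀ l, γ + βb ≠ σ.deg k + σ.deg l) := fun k => hcase.imp id fun h => ⟨fun α hα =>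
      h.2 α (Or.inl (IndexSet.mem_below.1 hα).1) k, fun l => by
        rw [← σ.deg_add]; exact h.2 γ (by simp) _⟩
  have hSζ : ∀ α ∈ A.below γ, ζ ≤ α := fun α hα =>
    hζα.trans (IndexSet.reg_le (IndexSet.mem_below.1 hα).1)
  have hS : ∀ k : Idx d, ∃ C : ℝ, 0 ≤ C ∧ (σ.deg k < γ + β → ∀ (Q K : Ker d) (CK : ℝ), 0 < CK →
      IsRegularizing σ G Q K βb δ CK →
      ∀ L P₁ P₂ E : ℝ, 0 ≤ L → 0 ≤ P₁ → 0 ≤ E → ∀ lam size inc,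
      LiftData σ w v (A.below γ) N γ η ζ L P₁ P₂ E lam size inc →
      LiftTimeMeasurable σ K δ (A.below γ) lam size inc → ∀ x, x 0 ≠ 0 →
      |∑ α ∈ A.below γ with σ.deg k < α + β, (∫ t in Set.Ioc 0 1, kint K k t x (size x α)) +
        ∫ t in Set.Ioc 0 1, (kint K k t x lam - ∑ α ∈ A.below γ, kint K k t x (size x α))| ≤
        C * (CK * (P₁ + L + E)) *
          (((w * w * v).w x)⁻¹ * σ.phi x ^ min (ζ + β - σ.deg k) 0)) := fun k => by
    by_cases hk : σ.deg k < γ + β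
    · obtain ⟨C, hC, h⟩ := exists_lift_size_bound (S := A.below γ) hw hv hu hd hG0 hη hηγ hββ hγ hζη
        hSζ N k hk (hc1 k)
      exact ⟨C, hC, fun _ => h⟩
    · exact ⟨0, le_rfl, fun h => absurd h hk⟩
  have hT : ∀ k : Idx d, ∃ C : ℝ, 0 ≤ C ∧ (σ.deg k < γ + β → ∀ (Q K : Ker d) (CK : ℝ), 0 < CK →
      IsRegularizing σ G Q K βb δ CK →
      ∀ L P₁ P₂ E : ℝ, 0 ≤ L → 0 ≤ P₁ → 0 ≤ P₂ → 0 ≤ E → ∀ lam size inc,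
      LiftData σ w v (A.below γ) N γ η ζ L P₁ P₂ E lam size inc →
      LiftTimeMeasurable σ K δ (A.below γ) lam size inc → ∀ x, x 0 ≠ 0 → ∀ y, y 0 ≠ 0 → x ≠ y →
      |(∑ α ∈ A.below γ with σ.deg k < α + β, ∫ t in Set.Ioc 0 1, kint K k t y (inc y x α)) +
        (∫ t in Set.Ioc 0 1, (kint K k t y lam - ∑ α ∈ A.below γ, kint K k t y (size y α))) -
        ∑ l ∈ σ.idxBelow (δ - σ.deg k) with σ.deg k + σ.deg l < γ + β,
          mpow (y - x) l / mfact l * ∫ t in Set.Ioc 0 1,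
            (kint K (k + l) t x lam - ∑ α ∈ A.below γ, kint K (k + l) t x (size x α))| ≤
        C * (CK * (P₂ + E)) * (((w * w * v).w x)⁻¹ * (w * w * v).star (x - y) *
          σ.phi₂ x y ^ (η - γ)) * σ.nrm (y - x) ^ (γ + β - σ.deg k)) := fun k => by
    by_cases hk : σ.deg k < γ + β
    · obtain ⟨C, hC, h⟩ := exists_lift_sharp_bound hw hv hwwv hd hG0 hη hηγ hββ hγ (A.below γ) ζ
        N k hk (hc2 k)
      exact ⟨C, hC, fun _ => h⟩
    · exact ⟨0, le_rfl, fun h => absurd h hk⟩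
  choose CS hCS0 hCS using hS
  choose CT hCT0 hCT using hT
  set U := σ.idxBelow (γ + β) with hU
  -- Only finitely many multiindices satisfy |k| < γ + β, so one constant serves them all.
  set C₀ := ∑ k ∈ U, (CS k + CT k) with hC₀
  have hC₀0 : 0 ≤ C₀ := Finset.sum_nonneg fun k _ => add_nonneg (hCS0 k) (hCT0 k)
  have hC₀S : ∀ k, σ.deg k < γ + β → CS k ≤ C₀ ∧ CT k ≤ C₀ := fun k hk => by
    have := Finset.single_le_sum (f := fun k => CS k + CT k)
      (fun k _ => add_nonneg (hCS0 k) (hCT0 k)) ((σ.mem_idxBelow (γ + β) k).2 hk)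
    have h1 := hCS0 k
    have h2 := hCT0 k
    constructor <;> linarith
  clear_value C₀
  refine ⟨1 + U.card * (C₀ * B), by positivity, ?_⟩
  intro Q K CK hQ hCK hK 𝒯 Ab 𝒯b X hX I M₁ M₂ Mb₁ Mb₂ hC₁ hC₂ f₁ f₂ Λ₁ Λ₂ hf₁ hf₂ hΛ₁ hΛ₂
  have hD := liftData_sub hQ hw hv hu hG0 hζ0 hN M₁ M₂ hf₁ hf₂ hΛ₁ hΛ₂
  have hM := hK.liftTimeMeasurable_sub (γ := γ) hQ hw hu hG0 hd hCK hζ0 M₁ M₂ f₁ f₂ Λ₁ Λ₂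
  have hv0 := fun x => (hv.pos x).le
  have hdiff := (sizeNorm_sub_le (σ := σ) (γ := γ) (η := η) hv0 f₁ f₂).trans_lt
    (ENNReal.add_lt_top.2 ⟨hf₁.sizeNorm_lt_top, hf₂.sizeNorm_lt_top⟩)
  have hidiff := (incrNorm_sub_le (σ := σ) (γ := γ) (η := η) hv0 hv.star_nonneg (incr M₁.Γ f₁)
    (incr M₂.Γ f₂)).trans_lt
    (ENNReal.add_lt_top.2 ⟨hf₁.sharpNorm_lt_top, hf₂.sharpNorm_lt_top⟩)
  have hsz := fun (α : ℝ) (hα : α < γ) (x : Pt d) (hx : x 0 ≠ 0) =>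
    norm_le_of_sizeNorm hdiff hx (hv.pos x) hα
  have hin := fun (α : ℝ) (hα : α < γ) (x : Pt d) (hx : x 0 ≠ 0) (y : Pt d) (hy : y 0 ≠ 0) =>
    norm_le_of_incrNorm hidiff hx hy (hv.pos x) (hv.one_le_star (x - y)) hα
      (fun e => by rw [e, M₁.incr_self, M₂.incr_self, sub_zero]; rfl)
  have hL0 : 0 ≤ (besovNorm σ ζ (w * v).w (fun t x => Λ₁.Qt t x - Λ₂.Qt t x)).toReal :=
    ENNReal.toReal_nonneg
  have hP₁0 := M₁.pieceConst_nonneg M₂ (γ := γ) (n := (sizeNorm σ 𝒯 v γ η f₁).toReal)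
    (e := (sizeNorm σ 𝒯 v γ η (fun x => f₁ x - f₂ x)).toReal) ENNReal.toReal_nonneg
    ENNReal.toReal_nonneg
  have hP₂0 := M₁.pieceConst_nonneg M₂ (γ := γ) (n := (sharpNorm σ v γ η M₁.Γ f₁).toReal)
    (e := (incrNorm σ 𝒯 v γ η (fun y x => incr M₁.Γ f₁ y x - incr M₂.Γ f₂ y x)).toReal)
    ENNReal.toReal_nonneg ENNReal.toReal_nonneg
  have hE0 := M₁.remConst_nonneg M₂ (γ := γ) (n := (sharpNorm σ v γ η M₁.Γ f₁).toReal)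
    (e := (incrNorm σ 𝒯 v γ η (fun y x => incr M₁.Γ f₁ y x - incr M₂.Γ f₂ y x)).toReal)
    (r := (recDist γ η M₁ M₂ f₁ f₂ Λ₁ Λ₂).toReal)
    ENNReal.toReal_nonneg ENNReal.toReal_nonneg ENNReal.toReal_nonneg
  have hsd0 : 0 ≤ (sizeNorm σ 𝒯 v γ η (fun x => f₁ x - f₂ x)).toReal := ENNReal.toReal_nonneg
  have hnd0 : 0 ≤ (incrNorm σ 𝒯 v γ η (fun y x => incr M₁.Γ f₁ y x - incr M₂.Γ f₂ y x)).toReal :=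
    ENNReal.toReal_nonneg
  have hi0 : 0 ≤ (I.normBelow γ).toReal := ENNReal.toReal_nonneg
  have hmap := fun (τ : 𝒯.Sum) (hτ : 𝒯.IsBelow γ τ) (α : ℝ) (hα : α < γ) =>
    I.norm_map_apply_le hτ hα
  generalize (besovNorm σ ζ (w * v).w (fun t x => Λ₁.Qt t x - Λ₂.Qt t x)).toReal = L at *
  generalize M₁.pieceConst M₂ γ (sizeNorm σ 𝒯 v γ η f₁).toReal
    (sizeNorm σ 𝒯 v γ η (fun x => f₁ x - f₂ x)).toReal = P₁ at *
  generalize M₁.pieceConst M₂ γ (sharpNorm σ v γ η M₁.Γ f₁).toReal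
    (incrNorm σ 𝒯 v γ η (fun y x => incr M₁.Γ f₁ y x - incr M₂.Γ f₂ y x)).toReal = P₂ at *
  generalize M₁.remConst M₂ γ (sharpNorm σ v γ η M₁.Γ f₁).toReal
    (incrNorm σ 𝒯 v γ η (fun y x => incr M₁.Γ f₁ y x - incr M₂.Γ f₂ y x)).toReal
    (recDist γ η M₁ M₂ f₁ f₂ Λ₁ Λ₂).toReal = E at *
  generalize (sizeNorm σ 𝒯 v γ η (fun x => f₁ x - f₂ x)).toReal = sd at *
  generalize (incrNorm σ 𝒯 v γ η (fun y x => incr M₁.Γ f₁ y x - incr M₂.Γ f₂ y x)).toReal = nd at *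
  generalize (I.normBelow γ).toReal = i at *
  have hγβ : γ + β < δ := by linarith
  have hUB : 0 ≤ (U.card : ℝ) * (C₀ * B) := by positivity
  have hvW : ∀ x, (v.w x)⁻¹ ≤ ((w * w * v).w x)⁻¹ := fun x => by
    refine inv_anti₀ (hwwv.pos x) ?_
    change w.w x * w.w x * v.w x ≤ v.w x
    exact mul_le_of_le_one_left (hv.pos x).le (mul_le_one₀ (hw.le_one x) (hw.pos x).le (hw.le_one x))
  have hvs : ∀ x, v.star x ≤ (w * w * v).star x := fun x => by
    change v.star x ≤ w.star x * w.star x * v.star x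
    exact le_mul_of_one_le_left (hv.star_nonneg x)
      (one_le_mul_of_one_le_of_one_le (hw.one_le_star x) (hw.one_le_star x))
  constructor
  · refine (sizeNorm_le_iff (by positivity)).2 fun a ha haγ x hx => ?_
    obtain ⟨α, rfl⟩ : ∃ α, a = α + β := ⟨a - β, by ring⟩
    have hα : α < γ := by linarith
    have hφ := σ.phi_pos hx
    set W := ((w * w * v).w x)⁻¹ with hW
    have hW0 : 0 ≤ W := inv_nonneg.2 (hwwv.pos x).le
    set Φ := σ.phi x ^ min (ζ + β - (α + β)) 0 with hΦ
    have hΦ0 : 0 < Φ := by positivity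
    rw [div_le_iff₀ hΦ0]
    have e1 : liftK K δ γ X I M₁ f₁ Λ₁ x - liftK K δ γ X I M₂ f₂ Λ₂ x =
        I.map (f₁ x - f₂ x) + ∑ k ∈ σ.idxBelow (γ + β), ((liftCoef K γ β M₁ f₁ Λ₁ k x -
          liftCoef K γ β M₂ f₂ Λ₂ k x) / mfact k) • X.mono k := by
      rw [hK.liftK_eq hQ hw hG0 hd hCK hγβ X I M₁ Λ₁ (hf₁.1 x hx),
        hK.liftK_eq hQ hw hG0 hd hCK hγβ X I M₂ Λ₂ (hf₂.1 x hx), map_sub, add_sub_add_comm,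
        ← Finset.sum_sub_distrib]
      refine congrArg₂ _ rfl (Finset.sum_congr rfl fun k _ => ?_)
      rw [← sub_smul, ← sub_div]
    have h1 : ‖I.map (f₁ x - f₂ x) (α + β)‖ ≤ i * sd * (W * Φ) := by
      refine (hmap _ ((hf₁.1 x hx).sub (hf₂.1 x hx)) α hα).trans ?_
      rw [mul_assoc]
      refine mul_le_mul_of_nonneg_left ((hsz α hα x hx).trans ?_) hi0
      refine mul_le_mul_of_nonneg_left ?_ hsd0
      rw [mul_comm W]
      refine mul_le_mul ?_ (hvW x) (inv_nonneg.2 (hv0 x)) hΦ0.le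
      -- The term 𝓘f has the better exponent η; it is weakened to ζ ≤ η, using φ ≤ 1.
      exact Real.rpow_le_rpow_of_exponent_ge hφ (σ.phi_le_one x)
        (min_le_min_right _ (by linarith))
    have h2 : ‖(∑ k ∈ σ.idxBelow (γ + β), ((liftCoef K γ β M₁ f₁ Λ₁ k x -
        liftCoef K γ β M₂ f₂ Λ₂ k x) / mfact k) • X.mono k) (α + β)‖ ≤
        U.card * ((C₀ * (CK * (P₁ + L + E)) * (W * Φ)) * B) := by
      refine X.norm_sum_mono_le hB (by positivity) hX _ _ fun k hk hka => ?_
      rw [hK.liftCoef_sub hQ hw hv hu hG0 hd hCK hζ0 hη hηγ hββ hγ hk M₁ M₂ hf₁ hf₂ hΛ₁ hΛ₂ hx]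
      refine (hCS k hk Q K CK hCK hK L P₁ P₂ E hL0 hP₁0 hE0 _ _ _ hD hM x hx).trans ?_
      rw [hka]
      have := (hC₀S k hk).1
      gcongr
    rw [e1, DFinsupp.add_apply]
    have h3 := (norm_add_le (I.map (f₁ x - f₂ x) (α + β)) _).trans (add_le_add h1 h2)
    have hwx := hwwv.pos x
    calc _ ≤ (w * w * v).w x * (i * sd * (W * Φ) +
          U.card * ((C₀ * (CK * (P₁ + L + E)) * (W * Φ)) * B)) :=
          mul_le_mul_of_nonneg_left h3 hwx.le
      _ = ((w * w * v).w x * W) * ((i * sd + U.card * (C₀ * B) * (CK * (P₁ + L + E))) * Φ) := by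
          ring
      _ = (i * sd + U.card * (C₀ * B) * (CK * (P₁ + L + E))) * Φ := by
          rw [hW, mul_inv_cancel₀ hwx.ne', one_mul]
      _ ≤ _ := by
          refine mul_le_mul_of_nonneg_right ?_ hΦ0.le
          have q1 : 0 ≤ U.card * (C₀ * B) * (i * sd) := by positivity
          have q2 : 0 ≤ CK * (P₁ + L + E) := by positivity
          nlinarith
  · refine (incrNorm_le_iff (by positivity)).2 fun a ha haγ x y hx hy hxy => ?_
    obtain ⟨α, rfl⟩ : ∃ α, a = α + β := ⟨a - β, by ring⟩
    have hα : α < γ := by linarith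
    have hφ := phi₂_pos (σ := σ) hx hy
    set W := ((w * w * v).w x)⁻¹ with hW
    have hW0 : 0 ≤ W := inv_nonneg.2 (hwwv.pos x).le
    have hr := σ.nrm_pos (sub_ne_zero.2 hxy.symm)
    set Φ := σ.phi₂ x y ^ (ζ + β - (γ + β)) with hΦ
    set St := (w * w * v).star (x - y) with hSt
    set R := σ.nrm (y - x) ^ (γ + β - (α + β)) with hR
    have hSt0 : 0 < St := zero_lt_one.trans_le (hwwv.one_le_star _)
    have hR0 : 0 < R := by positivity
    have hΦ0 : 0 < Φ := by positivity
    rw [div_le_iff₀ (by positivity)]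
    have e1 : incr Mb₁.Γ (liftK K δ γ X I M₁ f₁ Λ₁) y x -
        incr Mb₂.Γ (liftK K δ γ X I M₂ f₂ Λ₂) y x =
        I.map (incr M₁.Γ f₁ y x - incr M₂.Γ f₂ y x) + ∑ k ∈ σ.idxBelow (γ + β),
          ((liftIncrCoef K δ γ β M₁ f₁ Λ₁ k y x -
          liftIncrCoef K δ γ β M₂ f₂ Λ₂ k y x) / mfact k) • X.mono k := by
      rw [hK.liftK_incr hQ hw hG0 hd hCK hββ hγβ hC₁ Λ₁ (hf₁.1 x hx) (hf₁.1 y hy),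
        hK.liftK_incr hQ hw hG0 hd hCK hββ hγβ hC₂ Λ₂ (hf₂.1 x hx) (hf₂.1 y hy), map_sub,
        add_sub_add_comm, ← Finset.sum_sub_distrib]
      refine congrArg₂ _ rfl (Finset.sum_congr rfl fun k _ => ?_)
      rw [← sub_smul, ← sub_div]
    have hφle : σ.phi₂ x y ^ (η - γ) ≤ Φ :=
      Real.rpow_le_rpow_of_exponent_ge hφ (phi₂_le_one x y) (by linarith)
    have h1 : ‖I.map (incr M₁.Γ f₁ y x - incr M₂.Γ f₂ y x) (α + β)‖ ≤
        i * nd * (W * St * Φ * R) := by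
      refine (hmap _ ((M₁.isBelow_incr (hf₁.1 x hx) (hf₁.1 y hy)).sub
        (M₂.isBelow_incr (hf₂.1 x hx) (hf₂.1 y hy))) α hα).trans ?_
      rw [mul_assoc]
      refine mul_le_mul_of_nonneg_left ((hin α hα x hx y hy).trans ?_) hi0
      refine mul_le_mul_of_nonneg_left ?_ hnd0
      have e : R = σ.nrm (y - x) ^ (γ - α) := by rw [hR]; congr 1; ring
      rw [e]
      refine mul_le_mul_of_nonneg_right ?_ (by positivity)
      rw [mul_comm (W * St)]
      refine mul_le_mul hφle ?_ (mul_nonneg (inv_nonneg.2 (hv0 x)) (hv.star_nonneg _)) hΦ0.le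
      exact mul_le_mul (hvW x) (hvs _) (hv.star_nonneg _) hW0
    have h2 : ‖(∑ k ∈ σ.idxBelow (γ + β), ((liftIncrCoef K δ γ β M₁ f₁ Λ₁ k y x -
          liftIncrCoef K δ γ β M₂ f₂ Λ₂ k y x) / mfact k) • X.mono k) (α + β)‖ ≤
        U.card * ((C₀ * (CK * (P₂ + E)) * (W * St * Φ * R)) * B) := by
      refine X.norm_sum_mono_le hB (by positivity) hX _ _ fun k hk hka => ?_
      rw [hK.liftIncrCoef_sub hQ hw hv hu hG0 hd hCK hζ0 hη hηγ hββ hγ hk M₁ M₂ hf₁ hf₂ hΛ₁ hΛ₂ hx hy]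
      refine (hCT k hk Q K CK hCK hK L P₁ P₂ E hL0 hP₁0 hP₂0 hE0 _ _ _ hD hM x hx y hy hxy).trans ?_
      rw [hka]
      have := (hC₀S k hk).2
      rw [mul_assoc (CT k * _)]
      gcongr
    rw [e1, DFinsupp.add_apply]
    have h3 := (norm_add_le (I.map (incr M₁.Γ f₁ y x - incr M₂.Γ f₂ y x) (α + β)) _).trans
      (add_le_add h1 h2)
    have hwx := hwwv.pos x
    calc _ ≤ (w * w * v).w x * (i * nd * (W * St * Φ * R) +
          U.card * ((C₀ * (CK * (P₂ + E)) * (W * St * Φ * R)) * B)) :=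
          mul_le_mul_of_nonneg_left h3 hwx.le
      _ = ((w * w * v).w x * W) * ((i * nd + U.card * (C₀ * B) * (CK * (P₂ + E))) *
          (Φ * St * R)) := by ring
      _ = (i * nd + U.card * (C₀ * B) * (CK * (P₂ + E))) * (Φ * St * R) := by
          rw [hW, mul_inv_cancel₀ hwx.ne', one_mul]
      _ ≤ _ := by
          refine mul_le_mul_of_nonneg_right ?_ (by positivity)
          have q1 : 0 ≤ U.card * (C₀ * B) * (i * nd) := by positivity
          have q2 : 0 ≤ CK * (P₂ + E) := by positivity
          nlinarith

end MainBounds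

/-! ### Specialization to a single lift. -/

section LiftZero

variable [NeZero d] {A Ab : IndexSet} {𝒯 : RegStructure.{u₁} A} {𝒯b : RegStructure.{u₂} Ab}
  {σ : Scaling d} {Q K : Ker d} {w v : Weight d} {G : Pt d → ℝ} {γ η ζ β βb δ CK : ℝ}

/-- Zero data have zero lift, so the estimate for differences contains the one for a single lift. -/
theorem IsRegularizing.liftK_zero (hK : IsRegularizing σ G Q K βb δ CK)
    (hQ : IsSemigroup σ G Q) (hw : w.IsControlled σ G) (hu : (w * v).IsControlled σ G)
    (hG0 : ∀ x, 0 ≤ G x) (hd : w.HasDecay σ G) (hCK : 0 < CK) (hζ : ζ ≤ 0) (hδ : γ + β < δ)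
    (X : Polynomials σ 𝒯b) (I : AbsInt 𝒯 𝒯b β) (M : Model σ 𝒯 Q w) (x : Pt d) :
    liftK K δ γ X I M (fun _ => 0) (Besov.zero σ Q ζ (w * v).w) x = 0 := by
  have h0 : 𝒯.IsBelow γ (0 : 𝒯.Sum) := fun _ _ => rfl
  rw [hK.liftK_eq hQ hw hG0 hd hCK hδ X I M _ h0, map_zero, zero_add]
  refine Finset.sum_eq_zero fun k hk => ?_
  have hkδ : σ.deg k < δ := ((σ.mem_idxBelow _ _).1 hk).trans hδ
  have h1 : kCentered K k M (fun _ => 0) (Besov.zero σ Q ζ (w * v).w) x = 0 := by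
    unfold kCentered
    rw [setIntegral_congr_fun (g := fun _ => 0) measurableSet_Ioc fun t ht => ?_]
    · simp
    rw [hK.kbesov_sub_kPi hQ hw hu hG0 hd hCK hζ hkδ M (f := fun _ => 0) _ h0 ht.1 ht.2]
    simp [kint, Besov.zero, M.sizePiece_zero]
  have h2 : ∀ α, M.kPiInt K k x (𝒯.emb α ((0 : 𝒯.Sum) α)) = 0 := fun α => by
    rw [DFinsupp.zero_apply, show 𝒯.emb α (0 : 𝒯.T α) = 0 from DFinsupp.single_zero α]
    exact hK.kPiInt_zero hQ hw hG0 hd hCK hkδ M x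
  unfold liftCoef
  rw [h1, Finset.sum_eq_zero fun α _ => h2 α]
  simp

theorem IsRegularizing.isBelow_liftK (hK : IsRegularizing σ G Q K βb δ CK)
    (hQ : IsSemigroup σ G Q) (hw : w.IsControlled σ G) (hG0 : ∀ x, 0 ≤ G x) (hd : w.HasDecay σ G)
    (hCK : 0 < CK) (hδ : γ + β < δ) (X : Polynomials σ 𝒯b) (I : AbsInt 𝒯 𝒯b β)
    (M : Model σ 𝒯 Q w) {f : Pt d → 𝒯.Sum} (Λ : Besov σ Q ζ (w * v).w) {x : Pt d}
    (hx : 𝒯.IsBelow γ (f x)) : 𝒯b.IsBelow (γ + β) (liftK K δ γ X I M f Λ x) := by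
  rw [hK.liftK_eq hQ hw hG0 hd hCK hδ X I M Λ hx]
  exact (I.isBelow_map hx).add (X.isBelow_sum_mono _ _)

theorem Model.distPi_self (M : Model σ 𝒯 Q w) (γ : ℝ) : M.distPi M γ = 0 := by
  simp [Model.distPi, piNorm]

theorem Model.distΓ_self (M : Model σ 𝒯 Q w) (γ : ℝ) : M.distΓ M γ = 0 := by
  simp [Model.distΓ, gammaNorm]

theorem Model.pieceConst_self (M : Model σ 𝒯 Q w) (γ n e : ℝ) :
    M.pieceConst M γ n e =
      (A.below γ).card * ((M.normPi γ).toReal * ((1 + (M.normΓ γ).toReal) * e)) := by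
  simp [Model.pieceConst, Model.distPi_self, Model.distΓ_self]

theorem Model.remConst_self (M : Model σ 𝒯 Q w) (γ n e r : ℝ) :
    M.remConst M γ n e r = r + (A.below γ).card * ((M.normPi γ).toReal * e) := by
  simp [Model.remConst, Model.distPi_self]

/-- Returns from real numbers to extended ones and moves the number c of homogeneities into the
constant: the right side minus the left is a polynomial with nonnegative coefficients. -/
theorem ofReal_size_bound_le {C c CK : ℝ} (hC : 0 ≤ C) (hc : 0 ≤ c) (hCK : 0 < CK)
    {i s n b r p g : ℝ≥0∞} (hi : i < ∞) (hs : s < ∞) (hn : n < ∞) (hb : b < ∞) (hr : r < ∞)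
    (hp : p < ∞) (hg : g < ∞) :
    ENNReal.ofReal (C * (i.toReal * s.toReal + CK * (c * (p.toReal * ((1 + g.toReal) * s.toReal)) +
      b.toReal + (r.toReal + c * (p.toReal * n.toReal))))) ≤
      ((C * (1 + c)).toNNReal : ℝ≥0∞) *
        (i * s + ENNReal.ofReal CK * (p * (1 + g) * (s + n) + b + r)) := by
  lift i to ℝ≥0 using hi.ne
  lift s to ℝ≥0 using hs.ne
  lift n to ℝ≥0 using hn.ne
  lift b to ℝ≥0 using hb.ne
  lift r to ℝ≥0 using hr.ne
  lift p to ℝ≥0 using hp.ne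
  lift g to ℝ≥0 using hg.ne
  lift C to ℝ≥0 using hC
  lift c to ℝ≥0 using hc
  lift CK to ℝ≥0 using hCK.le
  rw [ENNReal.ofReal_coe_nnreal]
  simp only [ENNReal.coe_toReal]
  refine ENNReal.ofReal_le_iff_le_toReal (by finiteness) |>.2 ?_
  have e : (C * (1 + c) : ℝ).toNNReal = C * (1 + c) := by
    rw [← NNReal.coe_one, ← NNReal.coe_add, ← NNReal.coe_mul, Real.toNNReal_coe]
  rw [e]
  norm_cast
  rw [ENNReal.coe_toReal, NNReal.coe_le_coe]
  have h : i * s + CK * (c * (p * ((1 + g) * s)) + b + (r + c * (p * n))) ≤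
      (1 + c) * (i * s + CK * (p * (1 + g) * (s + n) + b + r)) := by
    have : (1 + c) * (i * s + CK * (p * (1 + g) * (s + n) + b + r)) =
        (i * s + CK * (c * (p * ((1 + g) * s)) + b + (r + c * (p * n)))) + (c * (i * s) +
          CK * (p * (1 + g) * (s + n) + c * (p * g * n) + c * b + c * r)) := by ring
    rw [this]
    exact le_self_add
  calc _ ≤ C * _ := mul_le_mul_right h C
    _ = _ := by ring

theorem ofReal_sharp_bound_le {C c CK : ℝ} (hC : 0 ≤ C) (hc : 0 ≤ c) (hCK : 0 < CK)
    {i n r p g : ℝ≥0∞} (hi : i < ∞) (hn : n < ∞) (hr : r < ∞) (hp : p < ∞) (hg : g < ∞) :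
    ENNReal.ofReal (C * (i.toReal * n.toReal + CK * (c * (p.toReal * ((1 + g.toReal) * n.toReal)) +
      (r.toReal + c * (p.toReal * n.toReal))))) ≤
      ((C * (1 + 2 * c)).toNNReal : ℝ≥0∞) *
        (i * n + ENNReal.ofReal CK * (p * (1 + g) * n + r)) := by
  lift i to ℝ≥0 using hi.ne
  lift n to ℝ≥0 using hn.ne
  lift r to ℝ≥0 using hr.ne
  lift p to ℝ≥0 using hp.ne
  lift g to ℝ≥0 using hg.ne
  lift C to ℝ≥0 using hC
  lift c to ℝ≥0 using hc
  lift CK to ℝ≥0 using hCK.le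
  rw [ENNReal.ofReal_coe_nnreal]
  simp only [ENNReal.coe_toReal]
  refine ENNReal.ofReal_le_iff_le_toReal (by finiteness) |>.2 ?_
  have e : (C * (1 + 2 * c) : ℝ).toNNReal = C * (1 + 2 * c) := by
    rw [← NNReal.coe_one, ← NNReal.coe_two, ← NNReal.coe_mul, ← NNReal.coe_add, ← NNReal.coe_mul,
      Real.toNNReal_coe]
  rw [e]
  norm_cast
  rw [ENNReal.coe_toReal, NNReal.coe_le_coe]
  have h : i * n + CK * (c * (p * ((1 + g) * n)) + (r + c * (p * n))) ≤
      (1 + 2 * c) * (i * n + CK * (p * (1 + g) * n + r)) := by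
    have : (1 + 2 * c) * (i * n + CK * (p * (1 + g) * n + r)) =
        (i * n + CK * (c * (p * ((1 + g) * n)) + (r + c * (p * n)))) + (2 * c * (i * n) +
          CK * (p * (1 + g) * n + c * (p * g * n) + 2 * c * r)) := by ring
    rw [this]
    exact le_self_add
  calc _ ≤ C * _ := mul_le_mul_right h C
    _ = _ := by ring

end LiftZero

/-! ### Part (a): membership and linear estimates. -/

section Bounds

variable [NeZero d] {σ : Scaling d} {w v : Weight d} {G : Pt d → ℝ} {A : IndexSet}
  {γ η ζ β βb δ : ℝ}

/-- The lift is a modelled distribution, with linear estimates. -/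
theorem exists_lift_bounds (hw : w.IsControlled σ G) (hv : v.IsControlled σ G)
    (hwwv : (w * w * v).IsControlled σ G) (hd : w.HasDecay σ G) (hG0 : ∀ x, 0 ≤ G x)
    (hββ : β ≤ βb) (hγ : γ + βb < δ) (hη : γ - σ.s 0 < η) (hηγ : η ≤ γ)
    (hζ0 : ζ ≤ 0) (hζη : ζ ≤ η) (hζα : ζ ≤ A.reg)
    (hcase : β < βb ∨
      (β = βb ∧ ∀ α ∈ A.carrier ∪ {γ, ζ}, ∀ k : Idx d, α + βb ≠ σ.deg k)) (B : ℝ) :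
    ∃ C : ℝ≥0,
      ∀ (Q K : Ker d) (CK : ℝ), IsSemigroup σ G Q → 0 < CK →
        IsRegularizing σ G Q K βb δ CK →
      ∀ (𝒯 : RegStructure.{u₁} A) (Ab : IndexSet)
        (𝒯b : RegStructure.{u₂} Ab) (X : Polynomials σ 𝒯b),
        (∀ k, σ.deg k < γ + β → ‖X.X k‖ ≤ B) →
      ∀ (I : AbsInt 𝒯 𝒯b β)
        (M : Model σ 𝒯 Q w) (Mb : Model σ 𝒯b Q w),
        Compatible K δ X I M Mb →
      ∀ (f : Pt d → 𝒯.Sum) (Λ : Besov σ Q ζ (w * v).w),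
        MemD σ v γ η M.Γ f → IsReconstruction γ η M f Λ →
        MemD σ (w * w * v) (γ + β) (ζ + β) Mb.Γ
          (liftK K δ γ X I M f Λ) ∧
        sizeNorm σ 𝒯b (w * w * v) (γ + β) (ζ + β)
            (liftK K δ γ X I M f Λ) ≤
          C * (I.normBelow γ * sizeNorm σ 𝒯 v γ η f +
            ENNReal.ofReal CK *
              (M.normPi γ * (1 + M.normΓ γ) * fullNorm σ v γ η M.Γ f +
                besovNorm σ ζ (w * v).w Λ.Qt +
                recSize γ η M f Λ)) ∧
        sharpNorm σ (w * w * v) (γ + β) (ζ + β) Mb.Γ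
            (liftK K δ γ X I M f Λ) ≤
          C * (I.normBelow γ * sharpNorm σ v γ η M.Γ f +
            ENNReal.ofReal CK *
              (M.normPi γ * (1 + M.normΓ γ) * sharpNorm σ v γ η M.Γ f +
                recSize γ η M f Λ)) := by
  have hu := hw.mul_of_mul_mul hv hwwv hG0
  obtain ⟨C, hC, h⟩ := exists_lift_sub_bounds.{u₁, u₂} hw hv hwwv hd hG0 hββ hγ hη hηγ hζ0 hζη
    hζα hcase (max B 0) (le_max_right _ _)
  refine ⟨(C * (1 + 2 * (A.below γ).card)).toNNReal,
    fun Q K CK hQ hCK hK 𝒯 Ab 𝒯b X hX I M Mb hMb f Λ hf hΛ => ?_⟩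
  have hδ : γ + β < δ := by linarith
  -- The second set of data is zero over the same models, so both model distances vanish and only
  -- terms linear in f and Λ survive.
  have h1 := h Q K CK hQ hCK hK 𝒯 Ab 𝒯b X (fun k hk => (hX k hk).trans (le_max_left _ _)) I M M Mb Mb
    hMb hMb f (fun _ => 0) Λ (Besov.zero σ Q ζ (w * v).w) hf (memD_zero _) hΛ
    (isReconstruction_zero M)
  have e0 : ∀ x, liftK K δ γ X I M (fun _ => 0) (Besov.zero σ Q ζ (w * v).w) x = 0 := fun x =>
    hK.liftK_zero hQ hw hu hG0 hd hCK hζ0 hδ X I M x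
  have e1 : ∀ y x, incr Mb.Γ (liftK K δ γ X I M (fun _ => 0) (Besov.zero σ Q ζ (w * v).w)) y x = 0 :=
    fun y x => by simp [incr, e0]
  have e2 : ∀ y x, incr M.Γ (fun _ => 0) y x = 0 := fun y x => by simp [incr]
  have e3 : recDist γ η M M f (fun _ => 0) Λ (Besov.zero σ Q ζ (w * v).w) = recSize γ η M f Λ := by
    simp only [recDist, recSize, centered, Besov.zero, map_zero, sub_zero]
    rfl
  simp only [e0, e1, e2, e3, sub_zero, M.pieceConst_self, M.remConst_self] at h1
  simp only [Besov.zero, sub_zero] at h1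
  have hb := Λ.norm_lt_top hQ hu hG0 hζ0
  have hp := M.normPi_lt_top (fun x => (hw.pos x).le) γ
  have hi := I.normBelow_lt_top γ
  have hg := M.normΓ_lt_top (fun x => (hw.pos x).le) hw.star_nonneg γ
  have hc : (0 : ℝ) ≤ (A.below γ).card := Nat.cast_nonneg _
  have hle : ((C * (1 + (A.below γ).card)).toNNReal : ℝ≥0∞) ≤
      ((C * (1 + 2 * (A.below γ).card)).toNNReal : ℝ≥0∞) := by
    refine ENNReal.coe_le_coe.2 (Real.toNNReal_le_toNNReal ?_)
    exact mul_le_mul_of_nonneg_left (by linarith) hC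
  refine ⟨⟨fun x hx => hK.isBelow_liftK hQ hw hG0 hd hCK hδ X I M Λ (hf.1 x hx),
    ENNReal.add_lt_top.2 ⟨h1.1.trans_lt ENNReal.ofReal_lt_top,
      h1.2.trans_lt ENNReal.ofReal_lt_top⟩⟩, ?_, ?_⟩
  · refine h1.1.trans ((ofReal_size_bound_le hC hc hCK hi hf.sizeNorm_lt_top hf.sharpNorm_lt_top hb
      hΛ hp hg).trans ?_)
    exact mul_le_mul_left hle _
  · exact h1.2.trans (ofReal_sharp_bound_le hC hc hCK hi hf.sharpNorm_lt_top hΛ hp hg)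

end Bounds

/-! ### Reconstructions in positive regularity. -/

section Uniqueness

variable [NeZero d] {A : IndexSet} {𝒯 : RegStructure.{u} A} {σ : Scaling d} {Q : Ker d}
  {w v : Weight d} {G : Pt d → ℝ} {γ η ζ : ℝ}

theorem Besov.integrable_smear {u : Weight d} (Λ : Besov σ Q ζ u.w) (hQ : IsSemigroup σ G Q)
    (hu : u.IsControlled σ G) (hG0 : ∀ x, 0 ≤ G x) (hζ : ζ ≤ 0) {r s : ℝ} (hr : 0 < r) (hr1 : r ≤ 1)
    (hs : 0 < s) (hs1 : s ≤ 1) (x : Pt d) : Integrable (fun z => Q r x z * Λ.Qt s z) := by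
  obtain ⟨C, hC, h⟩ := hu.exists_pairing hG0
  obtain ⟨C₁, hC₁, hq⟩ := hQ.upper
  exact (h r hr hr1 x (fun z => Q r x z) (Λ.Qt s) C₁
    ((besovNorm σ ζ u.w Λ.Qt).toReal * s ^ (ζ / σ.ell)) hC₁.le
    (mul_nonneg ENNReal.toReal_nonneg (by positivity))
    (hQ.measurable_right hr x).aestronglyMeasurable
    (Λ.measurable_Qt hQ hu hs hs1).aestronglyMeasurable (fun z => hq r hr x z)
    (fun z => abs_le_of_besovNorm (Λ.norm_lt_top hQ hu hG0 hζ) hs hs1 (hu.pos z))).1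

/-- The semigroup property for Λ_x with the base point x fixed: Q_t(x,Λ_x) is the integral of
Q_{t-s}(x,z) Q_s(z,Λ_x) over z. -/
theorem centered_sub_eq (hQ : IsSemigroup σ G Q) (hw : w.IsControlled σ G)
    (hu : (w * v).IsControlled σ G) (hG0 : ∀ x, 0 ≤ G x) (hd : w.HasDecay σ G) (hζ : ζ ≤ 0)
    (M₁ M₂ : Model σ 𝒯 Q w) {f₁ f₂ : Pt d → 𝒯.Sum} (Λ₁ Λ₂ : Besov σ Q ζ (w * v).w) {x : Pt d}
    (hx₁ : 𝒯.IsBelow γ (f₁ x)) (hx₂ : 𝒯.IsBelow γ (f₂ x)) {s t : ℝ} (hs : 0 < s) (hst : s < t)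
    (ht : t ≤ 1) :
    centered M₁ f₁ Λ₁ t x - centered M₂ f₂ Λ₂ t x = ∫ z, Q (t - s) x z *
      (Λ₁.Qt s z - Λ₂.Qt s z - ∑ α ∈ A.below γ,
        (M₁.sizePiece f₁ x α s z - M₂.sizePiece f₂ x α s z)) := by
  obtain ⟨C₁, hC₁, hq⟩ := hQ.upper
  have hr : 0 < t - s := by linarith
  have hr1 : t - s ≤ 1 := by linarith
  have hs1 : s ≤ 1 := by linarith
  have a₁ := Λ₁.integrable_smear hQ hu hG0 hζ hr hr1 hs hs1 x
  have a₂ := Λ₂.integrable_smear hQ hu hG0 hζ hr hr1 hs hs1 x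
  have b₁ := M₁.integrable_pairing hQ hw hG0 hd x hx₁ hr hr1 hs hs1 (hQ.measurable_right hr x) hC₁.le
    (fun z => hq _ hr x z)
  have b₂ := M₂.integrable_pairing hQ hw hG0 hd x hx₂ hr hr1 hs hs1 (hQ.measurable_right hr x) hC₁.le
    (fun z => hq _ hr x z)
  have c₁ : Integrable (fun z => Q (t - s) x z * Λ₁.Qt s z -
    Q (t - s) x z * M₁.evalAt s z x (f₁ x)) := a₁.sub b₁
  have c₂ : Integrable (fun z => Q (t - s) x z * Λ₂.Qt s z -
    Q (t - s) x z * M₂.evalAt s z x (f₂ x)) := a₂.sub b₂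
  unfold centered
  rw [Λ₁.Qt_eq hQ hu hG0 hζ hs hst ht x, Λ₂.Qt_eq hQ hu hG0 hζ hs hst ht x,
    M₁.QPi_eq hQ hw hG0 hd x hx₁ hs hst ht, M₂.QPi_eq hQ hw hG0 hd x hx₂ hs hst ht,
    ← integral_sub a₁ b₁, ← integral_sub a₂ b₂, ← integral_sub c₁ c₂]
  refine integral_congr_ae (Eventually.of_forall fun z => ?_)
  beta_reduce
  unfold Model.sizePiece
  rw [Finset.sum_sub_distrib, ← M₁.evalAt_eq_sum hx₁, ← M₂.evalAt_eq_sum hx₂]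
  ring

/-- With s = εt, Q_s(z,Λ_x) is Q_s(z,Λ_z) plus a tested increment. The first is again measured by
the reconstruction distance, and both carry (εt)^{γ/ℓ}, so the factor ε^{γ/ℓ} is gained. The power
of 1/ε pays for comparing ρ at scale εt with ρ at scale t - εt ≤ (1/ε)(εt). -/
theorem exists_centered_sub_bound (hQ : IsSemigroup σ G Q) (hw : w.IsControlled σ G)
    (hv : v.IsControlled σ G) (hu : (w * v).IsControlled σ G) (hG0 : ∀ x, 0 ≤ G x)
    (hd : w.HasDecay σ G) (hζ : ζ ≤ 0) (hη : γ - σ.s 0 < η) (hηγ : η ≤ γ) {N : ℕ}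
    (hN : γ - A.reg ≤ N) :
    ∃ C : ℝ, 0 ≤ C ∧ ∀ ε, 0 < ε → ε < 1 → ∀ (𝒯 : RegStructure.{u} A) (M₁ M₂ : Model σ 𝒯 Q w)
      (f₁ f₂ : Pt d → 𝒯.Sum) (Λ₁ Λ₂ : Besov σ Q ζ (w * v).w),
      MemD σ v γ η M₁.Γ f₁ → MemD σ v γ η M₂.Γ f₂ →
      IsReconstruction γ η M₁ f₁ Λ₁ → IsReconstruction γ η M₂ f₂ Λ₂ →
      (recDist γ η M₁ M₂ f₁ f₂ Λ₁ Λ₂).toReal ≤ C * ε ^ (γ / σ.ell) *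
        ((recDist γ η M₁ M₂ f₁ f₂ Λ₁ Λ₂).toReal + ((1 / ε) ^ (1 / σ.ell)) ^ N *
          M₁.remConst M₂ γ (sharpNorm σ v γ η M₁.Γ f₁).toReal
            (incrNorm σ 𝒯 v γ η (fun y x => incr M₁.Γ f₁ y x - incr M₂.Γ f₂ y x)).toReal 0) := by
  obtain ⟨C, hC, h⟩ := hu.decays.exists_split_test hG0 hu.star_nonneg N (a := γ - η) (by linarith)
    (by linarith)
  obtain ⟨C₁, hC₁, hq⟩ := hQ.upper
  refine ⟨C * C₁, by positivity, fun ε hε hε1 𝒯 M₁ M₂ f₁ f₂ Λ₁ Λ₂ hf₁ hf₂ hΛ₁ hΛ₂ => ?_⟩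
  have hrdiff : recDist γ η M₁ M₂ f₁ f₂ Λ₁ Λ₂ < ∞ :=
    (recNorm_sub_le (σ := σ) (γ := γ) (η := η) (fun x => (hu.pos x).le) (centered M₁ f₁ Λ₁)
    (centered M₂ f₂ Λ₂)).trans_lt (ENNReal.add_lt_top.2 ⟨hΛ₁, hΛ₂⟩)
  have hE0 := M₁.remConst_nonneg M₂ (γ := γ) (n := (sharpNorm σ v γ η M₁.Γ f₁).toReal)
    (e := (incrNorm σ 𝒯 v γ η (fun y x => incr M₁.Γ f₁ y x - incr M₂.Γ f₂ y x)).toReal)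
    (r := 0) ENNReal.toReal_nonneg ENNReal.toReal_nonneg le_rfl
  have hrem := fun (x z : Pt d) (hx : x 0 ≠ 0) (hz : z 0 ≠ 0) (s : ℝ) (hs : 0 < s) (hs1 : s ≤ 1) =>
    abs_rem_sub_centered_le hw hv hN M₁ M₂ hf₁ hf₂ (Λ₁ := Λ₁) (Λ₂ := Λ₂) hx hz hs hs1
  have hcen := fun (z : Pt d) (hz : z 0 ≠ 0) (s : ℝ) (hs : 0 < s) (hs1 : s ≤ 1) =>
    abs_le_of_recNorm (R := fun t x => centered M₁ f₁ Λ₁ t x - centered M₂ f₂ Λ₂ t x)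
        hrdiff hs hs1 hz (hu.pos z)
  have hmeas := liftData_sub hQ hw hv hu hG0 hζ hN M₁ M₂ hf₁ hf₂ hΛ₁ hΛ₂
  have hZ0 : 0 ≤ (recDist γ η M₁ M₂ f₁ f₂ Λ₁ Λ₂).toReal := ENNReal.toReal_nonneg
  suffices hs : recDist γ η M₁ M₂ f₁ f₂ Λ₁ Λ₂ ≤ ENNReal.ofReal (C * C₁ * ε ^ (γ / σ.ell) *
        ((recDist γ η M₁ M₂ f₁ f₂ Λ₁ Λ₂).toReal + ((1 / ε) ^ (1 / σ.ell)) ^ N *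
          M₁.remConst M₂ γ (sharpNorm σ v γ η M₁.Γ f₁).toReal
            (incrNorm σ 𝒯 v γ η (fun y x => incr M₁.Γ f₁ y x - incr M₂.Γ f₂ y x)).toReal 0)) by
    exact ENNReal.toReal_le_of_le_ofReal (by positivity) hs
  refine (recNorm_le_iff (by positivity)).2 fun t ht ht1 x hx => ?_
  change ∀ (z : Pt d), z 0 ≠ 0 → ∀ (s : ℝ), 0 < s → s ≤ 1 →
    |centered M₁ f₁ Λ₁ s z - centered M₂ f₂ Λ₂ s z| ≤ (recDist γ η M₁ M₂ f₁ f₂ Λ₁ Λ₂).toReal *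
      (s ^ (γ / σ.ell) * σ.phi z ^ (η - γ) * ((w * v).w z)⁻¹) at hcen
  have e0 : ((A.below γ).card : ℝ) * ((M₁.distPi M₂ γ).toReal * (sharpNorm σ v γ η M₁.Γ f₁).toReal +
        (M₂.normPi γ).toReal *
          (incrNorm σ 𝒯 v γ η (fun y x => incr M₁.Γ f₁ y x - incr M₂.Γ f₂ y x)).toReal) =
      M₁.remConst M₂ γ (sharpNorm σ v γ η M₁.Γ f₁).toReal
        (incrNorm σ 𝒯 v γ η (fun y x => incr M₁.Γ f₁ y x - incr M₂.Γ f₂ y x)).toReal 0 := by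
    unfold Model.remConst; ring
  rw [e0] at hrem
  generalize M₁.remConst M₂ γ (sharpNorm σ v γ η M₁.Γ f₁).toReal
    (incrNorm σ 𝒯 v γ η (fun y x => incr M₁.Γ f₁ y x - incr M₂.Γ f₂ y x)).toReal 0 = E at *
  generalize (recDist γ η M₁ M₂ f₁ f₂ Λ₁ Λ₂).toReal = Z at *
  have hs : 0 < ε * t := by positivity
  have hst : ε * t < t := mul_lt_of_lt_one_left ht hε1
  have hr : 0 < t - ε * t := by linarith
  have hux := inv_pos.2 (hu.pos x)
  have hφ := σ.phi_pos hx
  have hm : AEStronglyMeasurable (fun z => Q (t - ε * t) x z *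
      (Λ₁.Qt (ε * t) z - Λ₂.Qt (ε * t) z - ∑ α ∈ A.below γ,
        (M₁.sizePiece f₁ x α (ε * t) z - M₂.sizePiece f₂ x α (ε * t) z))) :=
    ((hQ.measurable_right hr x).mul ((hmeas.lam_meas _ hs (by linarith)).sub
      (Finset.measurable_fun_sum _ fun α hα => hmeas.size_meas x hx α hα _ hs
        (by linarith)))).aestronglyMeasurable
  set κ := ((1 / ε) ^ (1 / σ.ell)) ^ N with hκ
  have hκ0 : 0 ≤ κ := by positivity
  set S := (ε * t) ^ (γ / σ.ell) with hS
  have hS0 : 0 ≤ S := by positivity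
  have key := (h (t - ε * t) hr (by linarith) x _ (C₁ * (S * ((w * v).w x)⁻¹ * (Z + κ * E)))
    (by positivity) hm hx (by
      filter_upwards [ae_apply_zero_ne_zero] with z hz
      have h1 := hrem x z hx hz (ε * t) hs (by linarith)
      have h2 := hcen z hz (ε * t) hs (by linarith)
      have h3 := abs_add_le (Λ₁.Qt (ε * t) z - Λ₂.Qt (ε * t) z - ∑ α ∈ A.below γ,
        (M₁.sizePiece f₁ x α (ε * t) z - M₂.sizePiece f₂ x α (ε * t) z) -
        (centered M₁ f₁ Λ₁ (ε * t) z - centered M₂ f₂ Λ₂ (ε * t) z))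
        (centered M₁ f₁ Λ₁ (ε * t) z - centered M₂ f₂ Λ₂ (ε * t) z)
      rw [sub_add_cancel] at h3
      have hφx := Real.rpow_nonneg hφ.le (η - γ)
      have hφz := Real.rpow_nonneg (σ.phi_nonneg z) (η - γ)
      have hus := hu.star_nonneg (x - z)
      have hg := σ.scaled_nonneg hG0 hr (x - z)
      set ρ := σ.rho (t - ε * t) (x - z) ^ N with hρ
      have hρ1 : 1 ≤ ρ := one_le_pow₀ (σ.one_le_rho hr _)
      have hρs : σ.rho (ε * t) (x - z) ^ N ≤ κ * ρ := by
        rw [hκ, hρ, ← mul_pow]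
        refine pow_le_pow_left₀ (zero_le_one.trans (σ.one_le_rho hs _)) ?_ _
        refine σ.rho_le_mul hr ((one_le_div hε).2 hε1.le) ?_ _
        rw [one_div, inv_mul_cancel_left₀ hε.ne']
        linarith
      set Y := S * ((w * v).w x)⁻¹ * ((w * v).star (x - z) * ρ *
        (σ.phi x ^ (η - γ) + σ.phi z ^ (η - γ))) with hY
      have h4 : S * ((w * v).w x)⁻¹ * ((w * v).star (x - z) * σ.rho (ε * t) (x - z) ^ N *
          (σ.phi x ^ (η - γ) + σ.phi z ^ (η - γ))) ≤ κ * Y := by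
        calc _ ≤ S * ((w * v).w x)⁻¹ * ((w * v).star (x - z) * (κ * ρ) *
            (σ.phi x ^ (η - γ) + σ.phi z ^ (η - γ))) := by gcongr
          _ = _ := by rw [hY]; ring
      have h5 : S * σ.phi z ^ (η - γ) * ((w * v).w z)⁻¹ ≤ Y := by
        have h6 := hu.inv_le x z
        have := inv_pos.2 (hu.pos z)
        calc _ ≤ S * (σ.phi x ^ (η - γ) + σ.phi z ^ (η - γ)) *
              ((w * v).star (x - z) * ((w * v).w x)⁻¹) * 1 := by
              rw [mul_one]
              gcongr
              linarith
          _ ≤ S * (σ.phi x ^ (η - γ) + σ.phi z ^ (η - γ)) *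
              ((w * v).star (x - z) * ((w * v).w x)⁻¹) * ρ := by gcongr
          _ = Y := by rw [hY]; ring
      have h6 := h3.trans (add_le_add (h1.trans (mul_le_mul_of_nonneg_left h4 hE0))
        (h2.trans (mul_le_mul_of_nonneg_left h5 hZ0)))
      rw [abs_mul, neg_sub]
      calc _ ≤ C₁ * σ.scaled G (t - ε * t) (x - z) * (E * (κ * Y) + Z * Y) :=
            mul_le_mul (hq _ hr x z) h6 (abs_nonneg _) (by positivity)
        _ = _ := by rw [hY]; ring)).2
  rw [← centered_sub_eq hQ hw hu hG0 hd hζ M₁ M₂ Λ₁ Λ₂ (hf₁.1 x hx) (hf₂.1 x hx) hs hst ht1,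
    neg_sub] at key
  have e1 : t ^ (-γ / σ.ell) * t ^ (γ / σ.ell) = 1 := by
    rw [← Real.rpow_add ht, neg_div, neg_add_cancel, Real.rpow_zero]
  have e2 : σ.phi x ^ (γ - η) * σ.phi x ^ (η - γ) = 1 := by
    rw [← Real.rpow_add hφ, sub_add_sub_cancel, sub_self, Real.rpow_zero]
  have e3 : S = ε ^ (γ / σ.ell) * t ^ (γ / σ.ell) := by rw [hS, Real.mul_rpow hε.le ht.le]
  have hu0 := hu.pos x
  calc _ ≤ t ^ (-γ / σ.ell) * σ.phi x ^ (γ - η) * (w * v).w x *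
        (C * (C₁ * (S * ((w * v).w x)⁻¹ * (Z + κ * E))) * σ.phi x ^ (η - γ)) := by gcongr
    _ = (t ^ (-γ / σ.ell) * t ^ (γ / σ.ell)) * (σ.phi x ^ (γ - η) * σ.phi x ^ (η - γ)) *
        ((w * v).w x * ((w * v).w x)⁻¹) * (C * C₁ * ε ^ (γ / σ.ell) * (Z + κ * E)) := by
        rw [e3]; ring
    _ = _ := by rw [e1, e2, mul_inv_cancel₀ hu0.ne']; ring

/-- For positive regularity, reconstructions depend continuously on the data. -/
theorem exists_recDist_le (hQ : IsSemigroup σ G Q) (hw : w.IsControlled σ G)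
    (hv : v.IsControlled σ G) (hu : (w * v).IsControlled σ G) (hG0 : ∀ x, 0 ≤ G x)
    (hd : w.HasDecay σ G) (hζ : ζ ≤ 0) (hη : γ - σ.s 0 < η) (hηγ : η ≤ γ) (A : IndexSet) :
    ∃ C : ℝ, 0 ≤ C ∧ (0 < γ → ∀ (𝒯 : RegStructure.{u} A) (M₁ M₂ : Model σ 𝒯 Q w)
      (f₁ f₂ : Pt d → 𝒯.Sum) (Λ₁ Λ₂ : Besov σ Q ζ (w * v).w),
      MemD σ v γ η M₁.Γ f₁ → MemD σ v γ η M₂.Γ f₂ →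
      IsReconstruction γ η M₁ f₁ Λ₁ → IsReconstruction γ η M₂ f₂ Λ₂ →
      (recDist γ η M₁ M₂ f₁ f₂ Λ₁ Λ₂).toReal ≤ C *
          M₁.remConst M₂ γ (sharpNorm σ v γ η M₁.Γ f₁).toReal
            (incrNorm σ 𝒯 v γ η (fun y x => incr M₁.Γ f₁ y x - incr M₂.Γ f₂ y x)).toReal 0) := by
  obtain ⟨N, hN⟩ := A.exists_nat γ
  obtain ⟨C, hC, h⟩ := exists_centered_sub_bound.{u} hQ hw hv hu hG0 hd hζ hη hηγ hN
  by_cases hγ : 0 < γ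
  · have hγl : 0 < γ / σ.ell := div_pos hγ σ.ell_pos
    have h0 : Tendsto (fun ε : ℝ => C * ε ^ (γ / σ.ell)) (𝓝[>] 0) (𝓝 0) := by
      have := ((Real.continuousAt_rpow_const 0 (γ / σ.ell) (Or.inr hγl.le)).tendsto.const_mul C)
      rw [Real.zero_rpow hγl.ne', mul_zero] at this
      exact this.mono_left nhdsWithin_le_nhds
    -- Because γ > 0, some ε makes Cε^{γ/ℓ} less than 1/2. Then Z ≤ (Z + κE)/2 with κ the power of
    -- 1/ε, hence Z ≤ κE; Z is finite since both terms are reconstructions.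
    obtain ⟨ε, h1, h2, h3⟩ := ((h0.eventually_lt_const (by norm_num : (0 : ℝ) < 1 / 2)).and
      ((eventually_mem_nhdsWithin).and (nhdsWithin_le_nhds (eventually_lt_nhds one_pos)))).exists
    have hε : 0 < ε := h2
    refine ⟨((1 / ε) ^ (1 / σ.ell)) ^ N, by positivity,
      fun _ 𝒯 M₁ M₂ f₁ f₂ Λ₁ Λ₂ hf₁ hf₂ hΛ₁ hΛ₂ => ?_⟩
    have h4 := h ε hε h3 𝒯 M₁ M₂ f₁ f₂ Λ₁ Λ₂ hf₁ hf₂ hΛ₁ hΛ₂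
    have hE0 := M₁.remConst_nonneg M₂ (γ := γ) (n := (sharpNorm σ v γ η M₁.Γ f₁).toReal)
      (e := (incrNorm σ 𝒯 v γ η (fun y x => incr M₁.Γ f₁ y x - incr M₂.Γ f₂ y x)).toReal)
      (r := 0) ENNReal.toReal_nonneg ENNReal.toReal_nonneg le_rfl
    have hZ0 : 0 ≤ (recDist γ η M₁ M₂ f₁ f₂ Λ₁ Λ₂).toReal := ENNReal.toReal_nonneg
    generalize M₁.remConst M₂ γ (sharpNorm σ v γ η M₁.Γ f₁).toReal
      (incrNorm σ 𝒯 v γ η (fun y x => incr M₁.Γ f₁ y x - incr M₂.Γ f₂ y x)).toReal 0 = E at *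
    generalize (recDist γ η M₁ M₂ f₁ f₂ Λ₁ Λ₂).toReal = Z at *
    have hκ : 0 ≤ ((1 / ε) ^ (1 / σ.ell)) ^ N * E := by positivity
    nlinarith [mul_le_mul_of_nonneg_right h1.le (add_nonneg hZ0 hκ)]
  · exact ⟨0, le_rfl, fun h => absurd h hγ⟩

end Uniqueness

/-! ### The Besov distance of two reconstructions. -/

section BesovDistance

variable [NeZero d] {A : IndexSet} {𝒯 : RegStructure.{u} A} {σ : Scaling d} {Q : Ker d}
  {w v : Weight d} {G : Pt d → ℝ} {γ η ζ : ℝ}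

/-- For α ≥ η the left side is s^{η/ℓ} q^{α-η} with q = s^{1/ℓ}/φ, and 0 ≤ α-η ≤ γ-η gives q^{α-η} ≤
1 + q^{γ-η}. For α ≤ η there is no singularity. One singular profile thus dominates all
homogeneities. -/
theorem rpow_mul_rpow_min_le {ℓ s φ α : ℝ} (hℓ : 0 < ℓ) (hs : 0 < s) (hs1 : s ≤ 1) (hφ : 0 < φ)
    (hζη : ζ ≤ η) (hζα : ζ ≤ α) (hαγ : α ≤ γ) :
    s ^ (α / ℓ) * φ ^ min (η - α) 0 ≤ s ^ (ζ / ℓ) * (1 + s ^ ((γ - η) / ℓ) * φ ^ (η - γ)) := by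
  have hp : 0 ≤ s ^ ((γ - η) / ℓ) * φ ^ (η - γ) := by positivity
  rcases le_total α η with h | h
  · rw [min_eq_right (by linarith), Real.rpow_zero, mul_one]
    have h1 : s ^ (α / ℓ) ≤ s ^ (ζ / ℓ) :=
      Real.rpow_le_rpow_of_exponent_ge hs hs1 (by gcongr)
    have h2 : 0 ≤ s ^ (ζ / ℓ) := by positivity
    nlinarith
  · rw [min_eq_left (by linarith)]
    have hq : 0 < s ^ (1 / ℓ) := by positivity
    have e : ∀ c : ℝ, s ^ (c / ℓ) = (s ^ (1 / ℓ)) ^ c := fun c => by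
      rw [← Real.rpow_mul hs.le]; congr 1; ring
    have hm : ∀ c : ℝ, s ^ (c / ℓ) * φ ^ (-c) = (s ^ (1 / ℓ) / φ) ^ c := fun c => by
      rw [Real.div_rpow hq.le hφ.le, Real.rpow_neg hφ.le, e, ← div_eq_mul_inv]
    have e1 : s ^ (α / ℓ) = s ^ (η / ℓ) * s ^ ((α - η) / ℓ) := by
      rw [← Real.rpow_add hs]; congr 1; ring
    have h2 : (s ^ (1 / ℓ) / φ) ^ (α - η) ≤ 1 + (s ^ (1 / ℓ) / φ) ^ (γ - η) := by
      have hr : 0 < s ^ (1 / ℓ) / φ := by positivity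
      have h0 := Real.rpow_nonneg hr.le (γ - η)
      rcases le_total (s ^ (1 / ℓ) / φ) 1 with h3 | h3
      · have := Real.rpow_le_one hr.le h3 (by linarith : 0 ≤ α - η)
        linarith
      · have := Real.rpow_le_rpow_of_exponent_le h3 (by linarith : α - η ≤ γ - η)
        linarith
    have h3 : s ^ (η / ℓ) ≤ s ^ (ζ / ℓ) :=
      Real.rpow_le_rpow_of_exponent_ge hs hs1 (by gcongr)
    calc s ^ (α / ℓ) * φ ^ (η - α) = s ^ (η / ℓ) * (s ^ ((α - η) / ℓ) * φ ^ (-(α - η))) := by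
          rw [e1, neg_sub]; ring
      _ ≤ s ^ (ζ / ℓ) * (1 + (s ^ (1 / ℓ) / φ) ^ (γ - η)) := by
          rw [hm]
          gcongr
      _ = _ := by rw [← hm, neg_sub]

/-- Testing a function which is singular at the hyperplane, at scales below the distance to it. -/
theorem Scaling.Decays.exists_scale_test {W : Pt d → ℝ} (hW : σ.Decays G W) (hG0 : ∀ x, 0 ≤ G x)
    (hW0 : ∀ x, 0 ≤ W x) {a : ℝ} (ha0 : 0 ≤ a) (ha : a < σ.s 0) :
    ∃ C : ℝ, 0 ≤ C ∧ ∀ t, 0 < t → t ≤ 1 → ∀ (x : Pt d) (f : Pt d → ℝ) (p : ℝ), 0 ≤ p →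
      AEStronglyMeasurable f →
      (∀ᵐ z, |f z| ≤ p * (σ.scaled G t (x - z) * W (x - z) *
        (1 + t ^ (a / σ.ell) * σ.phi z ^ (-a)))) → |∫ z, f z| ≤ C * p := by
  obtain ⟨C₁, hC₁, h₁⟩ := hW.exists_test hG0 hW0 0 le_rfl (σ.s_pos 0)
  obtain ⟨C₂, hC₂, h₂⟩ := hW.exists_test hG0 hW0 0 ha0 ha
  refine ⟨2 * C₁ + 2 * C₂, by positivity, fun t ht ht1 x f p hp hf hle => ?_⟩
  -- Where the singular term is at most 1 the regular test suffices. On the complement the singular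
  -- test produces t^{-a/ℓ}, which cancels the factor t^{a/ℓ}.
  set S := {z : Pt d | t ^ (a / σ.ell) * σ.phi z ^ (-a) ≤ 1} with hS
  have hSm : MeasurableSet S :=
    measurableSet_le (((σ.measurable_phi).pow_const _).const_mul _) measurable_const
  have hb0 : ∀ z, 0 ≤ σ.scaled G t (x - z) * W (x - z) := fun z =>
    mul_nonneg (σ.scaled_nonneg hG0 ht _) (hW0 _)
  have hφ0 : ∀ z, 0 ≤ σ.phi z ^ (-a) := fun z => Real.rpow_nonneg (σ.phi_nonneg z) _
  have hta : 0 < t ^ (a / σ.ell) := by positivity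
  obtain ⟨i₁, b₁, -⟩ := h₁ t ht ht1 x (S.indicator f) (p * 2) (by positivity) (hf.indicator hSm) (by
      filter_upwards [hle] with z hz
      rw [pow_zero, mul_one, neg_zero, Real.rpow_zero, mul_one]
      by_cases hzS : z ∈ S
      · rw [Set.indicator_of_mem hzS]
        have h : t ^ (a / σ.ell) * σ.phi z ^ (-a) ≤ 1 := hzS
        nlinarith [mul_le_mul_of_nonneg_left h (mul_nonneg hp (hb0 z))]
      · rw [Set.indicator_of_notMem hzS, abs_zero]
        exact mul_nonneg (by positivity) (hb0 z))
  obtain ⟨i₂, b₂, -⟩ := h₂ t ht ht1 x (Sᶜ.indicator f) (p * 2 * t ^ (a / σ.ell)) (by positivity)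
    (hf.indicator hSm.compl) (by
      filter_upwards [hle] with z hz
      rw [pow_zero, mul_one]
      by_cases hzS : z ∈ S
      · rw [Set.indicator_of_notMem (by simpa using hzS), abs_zero]
        exact mul_nonneg (by positivity) (mul_nonneg (hb0 z) (hφ0 z))
      · rw [Set.indicator_of_mem (by simpa using hzS)]
        have h : 1 ≤ t ^ (a / σ.ell) * σ.phi z ^ (-a) := (not_le.1 hzS).le
        nlinarith [mul_le_mul_of_nonneg_left h (mul_nonneg hp (hb0 z))])
  have e : ∫ z, f z = (∫ z, S.indicator f z) + ∫ z, Sᶜ.indicator f z := by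
    have := integral_add i₁ i₂
    rwa [← Pi.add_def, Set.indicator_self_add_compl] at this
  have e2 : t ^ (a / σ.ell) * t ^ (-a / σ.ell) = 1 := by
    rw [← Real.rpow_add ht, neg_div, add_neg_cancel, Real.rpow_zero]
  rw [neg_zero, zero_div, Real.rpow_zero, mul_one] at b₁
  rw [e]
  refine (abs_add_le _ _).trans ((add_le_add b₁ b₂).trans (le_of_eq ?_))
  linear_combination 2 * C₂ * p * e2

/-- Q_s(z,Λ) = Q_s(z,Λ_z) + Q_s(z,Π_zf(z)): both terms are controlled at the point z itself, at the
price of a singularity at the hyperplane. -/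
theorem abs_besov_sub_le (hw : w.IsControlled σ G) (hv : v.IsControlled σ G)
    (hu : (w * v).IsControlled σ G) (hηγ : η ≤ γ) (hζη : ζ ≤ η) (hζα : ζ ≤ A.reg)
    (M₁ M₂ : Model σ 𝒯 Q w) {f₁ f₂ : Pt d → 𝒯.Sum} {Λ₁ Λ₂ : Besov σ Q ζ (w * v).w}
    (hf₁ : MemD σ v γ η M₁.Γ f₁) (hf₂ : MemD σ v γ η M₂.Γ f₂)
    (hΛ₁ : IsReconstruction γ η M₁ f₁ Λ₁) (hΛ₂ : IsReconstruction γ η M₂ f₂ Λ₂)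
    {z : Pt d} (hz : z 0 ≠ 0) {s : ℝ} (hs : 0 < s) (hs1 : s ≤ 1) :
    |Λ₁.Qt s z - Λ₂.Qt s z| ≤ M₁.remConst M₂ γ (sizeNorm σ 𝒯 v γ η f₁).toReal
        (sizeNorm σ 𝒯 v γ η (fun x => f₁ x - f₂ x)).toReal (recDist γ η M₁ M₂ f₁ f₂ Λ₁ Λ₂).toReal *
      (s ^ (ζ / σ.ell) * ((w * v).w z)⁻¹ * (1 + s ^ ((γ - η) / σ.ell) * σ.phi z ^ (η - γ))) := by
  have hrdiff : recDist γ η M₁ M₂ f₁ f₂ Λ₁ Λ₂ < ∞ :=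
    (recNorm_sub_le (σ := σ) (γ := γ) (η := η) (fun x => (hu.pos x).le) (centered M₁ f₁ Λ₁)
    (centered M₂ f₂ Λ₂)).trans_lt (ENNReal.add_lt_top.2 ⟨hΛ₁, hΛ₂⟩)
  have hdiff := (sizeNorm_sub_le (σ := σ) (γ := γ) (η := η) (fun x => (hv.pos x).le) f₁ f₂).trans_lt
    (ENNReal.add_lt_top.2 ⟨hf₁.sizeNorm_lt_top, hf₂.sizeNorm_lt_top⟩)
  have hφ := σ.phi_pos hz
  have hwz := inv_pos.2 (hw.pos z)
  have hvz := inv_pos.2 (hv.pos z)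
  have huz := inv_pos.2 (hu.pos z)
  have eu : ((w * v).w z)⁻¹ = (w.w z)⁻¹ * (v.w z)⁻¹ := by rw [← mul_inv]; rfl
  set Y := s ^ (ζ / σ.ell) * ((w * v).w z)⁻¹ * (1 + s ^ ((γ - η) / σ.ell) * σ.phi z ^ (η - γ))
    with hY
  have hcen : |centered M₁ f₁ Λ₁ s z - centered M₂ f₂ Λ₂ s z| ≤
      (recDist γ η M₁ M₂ f₁ f₂ Λ₁ Λ₂).toReal * Y := by
    refine (abs_le_of_recNorm (R := fun t x => centered M₁ f₁ Λ₁ t x - centered M₂ f₂ Λ₂ t x)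
        hrdiff hs hs1 hz (hu.pos z)).trans ?_
    refine mul_le_mul_of_nonneg_left ?_ ENNReal.toReal_nonneg
    have h1 := rpow_mul_rpow_min_le (α := γ) σ.ell_pos hs hs1 hφ hζη (hζη.trans hηγ) le_rfl
    rw [min_eq_left (by linarith)] at h1
    calc _ ≤ _ := mul_le_mul_of_nonneg_right h1 huz.le
      _ = _ := by rw [hY]; ring
  have hsum : |M₁.QPi s z (f₁ z) - M₂.QPi s z (f₂ z)| ≤ (A.below γ).card *
      (((M₁.distPi M₂ γ).toReal * (sizeNorm σ 𝒯 v γ η f₁).toReal + (M₂.normPi γ).toReal *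
        (sizeNorm σ 𝒯 v γ η (fun x => f₁ x - f₂ x)).toReal) * Y) := by
    have e : M₁.QPi s z (f₁ z) - M₂.QPi s z (f₂ z) = ∑ α ∈ A.below γ,
        ((M₁.QPi s z - M₂.QPi s z) (𝒯.emb α (f₁ z α)) +
          M₂.QPi s z (𝒯.emb α ((f₁ z - f₂ z) α))) := by
      rw [Finset.sum_add_distrib, ← map_sum, ← map_sum, ← (hf₁.1 z hz).eq_sum,
        ← ((hf₁.1 z hz).sub (hf₂.1 z hz)).eq_sum, map_sub, LinearMap.sub_apply]
      ring
    rw [e, ← nsmul_eq_mul]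
    refine (Finset.abs_sum_le_sum_abs _ _).trans (Finset.sum_le_card_nsmul _ _ _ fun α hα => ?_)
    obtain ⟨hαA, hα⟩ := IndexSet.mem_below.1 hα
    have h1 := M₁.abs_QPi_sub_le M₂ hw hα hs hs1 z (f₁ z α)
    have h2 := M₂.abs_QPi_le hw hα hs hs1 z ((f₁ z - f₂ z) α)
    have n1 := norm_le_of_sizeNorm hf₁.sizeNorm_lt_top hz (hv.pos z) hα
    have n2 := norm_le_of_sizeNorm hdiff hz (hv.pos z) hα
    have h3 := rpow_mul_rpow_min_le σ.ell_pos hs hs1 hφ hζη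
      (hζα.trans (IndexSet.reg_le hαA)) hα.le
    have g1 : 0 ≤ (M₁.distPi M₂ γ).toReal := ENNReal.toReal_nonneg
    have g2 : 0 ≤ (M₂.normPi γ).toReal := ENNReal.toReal_nonneg
    have g3 : 0 ≤ (sizeNorm σ 𝒯 v γ η f₁).toReal := ENNReal.toReal_nonneg
    have g4 : 0 ≤ (sizeNorm σ 𝒯 v γ η (fun x => f₁ x - f₂ x)).toReal := ENNReal.toReal_nonneg
    generalize (M₁.distPi M₂ γ).toReal = a₁ at *
    generalize (M₂.normPi γ).toReal = a₂ at *
    generalize (sizeNorm σ 𝒯 v γ η f₁).toReal = a₃ at *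
    generalize (sizeNorm σ 𝒯 v γ η (fun x => f₁ x - f₂ x)).toReal = a₄ at *
    have h4 : s ^ (α / σ.ell) * (w.w z)⁻¹ * (σ.phi z ^ min (η - α) 0 * (v.w z)⁻¹) ≤ Y := by
      calc _ = s ^ (α / σ.ell) * σ.phi z ^ min (η - α) 0 * ((w.w z)⁻¹ * (v.w z)⁻¹) := by ring
        _ ≤ _ := mul_le_mul_of_nonneg_right h3 (by positivity)
        _ = Y := by rw [hY, eu]; ring
    have k1 : s ^ (α / σ.ell) * (w.w z)⁻¹ * ‖f₁ z α‖ ≤ a₃ * Y := by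
      calc _ ≤ s ^ (α / σ.ell) * (w.w z)⁻¹ * (a₃ * (σ.phi z ^ min (η - α) 0 * (v.w z)⁻¹)) := by
            gcongr
        _ = a₃ * (s ^ (α / σ.ell) * (w.w z)⁻¹ * (σ.phi z ^ min (η - α) 0 * (v.w z)⁻¹)) := by ring
        _ ≤ _ := mul_le_mul_of_nonneg_left h4 g3
    have k2 : s ^ (α / σ.ell) * (w.w z)⁻¹ * ‖(f₁ z - f₂ z) α‖ ≤ a₄ * Y := by
      calc _ ≤ s ^ (α / σ.ell) * (w.w z)⁻¹ * (a₄ * (σ.phi z ^ min (η - α) 0 * (v.w z)⁻¹)) := by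
            gcongr
        _ = a₄ * (s ^ (α / σ.ell) * (w.w z)⁻¹ * (σ.phi z ^ min (η - α) 0 * (v.w z)⁻¹)) := by ring
        _ ≤ _ := mul_le_mul_of_nonneg_left h4 g4
    have m1 := mul_le_mul_of_nonneg_left k1 g1
    have m2 := mul_le_mul_of_nonneg_left k2 g2
    refine (abs_add_le _ _).trans ?_
    linarith
  have e : Λ₁.Qt s z - Λ₂.Qt s z = (centered M₁ f₁ Λ₁ s z - centered M₂ f₂ Λ₂ s z) +
      (M₁.QPi s z (f₁ z) - M₂.QPi s z (f₂ z)) := by unfold centered; ring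
  rw [e]
  refine (abs_add_le _ _).trans ((add_le_add hcen hsum).trans (le_of_eq ?_))
  unfold Model.remConst
  ring

/-- The Besov distance of two reconstructions is controlled by their distance as reconstructions. -/
theorem exists_besovNorm_sub_le (hQ : IsSemigroup σ G Q) (hw : w.IsControlled σ G)
    (hv : v.IsControlled σ G) (hu : (w * v).IsControlled σ G) (hG0 : ∀ x, 0 ≤ G x)
    (hζ : ζ ≤ 0) (hη : γ - σ.s 0 < η) (hηγ : η ≤ γ) (hζη : ζ ≤ η) (hζα : ζ ≤ A.reg) :
    ∃ C : ℝ, 0 ≤ C ∧ ∀ (𝒯 : RegStructure.{u} A) (M₁ M₂ : Model σ 𝒯 Q w)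
      (f₁ f₂ : Pt d → 𝒯.Sum) (Λ₁ Λ₂ : Besov σ Q ζ (w * v).w),
      MemD σ v γ η M₁.Γ f₁ → MemD σ v γ η M₂.Γ f₂ →
      IsReconstruction γ η M₁ f₁ Λ₁ → IsReconstruction γ η M₂ f₂ Λ₂ →
      (besovNorm σ ζ (w * v).w (fun t x => Λ₁.Qt t x - Λ₂.Qt t x)).toReal ≤ C *
        M₁.remConst M₂ γ (sizeNorm σ 𝒯 v γ η f₁).toReal
          (sizeNorm σ 𝒯 v γ η (fun x => f₁ x - f₂ x)).toReal
          (recDist γ η M₁ M₂ f₁ f₂ Λ₁ Λ₂).toReal := by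
  obtain ⟨C, hC, h⟩ := hu.decays.exists_scale_test hG0 hu.star_nonneg (a := γ - η) (by linarith)
    (by linarith)
  obtain ⟨C₁, hC₁, hq⟩ := hQ.upper
  refine ⟨C * C₁ * 2 ^ |ζ / σ.ell|, by positivity,
    fun 𝒯 M₁ M₂ f₁ f₂ Λ₁ Λ₂ hf₁ hf₂ hΛ₁ hΛ₂ => ?_⟩
  have hE0 := M₁.remConst_nonneg M₂ (γ := γ) (n := (sizeNorm σ 𝒯 v γ η f₁).toReal)
    (e := (sizeNorm σ 𝒯 v γ η (fun x => f₁ x - f₂ x)).toReal)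
    (r := (recDist γ η M₁ M₂ f₁ f₂ Λ₁ Λ₂).toReal) ENNReal.toReal_nonneg ENNReal.toReal_nonneg
    ENNReal.toReal_nonneg
  have hle := fun (z : Pt d) (hz : z 0 ≠ 0) (s : ℝ) (hs : 0 < s) (hs1 : s ≤ 1) =>
    abs_besov_sub_le hw hv hu hηγ hζη hζα M₁ M₂ hf₁ hf₂ hΛ₁ hΛ₂ hz hs hs1
  generalize M₁.remConst M₂ γ (sizeNorm σ 𝒯 v γ η f₁).toReal
    (sizeNorm σ 𝒯 v γ η (fun x => f₁ x - f₂ x)).toReal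
    (recDist γ η M₁ M₂ f₁ f₂ Λ₁ Λ₂).toReal = E at *
  refine ENNReal.toReal_le_of_le_ofReal (by positivity)
    ((besovNorm_le_iff (by positivity)).2 fun t ht ht1 x => ?_)
  have ht2 := half_pos ht
  have ht3 : t / 2 ≤ 1 := by linarith
  have hu0 := hu.pos x
  have hux := inv_pos.2 hu0
  have e1 : t - t / 2 = t / 2 := by ring
  -- The pointwise bound is singular at the hyperplane; smoothing by Q_{t/2} removes the singularity
  -- and yields a bound at every x.
  have e : Λ₁.Qt t x - Λ₂.Qt t x =
      ∫ z, Q (t / 2) x z * (Λ₁.Qt (t / 2) z - Λ₂.Qt (t / 2) z) := by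
    rw [Λ₁.Qt_eq hQ hu hG0 hζ ht2 (half_lt_self ht) ht1 x,
      Λ₂.Qt_eq hQ hu hG0 hζ ht2 (half_lt_self ht) ht1 x, e1,
      ← integral_sub (Λ₁.integrable_smear hQ hu hG0 hζ ht2 ht3 ht2 ht3 x)
        (Λ₂.integrable_smear hQ hu hG0 hζ ht2 ht3 ht2 ht3 x)]
    simp only [mul_sub]
  set S := (t / 2) ^ (ζ / σ.ell) with hS
  have key := h (t / 2) ht2 ht3 x _ (C₁ * (E * (S * ((w * v).w x)⁻¹))) (by positivity)
    ((hQ.measurable_right ht2 x).mul ((Λ₁.measurable_Qt hQ hu ht2 ht3).sub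
      (Λ₂.measurable_Qt hQ hu ht2 ht3))).aestronglyMeasurable (by
    filter_upwards [ae_apply_zero_ne_zero] with z hz
    have h1 := hle z hz (t / 2) ht2 ht3
    have h2 := hu.inv_le x z
    have hg := σ.scaled_nonneg hG0 ht2 (x - z)
    have hφz := Real.rpow_nonneg (σ.phi_nonneg z) (η - γ)
    rw [Pi.mul_apply, Pi.sub_apply, abs_mul, neg_sub]
    calc _ ≤ C₁ * σ.scaled G (t / 2) (x - z) * (E * (S * ((w * v).w z)⁻¹ *
          (1 + (t / 2) ^ ((γ - η) / σ.ell) * σ.phi z ^ (η - γ)))) :=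
          mul_le_mul (hq _ ht2 x z) h1 (abs_nonneg _) (by positivity)
      _ ≤ C₁ * σ.scaled G (t / 2) (x - z) * (E * (S * ((w * v).star (x - z) * ((w * v).w x)⁻¹) *
          (1 + (t / 2) ^ ((γ - η) / σ.ell) * σ.phi z ^ (η - γ)))) := by gcongr
      _ = _ := by ring)
  have key' : |Λ₁.Qt t x - Λ₂.Qt t x| ≤ C * (C₁ * (E * (S * ((w * v).w x)⁻¹))) := by
    rw [e]; exact key
  have e2 : t ^ (-ζ / σ.ell) * t ^ (ζ / σ.ell) = 1 := by
    rw [← Real.rpow_add ht, neg_div, neg_add_cancel, Real.rpow_zero]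
  have h3 : S ≤ 2 ^ |ζ / σ.ell| * t ^ (ζ / σ.ell) := half_rpow_le ht _
  calc _ ≤ t ^ (-ζ / σ.ell) * ((w * v).w x * (C * (C₁ * (E *
        ((2 ^ |ζ / σ.ell| * t ^ (ζ / σ.ell)) * ((w * v).w x)⁻¹))))) := by
        refine mul_le_mul_of_nonneg_left (mul_le_mul_of_nonneg_left (key'.trans ?_) hu0.le)
          (by positivity)
        gcongr
    _ = (t ^ (-ζ / σ.ell) * t ^ (ζ / σ.ell)) * ((w * v).w x * ((w * v).w x)⁻¹) *
        (C * C₁ * 2 ^ |ζ / σ.ell| * E) := by ring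
    _ = _ := by rw [e2, mul_inv_cancel₀ hu0.ne']; ring

end BesovDistance

/-! ### Part (b): local Lipschitz continuity. -/

section Lipschitz

variable [NeZero d] {σ : Scaling d} {w v : Weight d} {G : Pt d → ℝ} {A : IndexSet}
  {γ η ζ β βb δ : ℝ} {Q : Ker d} {𝒯 : RegStructure.{u} A}

/-- Each term is one distance times at most two factors bounded by R or 1 + R, hence the quadratic
growth. -/
theorem Model.pieceConst_le (M₁ M₂ : Model σ 𝒯 Q w) {n e R D F : ℝ} (hn0 : 0 ≤ n) (he0 : 0 ≤ e)
    (hn : n ≤ R) (he : e ≤ F) (hP : (M₁.distPi M₂ γ).toReal ≤ D) (hΓ : (M₁.distΓ M₂ γ).toReal ≤ D)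
    (hp : (M₂.normPi γ).toReal ≤ R) (hg₁ : (M₁.normΓ γ).toReal ≤ R)
    (hg₂ : (M₂.normΓ γ).toReal ≤ R) :
    M₁.pieceConst M₂ γ n e ≤ (A.below γ).card * ((R + 2 * R ^ 2) * (D + F)) := by
  have h1 : 0 ≤ (M₁.distPi M₂ γ).toReal := ENNReal.toReal_nonneg
  have h2 : 0 ≤ (M₁.normΓ γ).toReal := ENNReal.toReal_nonneg
  have h3 : 0 ≤ (M₂.normPi γ).toReal := ENNReal.toReal_nonneg
  have h4 : 0 ≤ (M₁.distΓ M₂ γ).toReal := ENNReal.toReal_nonneg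
  have h5 : 0 ≤ (M₂.normΓ γ).toReal := ENNReal.toReal_nonneg
  unfold Model.pieceConst
  generalize (M₁.distPi M₂ γ).toReal = a₁ at *
  generalize (M₁.normΓ γ).toReal = a₂ at *
  generalize (M₂.normPi γ).toReal = a₃ at *
  generalize (M₁.distΓ M₂ γ).toReal = a₄ at *
  generalize (M₂.normΓ γ).toReal = a₅ at *
  have hR : 0 ≤ R := hn0.trans hn
  have hF : 0 ≤ F := he0.trans he
  refine mul_le_mul_of_nonneg_left ?_ (Nat.cast_nonneg _)
  calc _ ≤ D * ((1 + R) * R) + R * (D * R) + R * ((1 + R) * F) := by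
        have hD : 0 ≤ D := h1.trans hP
        gcongr
    _ ≤ _ := by nlinarith [mul_nonneg (sq_nonneg R) hF]

theorem Model.remConst_le (M₁ M₂ : Model σ 𝒯 Q w) {n e R D F r : ℝ} (hn0 : 0 ≤ n) (he0 : 0 ≤ e)
    (hn : n ≤ R) (he : e ≤ F) (hP : (M₁.distPi M₂ γ).toReal ≤ D)
    (hp : (M₂.normPi γ).toReal ≤ R) :
    M₁.remConst M₂ γ n e r ≤ r + (A.below γ).card * (R * (D + F)) := by
  have h1 : 0 ≤ (M₁.distPi M₂ γ).toReal := ENNReal.toReal_nonneg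
  have h3 : 0 ≤ (M₂.normPi γ).toReal := ENNReal.toReal_nonneg
  unfold Model.remConst
  generalize (M₁.distPi M₂ γ).toReal = a₁ at *
  generalize (M₂.normPi γ).toReal = a₃ at *
  have hR : 0 ≤ R := hn0.trans hn
  refine add_le_add_right (mul_le_mul_of_nonneg_left ?_ (Nat.cast_nonneg _)) _
  calc _ ≤ D * R + R * F := by
        have hD : 0 ≤ D := h1.trans hP
        gcongr
    _ = _ := by ring

/-- One polynomial serves both claims. The first keeps the distances b and r of the reconstructions;
the second replaces them by bounds linear in R, through which C₁ and C₂ enter the coefficient of R.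
The square of R stems from P₁ and P₂ only. -/
theorem lipschitz_const_bound {C₀ C₁ C₂ i CK c R T b r sd nd P₁ P₂ E : ℝ} (hC₀ : 0 ≤ C₀)
    (hC₁ : 0 ≤ C₁) (hC₂ : 0 ≤ C₂) (hi : 0 ≤ i) (hCK : 0 ≤ CK) (hc : 0 ≤ c) (hR : 0 ≤ R)
    (hT : 0 ≤ T) (hs : sd + nd ≤ T)
    (hP₁ : P₁ ≤ c * ((R + 2 * R ^ 2) * T)) (hP₂ : P₂ ≤ c * ((R + 2 * R ^ 2) * T))
    (hE : E ≤ r + c * (R * T)) :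
    (0 ≤ b → 0 ≤ r → C₀ * (i * sd + CK * (P₁ + b + E)) + C₀ * (i * nd + CK * (P₂ + E)) ≤
      (C₀ * i + 2 * C₀ * CK + 1 + C₀ * CK * c * (4 + C₂ * (C₁ + 1) + 2 * C₁) * R +
        4 * C₀ * CK * c * R ^ 2) * (T + b + r)) ∧
    (r ≤ C₁ * (c * (R * T)) → b ≤ C₂ * (r + c * (R * T)) →
      C₀ * (i * sd + CK * (P₁ + b + E)) + C₀ * (i * nd + CK * (P₂ + E)) ≤
      (C₀ * i + 2 * C₀ * CK + 1 + C₀ * CK * c * (4 + C₂ * (C₁ + 1) + 2 * C₁) * R +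
        4 * C₀ * CK * c * R ^ 2) * T) := by
  set q := C₀ * i + 2 * C₀ * CK + 1 + C₀ * CK * c * (4 + C₂ * (C₁ + 1) + 2 * C₁) * R +
        4 * C₀ * CK * c * R ^ 2 with hq
  have h0 : C₀ * (i * sd + CK * (P₁ + b + E)) + C₀ * (i * nd + CK * (P₂ + E)) ≤
      (C₀ * i + 4 * C₀ * CK * c * R + 4 * C₀ * CK * c * R ^ 2) * T + C₀ * CK * b +
        2 * C₀ * CK * r := by
    calc _ = C₀ * (i * (sd + nd) + CK * (P₁ + P₂ + b + 2 * E)) := by ring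
      _ ≤ C₀ * (i * T + CK * (c * ((R + 2 * R ^ 2) * T) + c * ((R + 2 * R ^ 2) * T) + b +
          2 * (r + c * (R * T)))) := by gcongr
      _ = _ := by ring
  refine ⟨fun hb hr => h0.trans ?_, fun hr hb => h0.trans ?_⟩
  · have k1 : C₀ * i + 4 * C₀ * CK * c * R + 4 * C₀ * CK * c * R ^ 2 ≤ q := by
      have : 0 ≤ 2 * C₀ * CK + 1 + C₀ * CK * c * (C₂ * (C₁ + 1) + 2 * C₁) * R := by positivity
      rw [hq]; linarith
    have k2 : C₀ * CK ≤ q := by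
      have : 0 ≤ C₀ * i + C₀ * CK + 1 + C₀ * CK * c * (4 + C₂ * (C₁ + 1) + 2 * C₁) * R +
        4 * C₀ * CK * c * R ^ 2 := by positivity
      rw [hq]; linarith
    have k3 : 2 * C₀ * CK ≤ q := by
      have : 0 ≤ C₀ * i + 1 + C₀ * CK * c * (4 + C₂ * (C₁ + 1) + 2 * C₁) * R +
        4 * C₀ * CK * c * R ^ 2 := by positivity
      rw [hq]; linarith
    have m1 := mul_le_mul_of_nonneg_right k1 hT
    have m2 := mul_le_mul_of_nonneg_right k2 hb
    have m3 := mul_le_mul_of_nonneg_right k3 hr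
    linarith
  · have hb' : b ≤ C₂ * (C₁ * (c * (R * T)) + c * (R * T)) :=
      hb.trans (by gcongr)
    have m2 := mul_le_mul_of_nonneg_left hb' (by positivity : 0 ≤ C₀ * CK)
    have m3 := mul_le_mul_of_nonneg_left hr (by positivity : 0 ≤ 2 * C₀ * CK)
    have : 0 ≤ (2 * C₀ * CK + 1) * T := by positivity
    rw [hq]
    linarith

/-- The lift is locally Lipschitz continuous, with a constant quadratic in the size of the data. -/
theorem exists_lift_lipschitz (hw : w.IsControlled σ G) (hv : v.IsControlled σ G)
    (hwwv : (w * w * v).IsControlled σ G) (hd : w.HasDecay σ G) (hG0 : ∀ x, 0 ≤ G x)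
    (hββ : β ≤ βb) (hγ : γ + βb < δ) (hη : γ - σ.s 0 < η) (hηγ : η ≤ γ)
    (hζ0 : ζ ≤ 0) (hζη : ζ ≤ η) (hζα : ζ ≤ A.reg)
    (hcase : β < βb ∨
      (β = βb ∧ ∀ α ∈ A.carrier ∪ {γ, ζ}, ∀ k : Idx d, α + βb ≠ σ.deg k))
    (Q K : Ker d) (CK : ℝ) (hQ : IsSemigroup σ G Q) (hCK : 0 < CK)
    (hK : IsRegularizing σ G Q K βb δ CK) (𝒯 : RegStructure.{u₁} A) (Ab : IndexSet)
    (𝒯b : RegStructure.{u₂} Ab) (X : Polynomials σ 𝒯b) (I : AbsInt 𝒯 𝒯b β) :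
    ∃ a b c : ℝ, (∀ R : ℝ, 0 < R → 0 < a + b * R + c * R ^ 2) ∧
      ∀ (R : ℝ), 0 < R →
      ∀ (M₁ M₂ : Model σ 𝒯 Q w) (Mb₁ Mb₂ : Model σ 𝒯b Q w),
        Compatible K δ X I M₁ Mb₁ → Compatible K δ X I M₂ Mb₂ →
      ∀ (f₁ f₂ : Pt d → 𝒯.Sum) (Λ₁ Λ₂ : Besov σ Q ζ (w * v).w),
        MemD σ v γ η M₁.Γ f₁ → MemD σ v γ η M₂.Γ f₂ →
        IsReconstruction γ η M₁ f₁ Λ₁ → IsReconstruction γ η M₂ f₂ Λ₂ →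
        M₁.normPi γ + M₁.normΓ γ ≤ ENNReal.ofReal R →
        M₂.normPi γ + M₂.normΓ γ ≤ ENNReal.ofReal R →
        fullNorm σ v γ η M₁.Γ f₁ ≤ ENNReal.ofReal R →
        fullNorm σ v γ η M₂.Γ f₂ ≤ ENNReal.ofReal R →
        fullDist σ (w * w * v) (γ + β) (ζ + β) Mb₁.Γ Mb₂.Γ
            (liftK K δ γ X I M₁ f₁ Λ₁) (liftK K δ γ X I M₂ f₂ Λ₂) ≤
          ENNReal.ofReal (a + b * R + c * R ^ 2) *
            (M₁.dist M₂ γ + fullDist σ v γ η M₁.Γ M₂.Γ f₁ f₂ +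
              besovNorm σ ζ (w * v).w (fun t x => Λ₁.Qt t x - Λ₂.Qt t x) +
              recDist γ η M₁ M₂ f₁ f₂ Λ₁ Λ₂) ∧
        (0 < γ →
          fullDist σ (w * w * v) (γ + β) (ζ + β) Mb₁.Γ Mb₂.Γ
              (liftK K δ γ X I M₁ f₁ Λ₁) (liftK K δ γ X I M₂ f₂ Λ₂) ≤
            ENNReal.ofReal (a + b * R + c * R ^ 2) *
              (M₁.dist M₂ γ + fullDist σ v γ η M₁.Γ M₂.Γ f₁ f₂)) := by
  have hu := hw.mul_of_mul_mul hv hwwv hG0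
  obtain ⟨C₀, hC₀, h⟩ := exists_lift_sub_bounds.{u₁, u₂} hw hv hwwv hd hG0 hββ hγ hη hηγ hζ0 hζη
    hζα hcase (∑ k ∈ σ.idxBelow (γ + β), ‖X.X k‖) (Finset.sum_nonneg fun _ _ => norm_nonneg _)
  obtain ⟨C₁, hC₁, h₁⟩ := exists_recDist_le.{u₁} hQ hw hv hu hG0 hd hζ0 hη hηγ A
  obtain ⟨C₂, hC₂, h₂⟩ := exists_besovNorm_sub_le.{u₁} hQ hw hv hu hG0 hζ0 hη hηγ hζη hζα
  have hX : ∀ k, σ.deg k < γ + β → ‖X.X k‖ ≤ ∑ k ∈ σ.idxBelow (γ + β), ‖X.X k‖ := fun k hk =>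
    Finset.single_le_sum (f := fun k => ‖X.X k‖) (fun _ _ => norm_nonneg _)
      ((σ.mem_idxBelow _ k).2 hk)
  have hi : 0 ≤ (I.normBelow γ).toReal := ENNReal.toReal_nonneg
  have hc : (0 : ℝ) ≤ (A.below γ).card := Nat.cast_nonneg _
  -- The coefficients of `lipschitz_const_bound`; the summand 1 makes the polynomial strictly
  -- positive even if C₀ vanishes.
  refine ⟨C₀ * (I.normBelow γ).toReal + 2 * C₀ * CK + 1,
    C₀ * CK * (A.below γ).card * (4 + C₂ * (C₁ + 1) + 2 * C₁),
    4 * C₀ * CK * (A.below γ).card, fun R hR => ?_, ?_⟩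
  · generalize (I.normBelow γ).toReal = i at *
    positivity
  intro R hR M₁ M₂ Mb₁ Mb₂ hMb₁ hMb₂ f₁ f₂ Λ₁ Λ₂ hf₁ hf₂ hΛ₁ hΛ₂ hM₁ hM₂ hfR₁ _
  obtain ⟨b₁, b₂⟩ := h Q K CK hQ hCK hK 𝒯 Ab 𝒯b X hX I M₁ M₂ Mb₁ Mb₂ hMb₁ hMb₂ f₁ f₂ Λ₁ Λ₂
    hf₁ hf₂ hΛ₁ hΛ₂
  have hr₁ := fun hγ0 => h₁ hγ0 𝒯 M₁ M₂ f₁ f₂ Λ₁ Λ₂ hf₁ hf₂ hΛ₁ hΛ₂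
  have hb₁ := h₂ 𝒯 M₁ M₂ f₁ f₂ Λ₁ Λ₂ hf₁ hf₂ hΛ₁ hΛ₂
  have hdiff := (sizeNorm_sub_le (σ := σ) (γ := γ) (η := η) (fun x => (hv.pos x).le) f₁ f₂).trans_lt
    (ENNReal.add_lt_top.2 ⟨hf₁.sizeNorm_lt_top, hf₂.sizeNorm_lt_top⟩)
  have hidiff := (incrNorm_sub_le (σ := σ) (γ := γ) (η := η) (fun x => (hv.pos x).le)
    hv.star_nonneg (incr M₁.Γ f₁) (incr M₂.Γ f₂)).trans_lt
    (ENNReal.add_lt_top.2 ⟨hf₁.sharpNorm_lt_top, hf₂.sharpNorm_lt_top⟩)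
  have hrdiff : recDist γ η M₁ M₂ f₁ f₂ Λ₁ Λ₂ < ∞ :=
    (recNorm_sub_le (σ := σ) (γ := γ) (η := η) (fun x => (hu.pos x).le) (centered M₁ f₁ Λ₁)
    (centered M₂ f₂ Λ₂)).trans_lt (ENNReal.add_lt_top.2 ⟨hΛ₁, hΛ₂⟩)
  have hbdiff : besovNorm σ ζ (w * v).w (fun t x => Λ₁.Qt t x - Λ₂.Qt t x) < ∞ :=
    Λ₁.norm_sub_lt_top hQ hu hG0 hζ0 Λ₂
  have hdP := M₁.distPi_lt_top M₂ hw γ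
  have hdΓ := M₁.distΓ_lt_top M₂ hw γ
  have hle : ∀ {x y : ℝ≥0∞}, x + y ≤ ENNReal.ofReal R → x.toReal ≤ R ∧ y.toReal ≤ R := fun h =>
    ⟨ENNReal.toReal_le_of_le_ofReal hR.le (le_self_add.trans h),
      ENNReal.toReal_le_of_le_ofReal hR.le (le_add_self.trans h)⟩
  obtain ⟨-, hg₁⟩ := hle hM₁
  obtain ⟨hp₂, hg₂⟩ := hle hM₂
  obtain ⟨hs₁, hn₁⟩ := hle hfR₁
  set D := (M₁.distPi M₂ γ).toReal + (M₁.distΓ M₂ γ).toReal with hD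
  set sd := (sizeNorm σ 𝒯 v γ η (fun x => f₁ x - f₂ x)).toReal with hsd
  set nd := (incrNorm σ 𝒯 v γ η (fun y x => incr M₁.Γ f₁ y x - incr M₂.Γ f₂ y x)).toReal with hnd
  have hsd0 : 0 ≤ sd := ENNReal.toReal_nonneg
  have hnd0 : 0 ≤ nd := ENNReal.toReal_nonneg
  have hdP0 : 0 ≤ (M₁.distPi M₂ γ).toReal := ENNReal.toReal_nonneg
  have hdΓ0 : 0 ≤ (M₁.distΓ M₂ γ).toReal := ENNReal.toReal_nonneg
  have hD0 : 0 ≤ D := add_nonneg hdP0 hdΓ0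
  have hPD : (M₁.distPi M₂ γ).toReal ≤ D := le_add_of_nonneg_right hdΓ0
  have hΓD : (M₁.distΓ M₂ γ).toReal ≤ D := le_add_of_nonneg_left hdP0
  have hsF : sd ≤ sd + nd := le_add_of_nonneg_right hnd0
  have hnF : nd ≤ sd + nd := le_add_of_nonneg_left hsd0
  have p₁ := M₁.pieceConst_le M₂ ENNReal.toReal_nonneg hsd0 hs₁ hsF hPD hΓD hp₂ hg₁ hg₂
  have p₂ := M₁.pieceConst_le M₂ ENNReal.toReal_nonneg hnd0 hn₁ hnF hPD hΓD hp₂ hg₁ hg₂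
  have q₁ := M₁.remConst_le M₂ (r := (recDist γ η M₁ M₂ f₁ f₂ Λ₁ Λ₂).toReal)
    ENNReal.toReal_nonneg hnd0 hn₁ hnF hPD hp₂
  have q₂ := M₁.remConst_le M₂ (r := 0) ENNReal.toReal_nonneg hnd0 hn₁ hnF hPD hp₂
  have q₃ := M₁.remConst_le M₂ (r := (recDist γ η M₁ M₂ f₁ f₂ Λ₁ Λ₂).toReal)
    ENNReal.toReal_nonneg hsd0 hs₁ hsF hPD hp₂
  have hb := hb₁.trans (mul_le_mul_of_nonneg_left q₃ hC₂)
  have hr := fun hγ0 => (hr₁ hγ0).trans (mul_le_mul_of_nonneg_left q₂ hC₁)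
  have hsdN : sizeNorm σ 𝒯 v γ η (fun x => f₁ x - f₂ x) = ENNReal.ofReal sd :=
    (ENNReal.ofReal_toReal hdiff.ne).symm
  have hndN : incrNorm σ 𝒯 v γ η (fun y x => incr M₁.Γ f₁ y x - incr M₂.Γ f₂ y x) =
      ENNReal.ofReal nd := (ENNReal.ofReal_toReal hidiff.ne).symm
  have hdist : M₁.dist M₂ γ + fullDist σ v γ η M₁.Γ M₂.Γ f₁ f₂ =
      ENNReal.ofReal (D + (sd + nd)) := by
    change M₁.distPi M₂ γ + M₁.distΓ M₂ γ + (sizeNorm σ 𝒯 v γ η (fun x => f₁ x - f₂ x) +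
      incrNorm σ 𝒯 v γ η (fun y x => incr M₁.Γ f₁ y x - incr M₂.Γ f₂ y x)) = _
    rw [hsdN, hndN, ENNReal.ofReal_add hD0 (by positivity), ENNReal.ofReal_add hsd0 hnd0, hD,
      ENNReal.ofReal_add hdP0 hdΓ0, ENNReal.ofReal_toReal hdP.ne, ENNReal.ofReal_toReal hdΓ.ne]
  have hP₁0 := M₁.pieceConst_nonneg M₂ (γ := γ) (n := (sizeNorm σ 𝒯 v γ η f₁).toReal)
    ENNReal.toReal_nonneg hsd0
  have hP₂0 := M₁.pieceConst_nonneg M₂ (γ := γ) (n := (sharpNorm σ v γ η M₁.Γ f₁).toReal)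
    ENNReal.toReal_nonneg hnd0
  have hE0 := M₁.remConst_nonneg M₂ (γ := γ) (n := (sharpNorm σ v γ η M₁.Γ f₁).toReal)
    (r := (recDist γ η M₁ M₂ f₁ f₂ Λ₁ Λ₂).toReal)
    ENNReal.toReal_nonneg hnd0 ENNReal.toReal_nonneg
  have hb0 : 0 ≤ (besovNorm σ ζ (w * v).w (fun t x => Λ₁.Qt t x - Λ₂.Qt t x)).toReal :=
    ENNReal.toReal_nonneg
  have hr0 : 0 ≤ (recDist γ η M₁ M₂ f₁ f₂ Λ₁ Λ₂).toReal := ENNReal.toReal_nonneg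
  rw [hdist, ← ENNReal.ofReal_toReal hbdiff.ne, ← ENNReal.ofReal_toReal hrdiff.ne]
  have hfull := add_le_add b₁ b₂
  change fullDist σ (w * w * v) (γ + β) (ζ + β) Mb₁.Γ Mb₂.Γ
    (liftK K δ γ X I M₁ f₁ Λ₁) (liftK K δ γ X I M₂ f₂ Λ₂) ≤ _ at hfull
  clear b₁ b₂ hb₁ hr₁ q₂ q₃
  clear_value D sd nd
  generalize (besovNorm σ ζ (w * v).w (fun t x => Λ₁.Qt t x - Λ₂.Qt t x)).toReal = b at *
  generalize (recDist γ η M₁ M₂ f₁ f₂ Λ₁ Λ₂).toReal = r at *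
  generalize (I.normBelow γ).toReal = i at *
  generalize M₁.pieceConst M₂ γ (sizeNorm σ 𝒯 v γ η f₁).toReal sd = P₁ at *
  generalize M₁.pieceConst M₂ γ (sharpNorm σ v γ η M₁.Γ f₁).toReal nd = P₂ at *
  generalize M₁.remConst M₂ γ (sharpNorm σ v γ η M₁.Γ f₁).toReal nd r = E at *
  obtain ⟨k₁, k₂⟩ := lipschitz_const_bound (b := b) hC₀ hC₁ hC₂ hi hCK.le hc hR.le
    (add_nonneg hD0 (add_nonneg hsd0 hnd0)) (le_add_of_nonneg_left hD0) p₁ p₂ q₁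
  have u₁ : 0 ≤ C₀ * (i * sd + CK * (P₁ + b + E)) := mul_nonneg hC₀ (add_nonneg (mul_nonneg hi hsd0)
    (mul_nonneg hCK.le (add_nonneg (add_nonneg hP₁0 hb0) hE0)))
  have u₂ : 0 ≤ C₀ * (i * nd + CK * (P₂ + E)) := mul_nonneg hC₀ (add_nonneg (mul_nonneg hi hnd0)
    (mul_nonneg hCK.le (add_nonneg hP₂0 hE0)))
  rw [← ENNReal.ofReal_add u₁ u₂] at hfull
  have hT0 : 0 ≤ D + (sd + nd) := add_nonneg hD0 (add_nonneg hsd0 hnd0)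
  rw [← ENNReal.ofReal_add hT0 hb0, ← ENNReal.ofReal_add (add_nonneg hT0 hb0) hr0,
    ← ENNReal.ofReal_mul' (add_nonneg (add_nonneg hT0 hb0) hr0), ← ENNReal.ofReal_mul' hT0]
  exact ⟨hfull.trans (ENNReal.ofReal_le_ofReal (k₁ hb0 hr0)), fun hγ0 => hfull.trans
    (ENNReal.ofReal_le_ofReal (k₂ (by simpa using hr hγ0) hb))⟩

end Lipschitz

end SingularMD

end

theorem theorem4 {d : ℕ} [NeZero d] (σ : Scaling d)
    (G : Pt d → ℝ) (hG : Measurable G) (hG0 : ∀ x, 0 ≤ G x)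
    (w v : Weight d)
    (hw : w.IsControlled σ G) (hv : v.IsControlled σ G) (hwwv : (w * w * v).IsControlled σ G)
    (hdecay : w.HasDecay σ G)
    (A : IndexSet) (β βb δ γ η ζ : ℝ)
    (hβ : 0 < β) (hββ : β ≤ βb) (hδ : 0 < δ) (hγ : γ + βb < δ)
    (hη : γ - σ.s 0 < η) (hηγ : η ≤ γ)
    (hζ0 : ζ ≤ 0) (hζη : ζ ≤ η) (hζα : ζ ≤ A.reg)
    (hcase : β < βb ∨
      (β = βb ∧ ∀ α ∈ A.carrier ∪ {γ, ζ}, ∀ k : Idx d, α + βb ≠ σ.deg k)) :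
    -- the bounds, with a constant that does not depend on the data quantified after it
    (∀ B : ℝ, ∃ C : ℝ≥0,
      ∀ (Q K : Ker d) (CK : ℝ), IsSemigroup σ G Q → 0 < CK →
        IsRegularizing σ G Q K βb δ CK →
      ∀ (𝒯 : RegStructure.{u₁} A) (Ab : IndexSet)
        (𝒯b : RegStructure.{u₂} Ab) (X : Polynomials σ 𝒯b),
        (∀ k, σ.deg k < γ + β → ‖X.X k‖ ≤ B) →
      ∀ (I : AbsInt 𝒯 𝒯b β)
        (M : Model σ 𝒯 Q w) (Mb : Model σ 𝒯b Q w),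
        Compatible K δ X I M Mb →
      ∀ (f : Pt d → 𝒯.Sum) (Λ : Besov σ Q ζ (w * v).w),
        MemD σ v γ η M.Γ f → IsReconstruction γ η M f Λ →
        MemD σ (w * w * v) (γ + β) (ζ + β) Mb.Γ
          (liftK K δ γ X I M f Λ) ∧
        sizeNorm σ 𝒯b (w * w * v) (γ + β) (ζ + β)
            (liftK K δ γ X I M f Λ) ≤
          C * (I.normBelow γ * sizeNorm σ 𝒯 v γ η f +
            ENNReal.ofReal CK *
              (M.normPi γ * (1 + M.normΓ γ) * fullNorm σ v γ η M.Γ f +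
                besovNorm σ ζ (w * v).w Λ.Qt +
                recSize γ η M f Λ)) ∧
        sharpNorm σ (w * w * v) (γ + β) (ζ + β) Mb.Γ
            (liftK K δ γ X I M f Λ) ≤
          C * (I.normBelow γ * sharpNorm σ v γ η M.Γ f +
            ENNReal.ofReal CK *
              (M.normPi γ * (1 + M.normΓ γ) * sharpNorm σ v γ η M.Γ f +
                recSize γ η M f Λ))) ∧
    -- the local Lipschitz estimates, with the quadratic function `a + b R + c R ^ 2`
    (∀ (Q K : Ker d) (CK : ℝ), IsSemigroup σ G Q → 0 < CK →
        IsRegularizing σ G Q K βb δ CK →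
      ∀ (𝒯 : RegStructure.{u₁} A) (Ab : IndexSet)
        (𝒯b : RegStructure.{u₂} Ab) (X : Polynomials σ 𝒯b)
        (I : AbsInt 𝒯 𝒯b β),
      ∃ a b c : ℝ, (∀ R : ℝ, 0 < R → 0 < a + b * R + c * R ^ 2) ∧
      ∀ (R : ℝ), 0 < R →
      ∀ (M₁ M₂ : Model σ 𝒯 Q w) (Mb₁ Mb₂ : Model σ 𝒯b Q w),
        Compatible K δ X I M₁ Mb₁ → Compatible K δ X I M₂ Mb₂ →
      ∀ (f₁ f₂ : Pt d → 𝒯.Sum) (Λ₁ Λ₂ : Besov σ Q ζ (w * v).w),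
        MemD σ v γ η M₁.Γ f₁ → MemD σ v γ η M₂.Γ f₂ →
        IsReconstruction γ η M₁ f₁ Λ₁ → IsReconstruction γ η M₂ f₂ Λ₂ →
        M₁.normPi γ + M₁.normΓ γ ≤ ENNReal.ofReal R →
        M₂.normPi γ + M₂.normΓ γ ≤ ENNReal.ofReal R →
        fullNorm σ v γ η M₁.Γ f₁ ≤ ENNReal.ofReal R →
        fullNorm σ v γ η M₂.Γ f₂ ≤ ENNReal.ofReal R →
        fullDist σ (w * w * v) (γ + β) (ζ + β) Mb₁.Γ Mb₂.Γ
            (liftK K δ γ X I M₁ f₁ Λ₁) (liftK K δ γ X I M₂ f₂ Λ₂) ≤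
          ENNReal.ofReal (a + b * R + c * R ^ 2) *
            (M₁.dist M₂ γ + fullDist σ v γ η M₁.Γ M₂.Γ f₁ f₂ +
              besovNorm σ ζ (w * v).w (fun t x => Λ₁.Qt t x - Λ₂.Qt t x) +
              recDist γ η M₁ M₂ f₁ f₂ Λ₁ Λ₂) ∧
        (0 < γ →
          fullDist σ (w * w * v) (γ + β) (ζ + β) Mb₁.Γ Mb₂.Γ
              (liftK K δ γ X I M₁ f₁ Λ₁) (liftK K δ γ X I M₂ f₂ Λ₂) ≤
            ENNReal.ofReal (a + b * R + c * R ^ 2) *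
              (M₁.dist M₂ γ + fullDist σ v γ η M₁.Γ M₂.Γ f₁ f₂))) := by
  exact ⟨fun B => exists_lift_bounds hw hv hwwv hdecay hG0 hββ hγ hη hηγ hζ0 hζη hζα hcase B,
    exists_lift_lipschitz hw hv hwwv hdecay hG0 hββ hγ hη hηγ hζ0 hζη hζα hcase⟩
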